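/- All graphs are finite and simple. For a graph $G=(V,E)$ let $C(G)$ be the set of induced cycles of $G$ (of length at least $3$), and let $S(G)$ be the set of solids in $G$, that is, of induced subgraphs of $G$ isomorphic to one of the following solid graphs: (1) a pyramid: a cycle together with one further vertex that is adjacent to at least three vertices of the cycle; (2) a trihedron: the union of three paths of length at least $2$ with the same two distinct end vertices and with no common interior vertices; (3) a stamp: the union of a triangle $T$ and three paths $P_1,P_2,P_3$ of length at least $1$ that start at the three different vertices of $T$ and end at the same vertex $x$, the $P_i-x$ being pairwise vertex-disjoint; (4) a prism: the union of two vertex-disjoint triangles $x_1x_2x_3$ and $y_1y_2y_3$ and of three pairwise vertex-disjoint paths from $x_i$ to $y_i$ ($i=1,2,3$). The third graph characteristic of $G$ is $$\beth^{3}(G)=|S(G)|-|C(G)|+|E(G)|-|V(G)|.$$ Contracting a nonedge $uv$ of $G$ means identifying the two nonadjacent vertices $u\neq v$ (multiple edges are replaced by single ones). For a vertex $w$ let $G_w$ be the subgraph of $G$ induced by $w$ and its neighbours. A vertex compression $G/w$ of $w$ is any graph obtained from $G$ by successive contractions of nonedges inside $G_w$ after which $G_w$ has become a complete graph with $\chi(G_w)$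 vertices. Theorem. Let $G$ be a connected graph. Then for every vertex $w$ of $G$ and every vertex compression $G/w$ of $w$, $$\beth^{3}(G/w)\le \beth^{3}(G).$$ Moreover $\beth^{3}(K^{\chi(G)})\le\beth^{3}(G)$, that is, $$\binom{\chi(G)}{4}-\binom{\chi(G)}{3}+\binom{\chi(G)}{2}-\binom{\chi(G)}{1}\le\beth^{3}(G).$$ -/

import Mathlib

universe u v

namespace GraphChar

/-- `H` is (isomorphic to) a cycle of length at least `3`. -/
def IsCycleGraph {V : Type u} (H : SimpleGraph V) : Prop :=
  ∃ n : ℕ, 3 ≤ n ∧ Nonempty (H ≃g SimpleGraph.cycleGraph n)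

/-- A pyramid: a cycle together with one further vertex `w` (an apex) that has at least three
neighbours on the cycle. -/
def IsPyramid {V : Type u} (H : SimpleGraph V) : Prop :=
  ∃ w : V, IsCycleGraph (H.induce {w}ᶜ) ∧ 3 ≤ (H.neighborSet w).ncard

/-- A trihedron: the union of three paths with the same two ends `x ≠ y`, without common interior
vertices. Every path has an interior vertex (a cycle with a chord is not a trihedron). -/
def IsTrihedron {V : Type u} (H : SimpleGraph V) : Prop :=
  ∃ (x y : V) (p : Fin 3 → H.Walk x y),
    x ≠ y ∧
    (∀ i, (p i).IsPath) ∧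
    (∀ i, 2 ≤ (p i).length) ∧
    (∀ i j, i ≠ j → ∀ z, z ∈ (p i).support → z ∈ (p j).support → z = x ∨ z = y) ∧
    (∀ z, ∃ i, z ∈ (p i).support) ∧
    (∀ a b, H.Adj a b → ∃ i, s(a, b) ∈ (p i).edges)

/-- A stamp: the union of a triangle and three paths of length at least `1` which start at the three
vertices of the triangle, end at the same vertex `x`, and are vertex-disjoint apart from `x`. -/
def IsStamp {V : Type u} (H : SimpleGraph V) : Prop :=
  ∃ (t : Fin 3 → V) (x : V) (p : ∀ i, H.Walk (t i) x),
    (∀ i j, i ≠ j → H.Adj (t i) (t j)) ∧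
    (∀ i, (p i).IsPath) ∧
    (∀ i, 1 ≤ (p i).length) ∧
    (∀ i j, i ≠ j → ∀ z, z ∈ (p i).support → z ∈ (p j).support → z = x) ∧
    (∀ z, ∃ i, z ∈ (p i).support) ∧
    (∀ a b, H.Adj a b →
      (∃ i j, a = t i ∧ b = t j) ∨ ∃ i, s(a, b) ∈ (p i).edges)

/-- A prism: the union of two vertex-disjoint triangles and three vertex-disjoint paths which join
the vertices of the first triangle to those of the second. -/
def IsPrism {V : Type u} (H : SimpleGraph V) : Prop :=
  ∃ (x y : Fin 3 → V) (p : ∀ i, H.Walk (x i) (y i)),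
    (∀ i j, i ≠ j → H.Adj (x i) (x j)) ∧
    (∀ i j, i ≠ j → H.Adj (y i) (y j)) ∧
    (∀ i j, x i ≠ y j) ∧
    (∀ i, (p i).IsPath) ∧
    (∀ i j, i ≠ j → ∀ z, z ∈ (p i).support → z ∉ (p j).support) ∧
    (∀ z, ∃ i, z ∈ (p i).support) ∧
    (∀ a b, H.Adj a b →
      (∃ i j, a = x i ∧ b = x j) ∨ (∃ i j, a = y i ∧ b = y j) ∨ ∃ i, s(a, b) ∈ (p i).edges)

/-- The solid graphs. -/
def IsSolidGraph {V : Type u} (H : SimpleGraph V) : Prop :=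
  IsPyramid H ∨ IsTrihedron H ∨ IsStamp H ∨ IsPrism H

/-- The induced cycles of `G`. An induced subgraph is recorded by its vertex set. -/
def inducedCycles {V : Type u} (G : SimpleGraph V) : Set (Set V) :=
  {s | IsCycleGraph (G.induce s)}

/-- The solids in `G`: the induced subgraphs of `G` that are solid graphs. An induced subgraph is
recorded by its vertex set. -/
def solids {V : Type u} (G : SimpleGraph V) : Set (Set V) :=
  {s | IsSolidGraph (G.induce s)}

/-- The third graph characteristic `|S(G)| - |C(G)| + |E(G)| - |V(G)|` of a finite graph. -/
noncomputable def beth3 {V : Type u} (G : SimpleGraph V) : ℤ :=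
  ((solids G).ncard : ℤ) - ((inducedCycles G).ncard : ℤ) + (G.edgeSet.ncard : ℤ) - (Nat.card V : ℤ)

/-- The contraction of a nonedge `ab` of `G`: the vertices `a` and `b` are merged. The
merged vertex is called `a`, so that the new vertex set consists of the old vertices other
than `b`. -/
def nonedgeContraction {V : Type u} (G : SimpleGraph V) (a b : V) : SimpleGraph {z : V // z ≠ b} where
  Adj p q := p ≠ q ∧ (G.Adj p.1 q.1 ∨ (p.1 = a ∧ G.Adj b q.1) ∨ (q.1 = a ∧ G.Adj b p.1))
  symm := ⟨by
    rintro p q ⟨hne, h⟩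
    refine ⟨hne.symm, ?_⟩
    rcases h with h | h | h
    · exact Or.inl h.symm
    · exact Or.inr (Or.inr h)
    · exact Or.inr (Or.inl h)⟩
  loopless := ⟨fun _ h => h.1 rfl⟩

/-- `FoldsTo G' A' G A`: up to isomorphism, `G'` arises from `G` by successive contractions of
nonedges inside the vertex set `A`, and `A'` is the set of vertices that `A` becomes in `G'`. -/
inductive FoldsTo {W : Type v} (G' : SimpleGraph W) (A' : Set W) :
    ∀ {V : Type u}, SimpleGraph V → Set V → Prop
  | of_iso {V : Type u} (G : SimpleGraph V) (A : Set V) (e : G ≃g G') (h : e '' A = A') :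
      FoldsTo G' A' G A
  | contract {V : Type u} (G : SimpleGraph V) (A : Set V) (a b : V) (ha : a ∈ A) (hb : b ∈ A)
      (hne : a ≠ b) (hab : ¬ G.Adj a b)
      (h : FoldsTo G' A' (nonedgeContraction G a b) {z | z.1 ∈ A}) :
      FoldsTo G' A' G A

/-- The closed neighbourhood of `w`, that is, the vertex set of `G_w`. -/
def closedNeighbourhood {V : Type u} (G : SimpleGraph V) (w : V) : Set V :=
  insert w (G.neighborSet w)

/-- `G'` is a vertex compression `G/w` of `w` in `G`: it arises from `G` by successive nonedge
contractions on the subgraph `G_w` induced by the closed neighbourhood of `w`, after which `G_w`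
has become a complete graph with `χ(G_w)` vertices. -/
def IsVertexCompression {V : Type u} {W : Type v} (G : SimpleGraph V) (w : V)
    (G' : SimpleGraph W) : Prop :=
  ∃ K : Set W, FoldsTo G' K G (closedNeighbourhood G w) ∧
    G'.IsClique K ∧
    K.encard = (G.induce (closedNeighbourhood G w)).chromaticNumber

end GraphChar

/-! The characteristic is a sum over all vertex sets of a local weight `contrib`: +1 for a solid or
an edge, -1 for an induced cycle or a vertex (`beth3_eq_sum`). Graphs can therefore be compared set
by set.

The four kinds of solids have one common description, an `Ear`: an induced cycle and a disjoint
induced path of which only the ends see the cycle, such that the neighbours of both ends together do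
not fit into a vertex or an edge (`Wide`), whereas each end of a path with distinct ends sees just a
vertex or an edge. `Sol.cases` and `Ear.sol` translate between solids and ears.

Let `A` be the closed neighbourhood of `w`, and consider first the sets that leave `A`. Making the
neighbourhood of `w` complete raises the weight of a set `T` that avoids `w` by at most the weight
of `insert w T` (`contrib_fill_le`). In the filled graph the vertices to be identified are adjacent,
so the compression becomes a sequence of edge contractions. If an edge `ab` is contracted to `x`,
the weight of `insert x T` is at most the sum of the weights of the three sets over it
(`EdgeContraction.contrib_le`); the core is that a solid through `x` lifts if both `a` and `b` have
private neighbours in `T` (`EdgeContraction.someSol`). In the compressed graph, sets that contain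
the image of `w` and leave the clique have weight at most 0.

Now consider the sets inside `A`. A clique with `m + 1` vertices has total weight `m.choose 4 - 1`.
In `G`, pairing `T` with `insert w T` shows that the sets inside `A` weigh at least the number of
solids among the neighbours of `w`, minus 1. For `m ≥ 1` these neighbours cannot be coloured with `m
- 1` colours, so `choose_le_ncard_sol` provides `m.choose 4` solids: delete a vertex `a` from a
critical subgraph and colour the rest; for any three colours some solid through `a` shows exactly
these three on its other vertices, and the solids that avoid `a` come from induction. For three
colours (`Critical.exists_sol`), failure would make the colour set constant on the cycles through
`a` inside each solid. `Frame.const_of` spreads this to all cycles through an edge at `a`, and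
connectedness to all cycles through `a`; but a Kempe chain gives a cycle with two colours, while the
third colour also occurs at a neighbour of `a`.

For the bound by the chromatic number, a connected graph that is not complete has a vertex with two
nonadjacent neighbours. Compressing it along an optimal colouring of its closed neighbourhood gives
a smaller connected graph whose chromatic number is not smaller, and induction ends at a complete
graph. -/

namespace GraphChar

/-! ### Induced paths, linked vertices and induced cycles, recorded by vertex sets -/

section

/-- `IPath G a b P`: the set `P` is the vertex set of an induced path of `G` from `a` to `b`. -/
inductive IPath {V : Type u} (G : SimpleGraph V) : V → V → Set V → Prop
  | single (a : V) : IPath G a a {a}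
  | cons {a b c : V} {S : Set V} (hab : G.Adj a b) (h : IPath G b c S) (ha : a ∉ S)
      (hS : ∀ z ∈ S, G.Adj a z → z = b) : IPath G a c (insert a S)

namespace IPath

variable {V : Type u} {G H : SimpleGraph V} {a b c d : V} {P Q S T : Set V}

theorem left_mem (h : IPath G a b P) : a ∈ P := by cases h <;> simp

theorem right_mem (h : IPath G a b P) : b ∈ P := by
  induction h with
  | single => simp
  | cons _ _ _ _ ih => exact Set.mem_insert_of_mem _ ih

theorem congr (h : IPath G a b P) (hGH : ∀ x ∈ P, ∀ y ∈ P, G.Adj x y ↔ H.Adj x y) :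
    IPath H a b P := by
  induction h with
  | single a => exact single a
  | @cons a b c S hab h ha hS ih =>
    refine cons ((hGH _ (by simp) _ (by simp [h.left_mem])).1 hab)
      (ih fun x hx y hy => hGH x (by simp [hx]) y (by simp [hy])) ha fun z hz haz => hS z hz ?_
    exact (hGH _ (by simp) _ (by simp [hz])).2 haz

theorem append (h : IPath G a b P) (h' : IPath G c d Q) (hbc : G.Adj b c)
    (hd : ∀ x ∈ P, x ∉ Q) (hPQ : ∀ x ∈ P, ∀ y ∈ Q, G.Adj x y → x = b ∧ y = c) :
    IPath G a d (P ∪ Q) := by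
  induction h with
  | single a =>
    rw [Set.singleton_union]
    exact cons hbc h' (hd _ rfl) fun z hz haz => (hPQ _ rfl z hz haz).2
  | @cons a b e S hab h ha hS ih =>
    rw [Set.insert_union]
    refine cons hab (ih hbc (fun x hx => hd x (by simp [hx]))
      fun x hx y hy => hPQ x (by simp [hx]) y hy) ?_ ?_
    · rintro (h1 | h1)
      · exact ha h1
      · exact hd a (by simp) h1
    · rintro z (hz | hz) haz
      · exact hS z hz haz
      · have := (hPQ a (by simp) z hz haz).1
        exact absurd (this ▸ h.right_mem) ha

theorem symm (h : IPath G a b P) : IPath G b a P := by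
  induction h with
  | single a => exact single a
  | @cons a b c S hab h ha hS ih =>
    have := ih.append (single a) hab.symm (fun x hx hxa => ha (by rw [← hxa]; exact hx))
      (fun x hx y hy hxy => by
        obtain rfl : y = a := hy
        exact ⟨hS x hx hxy.symm, rfl⟩)
    rwa [Set.union_singleton] at this

theorem eq_singleton (h : IPath G a a P) : P = {a} := by
  cases h with
  | single => rfl
  | cons hab h ha hS => exact absurd h.right_mem ha

theorem uncons (h : IPath G a b P) (hab : a ≠ b) :
    ∃ c S, IPath G c b S ∧ P = insert a S ∧ a ∉ S ∧ G.Adj a c ∧ ∀ z ∈ S, G.Adj a z → z = c := by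
  cases h with
  | single => exact absurd rfl hab
  | @cons _ c _ S hac h ha hS => exact ⟨c, S, h, rfl, ha, hac, hS⟩

theorem finite (h : IPath G a b P) : P.Finite := by
  induction h with
  | single => simp
  | cons _ _ _ _ ih => exact ih.insert _

theorem pair (hab : G.Adj a b) : IPath G a b {a, b} :=
  cons hab (single b) (by simpa using hab.ne) (by simp)

/-- Removing an interior vertex of an induced path leaves two induced paths. -/
theorem split (h : IPath G a b P) {x : V} (hx : x ∈ P) (hxa : x ≠ a) (hxb : x ≠ b) :
    ∃ p q P₁ P₂, IPath G a p P₁ ∧ IPath G q b P₂ ∧ P = P₁ ∪ insert x P₂ ∧ G.Adj p x ∧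
      G.Adj x q ∧ x ∉ P₁ ∧ x ∉ P₂ ∧ (∀ z ∈ P₁, z ∉ P₂) ∧ (∀ z ∈ P₁, G.Adj x z → z = p) ∧
      (∀ z ∈ P₂, G.Adj x z → z = q) ∧ (∀ z ∈ P₁, ∀ y ∈ P₂, ¬ G.Adj z y) := by
  induction h with
  | single a => exact absurd hx hxa
  | @cons a b c S hab h ha hS ih =>
    have hxS : x ∈ S := by grind
    by_cases hxb' : x = b
    · subst hxb'
      obtain ⟨q, S', h', rfl, h1, h2, h3⟩ := h.uncons hxb
      refine ⟨a, q, {a}, S', single a, h', by ext; simp; tauto, hab, h2, ?_, h1, ?_, ?_, h3, ?_⟩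
      · simpa using hab.ne'
      · grind
      · grind
      · rintro z rfl y hy hzy
        have := hS y (by simp [hy]) hzy
        grind
    · obtain ⟨p, q, P₁, P₂, h1, h2, rfl, h3, h4, h5, h6, h7, h8, h9, h10⟩ := ih hxS hxb' hxb
      refine ⟨p, q, insert a P₁, P₂, cons hab h1 (by grind) ?_, h2, by ext; simp; tauto,
        h3, h4, by grind, h6, by grind, ?_, h9, ?_⟩
      · grind
      · intro z hz hxz
        rcases hz with rfl | hz
        · exact absurd (hS x hxS hxz.symm) hxb'
        · exact h8 z hz hxz
      · intro z hz y hy hzy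
        rcases hz with rfl | hz
        · have := hS y (by grind) hzy
          have := h1.left_mem
          grind
        · exact h10 z hz y hy hzy

theorem left_eq_of_adj (h : IPath G a b P) {x y : V} (hx : x ∈ P) (hy : y ∈ P)
    (hax : G.Adj a x) (hay : G.Adj a y) : x = y := by
  cases h with
  | single => exact absurd hax (by simp [Set.mem_singleton_iff.1 hx])
  | cons hab h ha hS =>
    rw [hS x (by have := hax.ne; grind) hax, hS y (by have := hay.ne; grind) hay]

/-- A vertex of an induced path has no three neighbours on it. -/
theorem eq_of_adj (h : IPath G a b P) {x y₁ y₂ y₃ : V} (hx : x ∈ P) (h₁ : y₁ ∈ P) (h₂ : y₂ ∈ P)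
    (h₃ : y₃ ∈ P) (hx₁ : G.Adj x y₁) (hx₂ : G.Adj x y₂) (hx₃ : G.Adj x y₃) :
    y₁ = y₂ ∨ y₁ = y₃ ∨ y₂ = y₃ := by
  by_cases hxa : x = a
  · subst hxa
    exact .inl (h.left_eq_of_adj h₁ h₂ hx₁ hx₂)
  by_cases hxb : x = b
  · subst hxb
    exact .inl (h.symm.left_eq_of_adj h₁ h₂ hx₁ hx₂)
  obtain ⟨p, q, P₁, P₂, -, -, rfl, -, -, -, -, -, h8, h9, -⟩ := h.split hx hxa hxb
  have := hx₁.ne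
  have := hx₂.ne
  have := hx₃.ne
  grind

/-- The part of an induced path up to its first vertex in `Y`. -/
theorem exists_first (h : IPath G a b P) {Y : Set V} (hb : b ∈ Y) :
    ∃ b' P', P' ⊆ P ∧ IPath G a b' P' ∧ b' ∈ Y ∧ ∀ z ∈ P', z ∈ Y → z = b' := by
  induction h with
  | single a => exact ⟨a, {a}, le_rfl, single a, hb, by simp⟩
  | @cons a b c S hab h ha hS ih =>
    by_cases haY : a ∈ Y
    · exact ⟨a, {a}, by simp, single a, haY, by simp⟩
    · obtain ⟨b', P', h1, h2, h3, h4⟩ := ih hb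
      exact ⟨b', insert a P', Set.insert_subset_insert h1,
        cons hab h2 (fun h => ha (h1 h)) (fun z hz => hS z (h1 hz)), h3, by grind⟩

/-- The path is cut at its first vertex in `Y`; the initial piece is then read backwards and cut at
its first vertex in `X`. -/
theorem exists_crossing (h : IPath G a b P) {X Y : Set V} (ha : a ∈ X) (hb : b ∈ Y) :
    ∃ a' b' P', P' ⊆ P ∧ IPath G a' b' P' ∧ a' ∈ X ∧ b' ∈ Y ∧
      (∀ z ∈ P', z ∈ X → z = a') ∧ ∀ z ∈ P', z ∈ Y → z = b' := by
  obtain ⟨b', P₁, h1, h2, h3, h4⟩ := h.exists_first hb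
  obtain ⟨a', P₂, h5, h6, h7, h8⟩ := h2.symm.exists_first ha
  exact ⟨a', b', P₂, h5.trans h1, h6.symm, h7, h3, h8, fun z hz => h4 z (h5 hz)⟩

/-- The new path enters `P` at the last neighbour of `a`, so that no chord at `a` arises. -/
theorem exists_cons_of_notMem (h : IPath G b c P) (haP : a ∉ P) (hab : ∃ z ∈ P, G.Adj a z) :
    ∃ P', P' ⊆ P ∧ IPath G a c (insert a P') := by
  induction h with
  | single b =>
    obtain ⟨z, rfl, hz⟩ := hab
    exact ⟨{z}, le_rfl, pair hz⟩
  | @cons b d c S hbd h hb hS ih =>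
    by_cases hS' : ∃ z ∈ S, G.Adj a z
    · obtain ⟨P', h1, h2⟩ := ih (by grind) hS'
      exact ⟨P', fun z hz => by simp [h1 hz], h2⟩
    · push Not at hS'
      exact ⟨_, le_rfl, cons (b := b) (by grind) (cons hbd h hb hS) haP (by grind)⟩

theorem exists_drop (h : IPath G a b P) {x : V} (hx : x ∈ P) : ∃ P', P' ⊆ P ∧ IPath G x b P' := by
  induction h with
  | single b =>
    obtain rfl : x = b := hx
    exact ⟨_, le_rfl, single x⟩
  | @cons a d c S hbd h hb hS ih =>
    by_cases hxS : x ∈ S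
    · obtain ⟨P', h1, h2⟩ := ih hxS
      exact ⟨P', fun z hz => by simp [h1 hz], h2⟩
    · obtain rfl : x = a := by grind
      exact ⟨_, le_rfl, cons hbd h hb hS⟩

end IPath

/-- `x` and `y` are joined by a path inside `S`. -/
def Linked {V : Type u} (G : SimpleGraph V) (S : Set V) (x y : V) : Prop :=
  ∃ P ⊆ S, IPath G x y P

namespace Linked

variable {V : Type u} {G : SimpleGraph V} {S T : Set V} {x y z : V}

theorem refl (hx : x ∈ S) : Linked G S x x := ⟨{x}, by simpa, .single x⟩

theorem symm (h : Linked G S x y) : Linked G S y x := by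
  obtain ⟨P, h1, h2⟩ := h
  exact ⟨P, h1, h2.symm⟩

theorem mono (h : Linked G S x y) (hST : S ⊆ T) : Linked G T x y := by
  obtain ⟨P, h1, h2⟩ := h
  exact ⟨P, h1.trans hST, h2⟩

theorem cons (hxy : G.Adj x y) (h : Linked G S y z) (hx : x ∈ S) : Linked G S x z := by
  obtain ⟨P, h1, h2⟩ := h
  by_cases hxP : x ∈ P
  · obtain ⟨P', h3, h4⟩ := h2.exists_drop hxP
    exact ⟨P', h3.trans h1, h4⟩
  · obtain ⟨P', h3, h4⟩ := h2.exists_cons_of_notMem hxP ⟨y, h2.left_mem, hxy⟩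
    exact ⟨_, Set.insert_subset hx (h3.trans h1), h4⟩

theorem trans (h : Linked G S x y) (h' : Linked G S y z) : Linked G S x z := by
  obtain ⟨P, h1, h2⟩ := h
  induction h2 with
  | single => exact h'
  | @cons a b c Q hab h ha hS ih =>
    exact (ih h' fun z hz => h1 (by simp [hz])).cons hab (h1 (by simp))

theorem of_adj (hx : x ∈ S) (hy : y ∈ S) (h : G.Adj x y) : Linked G S x y :=
  (refl hy).cons h hx

theorem left_mem (h : Linked G S x y) : x ∈ S := by
  obtain ⟨P, h1, h2⟩ := h
  exact h1 h2.left_mem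

theorem right_mem (h : Linked G S x y) : y ∈ S := h.symm.left_mem

/-- A set that is closed under taking neighbours in `S` is closed under being linked in `S`. -/
theorem mem_of_closed (h : Linked G S x y) {C : Set V} (hx : x ∈ C)
    (hC : ∀ a ∈ C, ∀ b ∈ S, G.Adj a b → b ∈ C) : y ∈ C := by
  obtain ⟨P, h1, h2⟩ := h
  induction h2 with
  | single => exact hx
  | @cons a b c Q hab h ha hS ih =>
    exact ih (hC _ hx _ (h1 (by simp [h.left_mem])) hab)
      (fun z hz => h1 (by simp [hz]))

end Linked

/-- `S` induces a connected subgraph (or is empty). -/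
def Conn {V : Type u} (G : SimpleGraph V) (S : Set V) : Prop :=
  ∀ x ∈ S, ∀ y ∈ S, Linked G S x y

theorem IPath.conn {V : Type u} {G : SimpleGraph V} {a b : V} {P : Set V} (h : IPath G a b P) :
    Conn G P := by
  intro x hx y hy
  have key : ∀ x ∈ P, Linked G P x b := fun x hx => by
    obtain ⟨P', h1, h2⟩ := h.exists_drop hx
    exact ⟨P', h1, h2⟩
  exact (key x hx).trans (key y hy).symm

theorem Conn.union {V : Type u} {G : SimpleGraph V} {S T : Set V} (hS : Conn G S) (hT : Conn G T)
    (h : (∃ x ∈ S, x ∈ T) ∨ ∃ x ∈ S, ∃ y ∈ T, G.Adj x y) : Conn G (S ∪ T) := by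
  have h1 : ∀ x ∈ S, ∀ y ∈ S, Linked G (S ∪ T) x y := fun x hx y hy =>
    (hS x hx y hy).mono Set.subset_union_left
  have h2 : ∀ x ∈ T, ∀ y ∈ T, Linked G (S ∪ T) x y := fun x hx y hy =>
    (hT x hx y hy).mono Set.subset_union_right
  have h3 : ∀ x ∈ S, ∀ y ∈ T, Linked G (S ∪ T) x y := by
    intro x hx y hy
    rcases h with ⟨z, hz, hz'⟩ | ⟨z, hz, t, ht, hzt⟩
    · exact (h1 x hx z hz).trans (h2 z hz' y hy)
    · exact (h1 x hx z hz).trans (.cons hzt (h2 t ht y hy) (.inl hz))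
  rintro x (hx | hx) y (hy | hy)
  · exact h1 x hx y hy
  · exact h3 x hx y hy
  · exact (h3 y hy x hx).symm
  · exact h2 x hx y hy

/-- `Cyc G s`: the set `s` is the vertex set of an induced cycle of `G`. -/
def Cyc {V : Type u} (G : SimpleGraph V) (s : Set V) : Prop :=
  ∃ x a b P, s = insert x P ∧ x ∉ P ∧ IPath G a b P ∧ a ≠ b ∧ ∀ z ∈ P, G.Adj x z ↔ z = a ∨ z = b

namespace Cyc

variable {V : Type u} {G H : SimpleGraph V} {s t P Q : Set V} {a b c d x : V}

theorem congr (h : Cyc G s) (hGH : ∀ x ∈ s, ∀ y ∈ s, G.Adj x y ↔ H.Adj x y) : Cyc H s := by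
  obtain ⟨x, a, b, P, rfl, h1, h2, h3, h4⟩ := h
  exact ⟨x, a, b, P, rfl, h1, h2.congr (by grind), h3, by grind⟩

/-- Two disjoint induced paths whose ends are joined form a cycle. -/
theorem of_paths (h : IPath G a b P) (h' : IPath G c d Q) (hd : ∀ x ∈ P, x ∉ Q)
    (hne : a ≠ b ∨ c ≠ d) (hac : G.Adj a c) (hbd : G.Adj b d)
    (hPQ : ∀ x ∈ P, ∀ y ∈ Q, G.Adj x y → (x = a ∧ y = c) ∨ (x = b ∧ y = d)) : Cyc G (P ∪ Q) := by
  -- The first vertex of `P` serves as the distinguished vertex of the cycle. The assumption `hne`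
  -- excludes two one-vertex paths, which would only form an edge.
  by_cases hab : a = b
  · subst hab
    obtain rfl := h.eq_singleton
    have hcd : c ≠ d := by simpa using hne
    refine ⟨a, c, d, Q, by ext; simp, hd a rfl, h', hcd, fun z hz => ⟨fun haz => ?_, ?_⟩⟩
    · have := hPQ a rfl z hz haz
      tauto
    · rintro (rfl | rfl) <;> assumption
  · obtain ⟨e, S, h1, rfl, h2, h3, h4⟩ := h.uncons hab
    refine ⟨a, e, c, S ∪ Q, Set.insert_union .., ?_, h1.append h'.symm hbd ?_ ?_, ?_, ?_⟩
    · have := hd a (by simp)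
      grind
    · grind
    · intro x hx y hy hxy
      have := hPQ x (by simp [hx]) y hy hxy
      grind
    · rintro rfl
      exact hd e (by simp [h1.left_mem]) h'.left_mem
    · rintro z (hz | hz)
      · have : z ≠ c := fun hzc => hd z (by simp [hz]) (hzc ▸ h'.left_mem)
        grind
      · have : z ≠ e := fun hzc => hd e (by simp [h1.left_mem]) (hzc ▸ hz)
        have := hPQ a (by simp) z hz
        grind

/-- Every vertex of a cycle is joined to the ends of the path that the rest of the cycle forms. -/
theorem rotate (h : Cyc G s) {y : V} (hy : y ∈ s) :
    ∃ a b P, s = insert y P ∧ y ∉ P ∧ IPath G a b P ∧ a ≠ b ∧ G.Adj y a ∧ G.Adj y b ∧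
      ∀ z ∈ P, G.Adj y z → z = a ∨ z = b := by
  obtain ⟨x, a, b, P, rfl, h1, h2, h3, h4⟩ := h
  by_cases hyx : y = x
  · subst hyx
    exact ⟨a, b, P, rfl, h1, h2, h3, (h4 a h2.left_mem).2 (.inl rfl),
      (h4 b h2.right_mem).2 (.inr rfl), fun z hz => (h4 z hz).1⟩
  have hyP : y ∈ P := by grind
  have hxa := (h4 a h2.left_mem).2 (.inl rfl)
  have hxb := (h4 b h2.right_mem).2 (.inr rfl)
  have key : ∀ {a b : V}, IPath G a b P → a ≠ b → G.Adj x a → G.Adj x b →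
      (∀ z ∈ P, G.Adj x z ↔ z = a ∨ z = b) → y = a →
      ∃ a b P', insert x P = insert y P' ∧ y ∉ P' ∧ IPath G a b P' ∧ a ≠ b ∧ G.Adj y a ∧
        G.Adj y b ∧ ∀ z ∈ P', G.Adj y z → z = a ∨ z = b := by
    rintro a b h2 h3 hxa hxb h4 rfl
    obtain ⟨e, S, h5, rfl, h6, h7, h8⟩ := h2.uncons h3
    have hxS : x ∉ S := by grind
    refine ⟨x, e, insert x S, Set.insert_comm .., by grind, ?_, ?_, hxa.symm, h7, by grind⟩
    · exact .cons hxb h5.symm hxS (by grind)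
    · have := h5.left_mem
      grind
  by_cases hya : y = a
  · exact key h2 h3 hxa hxb h4 hya
  by_cases hyb : y = b
  · exact key h2.symm h3.symm hxb hxa (by grind) hyb
  -- For an interior vertex `y`, the rest of the cycle runs from `p` back to `a`, through `x` to
  -- `b`, and back to `q`.
  obtain ⟨p, q, P₁, P₂, h5, h6, rfl, h7, h8, h9, h10, h11, h12, h13, h14⟩ := h2.split hyP hya hyb
  have ha := h5.left_mem
  have hp := h5.right_mem
  have hb := h6.right_mem
  have hq := h6.left_mem
  refine ⟨p, q, insert x P₁ ∪ P₂, by ext; simp; tauto, by grind, ?_, by grind, h7.symm, h8, ?_⟩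
  · refine (IPath.cons hxa h5 (by grind) (by grind)).symm.append h6.symm hxb ?_ ?_
    · grind
    · intro y hy z hz hyz
      have := hyz.symm
      have := hyz.ne
      grind
  · rintro z ((rfl | hz) | hz) hyz
    · have := (h4 y hyP).1 hyz.symm
      grind
    · exact .inl (h12 z hz hyz)
    · exact .inr (h13 z hz hyz)

end Cyc

end

/-! ### Wide sets and elementary properties of induced cycles -/

section

variable {V : Type u} {G H : SimpleGraph V} {s t P Q O : Set V} {a b c d x y z : V}

/-- `X` is not contained in the vertex set of an edge, nor in a singleton. -/
def Wide (G : SimpleGraph V) (X : Set V) : Prop :=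
  (∃ y ∈ X, ∃ z ∈ X, y ≠ z ∧ ¬ G.Adj y z) ∨
    ∃ x ∈ X, ∃ y ∈ X, ∃ z ∈ X, x ≠ y ∧ x ≠ z ∧ y ≠ z

theorem Wide.mono {X Y : Set V} (h : Wide G X) (hXY : X ⊆ Y) : Wide G Y := by
  rcases h with ⟨y, hy, z, hz, h⟩ | ⟨x, hx, y, hy, z, hz, h⟩
  · exact .inl ⟨y, hXY hy, z, hXY hz, h⟩
  · exact .inr ⟨x, hXY hx, y, hXY hy, z, hXY hz, h⟩

theorem Wide.congr {X : Set V} (h : Wide G X) (hGH : ∀ x ∈ X, ∀ y ∈ X, G.Adj x y ↔ H.Adj x y) :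
    Wide H X := by
  rcases h with ⟨y, hy, z, hz, h1, h2⟩ | h
  · exact .inl ⟨y, hy, z, hz, h1, fun h => h2 ((hGH y hy z hz).2 h)⟩
  · exact .inr h

theorem Wide.of_not_adj {X : Set V} (hy : y ∈ X) (hz : z ∈ X) (hyz : y ≠ z)
    (h : ¬ G.Adj y z) : Wide G X := .inl ⟨y, hy, z, hz, hyz, h⟩

theorem Wide.of_three {X : Set V} (hx : x ∈ X) (hy : y ∈ X) (hz : z ∈ X) (hxy : x ≠ y)
    (hxz : x ≠ z) (hyz : y ≠ z) : Wide G X := .inr ⟨x, hx, y, hy, z, hz, hxy, hxz, hyz⟩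

theorem eq_singleton_or_pair_of_not_wide {X : Set V} (hX : X.Nonempty) (h : ¬ Wide G X) :
    (∃ y, X = {y}) ∨ ∃ y z, G.Adj y z ∧ X = {y, z} := by
  obtain ⟨y, hy⟩ := hX
  by_cases hz : ∃ z ∈ X, z ≠ y
  · obtain ⟨z, hz, hzy⟩ := hz
    refine .inr ⟨y, z, ?_, ?_⟩
    · by_contra h'
      exact h (.of_not_adj hy hz hzy.symm h')
    · ext w
      constructor
      · intro hw
        by_contra hw'
        simp only [Set.mem_insert_iff, Set.mem_singleton_iff, not_or] at hw'
        exact h (.of_three hy hz hw hzy.symm (Ne.symm hw'.1) (Ne.symm hw'.2))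
      · rintro (rfl | rfl) <;> assumption
  · push Not at hz
    exact .inl ⟨y, Set.eq_singleton_iff_unique_mem.2 ⟨hy, hz⟩⟩

namespace Cyc

theorem finite (h : Cyc G s) : s.Finite := by
  obtain ⟨x, a, b, P, rfl, h1, h2, -⟩ := h
  exact h2.finite.insert x

theorem exists_adj (h : Cyc G s) (hx : x ∈ s) :
    ∃ a ∈ s, ∃ b ∈ s, a ≠ b ∧ G.Adj x a ∧ G.Adj x b ∧ ∀ z ∈ s, G.Adj x z → z = a ∨ z = b := by
  obtain ⟨a, b, P, rfl, h1, h2, h3, h4, h5, h6⟩ := h.rotate hx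
  refine ⟨a, .inr h2.left_mem, b, .inr h2.right_mem, h3, h4, h5, ?_⟩
  rintro z (rfl | hz) hxz
  · exact absurd hxz (by simp)
  · exact h6 z hz hxz

theorem eq_of_adj (h : Cyc G s) {y₁ y₂ y₃ : V} (hx : x ∈ s) (h₁ : y₁ ∈ s) (h₂ : y₂ ∈ s)
    (h₃ : y₃ ∈ s) (hx₁ : G.Adj x y₁) (hx₂ : G.Adj x y₂) (hx₃ : G.Adj x y₃) :
    y₁ = y₂ ∨ y₁ = y₃ ∨ y₂ = y₃ := by
  obtain ⟨a, -, b, -, -, -, -, h⟩ := h.exists_adj hx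
  grind

/-- An end of an induced path has at most one neighbour on it, but every vertex of a cycle has two
on the cycle. So the first vertex of the path is not in `s` and can be dropped. -/
theorem not_subset_path (h : Cyc G s) (hP : IPath G a b P) : ¬ s ⊆ P := by
  induction hP with
  | single a =>
    intro hs
    obtain ⟨x, a', b', P, rfl, h1, h2, h3, h4⟩ := h
    have h5 := hs (.inr h2.left_mem)
    have h6 := hs (.inr h2.right_mem)
    simp only [Set.mem_singleton_iff] at h5 h6
    exact h3 (h5.trans h6.symm)
  | @cons a b c S hab h' ha hS ih =>
    intro hs
    by_cases has : a ∈ s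
    · obtain ⟨y, hy, z, hz, hyz, hay, haz, -⟩ := h.exists_adj has
      exact hyz ((IPath.cons hab h' ha hS).left_eq_of_adj (hs hy) (hs hz) hay haz)
    · exact ih fun z hz => by have := hs hz; grind

/-- If a vertex of `t` were missing in `s`, then `s` would lie on the induced path that remains of
`t`. -/
theorem eq_of_subset (h : Cyc G s) (h' : Cyc G t) (hst : s ⊆ t) : s = t := by
  by_contra hne
  obtain ⟨x, hx, hxs⟩ := Set.exists_of_ssubset (hst.ssubset_of_ne hne)
  obtain ⟨a, b, P, rfl, -, h2, -⟩ := h'.rotate hx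
  exact h.not_subset_path h2 fun z hz => by
    have := hst hz
    have : z ≠ x := by rintro rfl; exact hxs hz
    grind

theorem of_triangle (hxy : G.Adj x y) (hxz : G.Adj x z) (hyz : G.Adj y z) : Cyc G {x, y, z} := by
  refine ⟨x, y, z, {y, z}, rfl, ?_, .pair hyz, hyz.ne, ?_⟩
  · have := hxy.ne
    have := hxz.ne
    grind
  · rintro w (rfl | rfl) <;> simp [*]

/-- A cycle with three pairwise adjacent vertices is a triangle. -/
theorem eq_triangle (h : Cyc G s) (hx : x ∈ s) (hy : y ∈ s) (hz : z ∈ s) (hxy : G.Adj x y)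
    (hxz : G.Adj x z) (hyz : G.Adj y z) : s = {x, y, z} :=
  ((of_triangle hxy hxz hyz).eq_of_subset h (by grind)).symm

theorem exists_three (h : Cyc G s) : ∃ x ∈ s, ∃ y ∈ s, ∃ z ∈ s, x ≠ y ∧ x ≠ z ∧ y ≠ z := by
  obtain ⟨x, a, b, P, rfl, h1, h2, h3, h4⟩ := h
  have := h2.left_mem
  have := h2.right_mem
  exact ⟨x, by simp, a, by grind, b, by grind, by grind, by grind, h3⟩

/-- A path together with a vertex that has two neighbours on it contains a cycle. -/
theorem exists_of_path (hP : IPath G a b P) (hx : x ∉ P) (hy : y ∈ P) (hz : z ∈ P) (hyz : y ≠ z)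
    (hxy : G.Adj x y) (hxz : G.Adj x z) : ∃ o, Cyc G o ∧ o ⊆ insert x P := by
  induction hP generalizing y z with
  | single a => exact absurd (hy.trans hz.symm) hyz
  | @cons a b c S hab h ha hS ih =>
    -- If the tail contains only one neighbour `w` of `x`, then `a` is the other neighbour, and the
    -- piece of the path between `a` and `w` closes up through `x`.
    by_cases h2 : ∃ y ∈ S, ∃ z ∈ S, y ≠ z ∧ G.Adj x y ∧ G.Adj x z
    · obtain ⟨y', hy', z', hz', h3, h4, h5⟩ := h2
      obtain ⟨o, ho, ho'⟩ := ih (by grind) hy' hz' h3 h4 h5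
      exact ⟨o, ho, fun w hw => by have := ho' hw; grind⟩
    · push Not at h2
      have hxa : G.Adj x a := by
        by_contra hxa
        have : y ≠ a := by rintro rfl; exact hxa hxy
        have : z ≠ a := by rintro rfl; exact hxa hxz
        exact h2 y (by grind) z (by grind) hyz hxy hxz
      obtain ⟨w, hw, hxw, hw'⟩ : ∃ w ∈ S, G.Adj x w ∧ ∀ w' ∈ S, G.Adj x w' → w' = w := by
        by_cases hya : y = a
        · exact ⟨z, by grind, hxz, fun w' hw' h => by_contra fun hne =>
            h2 w' hw' z (by grind) hne h hxz⟩
        · exact ⟨y, by grind, hxy, fun w' hw' h => by_contra fun hne =>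
            h2 w' hw' y (by grind) hne h hxy⟩
      obtain ⟨P₁, h7, h8⟩ := (IPath.cons hab h ha hS).conn a (by simp) w (by grind)
      refine ⟨insert x P₁, ⟨x, a, w, P₁, rfl, fun h => hx (h7 h), h8, by grind, ?_⟩,
        Set.insert_subset_insert h7⟩
      intro v hv
      have := h7 hv
      constructor
      · grind
      · rintro (rfl | rfl) <;> assumption

end Cyc

end

/-! ### Transport along maps, and comparison with the standard cycle graphs -/

section

section Transport

variable {V : Type u} {W : Type v} {G : SimpleGraph V} {H : SimpleGraph W} {s P : Set V} {a b : V}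

theorem IPath.image (h : IPath G a b P) (f : V → W) (hf : Set.InjOn f P)
    (hadj : ∀ x ∈ P, ∀ y ∈ P, H.Adj (f x) (f y) ↔ G.Adj x y) :
    IPath H (f a) (f b) (f '' P) := by
  induction h with
  | single a => simpa using IPath.single (f a)
  | @cons a b c S hab h ha hS ih =>
    rw [Set.image_insert_eq]
    refine .cons ((hadj _ (by simp) _ (by simp [h.left_mem])).2 hab)
      (ih (hf.mono (by simp)) fun x hx y hy => hadj x (by simp [hx]) y (by simp [hy])) ?_ ?_
    · rintro ⟨z, hz, hza⟩
      have := hf (by simp [hz]) (by simp) hza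
      exact ha (this ▸ hz)
    · rintro _ ⟨z, hz, rfl⟩ h
      rw [hS z hz ((hadj _ (by simp) _ (by simp [hz])).1 h)]

theorem Cyc.image (h : Cyc G s) (f : V → W) (hf : Set.InjOn f s)
    (hadj : ∀ x ∈ s, ∀ y ∈ s, H.Adj (f x) (f y) ↔ G.Adj x y) : Cyc H (f '' s) := by
  obtain ⟨x, a, b, P, rfl, h1, h2, h3, h4⟩ := h
  have ha := h2.left_mem
  have hb := h2.right_mem
  refine ⟨f x, f a, f b, f '' P, Set.image_insert_eq, ?_, h2.image f (hf.mono (by simp)) ?_, ?_, ?_⟩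
  · rintro ⟨z, hz, hza⟩
    have := hf (by simp [hz]) (by simp) hza
    exact h1 (this ▸ hz)
  · exact fun x hx y hy => hadj x (by simp [hx]) y (by simp [hy])
  · exact fun h => h3 (hf (by simp [ha]) (by simp [hb]) h)
  · rintro _ ⟨z, hz, rfl⟩
    rw [hadj _ (by simp) _ (by simp [hz]), h4 z hz,
      hf.eq_iff (by simp [hz]) (by simp [ha]), hf.eq_iff (by simp [hz]) (by simp [hb])]

theorem IPath.of_induce {a b : s} {P : Set s} (h : IPath (G.induce s) a b P) :
    IPath G a b (Subtype.val '' P) :=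
  h.image Subtype.val Subtype.val_injective.injOn fun _ _ _ _ => Iff.rfl

theorem Cyc.of_induce {P : Set s} (h : Cyc (G.induce s) P) : Cyc G (Subtype.val '' P) :=
  h.image Subtype.val Subtype.val_injective.injOn fun _ _ _ _ => Iff.rfl

theorem IPath.induce (h : IPath G a b P) (hP : P ⊆ s) :
    IPath (G.induce s) ⟨a, hP h.left_mem⟩ ⟨b, hP h.right_mem⟩ (Subtype.val ⁻¹' P) := by
  induction h with
  | single a =>
    convert IPath.single (G := G.induce s) ⟨a, hP rfl⟩
    ext; simp [Subtype.ext_iff]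
  | @cons a b c S hab h ha hS ih =>
    have hS' : S ⊆ s := fun z hz => hP (by simp [hz])
    have ha' : a ∈ s := hP (by simp)
    have : (Subtype.val ⁻¹' insert a S : Set s) = insert ⟨a, ha'⟩ (Subtype.val ⁻¹' S) := by
      ext; simp [Subtype.ext_iff]
    rw [this]
    have hab' : (G.induce s).Adj ⟨a, ha'⟩ ⟨b, hS' h.left_mem⟩ := hab
    exact .cons hab' (ih hS') ha
      fun z hz haz => Subtype.ext (hS z hz haz)

theorem Cyc.induce {o : Set V} (h : Cyc G o) (ho : o ⊆ s) :
    Cyc (G.induce s) (Subtype.val ⁻¹' o) := by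
  obtain ⟨x, a, b, P, rfl, h1, h2, h3, h4⟩ := h
  have hP : P ⊆ s := fun z hz => ho (by simp [hz])
  refine ⟨⟨x, ho (by simp)⟩, _, _, _, ?_, h1, h2.induce hP, ?_, ?_⟩
  · ext; simp [Subtype.ext_iff]
  · simpa [Subtype.ext_iff] using h3
  · intro z hz
    simpa [Subtype.ext_iff] using h4 z hz

end Transport

variable {V : Type u} {G : SimpleGraph V} {s P : Set V} {a b : V}

theorem IPath.of_seq (f : ℕ → V) (n : ℕ)
    (hf : ∀ i ≤ n, ∀ j ≤ n, G.Adj (f i) (f j) ↔ i + 1 = j ∨ j + 1 = i)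
    (hinj : ∀ i ≤ n, ∀ j ≤ n, f i = f j → i = j) : IPath G (f 0) (f n) (f '' Set.Iic n) := by
  induction n with
  | zero =>
    have : Set.Iic 0 = ({0} : Set ℕ) := by ext; simp
    simpa [this] using IPath.single (G := G) (f 0)
  | succ n ih =>
    have : f '' Set.Iic (n + 1) = insert (f (n + 1)) (f '' Set.Iic n) := by
      rw [← Set.image_insert_eq]
      congr 1
      ext i
      simp only [Set.mem_Iic, Set.mem_insert_iff]
      omega
    rw [this]
    refine (IPath.cons ((hf _ le_rfl n (by omega)).2 (by omega)) (ih (fun i hi j hj => hf i (by omega) j (by omega))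
      fun i hi j hj => hinj i (by omega) j (by omega)).symm ?_ ?_).symm
    · rintro ⟨i, hi, h⟩
      have := hinj i (by have := Set.mem_Iic.1 hi; omega) (n + 1) le_rfl h
      have := Set.mem_Iic.1 hi
      omega
    · rintro _ ⟨i, hi, rfl⟩ h
      have := Set.mem_Iic.1 hi
      rw [hf _ le_rfl i (by omega)] at h
      congr 1
      omega

theorem IPath.exists_seq (h : IPath G a b P) : ∃ (f : ℕ → V) (n : ℕ), f 0 = a ∧ f n = b ∧
    P = f '' Set.Iic n ∧ (∀ i ≤ n, ∀ j ≤ n, G.Adj (f i) (f j) ↔ i + 1 = j ∨ j + 1 = i) ∧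
    ∀ i ≤ n, ∀ j ≤ n, f i = f j → i = j := by
  induction h with
  | single a =>
    refine ⟨fun _ => a, 0, rfl, rfl, by ext; simp [eq_comm], ?_, by omega⟩
    intro i hi j hj
    simp only [SimpleGraph.irrefl, false_iff]
    omega
  | @cons a b c S hab h ha hS ih =>
    obtain ⟨f, n, rfl, rfl, rfl, h1, h2⟩ := ih
    have key : ∀ j ≤ n, G.Adj a (f j) ↔ j = 0 := fun j hj =>
      ⟨fun h => h2 _ hj _ (by omega) (hS _ ⟨j, hj, rfl⟩ h), by rintro rfl; exact hab⟩
    refine ⟨fun i => if i = 0 then a else f (i - 1), n + 1, rfl, by simp, ?_, ?_, ?_⟩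
    · ext z
      simp only [Set.mem_insert_iff, Set.mem_image, Set.mem_Iic]
      constructor
      · rintro (rfl | ⟨i, hi, rfl⟩)
        · exact ⟨0, by omega, by simp⟩
        · exact ⟨i + 1, by omega, by simp⟩
      · rintro ⟨i, hi, rfl⟩
        by_cases hi0 : i = 0
        · simp [hi0]
        · exact .inr ⟨i - 1, by omega, by simp [hi0]⟩
    · intro i hi j hj
      by_cases hi0 : i = 0 <;> by_cases hj0 : j = 0
      · simp [hi0, hj0]
      · simp only [hi0, hj0, if_true, if_false]
        rw [key _ (by omega)]
        omega
      · simp only [hi0, hj0, if_true, if_false]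
        rw [G.adj_comm, key _ (by omega)]
        omega
      · simp only [hi0, hj0, if_false]
        rw [h1 _ (by omega) _ (by omega)]
        omega
    · intro i hi j hj hij
      by_cases hi0 : i = 0 <;> by_cases hj0 : j = 0
      · omega
      · simp only [hi0, hj0, if_true, if_false] at hij
        exact absurd ⟨j - 1, by simp; omega, hij.symm⟩ ha
      · simp only [hi0, hj0, if_true, if_false] at hij
        exact absurd ⟨i - 1, by simp; omega, hij⟩ ha
      · simp only [hi0, hj0, if_false] at hij
        have := h2 _ (by omega) _ (by omega) hij
        omega

/-- This replaces the arithmetic modulo `n` by a case distinction in the natural numbers that linear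
arithmetic can handle. -/
theorem cycleGraph_adj_iff_val {n : ℕ} (hn : 3 ≤ n) (i j : Fin n) :
    (SimpleGraph.cycleGraph n).Adj i j ↔ i.val + 1 = j.val ∨ j.val + 1 = i.val ∨
      (i.val = 0 ∧ j.val + 1 = n) ∨ (j.val = 0 ∧ i.val + 1 = n) := by
  have key : ∀ i j : Fin n, (i - j).val = 1 ↔ j.val + 1 = i.val ∨ (i.val = 0 ∧ j.val + 1 = n) := by
    intro i j
    rw [Fin.sub_def]
    have := i.2
    have := j.2
    simp only
    rcases le_or_gt j.val i.val with h | h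
    · rw [show n - j.val + i.val = i.val - j.val + n by omega, Nat.add_mod_right,
        Nat.mod_eq_of_lt (by omega)]
      omega
    · rw [Nat.mod_eq_of_lt (by omega)]
      omega
  rw [SimpleGraph.cycleGraph_adj', key, key]
  tauto

theorem isCycleGraph_iff : IsCycleGraph G ↔ Cyc G Set.univ := by
  constructor
  · rintro ⟨n, hn, ⟨e⟩⟩
    have : NeZero n := ⟨by omega⟩
    have h1 : Cyc (SimpleGraph.cycleGraph n) Set.univ := by
      -- The vertex `n - 1` is singled out, and the vertices `0, ..., n - 2` form the path.
      have hp := IPath.of_seq (G := SimpleGraph.cycleGraph n) (fun i => Fin.ofNat n i) (n - 2)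
        (fun i hi j hj => by
          rw [cycleGraph_adj_iff_val hn, Fin.val_ofNat, Fin.val_ofNat, Nat.mod_eq_of_lt (by omega),
            Nat.mod_eq_of_lt (by omega)]
          omega)
        (fun i hi j hj h => by
          have := congrArg Fin.val h
          rwa [Fin.val_ofNat, Fin.val_ofNat, Nat.mod_eq_of_lt (by omega),
            Nat.mod_eq_of_lt (by omega)] at this)
      refine ⟨Fin.ofNat n (n - 1), _, _, _, ?_, ?_, hp, ?_, ?_⟩
      · symm
        rw [Set.eq_univ_iff_forall]
        intro i
        have := i.2
        by_cases hi : i.val = n - 1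
        · left
          ext
          rw [Fin.val_ofNat, Nat.mod_eq_of_lt (by omega), hi]
        · right
          refine ⟨i.val, by simp; omega, ?_⟩
          ext
          simp
      · rintro ⟨i, hi, h⟩
        have := Set.mem_Iic.1 hi
        have := congrArg Fin.val h
        rw [Fin.val_ofNat, Fin.val_ofNat, Nat.mod_eq_of_lt (by omega),
            Nat.mod_eq_of_lt (by omega)] at this
        omega
      · intro h
        have := congrArg Fin.val h
        rw [Fin.val_ofNat, Fin.val_ofNat, Nat.mod_eq_of_lt (by omega),
            Nat.mod_eq_of_lt (by omega)] at this
        omega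
      · rintro _ ⟨i, hi, rfl⟩
        have := Set.mem_Iic.1 hi
        rw [cycleGraph_adj_iff_val hn]
        simp only [Fin.ext_iff, Fin.val_ofNat]
        rw [Nat.mod_eq_of_lt (by omega : n - 1 < n), Nat.mod_eq_of_lt (by omega : i < n),
          Nat.mod_eq_of_lt (by omega : 0 < n), Nat.mod_eq_of_lt (by omega : n - 2 < n)]
        omega
    have h2 := h1.image (H := G) e.symm e.symm.injective.injOn
      fun x _ y _ => e.symm.map_adj_iff
    rwa [Set.image_univ, e.symm.surjective.range_eq] at h2
  · rintro ⟨x, a, b, P, h0, h1, h2, h3, h4⟩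
    obtain ⟨f, n, rfl, rfl, rfl, h5, h6⟩ := h2.exists_seq
    have hn : n ≠ 0 := by rintro rfl; exact h3 rfl
    have hx : ∀ i ≤ n, f i ≠ x := fun i hi h => h1 ⟨i, hi, h⟩
    have hxadj : ∀ i ≤ n, G.Adj x (f i) ↔ i = 0 ∨ i = n := fun i hi => by
      rw [h4 _ ⟨i, hi, rfl⟩]
      exact or_congr ⟨h6 _ hi _ (by omega), by rintro rfl; rfl⟩
        ⟨h6 _ hi _ (by omega), by rintro rfl; rfl⟩
    -- The path has the `n + 1` vertices `f 0, ..., f n`, and `x` receives the last index. The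
    -- length `n + 2` is at least 3 because the ends of the path differ.
    let g : Fin (n + 2) → V := fun i => if i.val = n + 1 then x else f i
    have hg : Function.Bijective g := by
      constructor
      · intro i j hij
        have := i.2
        have := j.2
        ext
        simp only [g] at hij
        split_ifs at hij with h7 h8 h8
        · omega
        · exact absurd hij.symm (hx _ (by omega))
        · exact absurd hij (hx _ (by omega))
        · exact h6 _ (by omega) _ (by omega) hij
      · intro z
        have hz : z ∈ insert x (f '' Set.Iic n) := h0 ▸ Set.mem_univ z
        rcases hz with rfl | ⟨i, hi, rfl⟩
        · exact ⟨⟨n + 1, by omega⟩, by simp [g]⟩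
        · have := Set.mem_Iic.1 hi
          exact ⟨⟨i, by omega⟩, by simp [g]; omega⟩
    refine ⟨n + 2, by omega, ⟨RelIso.symm ⟨Equiv.ofBijective g hg, ?_⟩⟩⟩
    intro i j
    have := i.2
    have := j.2
    rw [cycleGraph_adj_iff_val (by omega)]
    simp only [Equiv.ofBijective_apply, g]
    split_ifs with h7 h8 h8
    · simp only [SimpleGraph.irrefl, false_iff]
      omega
    · rw [hxadj _ (by omega)]
      omega
    · rw [G.adj_comm, hxadj _ (by omega)]
      omega
    · rw [h5 _ (by omega) _ (by omega)]
      omega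

theorem mem_inducedCycles : s ∈ inducedCycles G ↔ Cyc G s := by
  rw [inducedCycles, Set.mem_ofPred_eq, isCycleGraph_iff]
  constructor
  · intro h
    simpa using h.of_induce
  · intro h
    simpa using h.induce le_rfl

end

/-! ### Solids as cycles with ears, relative to a chosen vertex -/

section

/-- The neighbours of `x` in `O`. -/
def Nb {V : Type u} (G : SimpleGraph V) (x : V) (O : Set V) : Set V := {y | y ∈ O ∧ G.Adj x y}

/-- An induced cycle `O` and an induced path `P` disjoint from it, of which only the ends `a` and
`b` have neighbours in `O`, such that the cycle and the path form a solid. -/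
structure Ear {V : Type u} (G : SimpleGraph V) (O P : Set V) (a b : V) : Prop where
  cyc : Cyc G O
  path : IPath G a b P
  disj : ∀ z ∈ O, z ∉ P
  inner : ∀ z ∈ P, ∀ y ∈ O, G.Adj z y → z = a ∨ z = b
  wide : Wide G (Nb G a O ∪ Nb G b O)
  left : a ≠ b → (Nb G a O).Nonempty ∧ ¬ Wide G (Nb G a O)
  right : a ≠ b → (Nb G b O).Nonempty ∧ ¬ Wide G (Nb G b O)

/-- The set `s` induces a solid. -/
def Sol {V : Type u} (G : SimpleGraph V) (s : Set V) : Prop := IsSolidGraph (G.induce s)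

variable {V : Type u} {G : SimpleGraph V} {s O P : Set V} {a b c x y z : V}

theorem Nb_mono {O' : Set V} (h : O ⊆ O') : Nb G x O ⊆ Nb G x O' := fun _ hz => ⟨h hz.1, hz.2⟩

theorem not_wide_of_subset_singleton {X : Set V} (h : X ⊆ {x}) : ¬ Wide G X := by
  rintro (⟨y, hy, z, hz, hyz, -⟩ | ⟨w, hw, y, hy, z, hz, hwy, -⟩)
  · exact hyz ((h hy).trans (h hz).symm)
  · exact hwy ((h hw).trans (h hy).symm)

theorem not_wide_of_subset_pair {X : Set V} (hxy : G.Adj x y) (h : X ⊆ {x, y}) : ¬ Wide G X := by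
  have := hxy.symm
  rintro (⟨y, hy, z, hz, hyz, hyz'⟩ | ⟨w, hw, y, hy, z, hz, hwy, hwz, hyz⟩)
  · have := h hy
    have := h hz
    grind
  · have := h hw
    have := h hy
    have := h hz
    grind

theorem Ear.of_vertex (hO : Cyc G O) (hc : c ∉ O) (hw : Wide G (Nb G c O)) : Ear G O {c} c c where
  cyc := hO
  path := .single c
  disj := by grind
  inner := by grind
  wide := by simpa using hw
  left h := absurd rfl h
  right h := absurd rfl h

theorem Ear.symm (h : Ear G O P a b) : Ear G O P b a where
  cyc := h.cyc
  path := h.path.symm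
  disj := h.disj
  inner z hz y hy hzy := (h.inner z hz y hy hzy).symm
  wide := by rw [Set.union_comm]; exact h.wide
  left hne := h.right hne.symm
  right hne := h.left hne.symm

theorem Ear.wide_of_eq (h : Ear G O P a a) : Wide G (Nb G a O) := by simpa using h.wide

/-- A decomposition of a solid into a cycle and a path, with the vertex `x` on the path. -/
def OnEar {V : Type u} (G : SimpleGraph V) (s : Set V) (x : V) : Prop :=
  ∃ O P a b, Ear G O P a b ∧ O ∪ P = s ∧ x ∈ P ∧ (a ≠ b → ∀ y ∈ O, G.Adj a y → ¬ G.Adj b y)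

/-- A decomposition of a solid into a cycle and one further vertex, with `x` on the cycle. -/
def OnRim {V : Type u} (G : SimpleGraph V) (s : Set V) (x : V) : Prop :=
  ∃ O c, Cyc G O ∧ c ∉ O ∧ Wide G (Nb G c O) ∧ insert c O = s ∧ x ∈ O

/-- A decomposition of a solid into a cycle and a path one of whose ends has exactly the
neighbour `x` on the cycle. -/
def IsTip {V : Type u} (G : SimpleGraph V) (s : Set V) (x : V) : Prop :=
  ∃ O P a b, Ear G O P a b ∧ O ∪ P = s ∧ a ≠ b ∧ Nb G a O = {x} ∧ ¬ G.Adj b x ∧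
    ∀ y ∈ s, ∀ z ∈ s, G.Adj x y → G.Adj x z → ¬ G.Adj y z

theorem IPath.of_walk {p : G.Walk x y} (hp : p.IsPath)
    (h : ∀ a ∈ p.support, ∀ b ∈ p.support, G.Adj a b → s(a, b) ∈ p.edges) :
    IPath G x y {z | z ∈ p.support} := by
  induction p with
  | nil =>
    simpa using IPath.single (G := G) _
  | @cons a b c hab p ih =>
    rw [SimpleGraph.Walk.cons_isPath_iff] at hp
    have h1 : {z | z ∈ (SimpleGraph.Walk.cons hab p).support} = insert a {z | z ∈ p.support} := by
      ext; simp
    rw [h1]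
    have hmem : ∀ z ∈ p.support, s(a, z) ∉ p.edges := fun z _ hz =>
      hp.2 (p.fst_mem_support_of_mem_edges hz)
    refine .cons hab (ih hp.1 fun c hc d hd hcd => ?_) hp.2 fun z hz haz => ?_
    · have := h c (by simp [hc]) d (by simp [hd]) hcd
      rw [SimpleGraph.Walk.edges_cons, List.mem_cons] at this
      rcases this with h2 | h2
      · have : a = c ∨ a = d := by
          rw [Sym2.eq_iff] at h2
          tauto
        rcases this with rfl | rfl
        · exact absurd hc hp.2
        · exact absurd hd hp.2
      · exact h2
    · have := h a (by simp) z (by rw [SimpleGraph.Walk.support_cons]; exact List.mem_cons_of_mem _ hz) haz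
      rw [SimpleGraph.Walk.edges_cons, List.mem_cons] at this
      rcases this with h2 | h2
      · rw [Sym2.eq_iff] at h2
        rcases h2 with h2 | h2
        · exact h2.2
        · exact absurd h2.2.symm haz.ne
      · exact absurd h2 (hmem z hz)

/-- The two common ends of a trihedron are nonadjacent for this reason: its paths have length at
least 2. -/
theorem length_eq_one_of_mem_edges {p : G.Walk x y} (hp : p.IsPath) (h : s(x, y) ∈ p.edges) :
    p.length = 1 := by
  cases p with
  | nil => simp at h
  | @cons _ b _ hab p =>
    rw [SimpleGraph.Walk.cons_isPath_iff] at hp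
    rw [SimpleGraph.Walk.edges_cons, List.mem_cons] at h
    rcases h with h | h
    · obtain rfl : y = b := by
        rw [Sym2.eq_iff] at h
        have := hab.ne
        rcases h with h | h
        · exact h.2
        · exact absurd h.1 this
      have := SimpleGraph.Walk.length_eq_zero_iff.2 (SimpleGraph.Walk.isPath_iff_nil.1 hp.1)
      simp [this]
    · exact absurd (p.fst_mem_support_of_mem_edges h) hp.2

theorem IPath.trim (h : IPath G x y s) (hne : x ≠ y) (hxy : ¬ G.Adj x y) :
    ∃ c d S, IPath G c d S ∧ s = insert x (insert y S) ∧ x ∉ S ∧ y ∉ S ∧ G.Adj x c ∧ G.Adj y d ∧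
      (∀ z ∈ S, G.Adj x z → z = c) ∧ ∀ z ∈ S, G.Adj y z → z = d := by
  obtain ⟨c, S, h1, rfl, h2, h3, h4⟩ := h.uncons hne
  have hcy : y ≠ c := by rintro rfl; exact hxy h3
  obtain ⟨d, S', h5, rfl, h6, h7, h8⟩ := h1.symm.uncons hcy
  exact ⟨c, d, S', h5.symm, rfl, by grind, h6, h3, h7, fun z hz => h4 z (by simp [hz]), h8⟩

theorem exists_others (i : Fin 3) : ∃ j k : Fin 3, i ≠ j ∧ i ≠ k ∧ j ≠ k ∧
    ∀ l, l = i ∨ l = j ∨ l = k := by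
  revert i; decide

/-- Three induced paths from `x` to `y` that form a theta. -/
structure Theta {V : Type u} (G : SimpleGraph V) (s : Set V) (x y : V) (S : Fin 3 → Set V) :
    Prop where
  path : ∀ i, IPath G x y (S i)
  ne : x ≠ y
  not_adj : ¬ G.Adj x y
  inter : ∀ i j, i ≠ j → ∀ z, z ∈ S i → z ∈ S j → z = x ∨ z = y
  cross : ∀ i j, i ≠ j → ∀ z ∈ S i, ∀ w ∈ S j, G.Adj z w → (z = x ∨ z = y) ∨ (w = x ∨ w = y)
  union : ∀ z, z ∈ s ↔ ∃ i, z ∈ S i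

namespace Theta

variable {S : Fin 3 → Set V}

theorem symm (h : Theta G s x y S) : Theta G s y x S where
  path i := (h.path i).symm
  ne := h.ne.symm
  not_adj h' := h.not_adj h'.symm
  inter i j hij z hz hz' := (h.inter i j hij z hz hz').symm
  cross i j hij z hz w hw hzw := by
    have := h.cross i j hij z hz w hw hzw
    tauto
  union := h.union

/-- Two of the three paths form the cycle, and the interior of the remaining path is the ear. Its
ends see `x` and `y`, which are nonadjacent and hence form a wide set. -/
theorem ear (h : Theta G s x y S) (i : Fin 3) : ∃ O P a b, Ear G O P a b ∧ O ∪ P = s ∧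
    x ∈ O ∧ y ∈ O ∧ S i = insert x (insert y P) ∧ G.Adj x a ∧ G.Adj y b ∧
    (∀ z ∈ P, G.Adj x z → z = a) ∧ (∀ z ∈ P, G.Adj y z → z = b) ∧ x ∉ P ∧ y ∉ P ∧
    ∀ z ∈ P, ∀ w ∈ O, G.Adj z w → w = x ∨ w = y := by
  obtain ⟨j, k, hij, hik, hjk, hl⟩ := exists_others i
  obtain ⟨a, b, P, h1, h2, h3, h4, h5, h6, h7, h8⟩ := (h.path i).trim h.ne h.not_adj
  obtain ⟨a', b', P', h1', h2', h3', h4', h5', h6', h7', h8'⟩ := (h.path k).trim h.ne h.not_adj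
  have hx : ∀ i, x ∈ S i := fun i => (h.path i).left_mem
  have hy : ∀ i, y ∈ S i := fun i => (h.path i).right_mem
  have hO : Cyc G (S j ∪ S k) := by
    have : S j ∪ S k = S j ∪ P' := by
      have := hx j
      have := hy j
      rw [h2']
      ext z
      simp only [Set.mem_union, Set.mem_insert_iff]
      constructor
      · rintro (hz | rfl | rfl | hz) <;> simp [*]
      · tauto
    rw [this]
    refine .of_paths (h.path j) h1' ?_ (.inl h.ne) h5' h6' ?_
    · intro z hz hz'
      have := h.inter j k hjk z hz (by simp [h2', hz'])
      grind
    · intro z hz w hw hzw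
      have := h.cross j k hjk z hz w (by simp [h2', hw]) hzw
      grind
  have hP : ∀ z ∈ P, z ∈ S i := fun z hz => by simp [h2, hz]
  have hcross : ∀ z ∈ P, ∀ w ∈ S j ∪ S k, G.Adj z w → w = x ∨ w = y := by
    rintro z hz w (hw | hw) hzw
    · have := h.cross i j hij z (hP z hz) w hw hzw
      grind
    · have := h.cross i k hik z (hP z hz) w hw hzw
      grind
  refine ⟨S j ∪ S k, P, a, b, ⟨hO, h1, ?_, ?_, ?_, ?_, ?_⟩, ?_, .inl (hx j), .inl (hy j), h2, h5,
    h6, h7, h8, h3, h4, hcross⟩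
  · rintro z (hz | hz) hzP
    · have := h.inter i j hij z (hP z hzP) hz
      grind
    · have := h.inter i k hik z (hP z hzP) hz
      grind
  · intro z hz w hw hzw
    rcases hcross z hz w hw hzw with rfl | rfl
    · exact .inl (h7 z hz hzw.symm)
    · exact .inr (h8 z hz hzw.symm)
  · exact .of_not_adj (.inl ⟨.inl (hx j), h5.symm⟩) (.inr ⟨.inl (hy j), h6.symm⟩) h.ne h.not_adj
  · intro hab
    refine ⟨⟨x, .inl (hx j), h5.symm⟩, not_wide_of_subset_singleton (x := x) ?_⟩
    rintro w ⟨hw, haw⟩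
    rcases hcross a h1.left_mem w hw haw with rfl | rfl
    · rfl
    · exact absurd (h8 a h1.left_mem haw.symm) hab
  · intro hab
    refine ⟨⟨y, .inl (hy j), h6.symm⟩, not_wide_of_subset_singleton (x := y) ?_⟩
    rintro w ⟨hw, haw⟩
    rcases hcross b h1.right_mem w hw haw with rfl | rfl
    · exact absurd (h7 b h1.right_mem haw.symm).symm hab
    · rfl
  · ext z
    rw [h.union]
    have := hx j
    have := hy j
    constructor
    · rintro ((hz | hz) | hz)
      exacts [⟨j, hz⟩, ⟨k, hz⟩, ⟨i, hP z hz⟩]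
    · rintro ⟨l, hz⟩
      rcases hl l with rfl | rfl | rfl
      · grind
      · exact .inl (.inl hz)
      · exact .inl (.inr hz)

/-- If one of the paths has a single interior vertex, this vertex is added to the cycle of the other
two, on which `x` lies. Otherwise every ear has distinct ends, and the end near `x` sees only `x` on
the cycle. -/
theorem end_cases (h : Theta G s x y S) : OnRim G s x ∨ IsTip G s x := by
  by_cases hex : ∃ i P a, IPath G a a P ∧ S i = insert x (insert y P) ∧ x ∉ P ∧ y ∉ P
  · obtain ⟨i, P, c, hP, hi, hxP, hyP⟩ := hex
    left
    obtain ⟨O, P', a, b, hE, hs, hx, hy, hi', hxa, hyb, hxa', hyb', hxP', hyP', hcross⟩ := h.ear i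
    obtain rfl := hP.eq_singleton
    obtain rfl : {c} = P' := by
      ext z
      have : z ∈ insert x (insert y P') ↔ z ∈ insert x (insert y ({c} : Set V)) := by rw [← hi, hi']
      by_cases hzx : z = x
      · subst hzx; tauto
      by_cases hzy : z = y
      · subst hzy; tauto
      simp only [Set.mem_insert_iff, hzx, hzy, false_or] at this
      exact this.symm
    obtain rfl : a = c := hE.path.left_mem
    obtain rfl : b = a := hE.path.right_mem
    refine ⟨O, b, hE.cyc, fun hb => hE.disj b hb rfl, by simpa using hE.wide, ?_, hx⟩
    rw [← hs, Set.union_singleton]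
  · right
    have hex' : ∀ i O P a b, Ear G O P a b → S i = insert x (insert y P) → x ∉ P → y ∉ P →
        a ≠ b := by
      rintro i O P a b hE hi hx hy rfl
      exact hex ⟨i, P, a, hE.path, hi, hx, hy⟩
    obtain ⟨O, P, a, b, hE, hs, hx, hy, hi, hxa, hyb, hxa', hyb', hxP, hyP, hcross⟩ := h.ear 0
    have hab := hex' _ _ _ _ _ hE hi hxP hyP
    refine ⟨O, P, a, b, hE, hs, hab, ?_, ?_, ?_⟩
    · ext w
      constructor
      · rintro ⟨hw, haw⟩
        rcases hcross a hE.path.left_mem w hw haw with rfl | rfl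
        · rfl
        · exact absurd (hyb' a hE.path.left_mem haw.symm) hab
      · rintro rfl
        exact ⟨hx, hxa.symm⟩
    · exact fun hbx => hab (hxa' b hE.path.right_mem hbx.symm).symm
    · intro p hp q hq hxp hxq hpq
      obtain ⟨i, hpi⟩ := (h.union p).1 hp
      obtain ⟨j, hqj⟩ := (h.union q).1 hq
      have hpx := hxp.ne'
      have hqx := hxq.ne'
      have hpy : p ≠ y := by rintro rfl; exact h.not_adj hxp
      have hqy : q ≠ y := by rintro rfl; exact h.not_adj hxq
      by_cases hij : i = j
      · subst hij
        exact hpq.ne ((h.path i).left_eq_of_adj hpi hqj hxp hxq)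
      · have := h.cross i j hij p hpi q hqj hpq
        tauto

theorem cases (h : Theta G s x y S) (hz : z ∈ s) : OnEar G s z ∨ OnRim G s z ∨ IsTip G s z := by
  obtain ⟨i, hzi⟩ := (h.union z).1 hz
  obtain ⟨O, P, a, b, hE, hs, hx, hy, hi, hxa, hyb, hxa', hyb', hxP, hyP, hcross⟩ := h.ear i
  rw [hi] at hzi
  rcases hzi with rfl | rfl | hzP
  · exact .inr h.end_cases
  · exact .inr h.symm.end_cases
  · refine .inl ⟨O, P, a, b, hE, hs, hzP, fun hab w hw haw hbw => ?_⟩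
    rcases hcross a hE.path.left_mem w hw haw with rfl | rfl
    · exact hab (hxa' b hE.path.right_mem hbw.symm).symm
    · exact hab (hyb' a hE.path.left_mem haw.symm)

end Theta

theorem theta_of_isTrihedron (h : IsTrihedron G) : ∃ x y S, Theta G Set.univ x y S := by
  obtain ⟨x, y, p, hne, hp, hlen, hint, hcov, hadj⟩ := h
  have hxy : ¬ G.Adj x y := by
    intro h
    obtain ⟨i, hi⟩ := hadj _ _ h
    have := length_eq_one_of_mem_edges (hp i) hi
    have := hlen i
    omega
  have key : ∀ i j, i ≠ j → ∀ a ∈ (p i).support, ∀ b ∈ (p j).support, G.Adj a b →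
      (a = x ∨ a = y) ∨ b = x ∨ b = y := by
    intro i j hij a ha b hb hab
    obtain ⟨k, hk⟩ := hadj a b hab
    have h1 := (p k).fst_mem_support_of_mem_edges hk
    have h2 := (p k).snd_mem_support_of_mem_edges hk
    by_cases hki : k = i
    · subst hki
      exact .inr (hint _ _ hij b h2 hb)
    · exact .inl (hint _ _ hki a h1 ha)
  refine ⟨x, y, fun i => {z | z ∈ (p i).support}, fun i => .of_walk (hp i) ?_, hne, hxy, hint, key,
    fun z => ⟨fun _ => hcov z, fun _ => trivial⟩⟩
  intro a ha b hb hab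
  obtain ⟨k, hk⟩ := hadj a b hab
  have h1 := (p k).fst_mem_support_of_mem_edges hk
  have h2 := (p k).snd_mem_support_of_mem_edges hk
  by_cases hki : k = i
  · subst hki
    exact hk
  · have h3 := hint _ _ hki a h1 ha
    have h4 := hint _ _ hki b h2 hb
    have := hab.ne
    have := hab.symm
    grind


/-- Three induced paths `S i` from the vertices of a triangle to `x` that form a stamp. -/
structure Stamp {V : Type u} (G : SimpleGraph V) (s : Set V) (t : Fin 3 → V) (x : V)
    (S : Fin 3 → Set V) : Prop where
  path : ∀ i, IPath G (t i) x (S i)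
  adj : ∀ i j, i ≠ j → G.Adj (t i) (t j)
  ne : ∀ i, t i ≠ x
  inter : ∀ i j, i ≠ j → ∀ z, z ∈ S i → z ∈ S j → z = x
  cross : ∀ i j, i ≠ j → ∀ z ∈ S i, ∀ w ∈ S j, G.Adj z w → z = x ∨ w = x ∨ (z = t i ∧ w = t j)
  union : ∀ z, z ∈ s ↔ ∃ i, z ∈ S i

namespace Stamp

variable {S : Fin 3 → Set V} {t : Fin 3 → V}

/-- Two paths and the edge of the triangle between them form the cycle; the third path without `x`
is the ear. One of its ends sees an edge of the triangle, the other sees `x`. -/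
theorem ear (h : Stamp G s t x S) (i : Fin 3) : ∃ j k O P b, i ≠ j ∧ i ≠ k ∧ j ≠ k ∧
    Ear G O P (t i) b ∧ O ∪ P = s ∧
    x ∈ O ∧ t j ∈ O ∧ t k ∈ O ∧ S i = insert x P ∧ x ∉ P ∧ G.Adj x b ∧
    (∀ z ∈ P, G.Adj x z → z = b) ∧ ∀ z ∈ P, ∀ w ∈ O, G.Adj z w → w = x ∨
      (z = t i ∧ (w = t j ∨ w = t k)) := by
  obtain ⟨j, k, hij, hik, hjk, hl⟩ := exists_others i
  obtain ⟨b, P, h1, h2, h3, h4, h5⟩ := (h.path i).symm.uncons (h.ne i).symm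
  obtain ⟨b', P', h1', h2', h3', h4', h5'⟩ := (h.path k).symm.uncons (h.ne k).symm
  have hx : ∀ i, x ∈ S i := fun i => (h.path i).right_mem
  have ht : ∀ i, t i ∈ S i := fun i => (h.path i).left_mem
  have hO : Cyc G (S j ∪ S k) := by
    have : S j ∪ S k = S j ∪ P' := by
      have := hx j
      rw [h2']
      ext z
      simp only [Set.mem_union, Set.mem_insert_iff]
      constructor
      · rintro (hz | rfl | hz) <;> simp [*]
      · tauto
    rw [this]
    refine .of_paths (h.path j) h1'.symm ?_ (.inl (h.ne j)) (h.adj j k hjk) h4' ?_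
    · intro z hz hz'
      have := h.inter j k hjk z hz (by simp [h2', hz'])
      grind
    · intro z hz w hw hzw
      have := h.cross j k hjk z hz w (by simp [h2', hw]) hzw
      grind
  have hP : ∀ z ∈ P, z ∈ S i := fun z hz => by simp [h2, hz]
  have hcross : ∀ z ∈ P, ∀ w ∈ S j ∪ S k, G.Adj z w → w = x ∨
      (z = t i ∧ (w = t j ∨ w = t k)) := by
    rintro z hz w (hw | hw) hzw
    · have := h.cross i j hij z (hP z hz) w hw hzw
      grind
    · have := h.cross i k hik z (hP z hz) w hw hzw
      grind
  refine ⟨j, k, S j ∪ S k, P, b, hij, hik, hjk, ⟨hO, h1.symm, ?_, ?_, ?_, ?_, ?_⟩, ?_,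
    .inl (hx j), .inl (ht j), .inr (ht k), h2, h3, h4, h5, hcross⟩
  · rintro z (hz | hz) hzP
    · have := h.inter i j hij z (hP z hzP) hz
      grind
    · have := h.inter i k hik z (hP z hzP) hz
      grind
  · intro z hz w hw hzw
    rcases hcross z hz w hw hzw with rfl | hw
    · exact .inr (h5 z hz hzw.symm)
    · exact .inl hw.1
  · exact .of_three (.inr ⟨.inl (hx j), h4.symm⟩) (.inl ⟨.inl (ht j), h.adj _ _ hij⟩)
      (.inl ⟨.inr (ht k), h.adj _ _ hik⟩) (h.ne j).symm (h.ne k).symm (h.adj j k hjk).ne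
  · intro hab
    refine ⟨⟨t j, .inl (ht j), h.adj _ _ hij⟩, not_wide_of_subset_pair (h.adj j k hjk) ?_⟩
    rintro w ⟨hw, haw⟩
    rcases hcross _ h1.right_mem w hw haw with rfl | hw
    · exact absurd (h5 _ h1.right_mem haw.symm) hab
    · exact hw.2
  · intro hab
    refine ⟨⟨x, .inl (hx j), h4.symm⟩, not_wide_of_subset_singleton (x := x) ?_⟩
    rintro w ⟨hw, haw⟩
    rcases hcross b h1.left_mem w hw haw with rfl | hw
    · rfl
    · exact absurd hw.1.symm hab
  · ext z
    rw [h.union]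
    have := hx j
    constructor
    · rintro ((hz | hz) | hz)
      exacts [⟨j, hz⟩, ⟨k, hz⟩, ⟨i, hP z hz⟩]
    · rintro ⟨l, hz⟩
      rcases hl l with rfl | rfl | rfl
      · grind
      · exact .inl (.inl hz)
      · exact .inl (.inr hz)

/-- Every vertex except `x` lies on an ear. The vertex `x` lies on a rim if one of the paths is a
single edge, since the ear is then one vertex; otherwise it is a tip. -/
theorem cases (h : Stamp G s t x S) (hz : z ∈ s) :
    OnEar G s z ∨ OnRim G s z ∨ IsTip G s z := by
  obtain ⟨i, hzi⟩ := (h.union z).1 hz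
  by_cases hzx : z = x
  · subst hzx
    right
    by_cases hex : ∃ i, G.Adj z (t i)
    · obtain ⟨i, hi⟩ := hex
      left
      obtain ⟨j, k, O, P, b, hij, hik, hjk, hE, hs, hx, hj, hk, hS, hxP, hxb, hb, hcross⟩ := h.ear i
      obtain rfl := hb _ hE.path.left_mem hi
      obtain rfl := hE.path.eq_singleton
      refine ⟨O, t i, hE.cyc, fun hb => hE.disj _ hb rfl, by simpa using hE.wide, ?_, hx⟩
      rw [← hs, Set.union_singleton]
    · right
      push Not at hex
      obtain ⟨j, k, O, P, b, hij, hik, hjk, hE, hs, hx, hj, hk, hS, hxP, hxb, hb, hcross⟩ := h.ear 0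
      have hbt : ∀ i, b ≠ t i := by rintro i rfl; exact hex _ hxb
      refine ⟨O, P, b, t 0, hE.symm, hs, hbt 0, ?_, fun h => hex _ h.symm, ?_⟩
      · ext w
        constructor
        · rintro ⟨hw, haw⟩
          rcases hcross b hE.path.right_mem w hw haw with rfl | h
          · rfl
          · exact absurd h.1 (hbt 0)
        · rintro rfl
          exact ⟨hx, hxb.symm⟩
      · intro p hp q hq hzp hzq hpq
        obtain ⟨i, hpi⟩ := (h.union p).1 hp
        obtain ⟨j, hqj⟩ := (h.union q).1 hq
        have hpx := hzp.ne'
        have hqx := hzq.ne'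
        by_cases hij : i = j
        · subst hij
          exact hpq.ne ((h.path i).symm.left_eq_of_adj hpi hqj hzp hzq)
        · have := h.cross i j hij p hpi q hqj hpq
          grind
  · left
    obtain ⟨j, k, O, P, b, hij, hik, hjk, hE, hs, hx, hj, hk, hS, hxP, hxb, hb, hcross⟩ := h.ear i
    refine ⟨O, P, t i, b, hE, hs, by grind, fun hab w hw haw hbw => ?_⟩
    have h1 := hcross _ hE.path.left_mem w hw haw
    have h2 := hcross _ hE.path.right_mem w hw hbw
    have := h.ne j
    have := h.ne k
    have := hb _ hE.path.left_mem
    have := haw.symm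
    grind

end Stamp

theorem stamp_of_isStamp (h : IsStamp G) : ∃ t x S, Stamp G Set.univ t x S := by
  obtain ⟨t, x, p, htri, hp, hlen, hint, hcov, hadj⟩ := h
  have hne : ∀ i, t i ≠ x := by
    intro i hi
    have h1 := hp i
    have h2 := hlen i
    revert h1 h2
    generalize p i = q
    revert q
    rw [hi]
    intro q h1 h2
    have := SimpleGraph.Walk.length_eq_zero_iff.2 (SimpleGraph.Walk.isPath_iff_nil.1 h1)
    omega
  have hti : ∀ i j, t i ∈ (p j).support → i = j := by
    intro i j hij
    by_contra hne'
    exact hne i (hint i j hne' _ (p i).start_mem_support hij)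
  refine ⟨t, x, fun i => {z | z ∈ (p i).support}, fun i => .of_walk (hp i) ?_, htri, hne, hint, ?_,
    fun z => ⟨fun _ => hcov z, fun _ => trivial⟩⟩
  · intro a ha b hb hab
    rcases hadj a b hab with ⟨j, k, rfl, rfl⟩ | ⟨k, hk⟩
    · have := hti _ _ ha
      have := hti _ _ hb
      subst this
      subst this
      exact absurd hab (by simp)
    · have h1 := (p k).fst_mem_support_of_mem_edges hk
      have h2 := (p k).snd_mem_support_of_mem_edges hk
      by_cases hki : k = i
      · subst hki
        exact hk
      · have h3 := hint _ _ hki a h1 ha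
        have h4 := hint _ _ hki b h2 hb
        have := hab.ne
        grind
  · intro i j hij a ha b hb hab
    rcases hadj a b hab with ⟨i', j', rfl, rfl⟩ | ⟨k, hk⟩
    · have := hti _ _ ha
      have := hti _ _ hb
      grind
    · have h1 := (p k).fst_mem_support_of_mem_edges hk
      have h2 := (p k).snd_mem_support_of_mem_edges hk
      by_cases hki : k = i
      · subst hki
        exact .inr (.inl (hint _ _ hij b h2 hb))
      · exact .inl (hint _ _ hki a h1 ha)

/-- Three induced paths `S i` between the vertices of two triangles that form a prism. -/
structure Prism {V : Type u} (G : SimpleGraph V) (s : Set V) (t t' : Fin 3 → V)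
    (S : Fin 3 → Set V) : Prop where
  path : ∀ i, IPath G (t i) (t' i) (S i)
  adj : ∀ i j, i ≠ j → G.Adj (t i) (t j)
  adj' : ∀ i j, i ≠ j → G.Adj (t' i) (t' j)
  ne : ∀ i j, t i ≠ t' j
  inter : ∀ i j, i ≠ j → ∀ z, z ∈ S i → z ∉ S j
  cross : ∀ i j, i ≠ j → ∀ z ∈ S i, ∀ w ∈ S j, G.Adj z w →
    (z = t i ∧ w = t j) ∨ (z = t' i ∧ w = t' j)
  union : ∀ z, z ∈ s ↔ ∃ i, z ∈ S i

/-- The path through `z`, with its ends included, is the ear, and the other two paths form the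
cycle. -/
theorem Prism.cases {S : Fin 3 → Set V} {t t' : Fin 3 → V} (h : Prism G s t t' S) (hz : z ∈ s) :
    OnEar G s z := by
  obtain ⟨i, hzi⟩ := (h.union z).1 hz
  obtain ⟨j, k, hij, hik, hjk, hl⟩ := exists_others i
  have ht : ∀ i, t i ∈ S i := fun i => (h.path i).left_mem
  have ht' : ∀ i, t' i ∈ S i := fun i => (h.path i).right_mem
  have hO : Cyc G (S j ∪ S k) :=
    .of_paths (h.path j) (h.path k) (h.inter j k hjk) (.inl (h.ne j j)) (h.adj j k hjk)
      (h.adj' j k hjk) (h.cross j k hjk)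
  have hcross : ∀ z ∈ S i, ∀ w ∈ S j ∪ S k, G.Adj z w →
      (z = t i ∧ (w = t j ∨ w = t k)) ∨ (z = t' i ∧ (w = t' j ∨ w = t' k)) := by
    rintro z hz w (hw | hw) hzw
    · have := h.cross i j hij z hz w hw hzw
      tauto
    · have := h.cross i k hik z hz w hw hzw
      tauto
  have hne := h.ne
  refine ⟨S j ∪ S k, S i, t i, t' i, ⟨hO, h.path i, ?_, ?_, ?_, fun _ => ⟨?_, ?_⟩,
    fun _ => ⟨?_, ?_⟩⟩, ?_, hzi, ?_⟩
  · rintro w (hw | hw) hwi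
    · exact h.inter i j hij w hwi hw
    · exact h.inter i k hik w hwi hw
  · intro z hz w hw hzw
    have := hcross z hz w hw hzw
    tauto
  · exact .of_three (.inl ⟨.inl (ht j), h.adj i j hij⟩) (.inl ⟨.inr (ht k), h.adj i k hik⟩)
      (.inr ⟨.inl (ht' j), h.adj' i j hij⟩) (h.adj j k hjk).ne (hne _ _) (hne _ _)
  · exact ⟨t j, .inl (ht j), h.adj i j hij⟩
  · refine not_wide_of_subset_pair (h.adj j k hjk) ?_
    rintro w ⟨hw, haw⟩
    have := hcross _ (ht i) w hw haw
    grind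
  · exact ⟨t' j, .inl (ht' j), h.adj' i j hij⟩
  · refine not_wide_of_subset_pair (h.adj' j k hjk) ?_
    rintro w ⟨hw, haw⟩
    have := hcross _ (ht' i) w hw haw
    grind
  · ext w
    rw [h.union]
    constructor
    · rintro ((hz | hz) | hz)
      exacts [⟨j, hz⟩, ⟨k, hz⟩, ⟨i, hz⟩]
    · rintro ⟨l, hz⟩
      rcases hl l with rfl | rfl | rfl
      · exact .inr hz
      · exact .inl (.inl hz)
      · exact .inl (.inr hz)
  · intro _ w hw haw hbw
    have := hcross _ (ht i) w hw haw
    have := hcross _ (ht' i) w hw hbw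
    grind

theorem prism_of_isPrism (h : IsPrism G) : ∃ t t' S, Prism G Set.univ t t' S := by
  obtain ⟨t, t', p, htri, htri', hne, hp, hint, hcov, hadj⟩ := h
  have hti : ∀ i j, t i ∈ (p j).support → i = j := by
    intro i j hij
    by_contra hne'
    exact hint i j hne' _ (p i).start_mem_support hij
  have hti' : ∀ i j, t' i ∈ (p j).support → i = j := by
    intro i j hij
    by_contra hne'
    exact hint i j hne' _ (p i).end_mem_support hij
  refine ⟨t, t', fun i => {z | z ∈ (p i).support}, fun i => .of_walk (hp i) ?_, htri, htri', hne,
    hint, ?_, fun z => ⟨fun _ => hcov z, fun _ => trivial⟩⟩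
  · intro a ha b hb hab
    rcases hadj a b hab with ⟨j, k, rfl, rfl⟩ | ⟨j, k, rfl, rfl⟩ | ⟨k, hk⟩
    · have := hti _ _ ha
      have := hti _ _ hb
      subst this
      subst this
      exact absurd hab (by simp)
    · have := hti' _ _ ha
      have := hti' _ _ hb
      subst this
      subst this
      exact absurd hab (by simp)
    · have h1 := (p k).fst_mem_support_of_mem_edges hk
      by_cases hki : k = i
      · subst hki
        exact hk
      · exact absurd ha (hint _ _ hki a h1)
  · intro i j hij a ha b hb hab
    rcases hadj a b hab with ⟨i', j', rfl, rfl⟩ | ⟨i', j', rfl, rfl⟩ | ⟨k, hk⟩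
    · have := hti _ _ ha
      have := hti _ _ hb
      grind
    · have := hti' _ _ ha
      have := hti' _ _ hb
      grind
    · have h1 := (p k).fst_mem_support_of_mem_edges hk
      have h2 := (p k).snd_mem_support_of_mem_edges hk
      by_cases hki : k = i
      · subst hki
        exact absurd hb (hint _ _ hij b h2)
      · exact absurd ha (hint _ _ hki a h1)

theorem isPyramid_cases (h : IsPyramid G) (x : V) : OnEar G Set.univ x ∨ OnRim G Set.univ x := by
  obtain ⟨w, h1, h2⟩ := h
  have hO : Cyc G {w}ᶜ := mem_inducedCycles.1 h1
  have hw : Wide G (Nb G w {w}ᶜ) := by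
    have hfin : (G.neighborSet w).Finite := hO.finite.subset fun z hz => by
      have : w ≠ z := G.ne_of_adj hz
      simpa using this.symm
    obtain ⟨a, b, c, ha, hb, hc, hab, hac, hbc⟩ := (Set.two_lt_ncard_iff hfin).1 h2
    have key : ∀ {a : V}, a ∈ G.neighborSet w → a ∈ Nb G w {w}ᶜ := fun {a} ha =>
      ⟨by have : w ≠ a := G.ne_of_adj ha
          simpa using this.symm, ha⟩
    exact .of_three (key ha) (key hb) (key hc) hab hac hbc
  by_cases hxw : x = w
  · subst hxw
    exact .inl ⟨_, _, _, _, .of_vertex hO (by simp) hw, by ext z; simpa using em _, rfl, fun h => absurd rfl h⟩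
  · exact .inr ⟨_, w, hO, by simp, hw, by ext z; simp [em], hxw⟩

theorem IsSolidGraph.cases (h : IsSolidGraph G) (x : V) :
    OnEar G Set.univ x ∨ OnRim G Set.univ x ∨ IsTip G Set.univ x := by
  rcases h with h | h | h | h
  · have := isPyramid_cases h x
    tauto
  · obtain ⟨_, _, _, h⟩ := theta_of_isTrihedron h
    exact h.cases trivial
  · obtain ⟨_, _, _, h⟩ := stamp_of_isStamp h
    exact h.cases trivial
  · obtain ⟨_, _, _, h⟩ := prism_of_isPrism h
    exact .inl (h.cases trivial)

theorem Wide.image {X : Set s} (h : Wide (G.induce s) X) : Wide G (Subtype.val '' X) := by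
  rcases h with ⟨y, hy, z, hz, hyz, h⟩ | ⟨x, hx, y, hy, z, hz, h1, h2, h3⟩
  · exact .of_not_adj ⟨y, hy, rfl⟩ ⟨z, hz, rfl⟩ (fun h => hyz (Subtype.ext h)) h
  · exact .of_three ⟨x, hx, rfl⟩ ⟨y, hy, rfl⟩ ⟨z, hz, rfl⟩ (fun h => h1 (Subtype.ext h))
      (fun h => h2 (Subtype.ext h)) (fun h => h3 (Subtype.ext h))

theorem wide_induce {X : Set s} (h : Wide G (Subtype.val '' X)) : Wide (G.induce s) X := by
  rcases h with ⟨_, ⟨y, hy, rfl⟩, _, ⟨z, hz, rfl⟩, hyz, h⟩ |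
    ⟨_, ⟨x, hx, rfl⟩, _, ⟨y, hy, rfl⟩, _, ⟨z, hz, rfl⟩, h1, h2, h3⟩
  · exact .of_not_adj hy hz (fun h => hyz (congrArg _ h)) h
  · exact .of_three hx hy hz (fun h => h1 (congrArg _ h))
      (fun h => h2 (congrArg _ h)) (fun h => h3 (congrArg _ h))

theorem image_Nb (x : s) (O : Set s) :
    Subtype.val '' Nb (G.induce s) x O = Nb G x (Subtype.val '' O) := by
  ext z
  constructor
  · rintro ⟨z, ⟨h1, h2⟩, rfl⟩
    exact ⟨⟨z, h1, rfl⟩, h2⟩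
  · rintro ⟨⟨z, h1, rfl⟩, h2⟩
    exact ⟨z, ⟨h1, h2⟩, rfl⟩

theorem Ear.of_induce {O P : Set s} {a b : s} (h : Ear (G.induce s) O P a b) :
    Ear G (Subtype.val '' O) (Subtype.val '' P) a b where
  cyc := h.cyc.of_induce
  path := h.path.of_induce
  disj := by
    rintro _ ⟨z, hz, rfl⟩ ⟨w, hw, hwz⟩
    exact h.disj z hz (Subtype.ext hwz ▸ hw)
  inner := by
    rintro _ ⟨z, hz, rfl⟩ _ ⟨y, hy, rfl⟩ hzy
    exact (h.inner z hz y hy hzy).imp (congrArg _) (congrArg _)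
  wide := by
    rw [← image_Nb, ← image_Nb, ← Set.image_union]
    exact h.wide.image
  left hab := by
    obtain ⟨h1, h2⟩ := h.left fun h => hab (congrArg _ h)
    rw [← image_Nb]
    exact ⟨h1.image _, fun h => h2 (wide_induce h)⟩
  right hab := by
    obtain ⟨h1, h2⟩ := h.right fun h => hab (congrArg _ h)
    rw [← image_Nb]
    exact ⟨h1.image _, fun h => h2 (wide_induce h)⟩

/-- All later arguments about a solid with a marked vertex start from these three positions of the
vertex, without regard to the kind of the solid. -/
theorem Sol.cases (h : Sol G s) (hx : x ∈ s) : OnEar G s x ∨ OnRim G s x ∨ IsTip G s x := by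
  have huniv : Subtype.val '' (Set.univ : Set s) = s := by simp
  rcases IsSolidGraph.cases h ⟨x, hx⟩ with ⟨O, P, a, b, h1, h2, h3, h4⟩ |
    ⟨O, c, h1, h2, h3, h4, h5⟩ | ⟨O, P, a, b, h1, h2, h3, h4, h5, h6⟩
  · refine .inl ⟨_, _, _, _, h1.of_induce, by rw [← Set.image_union, h2, huniv], ⟨_, h3, rfl⟩, ?_⟩
    rintro hab _ ⟨y, hy, rfl⟩
    exact h4 (fun h => hab (congrArg _ h)) y hy
  · refine .inr (.inl ⟨_, c, h1.of_induce, ?_, ?_, by rw [← Set.image_insert_eq, h4, huniv],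
      ⟨_, h5, rfl⟩⟩)
    · rintro ⟨w, hw, hwz⟩
      exact h2 (Subtype.ext hwz ▸ hw)
    · rw [← image_Nb]
      exact h3.image
  · refine .inr (.inr ⟨_, _, _, _, h1.of_induce, by rw [← Set.image_union, h2, huniv],
      fun h => h3 (Subtype.ext h), ?_, h5, ?_⟩)
    · rw [← image_Nb, h4, Set.image_singleton]
    · intro y hy z hz
      exact h6 ⟨y, hy⟩ trivial ⟨z, hz⟩ trivial

end

/-! ### Every cycle with an ear is a solid -/

section

variable {V : Type u} {G : SimpleGraph V} {s O P : Set V} {a b c x y z : V}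

theorem IPath.exists_walk (h : IPath G x y P) : ∃ p : G.Walk x y, p.IsPath ∧
    (∀ z, z ∈ p.support ↔ z ∈ P) ∧ ∀ a ∈ P, ∀ b ∈ P, G.Adj a b → s(a, b) ∈ p.edges := by
  induction h with
  | single a =>
    refine ⟨.nil, by simp, by simp, ?_⟩
    rintro _ rfl _ rfl h
    exact absurd h (by simp)
  | @cons a b c S hab h ha hS ih =>
    obtain ⟨p, h1, h2, h3⟩ := ih
    refine ⟨.cons hab p, ?_, ?_, ?_⟩
    · rw [SimpleGraph.Walk.cons_isPath_iff, h2]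
      exact ⟨h1, ha⟩
    · intro z
      simp [h2]
    · rintro c hc d hd hcd
      rw [SimpleGraph.Walk.edges_cons, List.mem_cons]
      rcases hc with rfl | hc <;> rcases hd with rfl | hd
      · exact absurd hcd (by simp)
      · rw [hS d hd hcd]
        exact .inl rfl
      · rw [hS c hc hcd.symm, Sym2.eq_swap]
        exact .inl rfl
      · exact .inr (h3 c hc d hd hcd)

theorem one_le_length_of_ne (p : G.Walk x y) (h : x ≠ y) : 1 ≤ p.length := by
  cases p with
  | nil => exact absurd rfl h
  | cons => simp

theorem two_le_length_of_not_adj (p : G.Walk x y) (h : x ≠ y) (h' : ¬ G.Adj x y) :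
    2 ≤ p.length := by
  cases p with
  | nil => exact absurd rfl h
  | cons hab p =>
    cases p with
    | nil => exact absurd hab h'
    | cons => simp

theorem Theta.isTrihedron {S : Fin 3 → Set V} (h : Theta G Set.univ x y S) : IsTrihedron G := by
  choose p hp hsup hedge using fun i => (h.path i).exists_walk
  refine ⟨x, y, p, h.ne, hp, fun i => two_le_length_of_not_adj _ h.ne h.not_adj, ?_, ?_, ?_⟩
  · intro i j hij z hz hz'
    exact h.inter i j hij z ((hsup i z).1 hz) ((hsup j z).1 hz')
  · intro z
    obtain ⟨i, hi⟩ := (h.union z).1 trivial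
    exact ⟨i, (hsup i z).2 hi⟩
  · intro a b hab
    obtain ⟨i, hi⟩ := (h.union a).1 trivial
    obtain ⟨j, hj⟩ := (h.union b).1 trivial
    have hx : ∀ i, x ∈ S i := fun i => (h.path i).left_mem
    have hy : ∀ i, y ∈ S i := fun i => (h.path i).right_mem
    by_cases hij : i = j
    · subst hij
      exact ⟨i, hedge i a hi b hj hab⟩
    · rcases h.cross i j hij a hi b hj hab with (rfl | rfl) | rfl | rfl
      · exact ⟨j, hedge j _ (hx j) b hj hab⟩
      · exact ⟨j, hedge j _ (hy j) b hj hab⟩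
      · exact ⟨i, hedge i a hi _ (hx i) hab⟩
      · exact ⟨i, hedge i a hi _ (hy i) hab⟩

theorem Stamp.isStamp {S : Fin 3 → Set V} {t : Fin 3 → V} (h : Stamp G Set.univ t x S) :
    IsStamp G := by
  choose p hp hsup hedge using fun i => (h.path i).exists_walk
  refine ⟨t, x, p, h.adj, hp, fun i => one_le_length_of_ne _ (h.ne i), ?_, ?_, ?_⟩
  · intro i j hij z hz hz'
    exact h.inter i j hij z ((hsup i z).1 hz) ((hsup j z).1 hz')
  · intro z
    obtain ⟨i, hi⟩ := (h.union z).1 trivial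
    exact ⟨i, (hsup i z).2 hi⟩
  · intro a b hab
    obtain ⟨i, hi⟩ := (h.union a).1 trivial
    obtain ⟨j, hj⟩ := (h.union b).1 trivial
    have hx : ∀ i, x ∈ S i := fun i => (h.path i).right_mem
    by_cases hij : i = j
    · subst hij
      exact .inr ⟨i, hedge i a hi b hj hab⟩
    · rcases h.cross i j hij a hi b hj hab with rfl | rfl | ⟨rfl, rfl⟩
      · exact .inr ⟨j, hedge j _ (hx j) b hj hab⟩
      · exact .inr ⟨i, hedge i a hi _ (hx i) hab⟩
      · exact .inl ⟨i, j, rfl, rfl⟩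

theorem Prism.isPrism {S : Fin 3 → Set V} {t t' : Fin 3 → V} (h : Prism G Set.univ t t' S) :
    IsPrism G := by
  choose p hp hsup hedge using fun i => (h.path i).exists_walk
  refine ⟨t, t', p, h.adj, h.adj', h.ne, hp, ?_, ?_, ?_⟩
  · intro i j hij z hz hz'
    exact h.inter i j hij z ((hsup i z).1 hz) ((hsup j z).1 hz')
  · intro z
    obtain ⟨i, hi⟩ := (h.union z).1 trivial
    exact ⟨i, (hsup i z).2 hi⟩
  · intro a b hab
    obtain ⟨i, hi⟩ := (h.union a).1 trivial
    obtain ⟨j, hj⟩ := (h.union b).1 trivial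
    by_cases hij : i = j
    · subst hij
      exact .inr (.inr ⟨i, hedge i a hi b hj hab⟩)
    · rcases h.cross i j hij a hi b hj hab with ⟨rfl, rfl⟩ | ⟨rfl, rfl⟩
      · exact .inl ⟨i, j, rfl, rfl⟩
      · exact .inr (.inl ⟨i, j, rfl, rfl⟩)

/-- Removing an edge of an induced path leaves two induced paths. -/
theorem IPath.split_edge (h : IPath G a b P) (hy : y ∈ P) (hz : z ∈ P) (hyz : G.Adj y z) :
    ∃ y' z' P₁ P₂, (y' = y ∧ z' = z ∨ y' = z ∧ z' = y) ∧ IPath G a y' P₁ ∧ IPath G z' b P₂ ∧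
      P = P₁ ∪ P₂ ∧ (∀ w ∈ P₁, w ∉ P₂) ∧
      ∀ v ∈ P₁, ∀ w ∈ P₂, G.Adj v w → v = y' ∧ w = z' := by
  induction h with
  | single a =>
    obtain rfl : y = a := hy
    obtain rfl : z = y := hz
    exact absurd hyz (by simp)
  | @cons a b c S hab h ha hS ih =>
    by_cases hya : y = a
    · subst hya
      have : z = b := hS z (by have := hyz.ne; grind) hyz
      subst this
      exact ⟨y, z, {y}, S, .inl ⟨rfl, rfl⟩, .single y, h, by simp, by grind, by grind⟩
    by_cases hza : z = a
    · subst hza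
      have : y = b := hS y (by have := hyz.ne; grind) hyz.symm
      subst this
      exact ⟨z, y, {z}, S, .inr ⟨rfl, rfl⟩, .single z, h, by simp, by grind, by grind⟩
    obtain ⟨y', z', P₁, P₂, h1, h2, h3, rfl, h4, h5⟩ := ih (by grind) (by grind)
    have := h2.left_mem
    refine ⟨y', z', insert a P₁, P₂, h1, .cons hab h2 (by grind) (by grind), h3,
      by rw [Set.insert_union], by grind, ?_⟩
    rintro v (rfl | hv) w hw hvw
    · have := hS w (by grind) hvw
      grind
    · exact h5 v hv w hw hvw

/-- The two arcs of a cycle between nonadjacent vertices. -/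
theorem Cyc.arcs (h : Cyc G O) (hy : y ∈ O) (hz : z ∈ O) (hne : y ≠ z) (hyz : ¬ G.Adj y z) :
    ∃ S₁ S₂, IPath G y z S₁ ∧ IPath G y z S₂ ∧ O = S₁ ∪ S₂ ∧
      (∀ w ∈ S₁, w ∈ S₂ → w = y ∨ w = z) ∧
      ∀ v ∈ S₁, ∀ w ∈ S₂, G.Adj v w → (v = y ∨ v = z) ∨ w = y ∨ w = z := by
  obtain ⟨a, b, P, rfl, h1, h2, h3, h4, h5, h6⟩ := h.rotate hy
  have hzP : z ∈ P := by grind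
  obtain ⟨p, q, P₁, P₂, k1, k2, rfl, k3, k4, k5, k6, k7, k8, k9, k10⟩ :=
    h2.split hzP (by rintro rfl; exact hyz h4) (by rintro rfl; exact hyz h5)
  have := k1.left_mem
  have := k2.right_mem
  have m1 := k1.right_mem
  have m2 := k2.left_mem
  have e1 : IPath G a z (insert z P₁) :=
    (IPath.cons k3.symm k1.symm k5 k8).symm
  have e2 : IPath G b z (insert z P₂) :=
    (IPath.cons k4 k2 k6 k9).symm
  refine ⟨insert y (insert z P₁), insert y (insert z P₂), .cons h4 e1 (by grind) ?_,
    .cons h5 e2 (by grind) ?_, ?_, ?_, ?_⟩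
  · intro w hw hyw
    rcases hw with rfl | hw
    · exact absurd hyw hyz
    · have := h6 w (by grind) hyw
      grind
  · intro w hw hyw
    rcases hw with rfl | hw
    · exact absurd hyw hyz
    · have := h6 w (by grind) hyw
      grind
  · ext w
    simp only [Set.mem_insert_iff, Set.mem_union]
    tauto
  · grind
  · intro v hv w hw hvw
    by_contra hcon
    push Not at hcon
    exact k10 v (by grind) w (by grind) hvw

/-- The cycle is cut at the vertex `z` and at the edge `yx`; this gives two of the three paths of a
stamp. -/
theorem Cyc.arcs_edge (h : Cyc G O) (hy : y ∈ O) (hx : x ∈ O) (hz : z ∈ O) (hyx : G.Adj y x)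
    (hzy : z ≠ y) (hzx : z ≠ x) :
    ∃ S₁ S₂, IPath G y z S₁ ∧ IPath G x z S₂ ∧ O = S₁ ∪ S₂ ∧
      (∀ w ∈ S₁, w ∈ S₂ → w = z) ∧
      ∀ v ∈ S₁, ∀ w ∈ S₂, G.Adj v w → v = z ∨ w = z ∨ (v = y ∧ w = x) := by
  obtain ⟨a, b, P, rfl, h1, h2, h3, h4, h5, h6⟩ := h.rotate hz
  obtain ⟨y', x', P₁, P₂, k0, k1, k2, rfl, k3, k4⟩ :=
    h2.split_edge (show y ∈ P by grind) (show x ∈ P by grind) hyx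
  have m1 := k1.left_mem
  have m2 := k2.right_mem
  have e1 : IPath G y' z (insert z P₁) := (IPath.cons h4 k1 (by grind) fun w hw hzw => by
    have := h6 w (by grind) hzw
    grind).symm
  have e2 : IPath G x' z (insert z P₂) := (IPath.cons h5 k2.symm (by grind) fun w hw hzw => by
    have := h6 w (by grind) hzw
    grind).symm
  rcases k0 with ⟨rfl, rfl⟩ | ⟨rfl, rfl⟩
  · exact ⟨_, _, e1, e2, by grind, by grind, by grind⟩
  · refine ⟨_, _, e2, e1, by grind, by grind, fun v hv w hw hvw => ?_⟩
    have := hvw.symm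
    grind

/-- The cycle is cut at two disjoint edges; this gives two of the three paths of a prism. The names
`t`, `t'` are needed because it is not known which end of the second edge is reached from `y`. -/
theorem Cyc.arcs_edges {y' z' : V} (h : Cyc G O) (hy : y ∈ O) (hy' : y' ∈ O) (hz : z ∈ O)
    (hz' : z' ∈ O) (hyy : G.Adj y y') (hzz : G.Adj z z') (h1 : y ≠ z) (h2 : y ≠ z') (h3 : y' ≠ z)
    (h4 : y' ≠ z') :
    ∃ t t' S₁ S₂, (t = z ∧ t' = z' ∨ t = z' ∧ t' = z) ∧ IPath G y t S₁ ∧ IPath G y' t' S₂ ∧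
      O = S₁ ∪ S₂ ∧ (∀ w ∈ S₁, w ∉ S₂) ∧
      ∀ v ∈ S₁, ∀ w ∈ S₂, G.Adj v w → (v = y ∧ w = y') ∨ (v = t ∧ w = t') := by
  have key : ∀ {a b : V} {P : Set V}, O = insert z P → z ∉ P → IPath G a b P → a ≠ b →
      G.Adj z a → G.Adj z b → (∀ w ∈ P, G.Adj z w → w = a ∨ w = b) → z' = a →
      ∃ t t' S₁ S₂, (t = z ∧ t' = z' ∨ t = z' ∧ t' = z) ∧ IPath G y t S₁ ∧ IPath G y' t' S₂ ∧
      O = S₁ ∪ S₂ ∧ (∀ w ∈ S₁, w ∉ S₂) ∧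
      ∀ v ∈ S₁, ∀ w ∈ S₂, G.Adj v w → (v = y ∧ w = y') ∨ (v = t ∧ w = t') := by
    rintro a b P rfl hzP hP hab hza hzb hadj rfl
    obtain ⟨c, d, P₁, P₂, k0, k1, k2, rfl, k3, k4⟩ :=
      hP.split_edge (show y ∈ P by grind) (show y' ∈ P by grind) hyy
    have m1 := k1.left_mem
    have m2 := k2.right_mem
    have e2 : IPath G d z (insert z P₂) := (IPath.cons hzb k2.symm (by grind) fun w hw hzw => by
      have := hadj w (by grind) hzw
      grind).symm
    rcases k0 with ⟨rfl, rfl⟩ | ⟨rfl, rfl⟩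
    · refine ⟨z', z, P₁, insert z P₂, .inr ⟨rfl, rfl⟩, k1.symm, e2, by grind, by grind,
        ?_⟩
      rintro v hv w (rfl | hw) hvw
      · have := hadj v (by grind) hvw.symm
        grind
      · exact .inl (k4 v hv w hw hvw)
    · refine ⟨z, z', insert z P₂, P₁, .inl ⟨rfl, rfl⟩, e2, k1.symm, by grind, by grind,
        ?_⟩
      rintro w (rfl | hw) v hv hvw
      · have := hadj v (by grind) hvw
        grind
      · have := k4 v hv w hw hvw.symm
        tauto
  obtain ⟨a, b, P, k1, k2, k3, k4, k5, k6, k7⟩ := h.rotate hz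
  rcases k7 z' (by have := hzz.ne; grind) hzz with h | h
  · exact key k1 k2 k3 k4 k5 k6 k7 h
  · exact key k1 k2 k3.symm k4.symm k6 k5 (fun w hw hzw => (k7 w hw hzw).symm) h

theorem isTrihedron_of_ear (hO : Cyc G O) (hP : IPath G a b P) (hd : ∀ z ∈ O, z ∉ P)
    (hu : O ∪ P = Set.univ) (hy : y ∈ O) (hz : z ∈ O) (hne : y ≠ z) (hyz : ¬ G.Adj y z)
    (hadj : ∀ v ∈ P, ∀ w ∈ O, G.Adj v w ↔ (v = a ∧ w = y) ∨ (v = b ∧ w = z)) : IsTrihedron G := by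
  obtain ⟨S₁, S₂, h1, h2, rfl, h3, h4⟩ := hO.arcs hy hz hne hyz
  have ma := hP.left_mem
  have mb := hP.right_mem
  have hya : G.Adj y a := ((hadj a ma y hy).2 (.inl ⟨rfl, rfl⟩)).symm
  have hzb : G.Adj z b := ((hadj b mb z hz).2 (.inr ⟨rfl, rfl⟩)).symm
  have e : IPath G y z (insert y (insert z P)) := by
    refine .cons hya (IPath.cons hzb hP.symm (hd z hz) fun w hw h => ?_).symm
      (by have := hd y hy; grind) ?_
    · have := (hadj w hw z hz).1 h.symm
      grind
    · rintro w (rfl | hw) h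
      · exact absurd h hyz
      · have := (hadj w hw y hy).1 h.symm
        grind
  have my1 := h1.left_mem
  have mz1 := h1.right_mem
  have my2 := h2.left_mem
  have mz2 := h2.right_mem
  refine Theta.isTrihedron (x := y) (y := z) (S := ![S₁, S₂, insert y (insert z P)])
    ⟨?_, hne, hyz, ?_, ?_, ?_⟩
  · intro i; fin_cases i <;> assumption
  · intro i j hij w hw hw'
    fin_cases i <;> fin_cases j <;> simp at hij hw hw' <;> grind
  · intro i j hij v hv w hw hvw
    have hvw' := hvw.symm
    have h5 := fun hv hw => hadj v hv w hw
    have h6 := fun hv hw => hadj w hv v hw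
    have h7 := h4 v
    have h8 := h4 w
    clear hadj h4
    fin_cases i <;> fin_cases j <;> simp at hij hv hw <;> grind
  · intro w
    have : w ∈ S₁ ∪ S₂ ∪ P := hu ▸ Set.mem_univ w
    simp only [Set.mem_univ, true_iff]
    rcases this with (h | h) | h
    · exact ⟨0, h⟩
    · exact ⟨1, h⟩
    · exact ⟨2, by simp [h]⟩

theorem isStamp_of_ear (hO : Cyc G O) (hP : IPath G a b P) (hd : ∀ z ∈ O, z ∉ P)
    (hu : O ∪ P = Set.univ) (hy : y ∈ O) (hx : x ∈ O) (hz : z ∈ O) (hyx : G.Adj y x)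
    (hzy : z ≠ y) (hzx : z ≠ x)
    (hadj : ∀ v ∈ P, ∀ w ∈ O, G.Adj v w ↔ (v = a ∧ (w = y ∨ w = x)) ∨ (v = b ∧ w = z)) :
    IsStamp G := by
  obtain ⟨S₁, S₂, h1, h2, rfl, h3, h4⟩ := hO.arcs_edge hy hx hz hyx hzy hzx
  have ma := hP.left_mem
  have mb := hP.right_mem
  have hya : G.Adj y a := ((hadj a ma y hy).2 (.inl ⟨rfl, .inl rfl⟩)).symm
  have hxa : G.Adj x a := ((hadj a ma x hx).2 (.inl ⟨rfl, .inr rfl⟩)).symm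
  have hzb : G.Adj z b := ((hadj b mb z hz).2 (.inr ⟨rfl, rfl⟩)).symm
  have e : IPath G a z (insert z P) := by
    refine (IPath.cons hzb hP.symm (hd z hz) fun w hw h => ?_).symm
    have := (hadj w hw z hz).1 h.symm
    grind
  have my1 := h1.left_mem
  have mz1 := h1.right_mem
  have my2 := h2.left_mem
  have mz2 := h2.right_mem
  have hxy := hyx.symm
  have hay := hya.symm
  have hax := hxa.symm
  refine Stamp.isStamp (t := ![y, x, a]) (x := z) (S := ![S₁, S₂, insert z P])
    ⟨?_, ?_, ?_, ?_, ?_, ?_⟩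
  · intro i; fin_cases i <;> assumption
  · intro i j hij
    fin_cases i <;> fin_cases j <;> simp at hij ⊢ <;> assumption
  · have := hd z hz
    intro i
    fin_cases i <;> simp <;> grind
  · intro i j hij w hw hw'
    fin_cases i <;> fin_cases j <;> simp at hij hw hw' <;> grind
  · intro i j hij v hv w hw hvw
    have hvw' := hvw.symm
    have h5 := fun hv hw => hadj v hv w hw
    have h6 := fun hv hw => hadj w hv v hw
    have h7 := h4 v
    have h8 := h4 w
    have h9 := h3 y
    have h10 := h3 x
    clear hadj h4
    fin_cases i <;> fin_cases j <;> simp at hij hv hw ⊢ <;> grind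
  · intro w
    have : w ∈ S₁ ∪ S₂ ∪ P := hu ▸ Set.mem_univ w
    simp only [Set.mem_univ, true_iff]
    rcases this with (h | h) | h
    · exact ⟨0, h⟩
    · exact ⟨1, h⟩
    · exact ⟨2, by simp [h]⟩

theorem isPrism_of_ear {y' z' : V} (hO : Cyc G O) (hP : IPath G a b P) (hab : a ≠ b)
    (hd : ∀ z ∈ O, z ∉ P)
    (hu : O ∪ P = Set.univ) (hy : y ∈ O) (hy' : y' ∈ O) (hz : z ∈ O)
    (hz' : z' ∈ O) (hyy : G.Adj y y') (hzz : G.Adj z z') (h1 : y ≠ z) (h2 : y ≠ z') (h3 : y' ≠ z)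
    (h4 : y' ≠ z')
    (hadj : ∀ v ∈ P, ∀ w ∈ O, G.Adj v w ↔
      (v = a ∧ (w = y ∨ w = y')) ∨ (v = b ∧ (w = z ∨ w = z'))) :
    IsPrism G := by
  obtain ⟨t, t', S₁, S₂, k0, k1, k2, rfl, k3, k4⟩ :=
    hO.arcs_edges hy hy' hz hz' hyy hzz h1 h2 h3 h4
  have ma := hP.left_mem
  have mb := hP.right_mem
  have hya : G.Adj y a := ((hadj a ma y hy).2 (.inl ⟨rfl, .inl rfl⟩)).symm
  have hya' : G.Adj y' a := ((hadj a ma y' hy').2 (.inl ⟨rfl, .inr rfl⟩)).symm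
  have hzb : G.Adj z b := ((hadj b mb z hz).2 (.inr ⟨rfl, .inl rfl⟩)).symm
  have hzb' : G.Adj z' b := ((hadj b mb z' hz').2 (.inr ⟨rfl, .inr rfl⟩)).symm
  have htb : G.Adj t b := by rcases k0 with ⟨rfl, rfl⟩ | ⟨rfl, rfl⟩ <;> assumption
  have htb' : G.Adj t' b := by rcases k0 with ⟨rfl, rfl⟩ | ⟨rfl, rfl⟩ <;> assumption
  have htt : G.Adj t t' := by
    rcases k0 with ⟨rfl, rfl⟩ | ⟨rfl, rfl⟩
    · exact hzz
    · exact hzz.symm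
  have hadj' : ∀ v ∈ P, ∀ w ∈ S₁ ∪ S₂, G.Adj v w ↔
      (v = a ∧ (w = y ∨ w = y')) ∨ (v = b ∧ (w = t ∨ w = t')) := by
    intro v hv w hw
    rw [hadj v hv w hw]
    grind
  have mt1 := k1.left_mem
  have mt2 := k1.right_mem
  have mt3 := k2.left_mem
  have mt4 := k2.right_mem
  have hyy' := hyy.symm
  have htt' := htt.symm
  have hay := hya.symm
  have hay' := hya'.symm
  have hbt := htb.symm
  have hbt' := htb'.symm
  have d1 := hd y hy
  have d2 := hd y' hy'
  have d3 := hd t (.inl mt2)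
  have d4 := hd t' (.inr mt4)
  clear hadj
  refine Prism.isPrism (t := ![y, y', a]) (t' := ![t, t', b]) (S := ![S₁, S₂, P])
    ⟨?_, ?_, ?_, ?_, ?_, ?_, ?_⟩
  · intro i; fin_cases i <;> assumption
  · intro i j hij
    fin_cases i <;> fin_cases j <;> simp at hij ⊢ <;> assumption
  · intro i j hij
    fin_cases i <;> fin_cases j <;> simp at hij ⊢ <;> assumption
  · intro i j
    fin_cases i <;> fin_cases j <;> simp <;> grind
  · intro i j hij w hw hw'
    have := hd w
    fin_cases i <;> fin_cases j <;> simp at hij hw hw' <;> grind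
  · intro i j hij v hv w hw hvw
    have hvw' := hvw.symm
    have h5 := fun hv hw => hadj' v hv w hw
    have h6 := fun hv hw => hadj' w hv v hw
    have h7 := k4 v
    have h8 := k4 w
    have h9 := k3 v
    have h10 := k3 w
    clear hadj' k4 hd k0
    fin_cases i <;> fin_cases j <;> simp at hij hv hw ⊢ <;> grind
  · intro w
    have : w ∈ S₁ ∪ S₂ ∪ P := hu ▸ Set.mem_univ w
    simp only [Set.mem_univ, true_iff]
    rcases this with (h | h) | h
    · exact ⟨0, h⟩
    · exact ⟨1, h⟩
    · exact ⟨2, by simp [h]⟩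

theorem isPyramid_of_three (h : Cyc G {c}ᶜ) (hx : G.Adj c x) (hy : G.Adj c y) (hz : G.Adj c z)
    (hxy : x ≠ y) (hxz : x ≠ z) (hyz : y ≠ z) : IsPyramid G := by
  refine ⟨c, mem_inducedCycles.2 h, ?_⟩
  have hfin : (G.neighborSet c).Finite := h.finite.subset fun z hz => by
    have : c ≠ z := G.ne_of_adj hz
    simpa using this.symm
  exact (Set.two_lt_ncard_iff hfin).2 ⟨x, y, z, hx, hy, hz, hxy, hxz, hyz⟩

/-- A one-vertex ear with three neighbours gives a pyramid, and with exactly two, which are then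
nonadjacent, a trihedron. If the ends differ, each sees a vertex or an edge: two vertices give a
trihedron, a vertex and an edge a stamp, two disjoint edges a prism, and two edges with a common
vertex a pyramid. -/
theorem Ear.isSolidGraph (h : Ear G O P a b) (hu : O ∪ P = Set.univ) : IsSolidGraph G := by
  have hcompl : ∀ z, z ∉ O → z ∈ P := fun z hz => by
    have : z ∈ O ∪ P := hu ▸ Set.mem_univ z
    exact this.resolve_left hz
  by_cases hab : a = b
  · subst hab
    have hP := h.path.eq_singleton
    subst hP
    have hO : O = {a}ᶜ := by
      ext z
      exact ⟨fun hz => h.disj z hz, fun hz => by_contra fun hz' => hz (hcompl z hz')⟩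
    by_cases h3 : ∃ x ∈ Nb G a O, ∃ y ∈ Nb G a O, ∃ z ∈ Nb G a O, x ≠ y ∧ x ≠ z ∧ y ≠ z
    · obtain ⟨x, hx, y, hy, z, hz, hxy, hxz, hyz⟩ := h3
      exact .inl (isPyramid_of_three (hO ▸ h.cyc) hx.2 hy.2 hz.2 hxy hxz hyz)
    · rcases h.wide_of_eq with ⟨y, hy, z, hz, hyz, hyz'⟩ | h'
      · refine .inr (.inl (isTrihedron_of_ear h.cyc h.path h.disj hu hy.1 hz.1 hyz hyz' ?_))
        intro v hv w hw
        obtain rfl : v = a := hv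
        constructor
        · intro haw
          by_contra hcon
          exact h3 ⟨y, hy, z, hz, w, ⟨hw, haw⟩, hyz, by grind, by grind⟩
        · rintro (⟨-, rfl⟩ | ⟨-, rfl⟩)
          exacts [hy.2, hz.2]
      · exact absurd h' h3
  · have hwide := h.wide
    have hcross : ∀ v ∈ P, ∀ w ∈ O, G.Adj v w ↔ (v = a ∧ w ∈ Nb G a O) ∨ (v = b ∧ w ∈ Nb G b O) := by
      intro v hv w hw
      constructor
      · intro hvw
        rcases h.inner v hv w hw hvw with rfl | rfl
        · exact .inl ⟨rfl, hw, hvw⟩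
        · exact .inr ⟨rfl, hw, hvw⟩
      · rintro (⟨rfl, hw⟩ | ⟨rfl, hw⟩)
        exacts [hw.2, hw.2]
    have hsub : Nb G a O ⊆ O := fun _ hz => hz.1
    have hsub' : Nb G b O ⊆ O := fun _ hz => hz.1
    have stamp : ∀ {a b : V}, Ear G O P a b → a ≠ b → ∀ y x z, G.Adj y x → Nb G a O = {y, x} →
        Nb G b O = {z} → (∀ v ∈ P, ∀ w ∈ O, G.Adj v w ↔ (v = a ∧ w ∈ Nb G a O) ∨
          (v = b ∧ w ∈ Nb G b O)) → IsSolidGraph G := by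
      intro a b h hab y x z hyx hX hY hcross
      have hw := h.wide
      have hsub : Nb G a O ⊆ O := fun _ hz => hz.1
      have hsub' : Nb G b O ⊆ O := fun _ hz => hz.1
      rw [hX, hY] at hw hcross
      rw [hX] at hsub
      rw [hY] at hsub'
      have : z ∉ ({y, x} : Set V) := fun hz => by
        have h' : ({y, x} ∪ {z} : Set V) ⊆ {y, x} := by grind
        exact not_wide_of_subset_pair hyx h' hw
      exact .inr (.inr (.inl (isStamp_of_ear (y := y) (x := x) (z := z) h.cyc h.path h.disj hu
        (hsub (by simp)) (hsub (by simp)) (hsub' (by simp)) hyx (by grind) (by grind) (by simpa using hcross))))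
    -- The common vertex `y` of the two edges becomes the apex: the rest of `O` and the path `P`
    -- close up to a cycle on which `y` sees `a`, `b`, `y'` and `z'`.
    have wheel : ∀ y y' z', y ≠ y' → y ≠ z' → y' ≠ z' → Nb G a O = {y, y'} → Nb G b O = {y, z'} →
        G.Adj y y' → G.Adj y z' → IsSolidGraph G := by
      intro y y' z' h1 h2 h3 hX hY h4 h5
      rw [hX, hY] at hcross
      rw [hX] at hsub
      rw [hY] at hsub'
      have ma := h.path.left_mem
      have mb := h.path.right_mem
      have mO : ∀ v ∈ P, v ∉ O := fun v hv hv' => h.disj v hv' hv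
      obtain ⟨Q, hQ, k1, k2, k6⟩ : ∃ Q, O = insert y Q ∧ y ∉ Q ∧ IPath G y' z' Q ∧
          ∀ w ∈ Q, G.Adj y w → w = y' ∨ w = z' := by
        obtain ⟨c, d, Q, hQ, k1, k2, k3, k4, k5, k6⟩ := h.cyc.rotate (hsub (by simp) : y ∈ O)
        have e1 := k6 y' (by have := hsub (show y' ∈ {y, y'} by simp); grind) h4
        have e2 := k6 z' (by have := hsub' (show z' ∈ {y, z'} by simp); grind) h5
        by_cases hcy : y' = c
        · subst hcy
          obtain rfl : z' = d := by grind
          exact ⟨Q, hQ, k1, k2, k6⟩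
        · obtain rfl : y' = d := by tauto
          obtain rfl : z' = c := by grind
          exact ⟨Q, hQ, k1, k2.symm, fun w hw h => (k6 w hw h).symm⟩
      subst hQ
      have hc : ({y}ᶜ : Set V) = Q ∪ P := by
        ext w
        have : w ∈ insert y Q ∪ P := hu ▸ Set.mem_univ w
        have := mO y
        grind
      have e1 := (hcross a ma y' (hsub (by simp))).2 (.inl ⟨rfl, by simp⟩)
      have e2 := (hcross b mb z' (hsub' (by simp))).2 (.inr ⟨rfl, by simp⟩)
      have e3 := (hcross a ma y (hsub (by simp))).2 (.inl ⟨rfl, by simp⟩)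
      have e4 := (hcross b mb y (hsub (by simp))).2 (.inr ⟨rfl, by simp⟩)
      have hy'a : y' ≠ a := by
        rintro rfl
        exact mO _ ma (hsub (by simp))
      have hy'b : y' ≠ b := by
        rintro rfl
        exact mO _ mb (hsub (by simp))
      refine .inl (isPyramid_of_three (c := y) (x := a) (y := b) (z := y') ?_ e3.symm e4.symm h4
        hab hy'a.symm hy'b.symm)
      rw [hc]
      refine .of_paths k2 h.path (fun w hw => h.disj w (by simp [hw])) (.inr hab) e1.symm e2.symm ?_
      intro v hv w hw hvw
      have := (hcross w hw v (by simp [hv])).1 hvw.symm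
      grind
    obtain ⟨hX1, hX2⟩ := h.left hab
    obtain ⟨hY1, hY2⟩ := h.right hab
    rcases eq_singleton_or_pair_of_not_wide hX1 hX2 with ⟨y, hX⟩ | ⟨y, y', hyy, hX⟩ <;>
      rcases eq_singleton_or_pair_of_not_wide hY1 hY2 with ⟨z, hY⟩ | ⟨z, z', hzz, hY⟩
    · rw [hX, hY] at hcross hwide
      rw [hX] at hsub
      rw [hY] at hsub'
      have hyz : y ≠ z := by
        rintro rfl
        exact not_wide_of_subset_singleton (x := y) (by simp) hwide
      refine .inr (.inl (isTrihedron_of_ear h.cyc h.path h.disj hu (hsub (by simp))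
        (hsub' (by simp)) hyz (fun h => not_wide_of_subset_pair (X := {y} ∪ {z}) h (by grind) hwide)
        (by simpa using hcross)))
    · exact stamp h.symm (Ne.symm hab) z z' y hzz hY hX
        (fun v hv w hw => (hcross v hv w hw).trans or_comm)
    · exact stamp h hab y y' z hyy hX hY hcross
    · have hyz1 := hyy.ne
      have hyz2 := hzz.ne
      rw [hX, hY] at hwide
      by_cases h1 : y = z
      · subst h1
        refine wheel y y' z' hyz1 hyz2 ?_ hX hY hyy hzz
        rintro rfl
        exact not_wide_of_subset_pair hyy (by simp) hwide
      by_cases h2 : y = z'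
      · subst h2
        refine wheel y y' z hyz1 hyz2.symm ?_ hX (hY.trans (Set.pair_comm _ _)) hyy hzz.symm
        rintro rfl
        exact not_wide_of_subset_pair (X := {y, y'} ∪ {y', y}) hyy (by grind) hwide
      by_cases h3 : y' = z
      · subst h3
        exact wheel y' y z' hyz1.symm hyz2 h2 (hX.trans (Set.pair_comm _ _)) hY hyy.symm hzz
      by_cases h4 : y' = z'
      · subst h4
        exact wheel y' y z hyz1.symm hyz2.symm h1 (hX.trans (Set.pair_comm _ _))
          (hY.trans (Set.pair_comm _ _)) hyy.symm hzz.symm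
      rw [hX, hY] at hcross
      rw [hX] at hsub
      rw [hY] at hsub'
      exact .inr (.inr (.inr (isPrism_of_ear h.cyc h.path hab h.disj hu (hsub (by simp))
        (hsub (by simp)) (hsub' (by simp)) (hsub' (by simp)) hyy hzz h1 h2 h3 h4
        (by simpa using hcross))))

theorem Ear.induce (h : Ear G O P a b) (hO : O ⊆ s) (hP : P ⊆ s) :
    Ear (G.induce s) (Subtype.val ⁻¹' O) (Subtype.val ⁻¹' P) ⟨a, hP h.path.left_mem⟩
      ⟨b, hP h.path.right_mem⟩ := by
  have hNb : ∀ x : s, Subtype.val '' Nb (G.induce s) x (Subtype.val ⁻¹' O) = Nb G x O := by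
    intro x
    rw [image_Nb, Subtype.image_preimage_coe, Set.inter_eq_right.2 hO]
  have hw : ∀ x : s, Wide (G.induce s) (Nb (G.induce s) x (Subtype.val ⁻¹' O)) →
      Wide G (Nb G x O) := fun x hx => hNb x ▸ hx.image
  have hne : ∀ x : s, (Nb G x O).Nonempty →
      (Nb (G.induce s) x (Subtype.val ⁻¹' O)).Nonempty := fun x hx => by
    rw [← hNb] at hx
    exact Set.image_nonempty.1 hx
  refine ⟨h.cyc.induce hO, h.path.induce hP, fun z hz => h.disj z hz, ?_, ?_, ?_, ?_⟩
  · intro z hz y hy hzy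
    exact (h.inner z hz y hy hzy).imp Subtype.ext Subtype.ext
  · apply wide_induce
    rw [Set.image_union, hNb, hNb]
    exact h.wide
  · intro hab
    obtain ⟨h1, h2⟩ := h.left fun h => hab (Subtype.ext h)
    exact ⟨hne _ h1, fun h => h2 (hw _ h)⟩
  · intro hab
    obtain ⟨h1, h2⟩ := h.right fun h => hab (Subtype.ext h)
    exact ⟨hne _ h1, fun h => h2 (hw _ h)⟩

theorem Ear.sol (h : Ear G O P a b) : Sol G (O ∪ P) := by
  refine (h.induce Set.subset_union_left Set.subset_union_right).isSolidGraph ?_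
  exact Set.eq_univ_of_forall fun z => z.2

theorem Cyc.sol_insert (hO : Cyc G O) (hc : c ∉ O) (hw : Wide G (Nb G c O)) :
    Sol G (insert c O) := by
  rw [← Set.union_singleton]
  exact (Ear.of_vertex hO hc hw).sol

end

/-! ### Triangles, neighbourhoods and paths in solids -/

section

section

variable {V : Type u} {G : SimpleGraph V} {s O P : Set V} {a b c x y z : V}

theorem Sol.exists_ear (h : Sol G s) (hx : x ∈ s) : ∃ O P a b, Ear G O P a b ∧ O ∪ P = s := by
  rcases h.cases hx with ⟨O, P, a, b, h1, h2, -⟩ | ⟨O, c, h1, h2, h3, h4, h5⟩ |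
    ⟨O, P, a, b, h1, h2, -⟩
  · exact ⟨O, P, a, b, h1, h2⟩
  · exact ⟨O, {c}, c, c, .of_vertex h1 h2 h3, by rw [Set.union_singleton, h4]⟩
  · exact ⟨O, P, a, b, h1, h2⟩

theorem Sol.nonempty (h : Sol G s) : s.Nonempty := by
  by_contra hs
  rw [Set.not_nonempty_iff_eq_empty] at hs
  subst hs
  rcases h with ⟨x, -⟩ | ⟨x, -⟩ | ⟨-, x, -⟩ | ⟨x, -⟩
  exacts [x.2, x.2, x.2, (x 0).2]

theorem Sol.ear (h : Sol G s) : ∃ O P a b, Ear G O P a b ∧ O ∪ P = s := by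
  obtain ⟨x, hx⟩ := h.nonempty
  exact h.exists_ear hx

theorem Sol.exists_cyc (h : Sol G s) : ∃ O, Cyc G O ∧ O ⊆ s ∧ O ≠ s := by
  obtain ⟨O, P, a, b, hE, rfl⟩ := h.ear
  refine ⟨O, hE.cyc, Set.subset_union_left, fun heq => ?_⟩
  have : a ∈ O := heq ▸ .inr hE.path.left_mem
  exact hE.disj a this hE.path.left_mem

theorem Sol.not_cyc (h : Sol G s) : ¬ Cyc G s := by
  obtain ⟨O, h1, h2, h3⟩ := h.exists_cyc
  exact fun h => h3 (h1.eq_of_subset h h2)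

theorem Sol.exists_three (h : Sol G s) :
    ∃ x ∈ s, ∃ y ∈ s, ∃ z ∈ s, x ≠ y ∧ x ≠ z ∧ y ≠ z := by
  obtain ⟨O, h1, h2, -⟩ := h.exists_cyc
  obtain ⟨x, hx, y, hy, z, hz, h⟩ := h1.exists_three
  exact ⟨x, h2 hx, y, h2 hy, z, h2 hz, h⟩

theorem Ear.image {W : Type v} {H : SimpleGraph W} (h : Ear G O P a b) (f : V → W)
    (hf : Set.InjOn f (O ∪ P))
    (hadj : ∀ x ∈ O ∪ P, ∀ y ∈ O ∪ P, H.Adj (f x) (f y) ↔ G.Adj x y) :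
    Ear H (f '' O) (f '' P) (f a) (f b) := by
  have hNb : ∀ x ∈ P, Nb H (f x) (f '' O) = f '' Nb G x O := by
    intro x hx
    ext z
    constructor
    · rintro ⟨⟨z, hz, rfl⟩, h⟩
      exact ⟨z, ⟨hz, (hadj x (.inr hx) z (.inl hz)).1 h⟩, rfl⟩
    · rintro ⟨z, ⟨hz, h⟩, rfl⟩
      exact ⟨⟨z, hz, rfl⟩, (hadj x (.inr hx) z (.inl hz)).2 h⟩
  have hw : ∀ X ⊆ O, Wide H (f '' X) ↔ Wide G X := by
    intro X hX
    constructor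
    · rintro (⟨_, ⟨y, hy, rfl⟩, _, ⟨z, hz, rfl⟩, h1, h2⟩ |
        ⟨_, ⟨x, hx, rfl⟩, _, ⟨y, hy, rfl⟩, _, ⟨z, hz, rfl⟩, h1, h2, h3⟩)
      · exact .of_not_adj hy hz (fun h => h1 (congrArg f h))
          fun h => h2 ((hadj y (.inl (hX hy)) z (.inl (hX hz))).2 h)
      · exact .of_three hx hy hz (fun h => h1 (congrArg f h)) (fun h => h2 (congrArg f h))
          (fun h => h3 (congrArg f h))
    · rintro (⟨y, hy, z, hz, h1, h2⟩ | ⟨x, hx, y, hy, z, hz, h1, h2, h3⟩)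
      · exact .of_not_adj ⟨y, hy, rfl⟩ ⟨z, hz, rfl⟩
          (fun h => h1 (hf (.inl (hX hy)) (.inl (hX hz)) h))
          fun h => h2 ((hadj y (.inl (hX hy)) z (.inl (hX hz))).1 h)
      · exact .of_three ⟨x, hx, rfl⟩ ⟨y, hy, rfl⟩ ⟨z, hz, rfl⟩
          (fun h => h1 (hf (.inl (hX hx)) (.inl (hX hy)) h))
          (fun h => h2 (hf (.inl (hX hx)) (.inl (hX hz)) h))
          (fun h => h3 (hf (.inl (hX hy)) (.inl (hX hz)) h))
  have ha := h.path.left_mem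
  have hb := h.path.right_mem
  have hsub : ∀ x, Nb G x O ⊆ O := fun _ _ hz => hz.1
  refine ⟨h.cyc.image f (hf.mono Set.subset_union_left) (by grind),
    h.path.image f (hf.mono Set.subset_union_right) (by grind), ?_, ?_, ?_, ?_, ?_⟩
  · rintro _ ⟨z, hz, rfl⟩ ⟨w, hw, hwz⟩
    rw [hf (.inr hw) (.inl hz) hwz] at hw
    exact h.disj z hz hw
  · rintro _ ⟨z, hz, rfl⟩ _ ⟨y, hy, rfl⟩ hzy
    exact (h.inner z hz y hy ((hadj z (.inr hz) y (.inl hy)).1 hzy)).imp (congrArg f) (congrArg f)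
  · rw [hNb a ha, hNb b hb, ← Set.image_union, hw _ (Set.union_subset (hsub _) (hsub _))]
    exact h.wide
  · intro hab
    obtain ⟨h1, h2⟩ := h.left fun h => hab (congrArg f h)
    rw [hNb a ha, hw _ (hsub _)]
    exact ⟨h1.image f, h2⟩
  · intro hab
    obtain ⟨h1, h2⟩ := h.right fun h => hab (congrArg f h)
    rw [hNb b hb, hw _ (hsub _)]
    exact ⟨h1.image f, h2⟩

theorem Sol.image {W : Type v} {H : SimpleGraph W} (h : Sol G s) (f : V → W) (hf : Set.InjOn f s)
    (hadj : ∀ x ∈ s, ∀ y ∈ s, H.Adj (f x) (f y) ↔ G.Adj x y) : Sol H (f '' s) := by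
  obtain ⟨O, P, a, b, hE, rfl⟩ := h.ear
  rw [Set.image_union]
  exact (hE.image f hf hadj).sol

/-- The two neighbours of `x` on the cycle suffice unless they are adjacent. Then the cycle is a
triangle, and `c` must be adjacent to `x`, since otherwise its neighbours would lie in the opposite
edge. -/
theorem Cyc.wide_of_not_triangle (h : Cyc G O) (hw : Wide G (Nb G c O)) (hx : x ∈ O) (hc : c ∉ O) :
    Wide G (Nb G x (insert c O)) := by
  obtain ⟨p, hp, q, hq, h1, h2, h3, h4⟩ := h.exists_adj hx
  by_cases hpq : G.Adj p q
  · have hO := h.eq_triangle hx hp hq h2 h3 hpq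
    have h5 : G.Adj c x := by
      by_contra hcx
      refine not_wide_of_subset_pair (X := Nb G c O) hpq ?_ hw
      rintro w ⟨hw, hcw⟩
      grind
    refine .of_three ⟨.inr hp, h2⟩ ⟨.inr hq, h3⟩ ⟨.inl rfl, h5.symm⟩ h1 ?_ ?_
    · rintro rfl; exact hc hp
    · rintro rfl; exact hc hq
  · exact .of_not_adj ⟨.inr hp, h2⟩ ⟨.inr hq, h3⟩ h1 hpq

/-- This serves to exclude solids: a vertex whose neighbours in `s` fit into an edge cannot belong
to a solid on `s`. -/
theorem Sol.wide_Nb (h : Sol G s) (hx : x ∈ s) : Wide G (Nb G x s) := by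
  have key : ∀ {O P a b}, Ear G O P a b → a ≠ b → (∀ y ∈ O, G.Adj a y → ¬ G.Adj b y) →
      Wide G (Nb G a (O ∪ P)) := by
    intro O P a b h hab hst
    obtain ⟨⟨y, hy, hay⟩, -⟩ := h.left hab
    obtain ⟨c, S, h1, rfl, h2, h3, h4⟩ := h.path.uncons hab
    have h5 := h1.left_mem
    refine .of_not_adj (y := y) (z := c) ⟨.inl hy, hay⟩ ⟨.inr (.inr h5), h3⟩ ?_ ?_
    · rintro rfl
      exact h.disj _ hy (.inr h5)
    · intro hyc
      have := h.inner c (.inr h5) y hy hyc.symm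
      have := h3.ne
      have := hyc.symm
      grind
  rcases h.cases hx with ⟨O, P, a, b, h1, rfl, h3, h4⟩ | ⟨O, c, h1, h2, h3, rfl, h5⟩ |
    ⟨O, P, a, b, h1, rfl, h3, h4, -, h5⟩
  · by_cases hab : a = b
    · subst hab
      obtain rfl := h1.path.eq_singleton
      obtain rfl : x = a := h3
      exact h1.wide_of_eq.mono (Nb_mono Set.subset_union_left)
    by_cases hxa : x = a
    · subst hxa
      exact key h1 hab (h4 hab)
    by_cases hxb : x = b
    · subst hxb
      exact key h1.symm (Ne.symm hab) fun y hy h h' => h4 hab y hy h' h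
    obtain ⟨p, q, P₁, P₂, k1, k2, rfl, k3, k4, k5, k6, k7, k8, k9, k10⟩ := h1.path.split h3 hxa hxb
    have m1 := k1.right_mem
    have m2 := k2.left_mem
    refine .of_not_adj (y := p) (z := q) ⟨.inr (.inl m1), k3.symm⟩ ⟨.inr (.inr (.inr m2)), k4⟩ ?_
      (k10 p m1 q m2)
    rintro rfl
    exact k7 _ m1 m2
  · exact h1.wide_of_not_triangle h3 h5 h2
  · have hxO : x ∈ O ∧ G.Adj a x := by
      have : x ∈ Nb G a O := by rw [h4]; rfl
      exact this
    obtain ⟨p, hp, q, hq, k1, k2, k3, k4⟩ := h1.cyc.exists_adj hxO.1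
    have m := h1.path.left_mem
    refine .of_three ⟨.inl hp, k2⟩ ⟨.inl hq, k3⟩ ⟨.inr m, hxO.2.symm⟩ k1 ?_ ?_
    · rintro rfl; exact h1.disj _ hp m
    · rintro rfl; exact h1.disj _ hq m

/-- If `c` has two neighbours on the cycle besides `x`, then a cycle remains after the deletion of
`x`. If it has just one such neighbour, this one is not adjacent to `x`, so it keeps both of its
neighbours on the cycle and has `c` as a third neighbour, which is impossible on an induced path. -/
theorem Cyc.not_subset_path_of_wide (h : Cyc G O) (hx : x ∈ O) (hc : c ∉ O)
    (hw : Wide G ({x} ∪ Nb G c O)) (hP : IPath G a b P) : ¬ (O ∪ {c}) \ {x} ⊆ P := by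
  intro hsub
  obtain ⟨p, q, S, rfl, h1, h2, h3, h4, h5, h6⟩ := h.rotate hx
  by_cases h2n : ∃ y ∈ S, ∃ z ∈ S, y ≠ z ∧ G.Adj c y ∧ G.Adj c z
  · obtain ⟨y, hy, z, hz, hyz, hcy, hcz⟩ := h2n
    obtain ⟨o, ho, ho'⟩ := Cyc.exists_of_path h2 (by grind) hy hz hyz hcy hcz
    exact ho.not_subset_path hP (by grind)
  · have h7 : ∀ w ∈ Nb G c (insert x S), w ≠ x → w ∈ S ∧ G.Adj c w := by
      rintro w ⟨hw, hcw⟩ hwx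
      exact ⟨by grind, hcw⟩
    have h8 : ∃ y ∈ S, G.Adj c y ∧ ¬ G.Adj x y := by
      rcases hw with ⟨y, hy, z, hz, hyz, hyz'⟩ | ⟨y, hy, z, hz, w, hw, h9⟩
      · have := fun h => hyz' (G.adj_symm h)
        by_cases hyx : y = x
        · subst hyx
          have := h7 z (by grind) hyz.symm
          exact ⟨z, this.1, this.2, hyz'⟩
        · have h10 := h7 y (by grind) hyx
          by_cases hzx : z = x
          · subst hzx
            exact ⟨y, h10.1, h10.2, fun h => hyz' h.symm⟩
          · have := h7 z (by grind) hzx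
            grind
      · exfalso
        have k1 := h7 y
        have k2 := h7 z
        have k3 := h7 w
        grind
    obtain ⟨y, hy, hcy, hxy⟩ := h8
    obtain ⟨p', hp', q', hq', k1, k2, k3, k4⟩ := h.exists_adj (show y ∈ insert x S by grind)
    have k5 : p' ≠ x := by rintro rfl; exact hxy k2.symm
    have k6 : q' ≠ x := by rintro rfl; exact hxy k3.symm
    have := hP.eq_of_adj (x := y) (y₁ := p') (y₂ := q') (y₃ := c) (hsub (by grind)) (hsub (by grind))
      (hsub (by grind)) (hsub (by grind)) k2 k3 hcy.symm
    grind

/-- An induced path with one further vertex is never a solid. -/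
theorem IPath.not_sol_insert (hP : IPath G a b P) (hx : x ∉ P) : ¬ Sol G (insert x P) := by
  intro h
  rcases h.cases (x := x) (by simp) with ⟨O, Q, u, v, h1, h2, h3, h4⟩ | ⟨O, c, h1, h2, h3, h4, h5⟩ |
    ⟨O, Q, u, v, h1, h2, h3, h4, -, h5⟩
  · refine h1.cyc.not_subset_path hP fun z hz => ?_
    have : z ∈ insert x P := h2 ▸ .inl hz
    have : z ≠ x := by rintro rfl; exact h1.disj _ hz h3
    grind
  · exact h1.not_subset_path_of_wide h5 h2 (h3.mono Set.subset_union_right) hP (by grind)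
  · have hxO : x ∈ Nb G u O := by rw [h4]; rfl
    have hw := h1.wide
    rw [h4] at hw
    have m := h1.path.right_mem
    have hx' : x ∉ Q := h1.disj x hxO.1
    exact h1.cyc.not_subset_path_of_wide hxO.1 (fun h => h1.disj _ h m) hw hP (by grind)

theorem IPath.not_triangle (hP : IPath G a b P) (hx : x ∈ P) (hy : y ∈ P) (hz : z ∈ P)
    (hxy : G.Adj x y) (hxz : G.Adj x z) (hyz : G.Adj y z) : False :=
  (Cyc.of_triangle hxy hxz hyz).not_subset_path hP (by grind)

/-- A solid that contains a triangle has a decomposition in which one vertex of the triangle is an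
end of the path and the other two lie on the cycle. -/
theorem Sol.triangle (h : Sol G s) (hx : x ∈ s) (hy : y ∈ s) (hz : z ∈ s)
    (hxy : G.Adj x y) (hxz : G.Adj x z) (hyz : G.Adj y z) :
    ∃ x' y' z' O P v, ({x', y', z'} : Set V) = {x, y, z} ∧ Ear G O P x' v ∧ O ∪ P = s ∧
      y' ∈ O ∧ z' ∈ O ∧ G.Adj x' y' ∧ G.Adj x' z' ∧ G.Adj y' z' ∧
      (x' ≠ v → Nb G x' O = {y', z'} ∧ ¬ G.Adj v y' ∧ ¬ G.Adj v z') := by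
  rcases h.cases hx with ⟨O, P, u, v, h1, h2, h3, h4⟩ | ⟨O, c, h1, h2, h3, h4, h5⟩ |
    ⟨O, P, u, v, h1, h2, h3, h4, -, h5⟩
  -- A triangle with exactly two vertices on the ear would use both of its ends, but distinct ends
  -- have no common neighbour on the cycle here. A triangle inside the ear is excluded as the ear is
  -- a path.
  · have key : ∀ {w w'}, w ∈ O → w' ∈ P → G.Adj x w → G.Adj x w' → G.Adj w w' → False := by
      intro w w' hw hw' k1 k2 k3
      have e1 := h1.inner x h3 w hw k1
      have e2 := h1.inner w' hw' w hw k3.symm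
      have := k2.ne
      have := k3.symm
      grind
    have hyO : y ∈ O := by
      by_contra hyO
      have hyP : y ∈ P := (h2 ▸ hy : y ∈ O ∪ P).resolve_left hyO
      by_cases hzO : z ∈ O
      · exact key hzO hyP hxz hxy hyz.symm
      · exact h1.path.not_triangle h3 hyP ((h2 ▸ hz : z ∈ O ∪ P).resolve_left hzO) hxy hxz hyz
    have hzO : z ∈ O := by
      by_contra hzO
      exact key hyO ((h2 ▸ hz : z ∈ O ∪ P).resolve_left hzO) hxy hxz hyz
    have fin : ∀ {v}, Ear G O P x v → (x ≠ v → ∀ y ∈ O, G.Adj x y → ¬ G.Adj v y) →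
        (x ≠ v → Nb G x O = {y, z} ∧ ¬ G.Adj v y ∧ ¬ G.Adj v z) := by
      intro v h1 h4 hxv
      refine ⟨?_, h4 hxv y hyO hxy, h4 hxv z hzO hxz⟩
      have hnw := (h1.left hxv).2
      ext w
      constructor
      · intro hw
        by_contra hcon
        exact hnw (.of_three hw ⟨hyO, hxy⟩ ⟨hzO, hxz⟩ (by grind) (by grind) hyz.ne)
      · rintro (rfl | rfl)
        exacts [⟨hyO, hxy⟩, ⟨hzO, hxz⟩]
    rcases h1.inner x h3 y hyO hxy with rfl | rfl
    · exact ⟨x, y, z, O, P, v, rfl, h1, h2, hyO, hzO, hxy, hxz, hyz, fin h1 h4⟩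
    · exact ⟨x, y, z, O, P, u, rfl, h1.symm, h2, hyO, hzO, hxy, hxz, hyz,
        fin h1.symm fun h w hw hxw huw => h4 h.symm w hw huw hxw⟩
  · subst h4
    by_cases hyc : y = c
    · subst hyc
      have hzO : z ∈ O := by have := hyz.ne; grind
      exact ⟨y, x, z, O, {y}, y, by grind, .of_vertex h1 h2 h3, by simp, h5, hzO, hxy.symm, hyz, hxz,
        fun h => absurd rfl h⟩
    by_cases hzc : z = c
    · subst hzc
      have hyO : y ∈ O := by grind
      exact ⟨z, x, y, O, {z}, z, by grind, .of_vertex h1 h2 h3, by simp, h5, hyO, hxz.symm, hyz.symm,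
        hxy, fun h => absurd rfl h⟩
    have hyO : y ∈ O := by grind
    have hzO : z ∈ O := by grind
    have hO := h1.eq_triangle h5 hyO hzO hxy hxz hyz
    -- If the cycle is the triangle itself, the apex `c` sees all of it. The four vertices form a
    -- complete graph, and the roles of `c` and `x` can be exchanged.
    have hc : ∀ {p q r}, G.Adj p q → O = {r, p, q} → G.Adj c r := by
      intro p q r hpq hO
      by_contra hcr
      refine not_wide_of_subset_pair hpq ?_ h3
      rintro w ⟨hw, hcw⟩
      grind
    have hcx := hc hyz hO
    have hcy := hc (r := y) hxz (by grind)
    have hcz := hc (r := z) hxy (by grind)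
    have e1 : c ≠ y := hcy.ne
    have e2 : c ≠ z := hcz.ne
    refine ⟨x, y, z, {c, y, z}, {x}, x, rfl, .of_vertex (.of_triangle hcy hcz hyz) ?_ ?_, ?_,
      by simp, by simp, hxy, hxz, hyz, fun h => absurd rfl h⟩
    · have := hcx.ne
      have := hxy.ne
      have := hxz.ne
      grind
    · exact .of_three (x := c) (y := y) (z := z) ⟨by simp, hcx.symm⟩ ⟨by simp, hxy⟩ ⟨by simp, hxz⟩
        e1 e2 hyz.ne
    · rw [hO]
      grind
  · have hxO : x ∈ Nb G u O := by rw [h4]; rfl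
    exact absurd hyz (h5 y hy z hz hxy hxz)

/-- In the decomposition of `Sol.triangle`, a fourth vertex on the cycle makes the cycle a triangle
completely seen by `x'`, which forces a one-vertex ear. A fourth vertex on the ear would be its
other end, which sees neither `y'` nor `z'`. -/
theorem Sol.eq_of_four {w : V} (h : Sol G s) (hw : w ∈ s) (hx : x ∈ s) (hy : y ∈ s) (hz : z ∈ s)
    (hwx : G.Adj w x) (hwy : G.Adj w y) (hwz : G.Adj w z) (hxy : G.Adj x y) (hxz : G.Adj x z)
    (hyz : G.Adj y z) : s = {w, x, y, z} := by
  obtain ⟨x', y', z', O, P, v, h0, h1, rfl, h3, h4, h5, h6, h7, h8⟩ :=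
    h.triangle hx hy hz hxy hxz hyz
  have hx' : x' ∈ ({x, y, z} : Set V) := h0 ▸ by simp
  have hy' : y' ∈ ({x, y, z} : Set V) := h0 ▸ by simp
  have hz' : z' ∈ ({x, y, z} : Set V) := h0 ▸ by simp
  have hwx' : G.Adj w x' := by rcases hx' with rfl | rfl | rfl <;> assumption
  have hwy' : G.Adj w y' := by rcases hy' with rfl | rfl | rfl <;> assumption
  have hwz' : G.Adj w z' := by rcases hz' with rfl | rfl | rfl <;> assumption
  rw [← h0]
  have m := h1.path.left_mem
  by_cases hwO : w ∈ O
  · have hO := h1.cyc.eq_triangle hwO h3 h4 hwy' hwz' h7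
    have hv : x' = v := by
      by_contra hv
      exact (h1.left hv).2 (.of_three (x := w) ⟨hwO, hwx'.symm⟩ ⟨h3, h5⟩ ⟨h4, h6⟩ hwy'.ne hwz'.ne h7.ne)
    subst hv
    rw [h1.path.eq_singleton, hO]
    grind
  · have hwP : w ∈ P := hw.resolve_left hwO
    have := h1.inner w hwP _ h3 hwy'
    have := hwx'.ne
    grind

end

/-! ### The weight of a vertex set -/

section

variable {V : Type u} {G : SimpleGraph V} {s : Set V} {x y z : V}

open Classical in
/-- The contribution of the vertex set `s` to the third graph characteristic. -/
noncomputable def contrib (G : SimpleGraph V) (s : Set V) : ℤ :=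
  (if Sol G s then 1 else 0) - (if Cyc G s then 1 else 0) +
    (if ∃ x y, G.Adj x y ∧ s = {x, y} then 1 else 0) - (if ∃ x, s = {x} then 1 else 0)

/-- Solids, cycles, edges and vertices all count vertex sets, so the alternating count becomes one
sum over the power set. -/
theorem beth3_eq_sum [Fintype V] : beth3 G = ∑ s : Set V, contrib G s := by
  classical
  have key : ∀ p : Set V → Prop, ((∑ s : Set V, if p s then 1 else 0 : ℤ)) = ({s | p s}.ncard : ℤ) := by
    intro p
    rw [Finset.sum_boole, Set.ncard_eq_toFinset_card', Set.toFinset_ofPred]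
  simp only [contrib, Finset.sum_add_distrib, Finset.sum_sub_distrib, key]
  have h1 : {s | Sol G s} = solids G := rfl
  have h2 : {s | Cyc G s} = inducedCycles G := by
    ext s
    exact mem_inducedCycles.symm
  have h3 : {s : Set V | ∃ x y, G.Adj x y ∧ s = {x, y}} = (fun e : Sym2 V => (e : Set V)) '' G.edgeSet := by
    ext s
    constructor
    · rintro ⟨x, y, hxy, rfl⟩
      exact ⟨s(x, y), hxy, by ext; simp⟩
    · rintro ⟨e, he, rfl⟩
      induction e with
      | h x y => exact ⟨x, y, he, by ext; simp⟩
  have h4 : {s : Set V | ∃ x, s = {x}} = (fun x => {x}) '' (Set.univ : Set V) := by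
    ext s
    simp [eq_comm]
  rw [h1, h2, h3, h4, Set.ncard_image_of_injective _ SetLike.coe_injective,
    Set.ncard_image_of_injective _ Set.singleton_injective, Set.ncard_univ, beth3]

theorem contrib_of_three (hx : x ∈ s) (hy : y ∈ s) (hz : z ∈ s) (hxy : x ≠ y) (hxz : x ≠ z)
    (hyz : y ≠ z) :
    contrib G s = open Classical in (if Sol G s then 1 else 0) - (if Cyc G s then 1 else 0) := by
  have h1 : ¬ ∃ x y, G.Adj x y ∧ s = {x, y} := by
    rintro ⟨p, q, -, rfl⟩
    grind
  have h2 : ¬ ∃ x, s = {x} := by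
    rintro ⟨p, rfl⟩
    grind
  simp [contrib, h1, h2]

theorem contrib_of_sol (h : Sol G s) : contrib G s = 1 := by
  obtain ⟨x, hx, y, hy, z, hz, h1, h2, h3⟩ := h.exists_three
  rw [contrib_of_three hx hy hz h1 h2 h3, if_pos h, if_neg h.not_cyc]
  rfl

theorem contrib_of_cyc (h : Cyc G s) : contrib G s = -1 := by
  obtain ⟨x, hx, y, hy, z, hz, h1, h2, h3⟩ := h.exists_three
  rw [contrib_of_three hx hy hz h1 h2 h3, if_pos h, if_neg fun h' => h'.not_cyc h]
  rfl

theorem contrib_eq_zero (hx : x ∈ s) (hy : y ∈ s) (hz : z ∈ s) (hxy : x ≠ y) (hxz : x ≠ z)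
    (hyz : y ≠ z) (h : ¬ Sol G s) (h' : ¬ Cyc G s) : contrib G s = 0 := by
  rw [contrib_of_three hx hy hz hxy hxz hyz, if_neg h, if_neg h']
  rfl

theorem contrib_empty : contrib G ∅ = 0 := by
  have h1 : ¬ Sol G ∅ := fun h => h.nonempty.ne_empty rfl
  have h2 : ¬ Cyc G ∅ := fun h => by
    obtain ⟨x, hx, -⟩ := h.exists_three
    exact hx
  have h3 : ¬ ∃ x y, G.Adj x y ∧ (∅ : Set V) = {x, y} := by
    rintro ⟨p, q, -, h⟩
    exact (h ▸ Set.mem_insert p {q} : p ∈ (∅ : Set V))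
  have h4 : ¬ ∃ x, (∅ : Set V) = {x} := by
    rintro ⟨p, h⟩
    exact (h ▸ rfl : p ∈ (∅ : Set V))
  simp only [contrib, h1, h2, h3, h4]
  simp

theorem pair_ne_singleton (h : x ≠ y) : ({x, y} : Set V) ≠ {z} := fun h' => by
  have h1 : x ∈ ({z} : Set V) := h' ▸ by simp
  have h2 : y ∈ ({z} : Set V) := h' ▸ by simp
  exact h (Eq.trans h1 (Eq.symm h2))

theorem contrib_singleton : contrib G {x} = -1 := by
  have h1 : ¬ Sol G {x} := fun h => by
    obtain ⟨_, rfl, _, rfl, -, -, h, -⟩ := h.exists_three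
    exact h rfl
  have h2 : ¬ Cyc G {x} := fun h => by
    obtain ⟨_, rfl, _, rfl, -, -, h, -⟩ := h.exists_three
    exact h rfl
  have h3 : ¬ ∃ p q, G.Adj p q ∧ ({x} : Set V) = {p, q} := by
    rintro ⟨p, q, h, h'⟩
    exact pair_ne_singleton h.ne h'.symm
  have h4 : ∃ p, ({x} : Set V) = {p} := ⟨x, rfl⟩
  simp only [contrib, h1, h2, h3, h4]
  simp

theorem not_sol_pair : ¬ Sol G {x, y} := fun h => by
  obtain ⟨_, h1, _, h2, _, h3, h4, h5, h6⟩ := h.exists_three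
  grind

theorem not_cyc_pair : ¬ Cyc G {x, y} := fun h => by
  obtain ⟨_, h1, _, h2, _, h3, h4, h5, h6⟩ := h.exists_three
  grind

theorem contrib_pair (h : G.Adj x y) : contrib G {x, y} = 1 := by
  have h3 : ∃ p q, G.Adj p q ∧ ({x, y} : Set V) = {p, q} := ⟨x, y, h, rfl⟩
  have h4 : ¬ ∃ p, ({x, y} : Set V) = {p} := by
    exact fun ⟨p, hp⟩ => pair_ne_singleton h.ne hp
  simp only [contrib, not_sol_pair, not_cyc_pair, h3, h4]
  simp

theorem contrib_pair_of_not_adj (hne : x ≠ y) (h : ¬ G.Adj x y) : contrib G {x, y} = 0 := by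
  have h3 : ¬ ∃ p q, G.Adj p q ∧ ({x, y} : Set V) = {p, q} := by
    rintro ⟨p, q, hpq, h'⟩
    rw [Set.pair_eq_pair_iff] at h'
    rcases h' with ⟨rfl, rfl⟩ | ⟨rfl, rfl⟩
    exacts [h hpq, h hpq.symm]
  have h4 : ¬ ∃ p, ({x, y} : Set V) = {p} := by
    exact fun ⟨p, hp⟩ => pair_ne_singleton hne hp
  simp only [contrib, not_sol_pair, not_cyc_pair, h3, h4]
  simp

theorem contrib_image {W : Type v} {H : SimpleGraph W} (f : V → W) (hf : Set.InjOn f s)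
    (hadj : ∀ x ∈ s, ∀ y ∈ s, H.Adj (f x) (f y) ↔ G.Adj x y) : contrib H (f '' s) = contrib G s := by
  by_cases h3 : ∃ x ∈ s, ∃ y ∈ s, ∃ z ∈ s, x ≠ y ∧ x ≠ z ∧ y ≠ z
  · obtain ⟨x, hx, y, hy, z, hz, h1, h2, h3⟩ := h3
    -- `Sol.image` and `Cyc.image` go in one direction only; a partial inverse of `f` turns them
    -- into equivalences.
    have inv : ∃ g : W → V, ∀ x ∈ s, g (f x) = x := by
      have : Nonempty V := ⟨x⟩
      exact ⟨Function.invFunOn f s, fun x hx =>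
        hf (Function.invFunOn_mem ⟨x, hx, rfl⟩) hx (Function.invFunOn_eq ⟨x, hx, rfl⟩)⟩
    obtain ⟨g, hg⟩ := inv
    have hgs : g '' (f '' s) = s := by
      ext z
      constructor
      · rintro ⟨_, ⟨z, hz, rfl⟩, rfl⟩
        rwa [hg z hz]
      · intro hz
        exact ⟨f z, ⟨z, hz, rfl⟩, hg z hz⟩
    have hginj : Set.InjOn g (f '' s) := by
      rintro _ ⟨x, hx, rfl⟩ _ ⟨y, hy, rfl⟩ h
      rw [hg x hx, hg y hy] at h
      rw [h]
    have hgadj : ∀ x ∈ f '' s, ∀ y ∈ f '' s, G.Adj (g x) (g y) ↔ H.Adj x y := by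
      rintro _ ⟨x, hx, rfl⟩ _ ⟨y, hy, rfl⟩
      rw [hg x hx, hg y hy, hadj x hx y hy]
    have e1 : Sol H (f '' s) ↔ Sol G s :=
      ⟨fun h => hgs ▸ h.image g hginj hgadj, fun h => h.image f hf hadj⟩
    have e2 : Cyc H (f '' s) ↔ Cyc G s :=
      ⟨fun h => hgs ▸ h.image g hginj hgadj, fun h => h.image f hf hadj⟩
    rw [contrib_of_three hx hy hz h1 h2 h3, contrib_of_three (Set.mem_image_of_mem f hx)
      (Set.mem_image_of_mem f hy) (Set.mem_image_of_mem f hz) (fun h => h1 (hf hx hy h))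
      (fun h => h2 (hf hx hz h)) (fun h => h3 (hf hy hz h))]
    classical
    rw [if_congr e1 rfl rfl, if_congr e2 rfl rfl]
  · rcases s.eq_empty_or_nonempty with rfl | ⟨x, hx⟩
    · rw [Set.image_empty, contrib_empty, contrib_empty]
    by_cases hs : ∃ y ∈ s, x ≠ y
    · obtain ⟨y, hy, hxy⟩ := hs
      obtain rfl : s = {x, y} := by
        ext z
        grind
      rw [Set.image_pair]
      by_cases h : G.Adj x y
      · rw [contrib_pair h, contrib_pair ((hadj x hx y hy).2 h)]
      · rw [contrib_pair_of_not_adj hxy h, contrib_pair_of_not_adj (fun h => hxy (hf hx hy h))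
          fun h' => h ((hadj x hx y hy).1 h')]
    · obtain rfl : s = {x} := by
        ext z
        grind
      rw [Set.image_singleton, contrib_singleton, contrib_singleton]

theorem contrib_congr {H : SimpleGraph V} (hadj : ∀ x ∈ s, ∀ y ∈ s, G.Adj x y ↔ H.Adj x y) :
    contrib G s = contrib H s := by
  simpa using (contrib_image (G := G) (H := H) id (Set.injOn_id s) fun x hx y hy =>
    (hadj x hx y hy).symm).symm

end

end

/-! ### Contracting an edge: lifting solids in which the new vertex lies on the ear -/

section

/-- On `insert x T`, the graph `H` arises from the graph `G` on `insert a (insert b T)` by the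
contraction of the edge `ab` to the vertex `x`. -/
structure EdgeContraction {V : Type u} (G H : SimpleGraph V) (T : Set V) (a b x : V) : Prop where
  left_notMem : a ∉ T
  right_notMem : b ∉ T
  notMem : x ∉ T
  adj : G.Adj a b
  adj_iff : ∀ s ∈ T, ∀ t ∈ T, H.Adj s t ↔ G.Adj s t
  new_adj_iff : ∀ t ∈ T, H.Adj x t ↔ G.Adj a t ∨ G.Adj b t

/-- One of the three sets over which a contracted edge can be expanded is a solid. -/
def SomeSol {V : Type u} (G : SimpleGraph V) (T : Set V) (a b : V) : Prop :=
  Sol G (insert a T) ∨ Sol G (insert b T) ∨ Sol G (insert a (insert b T))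

variable {V : Type u} {G H : SimpleGraph V} {T O P Q X : Set V} {a b c p q r t u v x y z : V}

theorem SomeSol.symm (h : SomeSol G T a b) : SomeSol G T b a := by
  rcases h with h | h | h
  · exact .inr (.inl h)
  · exact .inl h
  · exact .inr (.inr (Set.insert_comm a b T ▸ h))

theorem SomeSol.of_ear (h : Ear G O P u v) (hs : O ∪ P = insert a (insert b T)) : SomeSol G T a b :=
  .inr (.inr (hs ▸ h.sol))

theorem SomeSol.of_ear_left (h : Ear G O P u v) (hs : O ∪ P = insert a T) : SomeSol G T a b :=
  .inl (hs ▸ h.sol)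

namespace EdgeContraction

theorem symm (h : EdgeContraction G H T a b x) : EdgeContraction G H T b a x :=
  ⟨h.right_notMem, h.left_notMem, h.notMem, h.adj.symm, h.adj_iff,
    fun t ht => (h.new_adj_iff t ht).trans or_comm⟩

theorem cyc_iff (h : EdgeContraction G H T a b x) (hO : O ⊆ T) : Cyc H O ↔ Cyc G O :=
  ⟨fun h' => h'.congr fun s hs t ht => h.adj_iff s (hO hs) t (hO ht),
    fun h' => h'.congr fun s hs t ht => (h.adj_iff s (hO hs) t (hO ht)).symm⟩

theorem path (h : EdgeContraction G H T a b x) (hP : IPath H u v P) (hPT : P ⊆ T) : IPath G u v P :=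
  hP.congr fun s hs t ht => h.adj_iff s (hPT hs) t (hPT ht)

theorem wide_iff (h : EdgeContraction G H T a b x) (hX : X ⊆ T) : Wide H X ↔ Wide G X :=
  ⟨fun h' => h'.congr fun s hs t ht => h.adj_iff s (hX hs) t (hX ht),
    fun h' => h'.congr fun s hs t ht => (h.adj_iff s (hX hs) t (hX ht)).symm⟩

theorem Nb_eq (h : EdgeContraction G H T a b x) (ht : t ∈ T) (hO : O ⊆ T) : Nb H t O = Nb G t O := by
  ext w
  exact and_congr_right fun hw => h.adj_iff t ht w (hO hw)

/-- Replacing `x` by a vertex `r` with no more neighbours in `X` preserves nonadjacent pairs and the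
number of elements, hence wideness. -/
theorem wide_subst (h : EdgeContraction G H T a b x) (hX : X ⊆ T) (hr : r ∉ T)
    (hadj : ∀ t ∈ X, G.Adj r t → H.Adj x t) (hw : Wide H ({x} ∪ X)) : Wide G ({r} ∪ X) := by
  have hxX : x ∉ X := fun hx => h.notMem (hX hx)
  have hrX : r ∉ X := fun hx => hr (hX hx)
  rcases hw with ⟨y, hy, z, hz, hyz, hyz'⟩ | ⟨y, hy, z, hz, w, hw, h1, h2, h3⟩
  · rcases hy with rfl | hy <;> rcases hz with rfl | hz
    · exact absurd rfl hyz
    · exact .of_not_adj (.inl rfl) (.inr hz) (by grind) fun h' => hyz' (hadj z hz h')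
    · exact .of_not_adj (.inl rfl) (.inr hy) (by grind) fun h' => hyz' (hadj y hy h').symm
    · exact .of_not_adj (.inr hy) (.inr hz) hyz fun h' =>
        hyz' ((h.adj_iff y (hX hy) z (hX hz)).2 h')
  · have key : ∀ {y z w}, y = x → z ∈ X → w ∈ X → z ≠ w → Wide G ({r} ∪ X) := fun h1 h2 h3 h4 =>
      .of_three (.inl rfl) (.inr h2) (.inr h3) (by grind) (by grind) h4
    by_cases hyx : y = x
    · exact key (w := w) hyx (z := z) (by grind) (by grind) h3
    by_cases hzx : z = x
    · exact key (w := w) hzx (z := y) (by grind) (by grind) h2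
    by_cases hwx : w = x
    · exact key (w := z) hwx (z := y) (by grind) (by grind) h1
    · exact .of_three (x := y) (y := z) (z := w) (.inr (by grind)) (.inr (by grind))
        (.inr (by grind)) h1 h2 h3

theorem ear_of (h : EdgeContraction G H T a b x) {u' v' : V} {P' : Set V} (hE : Ear H O P u v)
    (hO : O ⊆ T) (hP : IPath G u' v' P') (hd : ∀ z ∈ O, z ∉ P')
    (hin : ∀ z ∈ P', ∀ y ∈ O, G.Adj z y → z = u' ∨ z = v')
    (hu : Nb G u' O = Nb H u O) (hv : Nb G v' O = Nb H v O) (hne : u ≠ v) : Ear G O P' u' v' := by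
  have hs : ∀ u, Nb H u O ⊆ T := fun u z hz => hO hz.1
  refine ⟨(h.cyc_iff hO).1 hE.cyc, hP, hd, hin, ?_, fun _ => ?_, fun _ => ?_⟩
  · rw [hu, hv, ← h.wide_iff (Set.union_subset (hs _) (hs _))]
    exact hE.wide
  · rw [hu, ← h.wide_iff (hs _)]
    exact hE.left hne
  · rw [hv, ← h.wide_iff (hs _)]
    exact hE.right hne

theorem exists_cyc_path (h : EdgeContraction G H T a b x) (hO : Cyc H O) (hOT : O ⊆ insert x T)
    (hx : x ∈ O) : ∃ p q P, O = insert x P ∧ P ⊆ T ∧ IPath G p q P ∧ p ≠ q ∧ p ∈ P ∧ q ∈ P ∧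
      (∀ t ∈ P, G.Adj a t ∨ G.Adj b t ↔ t = p ∨ t = q) := by
  obtain ⟨p, q, P, rfl, h1, h2, h3, h4, h5, h6⟩ := hO.rotate hx
  have hP : P ⊆ T := fun z hz => by
    have := hOT (.inr hz)
    grind
  refine ⟨p, q, P, rfl, hP, h.path h2 hP, h3, h2.left_mem, h2.right_mem, fun t ht => ?_⟩
  rw [← h.new_adj_iff t (hP ht)]
  exact ⟨h6 t ht, by rintro (rfl | rfl) <;> assumption⟩

/-- Here `a` is responsible for `p` alone and `b` for `q` alone, so the vertex `x` of the cycle is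
replaced by the edge `ab`. -/
theorem subdivide (h : EdgeContraction G H T a b x) (hPT : P ⊆ T) (hP : IPath G p q P) (hpq : p ≠ q)
    (hadj : ∀ t ∈ P, G.Adj a t ∨ G.Adj b t ↔ t = p ∨ t = q) (hbp : ¬ G.Adj b p)
    (haq : ¬ G.Adj a q) : Cyc G ({a, b} ∪ P) := by
  have hp := hP.left_mem
  have hq := hP.right_mem
  have h1 := (hadj p hp).2 (.inl rfl)
  have h2 := (hadj q hq).2 (.inr rfl)
  have h3 := h.left_notMem
  have h4 := h.right_notMem
  refine .of_paths (.pair h.adj) hP ?_ (.inr hpq) (h1.resolve_right hbp) (h2.resolve_left haq) ?_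
  · rintro _ (rfl | rfl) h'
    exacts [h3 (hPT h'), h4 (hPT h')]
  · rintro _ (rfl | rfl) t ht hat
    · have := (hadj t ht).1 (.inl hat)
      grind
    · have := (hadj t ht).1 (.inr hat)
      grind

theorem substitute (h : EdgeContraction G H T a b x) (hPT : P ⊆ T) (hP : IPath G p q P) (hpq : p ≠ q)
    (hadj : ∀ t ∈ P, G.Adj a t ∨ G.Adj b t ↔ t = p ∨ t = q) (hbp : G.Adj b p)
    (hbq : G.Adj b q) : Cyc G (insert b P) := by
  refine ⟨b, p, q, P, rfl, fun hb => h.right_notMem (hPT hb), hP, hpq, fun t ht =>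
    ⟨fun h' => (hadj t ht).1 (.inr h'), ?_⟩⟩
  rintro (rfl | rfl) <;> assumption

/-- An interior vertex `x` of the ear has just two neighbours `p`, `q`. As `a` and `b` both have a
private neighbour, one of them sees only `p` and the other only `q`, and the ear is lengthened by
replacing `x` with the edge `ab`. -/
theorem someSol_of_interior (h : EdgeContraction G H T a b x) (hE : Ear H O P u v)
    (hs : O ∪ P = insert x T) (hx : x ∈ P) (hxu : x ≠ u) (hxv : x ≠ v)
    (hA : ∃ t ∈ T, G.Adj a t ∧ ¬ G.Adj b t) (hB : ∃ t ∈ T, G.Adj b t ∧ ¬ G.Adj a t) :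
    SomeSol G T a b := by
  have hxT := h.notMem
  have hxO : x ∉ O := fun h' => hE.disj x h' hx
  have hne : u ≠ v := by
    rintro rfl
    have := hE.path.eq_singleton
    subst this
    exact hxu hx
  obtain ⟨p, q, P₁, P₂, k1, k2, rfl, k3, k4, k5, k6, k7, k8, k9, k10⟩ := hE.path.split hx hxu hxv
  have hO : O ⊆ T := fun z hz => by
    have : z ∈ insert x T := hs ▸ .inl hz
    grind
  have hP₁ : P₁ ⊆ T := fun z hz => by
    have : z ∈ insert x T := hs ▸ .inr (.inl hz)
    grind
  have hP₂ : P₂ ⊆ T := fun z hz => by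
    have : z ∈ insert x T := hs ▸ .inr (.inr (.inr hz))
    grind
  have mp := k1.right_mem
  have mq := k2.left_mem
  have mu := k1.left_mem
  have mv := k2.right_mem
  have hpq : ∀ t ∈ T, H.Adj x t → t = p ∨ t = q := by
    intro t ht hxt
    have ht' : t ∈ O ∪ (P₁ ∪ insert x P₂) := by
      rw [hs]
      exact .inr ht
    rcases ht' with ht' | ht' | rfl | ht'
    · rcases hE.inner x hx t ht' hxt with h | h
      exacts [absurd h hxu, absurd h hxv]
    · exact .inl (k8 t ht' hxt)
    · exact absurd ht hxT
    · exact .inr (k9 t ht' hxt)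
  have key : ∀ {a b}, EdgeContraction G H T a b x → G.Adj a p → ¬ G.Adj b p → G.Adj b q →
      ¬ G.Adj a q → SomeSol G T a b := by
    intro a b h hap hbp hbq haq
    have h1 := h.left_notMem
    have h2 := h.right_notMem
    have ha : ∀ t ∈ T, G.Adj a t → t = p := fun t ht hat => by
      have := hpq t ht ((h.new_adj_iff t ht).2 (.inl hat))
      grind
    have hb : ∀ t ∈ T, G.Adj b t → t = q := fun t ht hat => by
      have := hpq t ht ((h.new_adj_iff t ht).2 (.inr hat))
      grind
    have e : IPath G u v (P₁ ∪ ({a, b} ∪ P₂)) := by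
      refine (h.path k1 hP₁).append ((IPath.pair h.adj).append (h.path k2 hP₂) hbq ?_ ?_)
        hap.symm ?_ ?_
      · grind
      · rintro w (rfl | rfl) t ht hwt
        · have := ha t (hP₂ ht) hwt
          grind
        · exact ⟨rfl, hb t (hP₂ ht) hwt⟩
      · grind
      · rintro t ht w ((rfl | rfl) | hw) hwt
        · exact ⟨ha t (hP₁ ht) hwt.symm, rfl⟩
        · have := hb t (hP₁ ht) hwt.symm
          grind
        · exact absurd ((h.adj_iff t (hP₁ ht) w (hP₂ hw)).2 hwt) (k10 t ht w hw)
    refine .of_ear (h.ear_of hE hO e ?_ ?_ (h.Nb_eq (hP₁ mu) hO).symm (h.Nb_eq (hP₂ mv) hO).symm hne)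
      ?_
    · intro z hz hz'
      have := hE.disj z hz
      have := hO hz
      grind
    · rintro z (hz | (rfl | rfl) | hz) y hy hzy
      · exact hE.inner z (.inl hz) y hy ((h.adj_iff z (hP₁ hz) y (hO hy)).2 hzy)
      · have := ha y (hO hy) hzy
        subst this
        exact absurd (.inl mp) (hE.disj _ hy)
      · have := hb y (hO hy) hzy
        subst this
        exact absurd (.inr (.inr mq)) (hE.disj _ hy)
      · exact hE.inner z (.inr (.inr hz)) y hy ((h.adj_iff z (hP₂ hz) y (hO hy)).2 hzy)
    · ext z
      have : z ∈ O ∪ (P₁ ∪ insert x P₂) ↔ z ∈ insert x T := by rw [hs]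
      grind
  obtain ⟨t, ht, hat, hbt⟩ := hA
  obtain ⟨r, hr, hbr, har⟩ := hB
  have e1 := hpq t ht ((h.new_adj_iff t ht).2 (.inl hat))
  have e2 := hpq r hr ((h.new_adj_iff r hr).2 (.inr hbr))
  by_cases htp : t = p
  · subst htp
    obtain rfl : r = q := by grind
    exact key h hat hbt hbr har
  · obtain rfl : t = q := by tauto
    obtain rfl : r = p := by grind
    exact (key h.symm hbr har hat hbt).symm

/-- If the neighbours of `a` or those of `b` on the cycle are already wide, that vertex alone gives
a solid. Otherwise `{a, b}` is an ear, because both together see what `x` saw. -/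
theorem someSol_of_apex (h : EdgeContraction G H T a b x) (hE : Ear H O {x} x x)
    (hs : O ∪ {x} = insert x T)
    (hA : ∃ t ∈ T, G.Adj a t ∧ ¬ G.Adj b t) (hB : ∃ t ∈ T, G.Adj b t ∧ ¬ G.Adj a t) :
    SomeSol G T a b := by
  have hxT := h.notMem
  have hO : O = T := by
    ext z
    have h1 : z ∈ O ∪ {x} ↔ z ∈ insert x T := by rw [hs]
    have h2 := hE.disj z
    grind
  subst hO
  have hc := (h.cyc_iff le_rfl).1 hE.cyc
  have hN : Nb G a O ∪ Nb G b O = Nb H x O := by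
    ext t
    constructor
    · rintro (ht | ht)
      · exact ⟨ht.1, (h.new_adj_iff t ht.1).2 (.inl ht.2)⟩
      · exact ⟨ht.1, (h.new_adj_iff t ht.1).2 (.inr ht.2)⟩
    · intro ht
      exact ((h.new_adj_iff t ht.1).1 ht.2).imp (fun h => ⟨ht.1, h⟩) fun h => ⟨ht.1, h⟩
  by_cases h1 : Wide G (Nb G a O)
  · exact .inl (hc.sol_insert h.left_notMem h1)
  by_cases h2 : Wide G (Nb G b O)
  · exact .inr (.inl (hc.sol_insert h.right_notMem h2))
  have := h.left_notMem
  have := h.right_notMem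
  refine .of_ear (O := O) (P := {a, b}) (u := a) (v := b)
    ⟨hc, .pair h.adj, by grind, by grind, ?_, fun _ => ⟨?_, h1⟩, fun _ => ⟨?_, h2⟩⟩ (by grind)
  · rw [hN, ← h.wide_iff fun z hz => hz.1]
    exact hE.wide_of_eq
  · obtain ⟨t, ht, hat, -⟩ := hA
    exact ⟨t, ht, hat⟩
  · obtain ⟨t, ht, hat, -⟩ := hB
    exact ⟨t, ht, hat⟩

-- Here `x` is one end of an ear with distinct ends, and it sees a vertex or an edge of `O`, besides
-- its neighbour `p` on the ear. Either the edge `ab` lengthens the ear, or one of `a`, `b` can be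
-- dropped, or the other end `v` sees a single vertex so close to the neighbours of `x` that another
-- cycle can be chosen.
set_option maxHeartbeats 1000000 in
theorem someSol_of_left (h : EdgeContraction G H T a b x) (hE : Ear H O P x v)
    (hs : O ∪ P = insert x T) (hxv : x ≠ v) (hst : ∀ y ∈ O, H.Adj x y → ¬ H.Adj v y)
    (hA : ∃ t ∈ T, G.Adj a t ∧ ¬ G.Adj b t) (hB : ∃ t ∈ T, G.Adj b t ∧ ¬ G.Adj a t) :
    SomeSol G T a b := by
  have hxT := h.notMem
  have hxO : x ∉ O := fun h' => hE.disj x h' hE.path.left_mem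
  obtain ⟨p, S, k1, rfl, k2, k3, k4⟩ := hE.path.uncons hxv
  have hO : O ⊆ T := fun z hz => by
    have : z ∈ insert x T := hs ▸ .inl hz
    grind
  have hS : S ⊆ T := fun z hz => by
    have : z ∈ insert x T := hs ▸ .inr (.inr hz)
    grind
  have hT : ∀ z ∈ T, z ∈ O ∨ z ∈ S := fun z hz => by
    have : z ∈ O ∪ insert x S := by
      rw [hs]
      exact .inr hz
    grind
  have mp := k1.left_mem
  have mv := k1.right_mem
  have hsub : ∀ u, Nb H u O ⊆ T := fun u z hz => hO hz.1
  obtain ⟨hX1, hX2⟩ := hE.left hxv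
  obtain ⟨hY1, hY2⟩ := hE.right hxv
  have hin : ∀ z ∈ S, ∀ y ∈ O, G.Adj z y → z = v := fun z hz y hy hzy => by
    have := hE.inner z (.inr hz) y hy ((h.adj_iff z (hS hz) y (hO hy)).2 hzy)
    grind
  have hd : ∀ z ∈ O, z ∉ S := fun z hz hz' => hE.disj z hz (.inr hz')
  have hpS := h.path k1 hS
  have hNv := h.Nb_eq (hS mv) hO
  have hc := (h.cyc_iff hO).1 hE.cyc
  rw [hNv] at hY1
  rw [h.wide_iff (hsub v), hNv] at hY2
  have hap : G.Adj a p ∨ G.Adj b p := (h.new_adj_iff p (hS mp)).1 k3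
  -- the path can start in `a`, if there are enough neighbours
  have drop : ∀ {a b y}, EdgeContraction G H T a b x → G.Adj a p → y ∈ O → G.Adj a y →
      (∀ t ∈ O, G.Adj a t → t = y) → Wide G ({y} ∪ Nb G v O) → SomeSol G T a b := by
    intro a b y h hap hy hay hy' hw
    have ha := h.left_notMem
    have hNa : Nb G a O = {y} := by
      ext t
      constructor
      · exact fun ht => hy' t ht.1 ht.2
      · rintro rfl
        exact ⟨hy, hay⟩
    refine .of_ear_left (O := O) (P := insert a S) (u := a) (v := v)
      ⟨hc, .cons hap hpS (fun h' => ha (hS h')) ?_, ?_, ?_, ?_, fun _ => ?_, fun _ => ⟨hY1, hY2⟩⟩ ?_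
    · exact fun t ht hat => k4 t ht ((h.new_adj_iff t (hS ht)).2 (.inl hat))
    · rintro z hz (rfl | hz')
      exacts [ha (hO hz), hd z hz hz']
    · rintro z (rfl | hz) y hy hzy
      exacts [.inl rfl, .inr (hin z hz y hy hzy)]
    · rw [hNa]
      exact hw
    · rw [hNa]
      exact ⟨by simp, not_wide_of_subset_singleton le_rfl⟩
    · ext z
      have := hT z
      have := @hO z
      have := @hS z
      grind
  -- This is the obstruction to dropping a vertex: if `y` and the neighbours of `v` do not form a
  -- wide set, then `v` sees a single vertex on `O`, and `y` is adjacent to it.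
  have narrow : ∀ {y}, y ∉ Nb G v O → ¬ Wide G ({y} ∪ Nb G v O) →
      ∀ z ∈ Nb G v O, G.Adj y z := by
    intro y hy hw z hz
    by_contra hyz
    exact hw (.of_not_adj (y := y) (z := z) (.inl rfl) (.inr hz) (by rintro rfl; exact hy hz) hyz)
  have narrow' : ∀ {y}, y ∉ Nb G v O → ¬ Wide G ({y} ∪ Nb G v O) →
      ∃ z, Nb G v O = {z} ∧ G.Adj y z := by
    intro y hy hw
    obtain ⟨z, hz⟩ := hY1
    refine ⟨z, ?_, narrow hy hw z hz⟩
    ext t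
    constructor
    · intro ht
      by_contra htz
      exact hw (.of_three (x := y) (y := t) (z := z) (.inl rfl) (.inr ht) (.inr hz)
        (by rintro rfl; exact hy ht) (by rintro rfl; exact hy hz) htz)
    · rintro rfl
      exact hz
  have hXadj : ∀ {y z}, y ∈ O → z ∈ O → (G.Adj a y ∨ G.Adj b y) → (G.Adj a z ∨ G.Adj b z) →
      y ≠ z → G.Adj y z := by
    intro y z hy hz h1 h2 hyz
    by_contra hadj
    exact hX2 (.of_not_adj (y := y) (z := z) ⟨hy, (h.new_adj_iff y (hO hy)).2 h1⟩
      ⟨hz, (h.new_adj_iff z (hO hz)).2 h2⟩ hyz fun h' =>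
        hadj ((h.adj_iff y (hO hy) z (hO hz)).1 h'))
  have hXeq : ∀ {y z t}, y ∈ O → z ∈ O → t ∈ O → (G.Adj a y ∨ G.Adj b y) →
      (G.Adj a z ∨ G.Adj b z) → (G.Adj a t ∨ G.Adj b t) → y ≠ z → t = y ∨ t = z := by
    intro y z t hy hz ht h1 h2 h3 hyz
    by_contra hcon
    exact hX2 (.of_three (x := y) (y := z) (z := t) ⟨hy, (h.new_adj_iff y (hO hy)).2 h1⟩
      ⟨hz, (h.new_adj_iff z (hO hz)).2 h2⟩ ⟨ht, (h.new_adj_iff t (hO ht)).2 h3⟩ hyz (by grind)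
      (by grind))
  have hstG : ∀ {y}, y ∈ O → (G.Adj a y ∨ G.Adj b y) → ¬ G.Adj v y := by
    intro y hy h1 h2
    exact hst y hy ((h.new_adj_iff y (hO hy)).2 h1) ((h.adj_iff v (hS mv) y (hO hy)).2 h2)
  have hSadj : ∀ {t}, t ∈ S → (G.Adj a t ∨ G.Adj b t) → t = p := fun {t} ht h' =>
    k4 t ht ((h.new_adj_iff t (hS ht)).2 h')
  -- If `p` is a common neighbour, the private neighbours `y` of `a` and `y'` of `b` lie on the
  -- cycle and form the edge seen by `x`.
  by_cases hM : G.Adj a p ∧ G.Adj b p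
  · obtain ⟨y, hy, hay, hby⟩ := hA
    obtain ⟨y', hy', hby', hay'⟩ := hB
    have hyO : y ∈ O := (hT y hy).resolve_right fun h' => by
      have := hSadj h' (.inl hay)
      grind
    have hyO' : y' ∈ O := (hT y' hy').resolve_right fun h' => by
      have := hSadj h' (.inr hby')
      grind
    have hne : y ≠ y' := by rintro rfl; exact hby hby'
    have hyy := hXadj hyO hyO' (.inl hay) (.inr hby') hne
    have hyY : y ∉ Nb G v O := fun h' => hstG hyO (.inl hay) h'.2
    have hyY' : y' ∉ Nb G v O := fun h' => hstG hyO' (.inr hby') h'.2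
    by_cases w1 : Wide G ({y} ∪ Nb G v O)
    · refine drop h hM.1 hyO hay (fun t ht hat => ?_) w1
      have := hXeq hyO hyO' ht (.inl hay) (.inr hby') (.inl hat) hne
      grind
    by_cases w2 : Wide G ({y'} ∪ Nb G v O)
    · refine (drop h.symm hM.2 hyO' hby' (fun t ht hat => ?_) w2).symm
      have := hXeq hyO hyO' ht (.inl hay) (.inr hby') (.inr hat) hne
      grind
    -- Neither `a` nor `b` can be dropped, so `O` is the triangle `y`, `y'`, `z`. The new cycle is
    -- the quadrangle on `y`, `y'`, `b`, `a`, and the path from `p` to `z` is an ear joining its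
    -- edges `ab` and `yy'`.
    obtain ⟨z, hz, hyz⟩ := narrow' hyY w1
    have hzm : z ∈ Nb G v O := hz ▸ rfl
    have hyz' := narrow hyY' w2 z hzm
    have hOeq := hc.eq_triangle hyO hyO' hzm.1 hyy hyz hyz'
    have ha := h.left_notMem
    have hb := h.right_notMem
    have hzab : ¬ (G.Adj a z ∨ G.Adj b z) := fun h' => hstG hzm.1 h' hzm.2
    have hab := h.adj.ne
    have hO' : Cyc G ({y, y'} ∪ {a, b}) :=
      .of_paths (.pair hyy) (.pair h.adj) (by grind) (.inl hne) hay.symm hby'.symm (by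
        rintro w (rfl | rfl) w' (rfl | rfl) hww
        · exact .inl ⟨rfl, rfl⟩
        · exact absurd hww.symm hby
        · exact absurd hww.symm hay'
        · exact .inr ⟨rfl, rfl⟩)
    have hP' : IPath G p z (S ∪ {z}) := by
      refine hpS.append (.single z) hzm.2 ?_ ?_
      · rintro w hw rfl
        exact hd w hzm.1 hw
      · rintro w hw _ rfl hww
        exact ⟨hin w hw _ hzm.1 hww, rfl⟩
    have hNp : ∀ w ∈ S, ∀ t ∈ ({y, y'} ∪ {a, b} : Set V), G.Adj w t → w = p ∧ t ∈ ({a, b} : Set V) := by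
      rintro w hw t ((rfl | rfl) | (rfl | rfl)) hwt
      · have := hin w hw _ hyO hwt
        subst this
        exact absurd ⟨hyO, hwt⟩ hyY
      · have := hin w hw _ hyO' hwt
        subst this
        exact absurd ⟨hyO', hwt⟩ hyY'
      · exact ⟨hSadj hw (.inl hwt.symm), by simp⟩
      · exact ⟨hSadj hw (.inr hwt.symm), by simp⟩
    refine .of_ear (O := {y, y'} ∪ {a, b}) (P := S ∪ {z}) (u := p) (v := z)
      ⟨hO', hP', ?_, ?_, ?_, fun _ => ⟨⟨a, by simp, hM.1.symm⟩, ?_⟩,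
        fun _ => ⟨⟨y, by simp, hyz.symm⟩, ?_⟩⟩ ?_
    · have h1 := hO hzm.1
      have h2 := @hS a
      have h3 := @hS b
      have h4 := hyz.ne
      have h5 := hyz'.ne
      clear * - h1 h2 h3 h4 h5 ha hb hyO hyO' hd
      grind
    · rintro w (hw | rfl) t ht hwt
      · exact .inl (hNp w hw t ht hwt).1
      · exact .inr rfl
    · exact .of_not_adj (y := a) (z := y') (.inl ⟨by simp, hM.1.symm⟩) (.inr ⟨by simp, hyz'.symm⟩)
        (by grind) hay'
    · exact not_wide_of_subset_pair h.adj fun t ht => (hNp p mp t ht.1 ht.2).2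
    · refine not_wide_of_subset_pair hyy ?_
      rintro t ⟨ht, hzt⟩
      have := hzt.symm
      clear * - this ht hzab
      grind
    · clear * - hT hO hS hOeq
      ext w
      have := hT w
      have := @hO w
      have := @hS w
      grind
  -- Only one of the two vertices, called `a`, sees `p`, so `b`, `a` and `S` form an induced path.
  -- If `a` sees nothing on the cycle, this path is the longer ear.
  · have key : ∀ {a b}, EdgeContraction G H T a b x → G.Adj a p → ¬ G.Adj b p →
        (∃ t ∈ T, G.Adj b t ∧ ¬ G.Adj a t) →
        (∀ {y z}, y ∈ O → z ∈ O → (G.Adj a y ∨ G.Adj b y) → (G.Adj a z ∨ G.Adj b z) →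
          y ≠ z → G.Adj y z) →
        (∀ {y z t}, y ∈ O → z ∈ O → t ∈ O → (G.Adj a y ∨ G.Adj b y) →
          (G.Adj a z ∨ G.Adj b z) → (G.Adj a t ∨ G.Adj b t) → y ≠ z → t = y ∨ t = z) →
        (∀ {y}, y ∈ O → (G.Adj a y ∨ G.Adj b y) → ¬ G.Adj v y) →
        (∀ {t}, t ∈ S → (G.Adj a t ∨ G.Adj b t) → t = p) → SomeSol G T a b := by
      intro a b h hap hbp hB hXadj hXeq hstG hSadj
      have ha := h.left_notMem
      have hb := h.right_notMem
      have hab := h.adj.ne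
      obtain ⟨y, hy, hby, hay⟩ := hB
      have hyO : y ∈ O := (hT y hy).resolve_right fun h' => by
        have := hSadj h' (.inr hby)
        grind
      have hpath : IPath G b v (insert b (insert a S)) := by
        refine .cons h.adj.symm (.cons hap hpS (fun h' => ha (hS h')) ?_) (by grind) ?_
        · exact fun t ht hat => hSadj ht (.inl hat)
        · rintro t (rfl | ht) hbt
          · rfl
          · have := hSadj ht (.inr hbt)
            grind
      by_cases hex : ∃ y' ∈ O, G.Adj a y'
      · obtain ⟨y', hyO', hay'⟩ := hex
        have hne : y' ≠ y := by rintro rfl; exact hay hay'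
        have hyY' : y' ∉ Nb G v O := fun h' => hstG hyO' (.inl hay') h'.2
        by_cases w1 : Wide G ({y'} ∪ Nb G v O)
        · refine drop h hap hyO' hay' (fun t ht hat => ?_) w1
          have := hXeq hyO hyO' ht (.inr hby) (.inl hay') (.inl hat) hne.symm
          grind
        obtain ⟨z, hz, hyz'⟩ := narrow' hyY' w1
        have hzm : z ∈ Nb G v O := hz ▸ rfl
        have hyz : y ≠ z := by
          rintro rfl
          exact hstG hyO (.inr hby) hzm.2
        have hyy := hXadj hyO hyO' (.inr hby) (.inl hay') hne.symm
        -- The vertex `y'` becomes an apex: the rest `Q` of the cycle is closed up by the path `b`,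
        -- `a`, `S`, and `y'` sees `y`, `z` and `a` on this new cycle.
        obtain ⟨Q, hQ, hyQ, hpQ⟩ : ∃ Q, O = insert y' Q ∧ y' ∉ Q ∧ IPath G y z Q := by
          obtain ⟨c, d, Q, hQ, e1, e2, e3, e4, e5, e6⟩ := hc.rotate hyO'
          have f1 := e6 y (by grind) hyy.symm
          have f2 := e6 z (by have := hzm.1; have := hyz'.ne; grind) hyz'
          by_cases hyc : y = c
          · subst hyc
            obtain rfl : z = d := by grind
            exact ⟨Q, hQ, e1, e2⟩
          · obtain rfl : y = d := by tauto
            obtain rfl : z = c := by grind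
            exact ⟨Q, hQ, e1, e2.symm⟩
        have hO' : Cyc G (Q ∪ insert b (insert a S)) := by
          refine .of_paths hpQ hpath ?_ (.inl hyz) hby.symm hzm.2.symm ?_
          · intro w hw
            have hw' : w ∈ O := hQ ▸ .inr hw
            have := hO hw'
            have := hd w hw'
            grind
          · intro w hw t ht hwt
            have hw' : w ∈ O := hQ ▸ .inr hw
            rcases ht with rfl | rfl | ht
            · have := hXeq hyO hyO' hw' (.inr hby) (.inl hay') (.inr hwt.symm) hne.symm
              grind
            · have := hXeq hyO hyO' hw' (.inr hby) (.inl hay') (.inl hwt.symm) hne.symm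
              have := hwt.symm
              grind
            · have hv := hin t ht w hw' hwt.symm
              subst hv
              have : w ∈ Nb G t O := ⟨hw', hwt.symm⟩
              rw [hz] at this
              exact .inr ⟨this, rfl⟩
        have hyn : y' ∉ Q ∪ insert b (insert a S) := by
          have h1 := hO hyO'
          have h2 := hd y' hyO'
          clear * - h1 h2 ha hb hyQ
          grind
        have myQ := hpQ.left_mem
        have mzQ := hpQ.right_mem
        refine .inr (.inr ?_)
        have hse : insert y' (Q ∪ insert b (insert a S)) = insert a (insert b T) := by
          clear * - hT hO hS hQ
          ext w
          have := hT w
          have := @hO w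
          have := @hS w
          grind
        rw [← hse]
        exact hO'.sol_insert hyn (.of_three (x := y) (y := z) (z := a) ⟨.inl myQ, hyy.symm⟩
          ⟨.inl mzQ, hyz'⟩ ⟨by simp, hay'.symm⟩ hyz (by grind) (by have := hO hzm.1; grind))
      · push Not at hex
        refine .of_ear (h.ear_of hE hO hpath ?_ ?_ ?_ hNv.symm hxv) ?_
        · intro w hw
          have h1 := hO hw
          have h2 := hd w hw
          clear * - h1 h2 ha hb
          grind
        · rintro w (rfl | rfl | hw) t ht hwt
          · exact .inl rfl
          · exact absurd hwt (hex t ht)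
          · exact .inr (hin w hw t ht hwt)
        · ext t
          refine and_congr_right fun ht => ?_
          have := hex t ht
          rw [h.new_adj_iff t (hO ht)]
          tauto
        · clear * - hT hO hS
          ext w
          have := hT w
          have := @hO w
          have := @hS w
          grind
    rcases hap with hap | hbp
    · exact key h hap (fun h' => hM ⟨hap, h'⟩) hB hXadj hXeq hstG hSadj
    · refine (key h.symm hbp (fun h' => hM ⟨h', hbp⟩) hA ?_ ?_ ?_ ?_).symm
      · exact fun h1 h2 h3 h4 => hXadj h1 h2 h3.symm h4.symm
      · exact fun h1 h2 h3 h4 h5 h6 => hXeq h1 h2 h3 h4.symm h5.symm h6.symm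
      · exact fun h1 h2 => hstG h1 h2.symm
      · exact fun h1 h2 => hSadj h1 h2.symm

end EdgeContraction

end

/-! ### Contracting an edge: lifting solids in which the new vertex lies on the cycle -/

section

namespace EdgeContraction

variable {V : Type u} {G H : SimpleGraph V} {T O P Q X : Set V} {a b c p q r t u v x y z : V}

/-- The vertices `p` and `q` are the neighbours of `x` on the cycle, and `c` is the only other
possible neighbour. In the first two cases `ab` subdivides the cycle; in the last two, one of `a`,
`b` takes the place of `x` on the cycle and the other is attached to `c`. -/
theorem adj_cases (h : EdgeContraction G H T a b x) (hp : p ∈ T) (hq : q ∈ T)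
    (hx : ∀ t ∈ T, H.Adj x t ↔ t = p ∨ t = q ∨ t = c ∧ H.Adj x c)
    (hA : ∃ t ∈ T, G.Adj a t ∧ ¬ G.Adj b t) (hB : ∃ t ∈ T, G.Adj b t ∧ ¬ G.Adj a t) :
    (¬ G.Adj b p ∧ ¬ G.Adj a q) ∨ (¬ G.Adj b q ∧ ¬ G.Adj a p) ∨
      (G.Adj a c ∧ ¬ G.Adj b c ∧ G.Adj b p ∧ G.Adj b q ∧ ¬ (G.Adj a p ∧ G.Adj a q)) ∨
      (G.Adj b c ∧ ¬ G.Adj a c ∧ G.Adj a p ∧ G.Adj a q ∧ ¬ (G.Adj b p ∧ G.Adj b q)) := by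
  obtain ⟨t, ht, hat, hbt⟩ := hA
  obtain ⟨r, hr, hbr, har⟩ := hB
  have h1 := (hx t ht).1 ((h.new_adj_iff t ht).2 (.inl hat))
  have h2 := (hx r hr).1 ((h.new_adj_iff r hr).2 (.inr hbr))
  have h3 := (h.new_adj_iff p hp).1 ((hx p hp).2 (.inl rfl))
  have h4 := (h.new_adj_iff q hq).1 ((hx q hq).2 (.inr (.inl rfl)))
  clear hx h
  rcases h1 with rfl | rfl | ⟨rfl, -⟩ <;> rcases h2 with rfl | rfl | ⟨rfl, -⟩ <;> tauto

/-- If `ab` subdivides the cycle, `c` still sees a wide set, since an end of `ab` adjacent to `c`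
can stand for `x`. In the other case `b` replaces `x`, and either `c` still sees a wide set, so that
`a` is dropped, or `{a, c}` is an ear. -/
theorem someSol_of_rim (h : EdgeContraction G H T a b x) (hO : Cyc H O) (hc : c ∉ O)
    (hw : Wide H (Nb H c O)) (hs : insert c O = insert x T) (hx : x ∈ O)
    (hA : ∃ t ∈ T, G.Adj a t ∧ ¬ G.Adj b t) (hB : ∃ t ∈ T, G.Adj b t ∧ ¬ G.Adj a t) :
    SomeSol G T a b := by
  have hxT := h.notMem
  have hcx : c ≠ x := by rintro rfl; exact hc hx
  have hcT : c ∈ T := by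
    have : c ∈ insert x T := hs ▸ .inl rfl
    exact this.resolve_left hcx
  obtain ⟨p, q, P, rfl, hPT, hP, hpq, mp, mq, hadj⟩ :=
    h.exists_cyc_path hO (fun z hz => hs ▸ .inr hz) hx
  have hT : ∀ z, z ∈ T ↔ z = c ∨ z ∈ P := fun z => by
    have : z ∈ insert c (insert x P) ↔ z ∈ insert x T := by rw [hs]
    have := @hPT z
    grind
  have hXT : Nb H c P ⊆ T := fun z hz => hPT hz.1
  have hXeq : Nb H c P = Nb G c P := h.Nb_eq hcT hPT
  have sub : ∀ {a b p q}, EdgeContraction G H T a b x → IPath G p q P → p ≠ q →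
      (∀ t ∈ P, G.Adj a t ∨ G.Adj b t ↔ t = p ∨ t = q) → ¬ G.Adj b p → ¬ G.Adj a q →
      SomeSol G T a b := by
    intro a b p q h hP hpq hadj hbp haq
    have hO' := h.subdivide hPT hP hpq hadj hbp haq
    have ha := h.left_notMem
    have hb := h.right_notMem
    have hcO : c ∉ ({a, b} ∪ P : Set V) := by grind
    refine .inr (.inr ?_)
    have hse : insert c ({a, b} ∪ P) = insert a (insert b T) := by
      ext z
      have := hT z
      grind
    rw [← hse]
    refine hO'.sol_insert hcO ?_
    by_cases hxc : H.Adj x c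
    · obtain ⟨r, hr, hrc, hradj⟩ : ∃ r, r ∈ ({a, b} : Set V) ∧ G.Adj r c ∧
          ∀ t ∈ T, G.Adj r t → H.Adj x t := by
        rcases (h.new_adj_iff c hcT).1 hxc with hac | hbc
        · exact ⟨a, by simp, hac, fun t ht h' => (h.new_adj_iff t ht).2 (.inl h')⟩
        · exact ⟨b, by simp, hbc, fun t ht h' => (h.new_adj_iff t ht).2 (.inr h')⟩
      have hrT : r ∉ T := by grind
      refine (h.wide_subst hXT hrT (fun t ht => hradj t (hXT ht)) (hw.mono ?_)).mono ?_
      · rintro z ⟨rfl | hz, hcz⟩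
        · exact .inl rfl
        · exact .inr ⟨hz, hcz⟩
      · rw [hXeq]
        rintro z (rfl | hz)
        · exact ⟨.inl hr, hrc.symm⟩
        · exact ⟨.inr hz.1, hz.2⟩
    · have : Nb H c (insert x P) ⊆ Nb H c P := by
        rintro z ⟨rfl | hz, hcz⟩
        · exact absurd hcz.symm hxc
        · exact ⟨hz, hcz⟩
      refine ((h.wide_iff hXT).1 (hw.mono this)).mono ?_
      rw [hXeq]
      exact Nb_mono Set.subset_union_right
  have key : ∀ {a b}, EdgeContraction G H T a b x →
      (∀ t ∈ P, G.Adj a t ∨ G.Adj b t ↔ t = p ∨ t = q) → (G.Adj a c ∧ ¬ G.Adj b c ∧ G.Adj b p ∧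
        G.Adj b q ∧ ¬ (G.Adj a p ∧ G.Adj a q)) → SomeSol G T a b := by
    rintro a b h hadj ⟨hac, hbc, hbp, hbq, hnot⟩
    have ha := h.left_notMem
    have hb := h.right_notMem
    have hab := h.adj.ne
    have hO' := h.substitute hPT hP hpq hadj hbp hbq
    have hcO : c ∉ insert b P := by grind
    have hNc : Nb G c (insert b P) = Nb H c P := by
      rw [hXeq]
      ext z
      constructor
      · rintro ⟨rfl | hz, hcz⟩
        · exact absurd hcz.symm hbc
        · exact ⟨hz, hcz⟩
      · exact fun hz => ⟨.inr hz.1, hz.2⟩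
    have hsub : Nb H c (insert x P) ⊆ {x} ∪ Nb H c P := by
      rintro z ⟨rfl | hz, hcz⟩
      · exact .inl rfl
      · exact .inr ⟨hz, hcz⟩
    by_cases hX : Wide G (Nb G c (insert b P))
    · refine .inr (.inl ?_)
      have hse : insert c (insert b P) = insert b T := by
        ext z
        have := hT z
        grind
      rw [← hse]
      exact hO'.sol_insert hcO hX
    -- Since `a` is not adjacent to both `p` and `q`, it sees on the new cycle at most the edge
    -- `bw`.
    · obtain ⟨w, hw1, hw2⟩ : ∃ w, (w = p ∨ w = q) ∧ ∀ t ∈ P, G.Adj a t → t = w := by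
        by_cases hap : G.Adj a p
        · refine ⟨p, .inl rfl, fun t ht hat => ?_⟩
          have := (hadj t ht).1 (.inl hat)
          grind
        · refine ⟨q, .inr rfl, fun t ht hat => ?_⟩
          have := (hadj t ht).1 (.inl hat)
          grind
      have hbw : G.Adj b w := by rcases hw1 with rfl | rfl <;> assumption
      refine .of_ear (O := insert b P) (P := {a, c}) (u := a) (v := c)
        ⟨hO', .pair hac, by grind, by grind, ?_, fun _ => ⟨⟨b, .inl rfl, h.adj⟩, ?_⟩,
          fun _ => ⟨?_, hX⟩⟩ ?_
      · refine (h.wide_subst hXT hb (fun t ht hbt => (h.new_adj_iff t (hXT ht)).2 (.inr hbt))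
          (hw.mono hsub)).mono ?_
        rw [hNc]
        rintro z (rfl | hz)
        · exact .inl ⟨.inl rfl, h.adj⟩
        · exact .inr hz
      · refine not_wide_of_subset_pair hbw ?_
        rintro t ⟨rfl | ht, hat⟩
        · exact .inl rfl
        · exact .inr (hw2 t ht hat)
      · rw [hNc]
        by_contra hemp
        rw [Set.not_nonempty_iff_eq_empty] at hemp
        rw [hemp, Set.union_empty] at hsub
        exact not_wide_of_subset_singleton hsub hw
      · ext z
        have := hT z
        grind
  have hx' : ∀ t ∈ T, H.Adj x t ↔ t = p ∨ t = q ∨ t = c ∧ H.Adj x c := by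
    intro t ht
    have h1 := hadj t
    rw [← h.new_adj_iff t ht] at h1
    rcases (hT t).1 ht with rfl | htP
    · have h2 := (hadj p mp).2 (.inl rfl)
      have h3 := (hadj q mq).2 (.inr rfl)
      rw [← h.new_adj_iff p (hPT mp)] at h2
      rw [← h.new_adj_iff q (hPT mq)] at h3
      grind
    · have : t ≠ c := by rintro rfl; exact hc (.inr htP)
      grind
  have hadj' : ∀ t ∈ P, G.Adj b t ∨ G.Adj a t ↔ t = p ∨ t = q := fun t ht => by
    rw [or_comm, hadj t ht]
  rcases h.adj_cases (hPT mp) (hPT mq) hx' hA hB with ⟨h1, h2⟩ | ⟨h1, h2⟩ | h1 | h1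
  · exact sub h hP hpq hadj h1 h2
  · exact sub h hP.symm hpq.symm (fun t ht => (hadj t ht).trans or_comm) h1 h2
  · exact key h hadj h1
  · exact (key h.symm hadj' h1).symm

/-- As for a vertex on the rim, with the end `u` of the ear in the role of `c`. If the cycle is
subdivided, the ear stays the same; otherwise `b` replaces `x` on the cycle and `a` is put in front
of the ear. -/
theorem someSol_of_tip (h : EdgeContraction G H T a b x) (hE : Ear H O P u v)
    (hs : O ∪ P = insert x T) (huv : u ≠ v) (hu : Nb H u O = {x}) (hvx : ¬ H.Adj v x)
    (hA : ∃ t ∈ T, G.Adj a t ∧ ¬ G.Adj b t) (hB : ∃ t ∈ T, G.Adj b t ∧ ¬ G.Adj a t) :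
    SomeSol G T a b := by
  have hxT := h.notMem
  have hx : x ∈ O ∧ H.Adj u x := by
    have : x ∈ Nb H u O := by rw [hu]; rfl
    exact this
  have hux := hx.2
  obtain ⟨p, q, Q, rfl, hQT, hQ, hpq, mp, mq, hadj⟩ :=
    h.exists_cyc_path hE.cyc (fun z hz => hs ▸ .inl hz) hx.1
  have hPT : P ⊆ T := fun z hz => by
    have h1 : z ∈ insert x T := hs ▸ .inr hz
    refine h1.resolve_left ?_
    rintro rfl
    exact hE.disj z (.inl rfl) hz
  have hxQ : x ∉ Q := fun h' => hxT (hQT h')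
  have hT : ∀ z, z ∈ T ↔ z ∈ Q ∨ z ∈ P := fun z => by
    have : z ∈ insert x Q ∪ P ↔ z ∈ insert x T := by rw [hs]
    have := @hPT z
    have := @hQT z
    grind
  have mu := hE.path.left_mem
  have mv := hE.path.right_mem
  have hP := h.path hE.path hPT
  have hd : ∀ z ∈ Q, z ∉ P := fun z hz => hE.disj z (.inr hz)
  have hPx : ∀ w ∈ P, H.Adj x w → w = u := fun w hw hxw => by
    rcases hE.inner w hw x (.inl rfl) hxw.symm with rfl | rfl
    · rfl
    · exact absurd hxw.symm hvx
  have hQP : ∀ w ∈ P, ∀ y ∈ Q, G.Adj w y → w = v := by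
    intro w hw y hy hwy
    have hwy' := (h.adj_iff w (hPT hw) y (hQT hy)).2 hwy
    rcases hE.inner w hw y (.inr hy) hwy' with rfl | rfl
    · have : y ∈ Nb H w (insert x Q) := ⟨.inr hy, hwy'⟩
      rw [hu] at this
      obtain rfl : y = x := this
      exact absurd hy hxQ
    · rfl
  obtain ⟨hY1, hY2⟩ := hE.right huv
  have hYT : Nb H v (insert x Q) ⊆ T := by
    rintro z ⟨rfl | hz, hvz⟩
    · exact absurd hvz hvx
    · exact hQT hz
  have hYQ : Nb H v (insert x Q) = Nb G v Q := by
    rw [← h.Nb_eq (hPT mv) hQT]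
    ext z
    constructor
    · rintro ⟨rfl | hz, hvz⟩
      · exact absurd hvz hvx
      · exact ⟨hz, hvz⟩
    · exact fun hz => ⟨.inr hz.1, hz.2⟩
  have hw := hE.wide
  rw [hu] at hw
  rw [h.wide_iff hYT, hYQ] at hY2
  rw [hYQ] at hY1
  have hvab : ¬ (G.Adj a v ∨ G.Adj b v) := fun h' => hvx ((h.new_adj_iff v (hPT mv)).2 h').symm
  have sub : ∀ {a b p q}, EdgeContraction G H T a b x → IPath G p q Q → p ≠ q →
      (∀ t ∈ Q, G.Adj a t ∨ G.Adj b t ↔ t = p ∨ t = q) → ¬ G.Adj b p → ¬ G.Adj a q →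
      ¬ (G.Adj a v ∨ G.Adj b v) → SomeSol G T a b := by
    intro a b p q h hQ hpq hadj hbp haq hvab
    have hO' := h.subdivide hQT hQ hpq hadj hbp haq
    have ha := h.left_notMem
    have hb := h.right_notMem
    obtain ⟨r, hr, hru, hradj⟩ : ∃ r, r ∈ ({a, b} : Set V) ∧ G.Adj r u ∧
        ∀ t ∈ T, G.Adj r t → H.Adj x t := by
      rcases (h.new_adj_iff u (hPT mu)).1 hux.symm with hac | hbc
      · exact ⟨a, by simp, hac, fun t ht h' => (h.new_adj_iff t ht).2 (.inl h')⟩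
      · exact ⟨b, by simp, hbc, fun t ht h' => (h.new_adj_iff t ht).2 (.inr h')⟩
    have hrT : r ∉ T := by grind
    have hvY : Nb G v ({a, b} ∪ Q) = Nb G v Q := by
      ext z
      constructor
      · rintro ⟨(rfl | rfl) | hz, hvz⟩
        · exact absurd (.inl hvz.symm) hvab
        · exact absurd (.inr hvz.symm) hvab
        · exact ⟨hz, hvz⟩
      · exact fun hz => ⟨.inr hz.1, hz.2⟩
    refine .of_ear (O := {a, b} ∪ Q) (P := P) (u := u) (v := v)
      ⟨hO', hP, ?_, ?_, ?_, fun _ => ⟨⟨r, .inl hr, hru.symm⟩, ?_⟩, fun _ => ?_⟩ ?_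
    · rintro z ((rfl | rfl) | hz) hzP
      exacts [ha (hPT hzP), hb (hPT hzP), hd z hz hzP]
    · rintro w hw y ((rfl | rfl) | hy) hwy
      · exact .inl (hPx w hw ((h.new_adj_iff w (hPT hw)).2 (.inl hwy.symm)))
      · exact .inl (hPx w hw ((h.new_adj_iff w (hPT hw)).2 (.inr hwy.symm)))
      · exact .inr (hQP w hw y hy hwy)
    · refine (h.wide_subst hYT hrT (fun t ht => hradj t (hYT ht)) hw).mono ?_
      rw [hYQ, hvY]
      rintro z (rfl | hz)
      · exact .inl ⟨.inl hr, hru.symm⟩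
      · exact .inr hz
    · refine not_wide_of_subset_pair h.adj ?_
      rintro z ⟨hz | hz, huz⟩
      · exact hz
      · exact absurd (hQP u mu z hz huz) huv
    · rw [hvY]
      exact ⟨hY1, hY2⟩
    · clear * - hT
      ext z
      have := hT z
      grind
  have key : ∀ {a b}, EdgeContraction G H T a b x →
      (∀ t ∈ Q, G.Adj a t ∨ G.Adj b t ↔ t = p ∨ t = q) → ¬ (G.Adj a v ∨ G.Adj b v) →
      (G.Adj a u ∧ ¬ G.Adj b u ∧ G.Adj b p ∧
        G.Adj b q ∧ ¬ (G.Adj a p ∧ G.Adj a q)) → SomeSol G T a b := by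
    rintro a b h hadj hvab ⟨hac, hbc, hbp, hbq, hnot⟩
    have ha := h.left_notMem
    have hb := h.right_notMem
    have hab := h.adj.ne
    have hO' := h.substitute hQT hQ hpq hadj hbp hbq
    have hvY : Nb G v (insert b Q) = Nb G v Q := by
      ext z
      constructor
      · rintro ⟨rfl | hz, hvz⟩
        · exact absurd (.inr hvz.symm) hvab
        · exact ⟨hz, hvz⟩
      · exact fun hz => ⟨.inr hz.1, hz.2⟩
    obtain ⟨w, hw1, hw2⟩ : ∃ w, (w = p ∨ w = q) ∧ ∀ t ∈ Q, G.Adj a t → t = w := by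
      clear * - hadj hnot
      by_cases hap : G.Adj a p
      · refine ⟨p, .inl rfl, fun t ht hat => ?_⟩
        have := (hadj t ht).1 (.inl hat)
        grind
      · refine ⟨q, .inr rfl, fun t ht hat => ?_⟩
        have := (hadj t ht).1 (.inl hat)
        grind
    have hbw : G.Adj b w := by rcases hw1 with rfl | rfl <;> assumption
    have hP' : IPath G a v (insert a P) := .cons hac hP (fun h' => ha (hPT h'))
      fun t ht hat => hPx t ht ((h.new_adj_iff t (hPT ht)).2 (.inl hat))
    refine .of_ear (O := insert b Q) (P := insert a P) (u := a) (v := v)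
      ⟨hO', hP', ?_, ?_, ?_, fun _ => ⟨⟨b, .inl rfl, h.adj⟩, ?_⟩, fun _ => ?_⟩ ?_
    · rintro z (rfl | hz) (rfl | hzP)
      exacts [hab rfl, hb (hPT hzP), ha (hQT hz), hd z hz hzP]
    · rintro t (rfl | ht) y (rfl | hy) hty
      · exact .inl rfl
      · exact .inl rfl
      · obtain rfl := hPx t ht ((h.new_adj_iff t (hPT ht)).2 (.inr hty.symm))
        exact absurd hty.symm hbc
      · exact .inr (hQP t ht y hy hty)
    · refine (h.wide_subst hYT hb (fun t ht hbt => (h.new_adj_iff t (hYT ht)).2 (.inr hbt))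
        hw).mono ?_
      rw [hYQ, hvY]
      rintro z (rfl | hz)
      · exact .inl ⟨.inl rfl, h.adj⟩
      · exact .inr hz
    · refine not_wide_of_subset_pair hbw ?_
      rintro t ⟨rfl | ht, hat⟩
      · exact .inl rfl
      · exact .inr (hw2 t ht hat)
    · rw [hvY]
      exact ⟨hY1, hY2⟩
    · clear * - hT
      ext z
      have := hT z
      grind
  have hx' : ∀ t ∈ T, H.Adj x t ↔ t = p ∨ t = q ∨ t = u ∧ H.Adj x u := by
    intro t ht
    have h1 := hadj t
    rw [← h.new_adj_iff t ht] at h1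
    rcases (hT t).1 ht with htQ | htP
    · have : t ≠ u := by rintro rfl; exact hd t htQ mu
      clear * - h1 this htQ
      grind
    · have h2 := hPx t htP
      have h3 : t ≠ p := by rintro rfl; exact hd t mp htP
      have h4 : t ≠ q := by rintro rfl; exact hd t mq htP
      have h5 := hux.symm
      clear * - h2 h3 h4 h5
      grind
  have hadj' : ∀ t ∈ Q, G.Adj b t ∨ G.Adj a t ↔ t = p ∨ t = q := fun t ht => by
    rw [or_comm, hadj t ht]
  rcases h.adj_cases (hQT mp) (hQT mq) hx' hA hB with ⟨h1, h2⟩ | ⟨h1, h2⟩ | h1 | h1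
  · exact sub h hQ hpq hadj h1 h2 hvab
  · exact sub h hQ.symm hpq.symm (fun t ht => (hadj t ht).trans or_comm) h1 h2 hvab
  · exact key h hadj hvab h1
  · exact (key h.symm hadj' (fun h' => hvab h'.symm) h1).symm

/-- If both ends of a contracted edge have private neighbours, then a solid through the new vertex
lifts to a solid. -/
theorem someSol (h : EdgeContraction G H T a b x) (hs : Sol H (insert x T))
    (hA : ∃ t ∈ T, G.Adj a t ∧ ¬ G.Adj b t) (hB : ∃ t ∈ T, G.Adj b t ∧ ¬ G.Adj a t) :
    SomeSol G T a b := by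
  rcases hs.cases (x := x) (by simp) with ⟨O, P, u, v, h1, h2, h3, h4⟩ | ⟨O, c, h1, h2, h3, h4, h5⟩ |
    ⟨O, P, u, v, h1, h2, h3, h4, h5, -⟩
  · by_cases hxu : x = u
    · subst hxu
      by_cases hxv : x = v
      · subst hxv
        have := h1.path.eq_singleton
        subst this
        exact h.someSol_of_apex h1 h2 hA hB
      · exact h.someSol_of_left h1 h2 hxv (h4 hxv) hA hB
    · by_cases hxv : x = v
      · subst hxv
        exact h.someSol_of_left h1.symm h2 hxu (fun y hy h5 h6 => h4 (Ne.symm hxu) y hy h6 h5) hA hB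
      · exact h.someSol_of_interior h1 h2 h3 hxu hxv hA hB
  · exact h.someSol_of_rim h1 h2 h3 h4 h5 hA hB
  · exact h.someSol_of_tip h1 h2 h3 h4 h5 hA hB

end EdgeContraction

end

/-! ### The inequality of weights for the contraction of an edge -/

section

section

variable {V : Type u} {G H : SimpleGraph V} {s T O P Q X : Set V} {a b c p q r t u v x y z : V}

theorem contrib_cases (hx : x ∈ s) (hy : y ∈ s) (hz : z ∈ s) (hxy : x ≠ y) (hxz : x ≠ z)
    (hyz : y ≠ z) : (Sol G s ∧ contrib G s = 1) ∨ (Cyc G s ∧ ¬ Sol G s ∧ contrib G s = -1) ∨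
      (¬ Sol G s ∧ ¬ Cyc G s ∧ contrib G s = 0) := by
  by_cases h1 : Sol G s
  · exact .inl ⟨h1, contrib_of_sol h1⟩
  by_cases h2 : Cyc G s
  · exact .inr (.inl ⟨h2, h1, contrib_of_cyc h2⟩)
  · exact .inr (.inr ⟨h1, h2, contrib_eq_zero hx hy hz hxy hxz hyz h1 h2⟩)

/-- If `a` did not see `t`, both neighbours of `t` on the first cycle would lie in `T`. Together
with `b` this makes three neighbours on the second cycle. -/
theorem Cyc.Nb_subset_of_cyc (ha : Cyc G (insert a T)) (hb : Cyc G (insert b T)) (haT : a ∉ T)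
    (hbT : b ∉ T) (ht : t ∈ T) (hbt : G.Adj b t) : G.Adj a t := by
  by_contra hat
  obtain ⟨p, hp, q, hq, h1, h2, h3, -⟩ := ha.exists_adj (x := t) (.inr ht)
  have h4 : p ∈ T := hp.resolve_left (by rintro rfl; exact hat h2.symm)
  have h5 : q ∈ T := hq.resolve_left (by rintro rfl; exact hat h3.symm)
  have := hb.eq_of_adj (x := t) (y₁ := p) (y₂ := q) (y₃ := b) (.inr ht) (.inr h4) (.inr h5) (.inl rfl)
    h2 h3 hbt.symm
  grind

namespace EdgeContraction

/-- If `b` has no private neighbour, then `x` is merely a copy of `a`, and cycles and solids can be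
carried over between `insert a T` and `insert x T`. -/
theorem adj_iff_of_no_private (h : EdgeContraction G H T a b x)
    (hB : ¬ ∃ t ∈ T, G.Adj b t ∧ ¬ G.Adj a t) : ∀ t ∈ T, H.Adj x t ↔ G.Adj a t := by
  intro t ht
  rw [h.new_adj_iff t ht]
  exact ⟨fun h' => h'.elim id fun hbt => by_contra fun hat => hB ⟨t, ht, hbt, hat⟩, .inl⟩

theorem cyc_of_no_private (h : EdgeContraction G H T a b x)
    (hB : ¬ ∃ t ∈ T, G.Adj b t ∧ ¬ G.Adj a t) (hc : Cyc G (insert a T)) : Cyc H (insert x T) := by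
  obtain ⟨p, q, P, h1, h2, h3, h4, h5, h6, h7⟩ := hc.rotate (y := a) (.inl rfl)
  have hadj := h.adj_iff_of_no_private hB
  have ha := h.left_notMem
  obtain rfl : T = P := by
    ext z
    have : z ∈ insert a T ↔ z ∈ insert a P := by rw [h1]
    grind
  have hp := h3.left_mem
  have hq := h3.right_mem
  refine ⟨x, p, q, T, rfl, h.notMem,
    h3.congr fun s hs t ht => (h.adj_iff s hs t ht).symm, h4, fun t ht => ?_⟩
  rw [hadj t ht]
  exact ⟨h7 t ht, by rintro (rfl | rfl) <;> assumption⟩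

theorem sol_of_no_private (h : EdgeContraction G H T a b x)
    (hB : ¬ ∃ t ∈ T, G.Adj b t ∧ ¬ G.Adj a t) (hs : Sol H (insert x T)) : Sol G (insert a T) := by
  classical
  have hadj := h.adj_iff_of_no_private hB
  have hx := h.notMem
  have := hs.image (H := G) (fun z => if z = x then a else z) ?_ ?_
  · convert this using 1
    ext z
    simp only [Set.image_insert_eq, if_true, Set.mem_insert_iff, Set.mem_image]
    refine or_congr_right ⟨fun hz => ⟨z, hz, by rw [if_neg]; rintro rfl; exact hx hz⟩, ?_⟩
    rintro ⟨w, hw, rfl⟩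
    rwa [if_neg]
    rintro rfl
    exact hx hw
  · have := h.left_notMem
    intro y hy z hz hyz
    simp only at hyz
    split_ifs at hyz <;> grind
  · have h1 : ∀ t ∈ T, H.Adj t x ↔ G.Adj t a := fun t ht => by
      rw [G.adj_comm, H.adj_comm, hadj t ht]
    have h2 := h.adj_iff
    rintro y (rfl | hy) z (rfl | hz)
    · simp
    · have : z ≠ y := by rintro rfl; exact hx hz
      simpa [this] using (hadj z hz).symm
    · have : y ≠ z := by rintro rfl; exact hx hy
      simpa [this] using (h1 y hy).symm
    · have h3 : y ≠ x := by rintro rfl; exact hx hy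
      have h4 : z ≠ x := by rintro rfl; exact hx hz
      simpa [h3, h4] using (h2 y hy z hz).symm

/-- The set `T` is then an induced path, and one further vertex does not make it a solid. -/
theorem not_sol_of_cyc (h : EdgeContraction G H T a b x) (hc : Cyc G (insert a T)) :
    ¬ Sol H (insert x T) := by
  obtain ⟨p, q, P, h1, h2, h3, -⟩ := hc.rotate (y := a) (.inl rfl)
  have ha := h.left_notMem
  obtain rfl : T = P := by
    ext z
    have : z ∈ insert a T ↔ z ∈ insert a P := by rw [h1]
    grind
  exact (h3.congr fun s hs t ht => (h.adj_iff s hs t ht).symm).not_sol_insert h.notMem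

/-- Contracting an edge of a cycle shortens it. Two vertices in `T` are required because a triangle
would become a single edge. -/
theorem cyc_of_cyc (h : EdgeContraction G H T a b x) (hc : Cyc G (insert a (insert b T)))
    (hy : y ∈ T) (hz : z ∈ T) (hyz : y ≠ z) : Cyc H (insert x T) := by
  have key : ∀ {p q P}, insert a (insert b T) = insert a P → a ∉ P → IPath G p q P → p ≠ q →
      G.Adj a p → G.Adj a q → (∀ w ∈ P, G.Adj a w → w = p ∨ w = q) → b = p →
      Cyc H (insert x T) := by
    rintro p q P h1 h2 h3 h4 h5 h6 h7 rfl
    obtain ⟨c, S, k1, rfl, k2, k3, k4⟩ := h3.uncons h4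
    have ha := h.left_notMem
    have hb := h.right_notMem
    have hab := h.adj.ne
    have hST : T = S := by
      ext z
      have : z ∈ insert a (insert b T) ↔ z ∈ insert a (insert b S) := by rw [h1]
      grind
    subst hST
    have mq := k1.right_mem
    have mc := k1.left_mem
    refine ⟨x, c, q, T, rfl, h.notMem, k1.congr fun s hs t ht => (h.adj_iff s hs t ht).symm, ?_,
      fun t ht => ?_⟩
    · rintro rfl
      have := k1.eq_singleton
      subst this
      exact hyz (Eq.trans hy (Eq.symm hz))
    · rw [h.new_adj_iff t ht]
      constructor
      · rintro (hat | hbt)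
        · have := h7 t (.inr ht) hat
          grind
        · exact .inl (k4 t ht hbt)
      · rintro (rfl | rfl)
        exacts [.inr k3, .inl h6]
  have hb : b ∈ insert a (insert b T) := by simp
  obtain ⟨p, q, P, h1, h2, h3, h4, h5, h6, h7⟩ := hc.rotate (y := a) (.inl rfl)
  have hbP : b ∈ P := by
    rw [h1] at hb
    exact hb.resolve_left h.adj.ne'
  rcases h7 b hbP h.adj with hbp | hbq
  · exact key h1 h2 h3 h4 h5 h6 h7 hbp
  · exact key h1 h2 h3.symm h4.symm h6 h5 (fun w hw hw' => (h7 w hw hw').symm) hbq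

/-- On the cycle through `a`, the vertex `b` sees `a` and its private neighbour, which are
nonadjacent. So the loss caused by the cycle is compensated by a solid. -/
theorem sol_of_cyc (h : EdgeContraction G H T a b x) (hc : Cyc G (insert a T))
    (hB : ∃ t ∈ T, G.Adj b t ∧ ¬ G.Adj a t) : Sol G (insert a (insert b T)) := by
  obtain ⟨t, ht, hbt, hat⟩ := hB
  have h1 := h.right_notMem
  have h2 := h.adj.ne
  have h3 : a ≠ t := by rintro rfl; exact h.left_notMem ht
  rw [Set.insert_comm]
  exact hc.sol_insert (by grind) (.of_not_adj (y := a) (z := t) ⟨.inl rfl, h.adj.symm⟩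
    ⟨.inr ht, hbt⟩ h3 hat)

theorem sol_of_cyc_cyc (h : EdgeContraction G H T a b x) (ha : Cyc G (insert a T))
    (hb : Cyc G (insert b T)) : Sol G (insert a (insert b T)) := by
  have h1 := h.left_notMem
  have h2 := h.right_notMem
  obtain ⟨p, hp, q, hq, h3, h4, h5, -⟩ := hb.exists_adj (x := b) (.inl rfl)
  have hpT : p ∈ T := hp.resolve_left h4.ne'
  have hqT : q ∈ T := hq.resolve_left h5.ne'
  have h6 := h.adj.ne
  rw [Set.insert_comm]
  exact ha.sol_insert (by grind) (.of_three (x := a) (y := p) (z := q) ⟨.inl rfl, h.adj.symm⟩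
    ⟨.inr hpT, h4⟩ ⟨.inr hqT, h5⟩ (by grind) (by grind) h3)

theorem not_cyc_of_cyc (h : EdgeContraction G H T a b x) (ha : Cyc G (insert a T)) :
    ¬ Cyc G (insert a (insert b T)) := by
  intro h'
  have h1 := ha.eq_of_subset h' (by grind)
  have h2 : b ∈ insert a T := h1 ▸ by simp
  have h3 := h.adj.ne
  have h4 := h.right_notMem
  grind

/-- The contraction of an edge does not increase the contributions. -/
theorem contrib_le (h : EdgeContraction G H T a b x) : contrib H (insert x T) ≤
    contrib G (insert a T) + contrib G (insert b T) + contrib G (insert a (insert b T)) := by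
  have ha := h.left_notMem
  have hb := h.right_notMem
  have hx := h.notMem
  have hab := h.adj.ne
  -- With two vertices in `T` all four sets have at least three elements, so only cycles and solids
  -- count. Each negative weight on the right is balanced by a solid on the right or by a cycle on
  -- the left; the cases depend on who has private neighbours.
  by_cases h2 : ∃ y ∈ T, ∃ z ∈ T, y ≠ z
  · obtain ⟨y, hy, z, hz, hyz⟩ := h2
    have key : ∀ {G : SimpleGraph V} {a : V} (s), a ∉ T → insert a T ⊆ s →
        (Sol G s ∧ contrib G s = 1) ∨ (Cyc G s ∧ ¬ Sol G s ∧ contrib G s = -1) ∨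
          (¬ Sol G s ∧ ¬ Cyc G s ∧ contrib G s = 0) := fun s ha hs =>
      contrib_cases (hs (.inl rfl)) (hs (.inr hy)) (hs (.inr hz)) (by grind) (by grind) hyz
    have c1 := key (G := H) (insert x T) hx le_rfl
    have c2 := key (G := G) (insert a T) ha le_rfl
    have c3 := key (G := G) (insert b T) hb le_rfl
    have c4 := key (G := G) (insert a (insert b T)) ha (by grind)
    have f1 := h.not_sol_of_cyc
    have f2 := h.symm.not_sol_of_cyc
    have f3 := fun hc => h.cyc_of_cyc hc hy hz hyz
    have f4 := h.not_cyc_of_cyc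
    have f5 := h.symm.not_cyc_of_cyc
    have f6 := h.sol_of_cyc_cyc
    have f7 : Sol H (insert x T) → ¬ Cyc H (insert x T) := Sol.not_cyc
    rw [Set.insert_comm] at f5
    by_cases hA : ∃ t ∈ T, G.Adj a t ∧ ¬ G.Adj b t <;>
      by_cases hB : ∃ t ∈ T, G.Adj b t ∧ ¬ G.Adj a t
    · have g1 := fun hs => h.someSol hs hA hB
      have g2 := fun hc => h.sol_of_cyc hc hB
      have g3 := fun hc => h.symm.sol_of_cyc hc hA
      rw [Set.insert_comm] at g3
      have g4 : Cyc G (insert a T) → ¬ Cyc G (insert b T) := by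
        rintro k1 k2
        obtain ⟨t, ht, hat, hbt⟩ := hA
        exact hbt (k2.Nb_subset_of_cyc k1 hb ha ht hat)
      unfold SomeSol at g1
      clear key hA hB h
      grind
    · have g1 := h.sol_of_no_private hB
      have g2 := h.cyc_of_no_private hB
      have g3 := fun hc => h.symm.sol_of_cyc hc hA
      rw [Set.insert_comm] at g3
      clear key hA hB h
      grind
    · have g1 := h.symm.sol_of_no_private hA
      have g2 := h.symm.cyc_of_no_private hA
      have g3 := fun hc => h.sol_of_cyc hc hB
      clear key hA hB h
      grind
    · have g1 := h.sol_of_no_private hB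
      have g2 := h.cyc_of_no_private hB
      have g3 := h.symm.cyc_of_no_private hA
      clear key hA hB h
      grind
  · rcases T.eq_empty_or_nonempty with rfl | ⟨t, ht⟩
    · have e1 : insert x (∅ : Set V) = {x} := by simp
      have e2 : insert a (∅ : Set V) = {a} := by simp
      have e3 : insert b (∅ : Set V) = {b} := by simp
      rw [e1, e2, e3, contrib_singleton, contrib_singleton, contrib_singleton, contrib_pair h.adj]
      rfl
    · obtain rfl : T = {t} := by
        ext z
        grind
      have hxt : x ≠ t := hx
      have hat : a ≠ t := ha
      have hbt : b ≠ t := hb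
      have h1 := h.new_adj_iff t rfl
      have c4 := contrib_cases (G := G) (s := {a, b, t}) (x := a) (y := b) (z := t) (by simp)
        (by simp) (by simp) hab hat hbt
      have h3 : ¬ Sol G {a, b, t} := by
        intro hs
        obtain ⟨O, hO, hsub, hne⟩ := hs.exists_cyc
        obtain ⟨p, hp, q, hq, r, hr, k1, k2, k3⟩ := hO.exists_three
        have := hsub hp
        have := hsub hq
        have := hsub hr
        grind
      have h4 : Cyc G {a, b, t} → G.Adj a t ∧ G.Adj b t := by
        intro hc
        obtain ⟨p, hp, q, hq, k1, k2, k3, k4⟩ := hc.exists_adj (x := t) (by simp)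
        have := k2.symm
        have := k3.symm
        have := k2.ne
        have := k3.ne
        grind
      by_cases k1 : G.Adj a t <;> by_cases k2 : G.Adj b t
      · rw [contrib_pair k1, contrib_pair k2, contrib_pair (h1.2 (.inl k1))]
        grind
      · rw [contrib_pair k1, contrib_pair_of_not_adj hbt k2, contrib_pair (h1.2 (.inl k1))]
        grind
      · rw [contrib_pair_of_not_adj hat k1, contrib_pair k2, contrib_pair (h1.2 (.inr k2))]
        grind
      · rw [contrib_pair_of_not_adj hat k1, contrib_pair_of_not_adj hbt k2,
          contrib_pair_of_not_adj hxt (by tauto)]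
        grind

end EdgeContraction

end

/-! ### Summation over all sets for a sequence of edge contractions -/

section

variable {V : Type u} {G : SimpleGraph V} {a b : V}

/-- The graph that arises from `G` if `a` becomes adjacent to all neighbours of `b`. -/
def absorb (G : SimpleGraph V) (a b : V) : SimpleGraph V where
  Adj p q := p ≠ q ∧ (G.Adj p q ∨ (p = a ∧ G.Adj b q) ∨ (q = a ∧ G.Adj b p))
  symm := ⟨fun p q h => ⟨h.1.symm, by
    have := h.2
    rw [G.adj_comm q p]
    tauto⟩⟩
  loopless := ⟨fun _ h => h.1 rfl⟩

theorem absorb_edgeContraction (hab : G.Adj a b) {T : Set V} (ha : a ∉ T) (hb : b ∉ T) :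
    EdgeContraction G (absorb G a b) T a b a where
  left_notMem := ha
  right_notMem := hb
  notMem := ha
  adj := hab
  adj_iff s hs t ht := by
    have h1 : s ≠ a := by rintro rfl; exact ha hs
    have h2 : t ≠ a := by rintro rfl; exact ha ht
    have := fun h : G.Adj s t => h.ne
    simp only [absorb, h1, h2]
    tauto
  new_adj_iff t ht := by
    have h2 : t ≠ a := by rintro rfl; exact ha ht
    simp only [absorb, h2]
    have := h2.symm
    tauto

open Classical in
/-- The contribution of `s` if it meets `R`, and `0` otherwise. -/
noncomputable def contribOn (G : SimpleGraph V) (R s : Finset V) : ℤ :=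
  if ∃ r ∈ R, r ∈ s then contrib G s else 0

-- Induction on `U`. If `π` is injective there, it is an isomorphism onto its image and the sums
-- agree. Otherwise two adjacent vertices `a`, `b` with the same image are contracted by letting `a`
-- absorb `b`. Neither lies in `R`, so whether a set meets `R` does not depend on which of them it
-- contains, and the restricted sums can be compared in the same way as the full ones.
open Classical in
theorem sum_contribOn_image {W : Type v} (G' : SimpleGraph W) (π : V → W) (U R : Finset V)
    (hRU : R ⊆ U) (hπ : ∀ a ∈ U, ∀ b ∈ U, π a = π b → a ≠ b → G.Adj a b ∧ a ∉ R ∧ b ∉ R)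
    (hadj : ∀ a ∈ U, ∀ b ∈ U, π a ≠ π b → (G'.Adj (π a) (π b) ↔
      ∃ a' ∈ U, ∃ b' ∈ U, π a' = π a ∧ π b' = π b ∧ G.Adj a' b')) :
    ∑ s ∈ (U.image π).powerset, contribOn G' (R.image π) s ≤ ∑ s ∈ U.powerset, contribOn G R s := by
  induction hn : U.card using Nat.strong_induction_on generalizing G U with
  | _ n ih =>
  subst hn
  by_cases hinj : Set.InjOn π U
  · have h1 : (U.image π).powerset = U.powerset.image (Finset.image π) := by
      ext s
      simp only [Finset.mem_powerset, Finset.mem_image, Finset.subset_image_iff]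
    rw [h1, Finset.sum_image]
    · refine Finset.sum_le_sum fun s hs => le_of_eq ?_
      have hsU : s ⊆ U := Finset.mem_powerset.1 hs
      have h2 : contrib G' ((s.image π : Finset W) : Set W) = contrib G s := by
        rw [Finset.coe_image]
        refine contrib_image π (hinj.mono (by exact_mod_cast hsU)) fun x hx y hy => ?_
        by_cases hxy : x = y
        · subst hxy
          simp
        rw [hadj x (hsU hx) y (hsU hy) fun h => hxy (hinj (hsU hx) (hsU hy) h)]
        constructor
        · rintro ⟨a', ha', b', hb', h1, h2, h3⟩
          rwa [hinj ha' (hsU hx) h1, hinj hb' (hsU hy) h2] at h3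
        · exact fun h => ⟨x, hsU hx, y, hsU hy, rfl, rfl, h⟩
      have h3 : (∃ r ∈ R.image π, r ∈ s.image π) ↔ ∃ r ∈ R, r ∈ s := by
        constructor
        · rintro ⟨_, h4, h5⟩
          obtain ⟨r, hr, rfl⟩ := Finset.mem_image.1 h4
          obtain ⟨r', hr', h6⟩ := Finset.mem_image.1 h5
          obtain rfl := hinj (hsU hr') (hRU hr) h6
          exact ⟨r', hr, hr'⟩
        · rintro ⟨r, hr, hr'⟩
          exact ⟨π r, Finset.mem_image_of_mem π hr, Finset.mem_image_of_mem π hr'⟩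
      unfold contribOn
      rw [h2, if_congr h3 rfl rfl]
    · intro s hs t ht hst
      have hs' : (s : Set V) ⊆ U := by exact_mod_cast Finset.mem_powerset.1 hs
      have ht' : (t : Set V) ⊆ U := by exact_mod_cast Finset.mem_powerset.1 ht
      have := congrArg (fun s : Finset W => (s : Set W)) hst
      simp only [Finset.coe_image] at this
      exact_mod_cast (hinj.image_eq_image_iff hs' ht').1 this
  · simp only [Set.InjOn, not_forall] at hinj
    obtain ⟨a, ha, b, hb, hπab, hab⟩ := hinj
    obtain ⟨hGab, haR, hbR⟩ := hπ a ha b hb hπab hab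
    set U₀ := (U.erase b).erase a with hU₀
    have ha0 : a ∉ U₀ := by simp [hU₀]
    have hb0 : b ∉ U₀ := by simp [hU₀]
    have e1 : U.erase b = insert a U₀ := by
      rw [hU₀, Finset.insert_erase]
      exact Finset.mem_erase.2 ⟨hab, ha⟩
    have e2 : U = insert b (insert a U₀) := by
      rw [← e1, Finset.insert_erase hb]
    have himg : (U.erase b).image π = U.image π := by
      ext w
      simp only [Finset.mem_image]
      constructor
      · rintro ⟨c, hc, rfl⟩
        exact ⟨c, Finset.mem_of_mem_erase hc, rfl⟩
      · rintro ⟨c, hc, rfl⟩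
        by_cases hcb : c = b
        · subst hcb
          exact ⟨a, Finset.mem_erase.2 ⟨hab, ha⟩, hπab⟩
        · exact ⟨c, Finset.mem_erase.2 ⟨hcb, hc⟩, rfl⟩
    have step := ih (U.erase b).card (Finset.card_erase_lt_of_mem hb) (G := absorb G a b)
      (U.erase b) ?_ ?_ ?_ rfl
    · rw [himg] at step
      refine step.trans ?_
      have hba : b ∉ insert a U₀ := by
        rw [Finset.mem_insert]
        rintro (h | h)
        exacts [hab h.symm, hb0 h]
      rw [e1]
      conv_rhs => rw [e2]
      -- Both sums are grouped by the part `t` of a set outside `{a, b}`: two sets over `t` on the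
      -- left and four on the right.
      rw [Finset.sum_powerset_insert ha0, Finset.sum_powerset_insert hba,
        Finset.sum_powerset_insert ha0, Finset.sum_powerset_insert ha0,
        ← Finset.sum_add_distrib, ← Finset.sum_add_distrib, ← Finset.sum_add_distrib,
        ← Finset.sum_add_distrib]
      refine Finset.sum_le_sum fun t ht => ?_
      have ht' : t ⊆ U₀ := Finset.mem_powerset.1 ht
      have hat : a ∉ t := fun h => ha0 (ht' h)
      have hbt : b ∉ t := fun h => hb0 (ht' h)
      have m1 : (∃ r ∈ R, r ∈ insert a t) ↔ ∃ r ∈ R, r ∈ t := by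
        simp only [Finset.mem_insert]
        exact exists_congr fun r => and_congr_right fun hr => or_iff_right (by rintro rfl; exact haR hr)
      have m2 : ∀ t : Finset V, (∃ r ∈ R, r ∈ insert b t) ↔ ∃ r ∈ R, r ∈ t := by
        intro t
        simp only [Finset.mem_insert]
        exact exists_congr fun r => and_congr_right fun hr => or_iff_right (by rintro rfl; exact hbR hr)
      unfold contribOn
      simp only [m1, m2]
      by_cases hR : ∃ r ∈ R, r ∈ t
      · simp only [if_pos hR]
        have hE := absorb_edgeContraction hGab (T := t) (by exact_mod_cast hat)
          (by exact_mod_cast hbt)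
        have h1 := hE.contrib_le
        -- The sets without `a` and `b` have the same weight on both sides; the remaining terms are
        -- those of the contraction inequality.
        have h2 : contrib (absorb G a b) t = contrib G t := contrib_congr hE.adj_iff
        rw [Set.insert_comm a b] at h1
        push_cast
        linarith
      · simp only [if_neg hR]
        simp
    · intro r hr
      refine Finset.mem_erase.2 ⟨?_, hRU hr⟩
      rintro rfl
      exact hbR hr
    · intro c hc d hd hcd hne
      have := hπ c (Finset.mem_of_mem_erase hc) d (Finset.mem_of_mem_erase hd) hcd hne
      exact ⟨⟨hne, .inl this.1⟩, this.2⟩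
    · intro c hc d hd hcd
      rw [hadj c (Finset.mem_of_mem_erase hc) d (Finset.mem_of_mem_erase hd) hcd]
      constructor
      · rintro ⟨c', hc', d', hd', h1, h2, h3⟩
        by_cases hcb : c' = b
        · subst hcb
          have hdb : d' ≠ c' := h3.ne'
          refine ⟨a, Finset.mem_erase.2 ⟨hab, ha⟩, d', Finset.mem_erase.2 ⟨hdb, hd'⟩,
            hπab.trans h1, h2, ?_, .inr (.inl ⟨rfl, h3⟩)⟩
          rintro rfl
          exact hcd (h1.symm.trans (hπab.symm.trans h2))
        by_cases hdb : d' = b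
        · subst hdb
          refine ⟨c', Finset.mem_erase.2 ⟨hcb, hc'⟩, a, Finset.mem_erase.2 ⟨hab, ha⟩,
            h1, hπab.trans h2, ?_, .inr (.inr ⟨rfl, h3.symm⟩)⟩
          rintro rfl
          exact hcd (h1.symm.trans (hπab.trans h2))
        · exact ⟨c', Finset.mem_erase.2 ⟨hcb, hc'⟩, d', Finset.mem_erase.2 ⟨hdb, hd'⟩, h1, h2, h3.ne,
            .inl h3⟩
      · rintro ⟨c', hc', d', hd', h1, h2, -, h3 | ⟨rfl, h3⟩ | ⟨rfl, h3⟩⟩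
        · exact ⟨c', Finset.mem_of_mem_erase hc', d', Finset.mem_of_mem_erase hd', h1, h2, h3⟩
        · exact ⟨b, hb, d', Finset.mem_of_mem_erase hd', hπab.symm.trans h1, h2, h3⟩
        · exact ⟨c', Finset.mem_of_mem_erase hc', b, hb, h1, hπab.symm.trans h2, h3.symm⟩

end

end

/-! ### Making the neighbourhood of a vertex complete -/

section

variable {V : Type u} {G : SimpleGraph V} {A T O P Q X : Set V} {a b c w x y z t : V}

/-- The graph that arises from `G` if all edges between vertices of `A` are added. -/
def fill (G : SimpleGraph V) (A : Set V) : SimpleGraph V where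
  Adj p q := p ≠ q ∧ (G.Adj p q ∨ (p ∈ A ∧ q ∈ A))
  symm := ⟨fun p q h => ⟨h.1.symm, by
    have := h.2
    rw [G.adj_comm q p]
    tauto⟩⟩
  loopless := ⟨fun _ h => h.1 rfl⟩

theorem fill_adj : (fill G A).Adj x y ↔ x ≠ y ∧ (G.Adj x y ∨ (x ∈ A ∧ y ∈ A)) := Iff.rfl

theorem fill_adj_of_adj (h : G.Adj x y) : (fill G A).Adj x y := ⟨h.ne, .inl h⟩

theorem contrib_nonpos (hx : x ∈ T) (hy : y ∈ T) (hz : z ∈ T) (hxy : x ≠ y) (hxz : x ≠ z)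
    (hyz : y ≠ z) (h : ¬ Sol G T) : contrib G T ≤ 0 := by
  rcases contrib_cases (G := G) hx hy hz hxy hxz hyz with h' | h' | h'
  · exact absurd h'.1 h
  · omega
  · omega

/-- Filling up an independent triple of the neighbours of `w`. -/
theorem sol_insert_of_fill (hw : w ∉ T)
    (ha : a ∈ T) (hb : b ∈ T) (hc : c ∈ T)
    (hK : ∀ t ∈ T, G.Adj w t ↔ t = a ∨ t = b ∨ t = c) (hab : a ≠ b) (hac : a ≠ c) (hbc : b ≠ c)
    (hab' : ¬ G.Adj a b) (hac' : ¬ G.Adj a c) (hbc' : ¬ G.Adj b c)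
    (hs : Sol (fill G (G.neighborSet w)) T) : Sol G (insert w T) ∧ ¬ Cyc G T := by
  have wa := (hK a ha).2 (by simp)
  have wb := (hK b hb).2 (by simp)
  have wc := (hK c hc).2 (by simp)
  -- The triple is a triangle of the filled graph, so one of its vertices is an end of an ear and
  -- the other two span an edge `yz` of the cycle. Without this edge the cycle becomes an induced
  -- path, which `w` closes again; the edges from `x` to `y` and `z` are replaced by the edge from
  -- `x` to `w`.
  obtain ⟨x, y, z, O, P, v, h1, h2, rfl, h4, h5, h6, h7, h8, h9⟩ :=
    hs.triangle ha hb hc ⟨hab, .inr ⟨wa, wb⟩⟩ ⟨hac, .inr ⟨wa, wc⟩⟩ ⟨hbc, .inr ⟨wb, wc⟩⟩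
  have hK' : ∀ t ∈ O ∪ P, G.Adj w t ↔ t = x ∨ t = y ∨ t = z := by
    intro t ht
    rw [hK t ht]
    have : t ∈ ({x, y, z} : Set V) ↔ t ∈ ({a, b, c} : Set V) := by rw [h1]
    simpa using this.symm
  have hind : ∀ s t, G.Adj s t → s ∈ ({x, y, z} : Set V) → t ∈ ({x, y, z} : Set V) → False := by
    rw [h1]
    rintro s t hst (rfl | rfl | rfl) (rfl | rfl | rfl)
    · exact absurd hst (by simp)
    · exact hab' hst
    · exact hac' hst
    · exact hab' hst.symm
    · exact absurd hst (by simp)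
    · exact hbc' hst
    · exact hac' hst.symm
    · exact hbc' hst.symm
    · exact absurd hst (by simp)
  have mx := h2.path.left_mem
  have mv := h2.path.right_mem
  have hyz := h8.ne
  have hfill : ∀ s ∈ O ∪ P, ∀ t ∈ O ∪ P, ¬ (s ∈ ({x, y, z} : Set V) ∧ t ∈ ({x, y, z} : Set V)) →
      ((fill G (G.neighborSet w)).Adj s t ↔ G.Adj s t) := by
    intro s hs t ht hst
    rw [fill_adj]
    constructor
    · rintro ⟨-, h | ⟨h, h'⟩⟩
      · exact h
      · exact absurd ⟨(hK' s hs).1 h, (hK' t ht).1 h'⟩ hst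
    · exact fun h => ⟨h.ne, .inl h⟩
  have hxyP : ∀ s ∈ P, s ∈ ({x, y, z} : Set V) → s = x := by
    rintro s hs (rfl | rfl | rfl)
    · rfl
    · exact absurd hs (h2.disj _ h4)
    · exact absurd hs (h2.disj _ h5)
  have hxO : x ∉ O := fun h => h2.disj x h mx
  have hP : IPath G x v P := h2.path.congr fun s hs t ht => by
    by_cases hst : s = t
    · subst hst
      simp
    · refine hfill s (.inr hs) t (.inr ht) fun h => hst ?_
      rw [hxyP s hs h.1, hxyP t ht h.2]
  obtain ⟨d, Q, hOQ, hyQ, hQ, hyd, hdz, hQy⟩ : ∃ d Q, O = insert y Q ∧ y ∉ Q ∧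
      IPath (fill G (G.neighborSet w)) d z Q ∧ (fill G (G.neighborSet w)).Adj y d ∧ d ≠ z ∧
      ∀ s ∈ Q, (fill G (G.neighborSet w)).Adj y s → s = d ∨ s = z := by
    obtain ⟨p, q, Q, k1, k2, k3, k4, k5, k6, k7⟩ := h2.cyc.rotate h4
    rcases k7 z (by grind) h8 with rfl | rfl
    · exact ⟨q, Q, k1, k2, k3.symm, k6, k4.symm, fun s hs h => (k7 s hs h).symm⟩
    · exact ⟨p, Q, k1, k2, k3, k5, k4, k7⟩
  have mz := hQ.right_mem
  have md := hQ.left_mem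
  have hQO : ∀ s ∈ Q, s ∈ O := fun s hs => hOQ ▸ .inr hs
  have hQz : ∀ s ∈ Q, s ∈ ({x, y, z} : Set V) → s = z := by
    rintro s hs (rfl | rfl | rfl)
    · exact absurd (hQO _ hs) hxO
    · exact absurd hs hyQ
    · rfl
  have hQG : IPath G d z Q := hQ.congr fun s hs t ht => by
    by_cases hst : s = t
    · subst hst
      simp
    · refine hfill s (.inl (hQO s hs)) t (.inl (hQO t ht)) fun h => hst ?_
      rw [hQz s hs h.1, hQz t ht h.2]
  have hyd' : G.Adj y d := (hfill y (.inl h4) d (.inl (hQO d md)) fun h => hdz (hQz d md h.2)).1 hyd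
  have hyn : ∀ s ∈ Q, G.Adj y s → s = d := fun s hs hys => by
    rcases hQy s hs (fill_adj_of_adj hys) with rfl | rfl
    · rfl
    · exact absurd (by simp) (hind y s hys (by simp))
  have hpath : IPath G y z O := hOQ ▸ .cons hyd' hQG hyQ hyn
  have hwO : w ∉ O := fun h => hw (.inl h)
  have hwP : w ∉ P := fun h => hw (.inr h)
  have hO' : Cyc G (insert w O) := by
    refine ⟨w, y, z, O, rfl, hwO, hpath, hyz, fun s hs => ?_⟩
    rw [hK' s (.inl hs)]
    refine or_iff_right ?_
    rintro rfl
    exact hxO hs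
  have hdisj : ∀ s ∈ insert w O, s ∉ P := by
    rintro s (rfl | hs)
    exacts [hwP, h2.disj s hs]
  have hwx : G.Adj w x := (hK' x (.inr mx)).2 (by simp)
  have hin : ∀ s ∈ P, ∀ t ∈ insert w O, G.Adj s t → s = x ∨ s = v := by
    rintro s hsP t (rfl | ht) hst
    · exact .inl (hxyP s hsP ((hK' s (.inr hsP)).1 hst.symm))
    · exact h2.inner s hsP t ht (fill_adj_of_adj hst)
  have hwt : ∀ t ∈ O, t ≠ y → t ≠ z → ¬ G.Adj w t ∧ t ∉ ({x, y, z} : Set V) := by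
    intro t ht hty htz
    have htx : t ≠ x := by rintro rfl; exact hxO ht
    refine ⟨fun hwt => ?_, by simp [htx, hty, htz]⟩
    have := (hK' t (.inl ht)).1 hwt
    tauto
  by_cases hxv : x = v
  · subst hxv
    have := h2.path.eq_singleton
    subst this
    constructor
    · rw [show insert w (O ∪ {x}) = insert x (insert w O) by grind]
      refine hO'.sol_insert (by have := hwx.ne; grind) ?_
      obtain ⟨t, ⟨ht, hxt⟩, hty⟩ : ∃ t ∈ Nb (fill G (G.neighborSet w)) x O,
          t ∉ ({y, z} : Set V) := by
        by_contra hcon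
        push Not at hcon
        exact not_wide_of_subset_pair h8 hcon h2.wide_of_eq
      have h10 := hwt t ht (by grind) (by grind)
      refine .of_not_adj (y := w) (z := t) ⟨.inl rfl, hwx.symm⟩ ⟨.inr ht, ?_⟩ ?_ h10.1
      · exact (hfill x (.inr rfl) t (.inl ht) fun h => h10.2 h.2).1 hxt
      · rintro rfl
        exact hwO ht
    -- In `G` the vertex `y` has only the one neighbour `d` in the set, so the set is not a cycle.
    · intro hcyc
      obtain ⟨p, hp, q, hq, k1, k2, k3, -⟩ := hcyc.exists_adj (x := y) (.inl h4)
      have key : ∀ p ∈ O ∪ {x}, G.Adj y p → p = d := by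
        rintro p (hp | rfl) hyp
        · exact hyn p (by have := hyp.ne; grind) hyp
        · exact absurd (by simp) (hind y p hyp (by simp))
      exact k1 ((key p hp k2).trans (key q hq k3).symm)
  · obtain ⟨e1, e2, e3⟩ := h9 hxv
    obtain ⟨hY1, hY2⟩ := h2.right hxv
    have hvK : v ∉ ({x, y, z} : Set V) := fun h => hxv (hxyP v mv h).symm
    have hwv : ¬ G.Adj w v := fun h => hvK ((hK' v (.inr mv)).1 h)
    have hNv : Nb G v (insert w O) = Nb (fill G (G.neighborSet w)) v O := by
      ext t
      constructor
      · rintro ⟨rfl | ht, hvt⟩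
        · exact absurd hvt.symm hwv
        · exact ⟨ht, (fill_adj_of_adj hvt)⟩
      · rintro ⟨ht, hvt⟩
        exact ⟨.inr ht, (hfill v (.inr mv) t (.inl ht) fun h => hvK h.1).1 hvt⟩
    have hYt : ∀ t ∈ Nb (fill G (G.neighborSet w)) v O, t ≠ y ∧ t ≠ z := by
      rintro t ⟨ht, hvt⟩
      exact ⟨by rintro rfl; exact e2 hvt, by rintro rfl; exact e3 hvt⟩
    have hvO : v ∉ O := fun h => h2.disj v h mv
    constructor
    · rw [show insert w (O ∪ P) = insert w O ∪ P by grind]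
      refine Ear.sol (a := x) (b := v) ⟨hO', hP, hdisj, hin, ?_, fun _ => ⟨⟨w, .inl rfl, hwx.symm⟩, ?_⟩,
        fun _ => ?_⟩
      · obtain ⟨t, ht⟩ := hY1
        have h10 := hwt t ht.1 (hYt t ht).1 (hYt t ht).2
        refine .of_not_adj (y := w) (z := t) (.inl ⟨.inl rfl, hwx.symm⟩) (.inr (hNv ▸ ht)) ?_ h10.1
        rintro rfl
        exact hwO ht.1
      · refine not_wide_of_subset_singleton (x := w) ?_
        rintro t ⟨rfl | ht, hxt⟩
        · rfl
        · have : t ∈ Nb (fill G (G.neighborSet w)) x O := ⟨ht, (fill_adj_of_adj hxt)⟩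
          rw [e1] at this
          exact absurd (.inr this) (hind x t hxt (by simp))
      · rw [hNv]
        refine ⟨hY1, fun hwide => hY2 (hwide.congr fun s hs t ht => (hfill s (.inl hs.1) t (.inl ht.1)
          fun h => ?_).symm)⟩
        exact (hwt s hs.1 (hYt s hs).1 (hYt s hs).2).2 h.1
    · intro hcyc
      obtain ⟨p, hp, q, hq, k1, k2, k3, -⟩ := hcyc.exists_adj (x := y) (.inl h4)
      have key : ∀ p ∈ O ∪ P, G.Adj y p → p = d := by
        rintro p (hp | hp) hyp
        · exact hyn p (by have := hyp.ne; grind) hyp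
        · rcases h2.inner p hp y h4 (fill_adj_of_adj hyp.symm) with rfl | rfl
          · exact absurd (by simp) (hind y p hyp (by simp))
          · exact absurd (fill_adj_of_adj hyp.symm) e2
      exact k1 ((key p hp k2).trans (key q hq k3).symm)

/-- Filling up the neighbourhood of a vertex does not increase the contributions. -/
theorem contrib_fill_le (hw : w ∉ T) (ht : t ∈ T) (hwt : ¬ G.Adj w t) :
    contrib (fill G (G.neighborSet w)) T ≤ contrib G T + contrib G (insert w T) := by
  have hwt' : w ≠ t := by rintro rfl; exact hw ht
  -- If the neighbours of `w` in `T` already form a clique, nothing changes on `T`. A cycle through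
  -- `w` would be a triangle and could not contain `t`, so the additional term is nonnegative.
  by_cases hcl : ∀ p ∈ T, ∀ q ∈ T, G.Adj w p → G.Adj w q → p ≠ q → G.Adj p q
  · have h1 : contrib (fill G (G.neighborSet w)) T = contrib G T := contrib_congr fun p hp q hq =>
      ⟨fun h => h.2.elim id fun h' => hcl p hp q hq h'.1 h'.2 h.1, fun h => ⟨h.ne, .inl h⟩⟩
    have h2 : 0 ≤ contrib G (insert w T) := by
      by_cases h3 : ∃ s ∈ T, s ≠ t
      · obtain ⟨s, hs, hst⟩ := h3
        rcases contrib_cases (G := G) (s := insert w T) (x := w) (y := t) (z := s) (.inl rfl)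
          (.inr ht) (.inr hs) hwt' (by rintro rfl; exact hw hs) hst.symm with h | h | h
        · omega
        · exfalso
          obtain ⟨p, hp, q, hq, k1, k2, k3, k4⟩ := h.1.exists_adj (x := w) (.inl rfl)
          have hp' : p ∈ T := hp.resolve_left k2.ne'
          have hq' : q ∈ T := hq.resolve_left k3.ne'
          have := h.1.eq_triangle (.inl rfl) hp hq k2 k3 (hcl p hp' q hq' k2 k3 k1)
          have : t ∈ ({w, p, q} : Set V) := this ▸ .inr ht
          grind
        · omega
      · have : T = {t} := by
          ext z
          grind
        rw [this, contrib_pair_of_not_adj hwt' hwt]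
    omega
  push Not at hcl
  obtain ⟨p₀, hp₀, q₀, hq₀, hwp, hwq, hpq, hpq'⟩ := hcl
  have hwideK : Wide G (Nb G w T) := .of_not_adj (y := p₀) (z := q₀) ⟨hp₀, hwp⟩ ⟨hq₀, hwq⟩ hpq hpq'
  have h3T : ∀ {H : SimpleGraph V}, ¬ Sol H T → contrib H T ≤ 0 := fun {H} => by
    refine contrib_nonpos hp₀ hq₀ ht hpq ?_ ?_
    · rintro rfl; exact hwt hwp
    · rintro rfl; exact hwt hwq
  by_cases hA : ∃ a ∈ Nb G w T, ¬ Wide G (Nb G w T \ {a})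
  · obtain ⟨a, ⟨haT, hwa⟩, hnw⟩ := hA
    have hta : t ≠ a := by rintro rfl; exact hwt hwa
    obtain ⟨b, hb, hba⟩ : ∃ b ∈ Nb G w T, b ≠ a := by
      by_cases h : p₀ = a
      · subst h
        exact ⟨q₀, ⟨hq₀, hwq⟩, hpq.symm⟩
      · exact ⟨p₀, ⟨hp₀, hwp⟩, h⟩
    -- The neighbours of `w` in `T` other than `a` fit into an edge, so filling only adds edges at
    -- `a`; this amounts to contracting the edge `wa`.
    have hE : EdgeContraction G (fill G (G.neighborSet w)) (T \ {a}) w a a := by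
      refine ⟨fun h => hw h.1, fun h => h.2 rfl, fun h => h.2 rfl, hwa, ?_, ?_⟩
      · intro s hs r hr
        refine ⟨fun h => ?_, fun h => ⟨h.ne, .inl h⟩⟩
        by_contra hsr
        have := h.2.resolve_left hsr
        exact hnw (.of_not_adj (y := s) (z := r) ⟨⟨hs.1, this.1⟩, hs.2⟩ ⟨⟨hr.1, this.2⟩, hr.2⟩ h.1 hsr)
      · intro s hs
        have : a ≠ s := fun h => hs.2 h.symm
        rw [fill_adj]
        simp only [SimpleGraph.mem_neighborSet, this, hwa, ne_eq, not_false_eq_true, true_and]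
        exact or_comm
    have h1 := hE.contrib_le
    have h2 : insert a (T \ {a}) = T := by
      ext z
      grind
    rw [h2] at h1
    -- The extra term of the contraction inequality does no harm: the neighbours of `w` in this set
    -- are not wide, so it is not a solid.
    have h4 : contrib G (insert w (T \ {a})) ≤ 0 := by
      refine contrib_nonpos (x := w) (y := t) (z := b) (.inl rfl) (.inr ⟨ht, hta⟩)
        (.inr ⟨hb.1, hba⟩) hwt' hb.2.ne (by rintro rfl; exact hwt hb.2) fun hs => ?_
      refine hnw ((hs.wide_Nb (x := w) (.inl rfl)).mono ?_)
      rintro z ⟨rfl | hz, hwz⟩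
      · exact absurd hwz (by simp)
      · exact ⟨⟨hz.1, hwz⟩, hz.2⟩
    omega
  · push Not at hA
    obtain ⟨r₀, hr₀, hrp, hrq⟩ : ∃ r ∈ Nb G w T, r ≠ p₀ ∧ r ≠ q₀ := by
      by_contra hcon
      push Not at hcon
      refine not_wide_of_subset_singleton (x := q₀) ?_ (hA p₀ ⟨hp₀, hwp⟩)
      rintro z ⟨hz, hzp⟩
      exact hcon z hz hzp
    have hcycT : Cyc G T → Sol G (insert w T) := fun h => h.sol_insert hw hwideK
    have hcycw : ¬ Cyc G (insert w T) := fun h => by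
      have := h.eq_of_adj (x := w) (y₁ := p₀) (y₂ := q₀) (y₃ := r₀) (.inl rfl) (.inr hp₀) (.inr hq₀)
        (.inr hr₀.1) hwp hwq hr₀.2
      grind
    have c1 := contrib_cases (G := G) hp₀ hq₀ hr₀.1 hpq hrp.symm hrq.symm
    have c2 := contrib_cases (G := G) (s := insert w T) (.inr hp₀) (.inr hq₀) (.inr hr₀.1) hpq
      hrp.symm hrq.symm
    -- The neighbours of `w` stay wide after the deletion of any one of them, so there are at least
    -- three. Four would give a complete graph in the filled solid, hence all of it, although `t` is
    -- not among them. Exactly three must be pairwise nonadjacent.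
    have hfin : ¬ Sol (fill G (G.neighborSet w)) T ∨ (Sol G (insert w T) ∧ ¬ Cyc G T) := by
      by_cases hs : Sol (fill G (G.neighborSet w)) T
      · by_cases h4 : ∃ s ∈ Nb G w T, s ≠ p₀ ∧ s ≠ q₀ ∧ s ≠ r₀
        · obtain ⟨s, hs', k1, k2, k3⟩ := h4
          exfalso
          have adj : ∀ {x y}, x ∈ Nb G w T → y ∈ Nb G w T → x ≠ y →
              (fill G (G.neighborSet w)).Adj x y := fun h h' hne => ⟨hne, .inr ⟨h.2, h'.2⟩⟩
          have := hs.eq_of_four (w := p₀) (x := q₀) (y := r₀) (z := s) hp₀ hq₀ hr₀.1 hs'.1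
            (adj ⟨hp₀, hwp⟩ ⟨hq₀, hwq⟩ hpq) (adj ⟨hp₀, hwp⟩ hr₀ hrp.symm)
            (adj ⟨hp₀, hwp⟩ hs' k1.symm) (adj ⟨hq₀, hwq⟩ hr₀ hrq.symm)
            (adj ⟨hq₀, hwq⟩ hs' k2.symm) (adj hr₀ hs' k3.symm)
          have ht' : t ∈ ({p₀, q₀, r₀, s} : Set V) := this ▸ ht
          have := hs'.2
          have := hr₀.2
          grind
        · push Not at h4
          have hK : ∀ t ∈ T, G.Adj w t ↔ t = p₀ ∨ t = q₀ ∨ t = r₀ := by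
            intro t ht
            constructor
            · intro hwt
              have := h4 t ⟨ht, hwt⟩
              tauto
            · rintro (rfl | rfl | rfl)
              exacts [hwp, hwq, hr₀.2]
          have ind : ∀ {a b c}, (∀ t ∈ Nb G w T, t = a ∨ t = b ∨ t = c) → a ∈ Nb G w T →
              ¬ G.Adj b c := by
            intro a b c h ha hbc
            refine not_wide_of_subset_pair hbc ?_ (hA a ha)
            rintro z ⟨hz, hza⟩
            exact (h z hz).resolve_left hza
          refine .inr (sol_insert_of_fill hw hp₀ hq₀ hr₀.1 hK hpq hrp.symm hrq.symm hpq' ?_ ?_ hs)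
          · refine ind (a := q₀) (fun t ht => ?_) ⟨hq₀, hwq⟩
            have := (hK t ht.1).1 ht.2
            tauto
          · exact ind (a := p₀) (fun t ht => (hK t ht.1).1 ht.2) ⟨hp₀, hwp⟩
      · exact .inl hs
    have c3 : contrib (fill G (G.neighborSet w)) T ≤ 1 := by
      by_cases hs : Sol (fill G (G.neighborSet w)) T
      · rw [contrib_of_sol hs]
      · exact (h3T hs).trans (by norm_num)
    have c4 := h3T (H := fill G (G.neighborSet w))
    clear h3T hA
    generalize contrib (fill G (G.neighborSet w)) T = n₁ at *
    generalize contrib G T = n₂ at *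
    generalize contrib G (insert w T) = n₃ at *
    have := @Sol.not_cyc V G T
    rcases hfin with hfin | ⟨h1, h2⟩
    · have := c4 hfin
      rcases c1 with ⟨k1, k2⟩ | ⟨k1, k2, k3⟩ | ⟨k1, k2, k3⟩ <;>
        rcases c2 with ⟨l1, l2⟩ | ⟨l1, l2, l3⟩ | ⟨l1, l2, l3⟩ <;>
        first | omega | exact absurd l1 hcycw | exact absurd (hcycT k1) l1
    · rcases c1 with ⟨k1, k2⟩ | ⟨k1, k2, k3⟩ | ⟨k1, k2, k3⟩ <;>
        rcases c2 with ⟨l1, l2⟩ | ⟨l1, l2, l3⟩ | ⟨l1, l2, l3⟩ <;>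
        first | omega | exact absurd l1 hcycw | exact absurd k1 h2 | exact absurd h1 l1

end

/-! ### Functions on cycles that are constant inside solids: crossing paths that touch -/

section

variable {V : Type u} {α : Type v} {G : SimpleGraph V} {F : Set V → α}
  {R Z S P P₁ P₂ P₃ Q : Set V} {a b x y x₁ x₂ x₃ y₁ y₂ y₃ p q z : V}

/-- An induced path `P` from a neighbour of `b` to a neighbour of `a`, without further neighbours of
`a` and `b`. -/
structure Crossing (G : SimpleGraph V) (a b x y : V) (P : Set V) : Prop where
  path : IPath G x y P
  left : G.Adj b x
  right : G.Adj a y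
  eq_left : ∀ z ∈ P, G.Adj b z → z = x
  eq_right : ∀ z ∈ P, G.Adj a z → z = y

/-- An induced path `R` from `a` to `b` and a set `Z` that is attached to `R` at its ends only,
such that the function `F` is constant on the cycles through `R` in a solid. -/
structure Frame (G : SimpleGraph V) (F : Set V → α) (R Z : Set V) (a b : V) : Prop where
  path : IPath G a b R
  ne : a ≠ b
  finite : Z.Finite
  disj : ∀ z ∈ Z, z ∉ R
  attach : ∀ z ∈ Z, ∀ t ∈ R, G.Adj z t → t = a ∨ t = b
  const : ∀ s, Sol G s → s ⊆ R ∪ Z → ∀ o, Cyc G o → R ⊆ o → o ⊆ s → ∀ o', Cyc G o' → R ⊆ o' →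
    o' ⊆ s → F o = F o'

theorem Crossing.symm (h : Crossing G a b x y P) : Crossing G b a y x P :=
  ⟨h.path.symm, h.right, h.left, h.eq_right, h.eq_left⟩

theorem exists_crossing (hS : Linked G S p q) (hp : G.Adj b p) (hq : G.Adj a q) :
    ∃ x y P, P ⊆ S ∧ Crossing G a b x y P := by
  obtain ⟨P, hP, h⟩ := hS
  obtain ⟨x, y, P', h1, h2, h3, h4, h5, h6⟩ :=
    h.exists_crossing (X := {z | G.Adj b z}) (Y := {z | G.Adj a z}) hp hq
  exact ⟨x, y, P', h1.trans hP, h2, h3, h4, h5, h6⟩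

theorem IPath.linked_diff_right (h : IPath G x y P) (hp : p ∈ P) (hpy : p ≠ y) :
    Linked G (P \ {y}) x p := by
  have hxy : y ≠ x := by
    rintro rfl
    have := h.eq_singleton
    subst this
    exact hpy hp
  obtain ⟨c, S, h1, rfl, h2, -⟩ := h.symm.uncons hxy
  exact (h1.conn x h1.right_mem p (hp.resolve_left hpy)).mono (by grind)

theorem IPath.linked_diff_left (h : IPath G x y P) (hp : p ∈ P) (hpx : p ≠ x) :
    Linked G (P \ {x}) p y :=
  (h.symm.linked_diff_right hp hpx).symm

theorem IPath.eq_of_subset (h : IPath G x y P) (h' : IPath G x y Q) (hQP : Q ⊆ P) : Q = P := by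
  induction h generalizing Q with
  | single a => exact (h'.eq_singleton)
  | @cons a b c S hab h ha hS ih =>
    have hac : a ≠ c := by rintro rfl; exact ha h.right_mem
    obtain ⟨d, S', h1, rfl, h2, h3, h4⟩ := h'.uncons hac
    have hS' : S' ⊆ S := fun z hz => (hQP (.inr hz)).resolve_left (by rintro rfl; exact h2 hz)
    obtain rfl := hS d (hS' h1.left_mem) h3
    rw [ih h1 hS']

theorem Crossing.eq_of_subset (h : Crossing G a b x₁ y₁ P₁) (h' : Crossing G a b x₂ y₂ P₂)
    (hs : P₁ ⊆ P₂) : P₁ = P₂ := by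
  obtain rfl := h'.eq_left _ (hs h.path.left_mem) h.left
  obtain rfl := h'.eq_right _ (hs h.path.right_mem) h.right
  exact h'.path.eq_of_subset h.path hs

/-- If a vertex `q` outside of a path has two nonadjacent neighbours on it, then some vertex of the
path can be replaced by `q`. -/
theorem IPath.exists_linked_replace (h : IPath G x y P) (hq : q ∉ P) {p p' : V} (hp : p ∈ P)
    (hp' : p' ∈ P) (hne : p ≠ p') (hadj : ¬ G.Adj p p') (hqp : G.Adj q p) (hqp' : G.Adj q p') :
    ∃ r ∈ P, Linked G (insert q (P \ {r})) x y := by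
  induction h generalizing p p' with
  | single a => exact absurd (Eq.trans hp (Eq.symm hp')) hne
  | @cons a b c S hab h ha hS ih =>
    by_cases h2 : p ∈ S ∧ p' ∈ S
    · obtain ⟨r, hr, hl⟩ := ih (by grind) h2.1 h2.2 hne hadj hqp hqp'
      refine ⟨r, .inr hr, (hl.mono (by grind)).cons hab ?_⟩
      right
      exact ⟨.inl rfl, by rintro rfl; exact ha hr⟩
    · have key : ∀ {p' : V}, p' ∈ S → ¬ G.Adj a p' → G.Adj q a → G.Adj q p' →
          ∃ r ∈ insert a S, Linked G (insert q (insert a S \ {r})) a c := by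
        intro p' hp' hadj hqa hqp'
        have hpb : p' ≠ b := by rintro rfl; exact hadj hab
        have h3 := h.linked_diff_left hp' hpb
        have mb := h.left_mem
        refine ⟨b, .inr mb, ((h3.mono (T := insert q (insert a S \ {b})) (by grind)).cons hqp'
          (.inl rfl)).cons hqa.symm ?_⟩
        right
        exact ⟨.inl rfl, by rintro rfl; exact ha mb⟩
      rcases hp with rfl | hp
      · exact key (hp'.resolve_left hne.symm) hadj hqp hqp'
      · rcases hp' with rfl | hp'
        · exact key hp (fun h => hadj h.symm) hqp' hqp
        · exact absurd ⟨hp, hp'⟩ h2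

namespace Frame

theorem symm (h : Frame G F R Z a b) : Frame G F R Z b a :=
  ⟨h.path.symm, h.ne.symm, h.finite, h.disj, fun z hz t ht hzt => (h.attach z hz t ht hzt).symm,
    h.const⟩

theorem mono {Z' : Set V} (h : Frame G F R Z a b) (hZ : Z' ⊆ Z) : Frame G F R Z' a b :=
  ⟨h.path, h.ne, h.finite.subset hZ, fun z hz => h.disj z (hZ hz), fun z hz => h.attach z (hZ hz),
    fun s hs hsZ => h.const s hs (hsZ.trans (Set.union_subset_union_right _ hZ))⟩

theorem cyc (h : Frame G F R Z a b) (hP : P ⊆ Z) (hc : Crossing G a b x y P) : Cyc G (R ∪ P) := by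
  refine .of_paths h.path hc.path.symm (fun z hz hzP => h.disj z (hP hzP) hz) (.inl h.ne) hc.right
    hc.left ?_
  intro z hz w hw hzw
  rcases h.attach w (hP hw) z hz hzw.symm with rfl | rfl
  · exact .inl ⟨rfl, hc.eq_right w hw hzw⟩
  · exact .inr ⟨rfl, hc.eq_left w hw hzw⟩

theorem eq_of_sol (h : Frame G F R Z a b) (h₁ : P₁ ⊆ Z) (h₂ : P₂ ⊆ Z)
    (c₁ : Crossing G a b x₁ y₁ P₁) (c₂ : Crossing G a b x₂ y₂ P₂) (hs : Sol G S) (hSZ : S ⊆ R ∪ Z)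
    (hR : R ⊆ S) (hPS₁ : P₁ ⊆ S) (hPS₂ : P₂ ⊆ S) : F (R ∪ P₁) = F (R ∪ P₂) :=
  h.const S hs hSZ _ (h.cyc h₁ c₁) Set.subset_union_left (Set.union_subset hR hPS₁) _ (h.cyc h₂ c₂)
    Set.subset_union_left (Set.union_subset hR hPS₂)

/-- `F` does not depend on the crossing path. -/
def Const (G : SimpleGraph V) (F : Set V → α) (R Z : Set V) (a b : V) : Prop :=
  ∀ x₁ y₁ P₁ x₂ y₂ P₂, P₁ ⊆ Z → P₂ ⊆ Z → Crossing G a b x₁ y₁ P₁ → Crossing G a b x₂ y₂ P₂ →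
    F (R ∪ P₁) = F (R ∪ P₂)

/-- The common first vertex `x` is moved from `Z` to the path `R`. If `a` and `x` are not adjacent,
this gives a smaller frame with nonadjacent ends; otherwise both crossings consist of `x` alone. -/
theorem eq_of_left (h : Frame G F R Z a b)
    (ih : ∀ R' Z' a' b', Z'.ncard < Z.ncard → Frame G F R' Z' a' b' → ¬ G.Adj a' b' →
      Const G F R' Z' a' b') (h₁ : P₁ ⊆ Z) (h₂ : P₂ ⊆ Z)
    (c₁ : Crossing G a b x y₁ P₁) (c₂ : Crossing G a b x y₂ P₂) : F (R ∪ P₁) = F (R ∪ P₂) := by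
  have hxZ : x ∈ Z := h₁ c₁.path.left_mem
  have hxR := h.disj x hxZ
  by_cases hax : G.Adj a x
  · obtain rfl := c₁.eq_right x c₁.path.left_mem hax
    obtain rfl := c₂.eq_right x c₂.path.left_mem hax
    rw [c₁.path.eq_singleton, c₂.path.eq_singleton]
  have hpath : IPath G a x (insert x R) := by
    refine (IPath.cons c₁.left.symm h.path.symm hxR fun z hz hxz => ?_).symm
    rcases h.attach x hxZ z hz hxz with rfl | rfl
    · exact absurd hxz.symm hax
    · rfl
  have ha := h.path.left_mem
  have hb := h.path.right_mem
  -- The vertex `b` becomes an interior vertex of the longer path, so its neighbours must leave `Z`.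
  -- On the crossings this concerns only `x`.
  set Z' : Set V := {z | z ∈ Z ∧ z ≠ x ∧ ¬ G.Adj b z} with hZ'
  have hsub : Z' ⊆ Z := fun z hz => hz.1
  have hfr : Frame G F (insert x R) Z' a x := by
    refine ⟨hpath, by rintro rfl; exact hxR ha, h.finite.subset hsub, ?_, ?_, ?_⟩
    · rintro z hz (rfl | hz')
      exacts [hz.2.1 rfl, h.disj z hz.1 hz']
    · rintro z hz t (rfl | ht) hzt
      · exact .inr rfl
      · rcases h.attach z hz.1 t ht hzt with rfl | rfl
        · exact .inl rfl
        · exact absurd hzt.symm hz.2.2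
    · intro s hs hsZ o ho hRo hos o' ho' hRo' hos'
      refine h.const s hs ?_ o ho (fun z hz => hRo (.inr hz)) hos o' ho'
        (fun z hz => hRo' (.inr hz)) hos'
      intro z hz
      rcases hsZ hz with (rfl | hz) | hz
      exacts [.inr hxZ, .inl hz, .inr hz.1]
  have hlt : Z'.ncard < Z.ncard :=
    Set.ncard_lt_ncard ⟨hsub, fun h' => (h' hxZ).2.1 rfl⟩ h.finite
  have key : ∀ {y P}, P ⊆ Z → Crossing G a b x y P → ∃ c S, P = insert x S ∧ S ⊆ Z' ∧
      Crossing G a x c y S := by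
    intro y P hP hc
    have hxy : x ≠ y := by rintro rfl; exact hax hc.right
    obtain ⟨c, S, h1, rfl, h2, h3, h4⟩ := hc.path.uncons hxy
    refine ⟨c, S, rfl, fun z hz => ⟨hP (.inr hz), by rintro rfl; exact h2 hz, fun hbz => h2 ?_⟩,
      ⟨h1, h3, hc.right, h4, fun z hz => hc.eq_right z (.inr hz)⟩⟩
    rw [← hc.eq_left z (.inr hz) hbz]
    exact hz
  obtain ⟨d₁, S₁, rfl, k1, k2⟩ := key h₁ c₁
  obtain ⟨d₂, S₂, rfl, k3, k4⟩ := key h₂ c₂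
  have := ih _ _ _ _ hlt hfr hax _ _ _ _ _ _ k1 k3 k2 k4
  simpa only [Set.insert_union, Set.union_insert] using this

theorem eq_of_right (h : Frame G F R Z a b)
    (ih : ∀ R' Z' a' b', Z'.ncard < Z.ncard → Frame G F R' Z' a' b' → ¬ G.Adj a' b' →
      Const G F R' Z' a' b') (h₁ : P₁ ⊆ Z) (h₂ : P₂ ⊆ Z)
    (c₁ : Crossing G a b x₁ y P₁) (c₂ : Crossing G a b x₂ y P₂) : F (R ∪ P₁) = F (R ∪ P₂) :=
  h.symm.eq_of_left ih h₁ h₂ c₁.symm c₂.symm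

/-- A third crossing can be found that starts like the first one and ends like the second one; it is
compared with both. -/
theorem eq_of_mixed (h : Frame G F R Z a b)
    (ih : ∀ R' Z' a' b', Z'.ncard < Z.ncard → Frame G F R' Z' a' b' → ¬ G.Adj a' b' →
      Const G F R' Z' a' b') (h₁ : P₁ ⊆ Z) (h₂ : P₂ ⊆ Z)
    (c₁ : Crossing G a b x₁ y₁ P₁) (c₂ : Crossing G a b x₂ y₂ P₂)
    (hl : Linked G ((P₁ \ {y₁}) ∪ (P₂ \ {x₂})) x₁ y₂) (hx : x₁ ≠ x₂) (hy : y₁ ≠ y₂) :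
    F (R ∪ P₁) = F (R ∪ P₂) := by
  obtain ⟨x₃, y₃, P₃, h₃, c₃⟩ := exists_crossing hl c₁.left c₂.right
  have hZ : P₃ ⊆ Z := fun z hz => by
    rcases h₃ hz with hz | hz
    exacts [h₁ hz.1, h₂ hz.1]
  have e1 : x₃ = x₁ := by
    rcases h₃ c₃.path.left_mem with h' | h'
    · exact c₁.eq_left _ h'.1 c₃.left
    · exact absurd (c₂.eq_left _ h'.1 c₃.left) h'.2
  have e2 : y₃ = y₂ := by
    rcases h₃ c₃.path.right_mem with h' | h'
    · exact absurd (c₁.eq_right _ h'.1 c₃.right) h'.2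
    · exact c₂.eq_right _ h'.1 c₃.right
  subst e1 e2
  exact (h.eq_of_left ih h₁ hZ c₁ c₃).trans (h.eq_of_right ih hZ h₂ c₃ c₂)

/-- The vertex `x` sees `a`, `b` and `q` on the cycle of the second crossing, so both cycles lie in
one solid. -/
theorem eq_of_single (h : Frame G F R Z a b) (h₁ : P₁ ⊆ Z) (h₂ : P₂ ⊆ Z)
    (c₁ : Crossing G a b x x P₁) (c₂ : Crossing G a b x₂ y₂ P₂) (hx : x ∉ P₂)
    (hq : q ∈ P₂) (hxq : G.Adj x q) : F (R ∪ P₁) = F (R ∪ P₂) := by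
  have hP := c₁.path.eq_singleton
  have hxZ := h₁ c₁.path.left_mem
  have ha := h.path.left_mem
  have hb := h.path.right_mem
  refine h.eq_of_sol (S := insert x (R ∪ P₂)) h₁ h₂ c₁ c₂ ((h.cyc h₂ c₂).sol_insert ?_ ?_) ?_ ?_ ?_ ?_
  · rintro (h' | h')
    exacts [h.disj x hxZ h', hx h']
  · refine .of_three (x := a) (y := b) (z := q) ⟨.inl ha, c₁.right.symm⟩ ⟨.inl hb, c₁.left.symm⟩
      ⟨.inr hq, hxq⟩ h.ne ?_ ?_
    · rintro rfl; exact h.disj _ (h₂ hq) ha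
    · rintro rfl; exact h.disj _ (h₂ hq) hb
  · rintro z (rfl | hz | hz)
    exacts [.inr hxZ, .inl hz, .inr (h₂ hz)]
  · exact fun z hz => .inr (.inl hz)
  · rw [hP]
    rintro z rfl
    exact .inl rfl
  · exact fun z hz => .inr (.inr hz)

/-- The second crossing is an ear of the cycle of the first one: its ends see `b` and perhaps `x₁`,
and `a` and perhaps `y₁`. By `hw` the union of these neighbourhoods is wide. -/
theorem eq_of_ear (h : Frame G F R Z a b) (h₁ : P₁ ⊆ Z) (h₂ : P₂ ⊆ Z)
    (c₁ : Crossing G a b x₁ y₁ P₁) (c₂ : Crossing G a b x₂ y₂ P₂) (hd : ∀ z ∈ P₁, z ∉ P₂)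
    (hadj : ∀ p ∈ P₁, ∀ q ∈ P₂, G.Adj p q → (p = x₁ ∧ q = x₂) ∨ (p = y₁ ∧ q = y₂))
    (hne : x₂ ≠ y₂) (hw : ¬ G.Adj a b ∨ G.Adj x₁ x₂ ∨ G.Adj y₁ y₂) :
    F (R ∪ P₁) = F (R ∪ P₂) := by
  have ha := h.path.left_mem
  have hb := h.path.right_mem
  have mx₁ := c₁.path.left_mem
  have my₁ := c₁.path.right_mem
  have mx₂ := c₂.path.left_mem
  have my₂ := c₂.path.right_mem
  have hR : ∀ z ∈ P₂, ∀ t ∈ R, G.Adj z t → (z = y₂ ∧ t = a) ∨ (z = x₂ ∧ t = b) := by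
    intro z hz t ht hzt
    rcases h.attach z (h₂ hz) t ht hzt with rfl | rfl
    · exact .inl ⟨c₂.eq_right z hz hzt.symm, rfl⟩
    · exact .inr ⟨c₂.eq_left z hz hzt.symm, rfl⟩
  have haP : a ∉ P₁ := fun h' => h.disj a (h₁ h') ha
  have hbP : b ∉ P₁ := fun h' => h.disj b (h₁ h') hb
  have hE : Ear G (R ∪ P₁) P₂ x₂ y₂ := by
    refine ⟨h.cyc h₁ c₁, c₂.path, ?_, ?_, ?_, fun _ => ⟨⟨b, .inl hb, c₂.left.symm⟩, ?_⟩,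
      fun _ => ⟨⟨a, .inl ha, c₂.right.symm⟩, ?_⟩⟩
    · rintro z (hz | hz) hz'
      exacts [h.disj z (h₂ hz') hz, hd z hz hz']
    · rintro z hz t (ht | ht) hzt
      · have := hR z hz t ht hzt
        tauto
      · have := hadj t ht z hz hzt.symm
        tauto
    · rcases hw with hw | hw | hw
      · exact .of_not_adj (y := a) (z := b) (.inr ⟨.inl ha, c₂.right.symm⟩)
          (.inl ⟨.inl hb, c₂.left.symm⟩) h.ne hw
      · exact .of_three (x := a) (y := b) (z := x₁) (.inr ⟨.inl ha, c₂.right.symm⟩)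
          (.inl ⟨.inl hb, c₂.left.symm⟩) (.inl ⟨.inr mx₁, hw.symm⟩) h.ne
          (by rintro rfl; exact haP mx₁) (by rintro rfl; exact hbP mx₁)
      · exact .of_three (x := a) (y := b) (z := y₁) (.inr ⟨.inl ha, c₂.right.symm⟩)
          (.inl ⟨.inl hb, c₂.left.symm⟩) (.inr ⟨.inr my₁, hw.symm⟩) h.ne
          (by rintro rfl; exact haP my₁) (by rintro rfl; exact hbP my₁)
    · refine not_wide_of_subset_pair c₁.left ?_
      rintro t ⟨ht | ht, hxt⟩
      · have := hR _ mx₂ t ht hxt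
        have := h.ne
        grind
      · have := hadj t ht _ mx₂ hxt.symm
        grind
    · refine not_wide_of_subset_pair c₁.right ?_
      rintro t ⟨ht | ht, hxt⟩
      · have := hR _ my₂ t ht hxt
        have := h.ne
        grind
      · have := hadj t ht _ my₂ hxt.symm
        grind
  refine h.eq_of_sol h₁ h₂ c₁ c₂ hE.sol ?_ ?_ ?_ ?_
  · rintro z ((hz | hz) | hz)
    exacts [.inl hz, .inr (h₁ hz), .inr (h₂ hz)]
  · exact fun z hz => .inl (.inl hz)
  · exact fun z hz => .inl (.inr hz)
  · exact fun z hz => .inr hz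

theorem eq_of_theta (h : Frame G F R Z a b) (h₁ : P₁ ⊆ Z) (h₂ : P₂ ⊆ Z)
    (c₁ : Crossing G a b x₁ y₁ P₁) (c₂ : Crossing G a b x x P₂) (hd : ∀ z ∈ P₁, z ∉ P₂)
    (hw : ¬ G.Adj a b) : F (R ∪ P₁) = F (R ∪ P₂) := by
  have hP := c₂.path.eq_singleton
  have hxZ := h₂ c₂.path.left_mem
  have ha := h.path.left_mem
  have hb := h.path.right_mem
  refine h.eq_of_sol (S := insert x (R ∪ P₁)) h₁ h₂ c₁ c₂ ((h.cyc h₁ c₁).sol_insert ?_ ?_) ?_ ?_ ?_ ?_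
  · rintro (h' | h')
    exacts [h.disj x hxZ h', hd x h' c₂.path.left_mem]
  · exact .of_not_adj (y := a) (z := b) ⟨.inl ha, c₂.right.symm⟩ ⟨.inl hb, c₂.left.symm⟩ h.ne hw
  · rintro z (rfl | hz | hz)
    exacts [.inr hxZ, .inl hz, .inr (h₁ hz)]
  · exact fun z hz => .inr (.inl hz)
  · exact fun z hz => .inr (.inr hz)
  · rw [hP]
    rintro z rfl
    exact .inl rfl

/-- Two crossing paths that touch each other, or any two crossing paths if `a` and `b` are not
adjacent. -/
theorem eq_of_touching (h : Frame G F R Z a b)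
    (ih : ∀ R' Z' a' b', Z'.ncard < Z.ncard → Frame G F R' Z' a' b' → ¬ G.Adj a' b' →
      Const G F R' Z' a' b') (h₁ : P₁ ⊆ Z) (h₂ : P₂ ⊆ Z)
    (c₁ : Crossing G a b x₁ y₁ P₁) (c₂ : Crossing G a b x₂ y₂ P₂)
    (ht : ¬ G.Adj a b ∨ ∃ p ∈ P₁, ∃ q ∈ P₂, p = q ∨ G.Adj p q) : F (R ∪ P₁) = F (R ∪ P₂) := by
  by_cases hx : x₁ = x₂
  · subst hx
    exact h.eq_of_left ih h₁ h₂ c₁ c₂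
  by_cases hy : y₁ = y₂
  · subst hy
    exact h.eq_of_right ih h₁ h₂ c₁ c₂
  have mx₁ := c₁.path.left_mem
  have my₁ := c₁.path.right_mem
  have mx₂ := c₂.path.left_mem
  have my₂ := c₂.path.right_mem
  by_contra hcon
  -- If the paths touch at other places than `y₁` or `x₂`, one can switch from the first to the
  -- second, and a mixed crossing arises. So contacts are only possible between corresponding ends.
  have key : ∀ {P₁ P₂ x₁ y₁ x₂ y₂}, P₁ ⊆ Z → P₂ ⊆ Z → Crossing G a b x₁ y₁ P₁ →
      Crossing G a b x₂ y₂ P₂ → x₁ ≠ x₂ → y₁ ≠ y₂ → F (R ∪ P₁) ≠ F (R ∪ P₂) →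
      ∀ p ∈ P₁, ∀ q ∈ P₂, p = q ∨ G.Adj p q → p = y₁ ∨ q = x₂ := by
    intro P₁ P₂ x₁ y₁ x₂ y₂ h₁ h₂ c₁ c₂ hx hy hcon p hp q hq hpq
    by_contra hne
    push Not at hne
    refine hcon (h.eq_of_mixed ih h₁ h₂ c₁ c₂ ?_ hx hy)
    have l1 := (c₁.path.linked_diff_right hp hne.1).mono
      (Set.subset_union_left (t := P₂ \ {x₂}))
    have l2 := (c₂.path.linked_diff_left hq hne.2).mono
      (Set.subset_union_right (s := P₁ \ {y₁}))
    rcases hpq with rfl | hpq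
    · exact l1.trans l2
    · exact l1.trans (l2.cons hpq (.inl ⟨hp, hne.1⟩))
  have k1 := key h₁ h₂ c₁ c₂ hx hy hcon
  have k2 : ∀ p ∈ P₁, ∀ q ∈ P₂, p = q ∨ G.Adj p q → q = y₂ ∨ p = x₁ := fun p hp q hq hpq =>
    key h₂ h₁ c₂ c₁ (Ne.symm hx) (Ne.symm hy) (Ne.symm hcon) q hq p hp
      (hpq.imp Eq.symm SimpleGraph.Adj.symm)
  have hd : ∀ z ∈ P₁, z ∉ P₂ := by
    intro z hz hz'
    rcases k1 z hz z hz' (.inl rfl) with rfl | rfl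
    · exact hy (c₂.eq_right _ hz' c₁.right)
    · exact hx (c₁.eq_left _ hz c₂.left).symm
  by_cases s₁ : x₁ = y₁
  · subst s₁
    rcases ht with hab | ⟨p, hp, q, hq, rfl | hpq⟩
    · by_cases s₂ : x₂ = y₂
      · subst s₂
        exact hcon (h.eq_of_theta h₁ h₂ c₁ c₂ hd hab)
      · exact hcon (h.eq_of_theta h₂ h₁ c₂ c₁ (fun z hz hz' => hd z hz' hz) hab).symm
    · exact hd p hp hq
    · have := c₁.path.eq_singleton
      subst this
      obtain rfl : p = x₁ := hp
      exact hcon (h.eq_of_single h₁ h₂ c₁ c₂ (hd p rfl) hq hpq)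
  by_cases s₂ : x₂ = y₂
  · subst s₂
    rcases ht with hab | ⟨p, hp, q, hq, rfl | hpq⟩
    · exact hcon (h.eq_of_theta h₁ h₂ c₁ c₂ hd hab)
    · exact hd p hp hq
    · have := c₂.path.eq_singleton
      subst this
      obtain rfl : q = x₂ := hq
      exact hcon (h.eq_of_single h₂ h₁ c₂ c₁ (fun h' => hd _ h' rfl) hp hpq.symm).symm
  have hadj : ∀ p ∈ P₁, ∀ q ∈ P₂, G.Adj p q → (p = x₁ ∧ q = x₂) ∨ (p = y₁ ∧ q = y₂) := by
    intro p hp q hq hpq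
    have e1 := k1 p hp q hq (.inr hpq)
    have e2 := k2 p hp q hq (.inr hpq)
    clear * - e1 e2 s₁ s₂
    grind
  refine hcon (h.eq_of_ear h₁ h₂ c₁ c₂ hd hadj s₂ ?_)
  rcases ht with hab | ⟨p, hp, q, hq, rfl | hpq⟩
  · exact .inl hab
  · exact absurd hq (hd p hp)
  · rcases hadj p hp q hq hpq with ⟨rfl, rfl⟩ | ⟨rfl, rfl⟩
    · exact .inr (.inl hpq)
    · exact .inr (.inr hpq)

end Frame

end

/-! ### Functions on cycles that are constant inside solids: crossing paths joined by a bridge -/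

section

variable {V : Type u} {α : Type v} {G : SimpleGraph V} {F : Set V → α}
  {R Z S P P₁ P₂ P₃ Q : Set V} {a b u v x y x₁ x₂ x₃ y₁ y₂ y₃ p q z : V}

/-- An induced path `Q` that joins `P₁` to `P₂`, attached at its first and last vertex only. -/
structure Bridge (G : SimpleGraph V) (P₁ P₂ Q : Set V) (u v : V) : Prop where
  path : IPath G u v Q
  disj_left : ∀ z ∈ Q, z ∉ P₁
  disj_right : ∀ z ∈ Q, z ∉ P₂
  apart : ∀ p ∈ P₁, ∀ q ∈ P₂, p ≠ q ∧ ¬ G.Adj p q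
  eq_left : ∀ z ∈ Q, ∀ p ∈ P₁, G.Adj z p → z = u
  eq_right : ∀ z ∈ Q, ∀ p ∈ P₂, G.Adj z p → z = v
  exists_left : ∃ p ∈ P₁, G.Adj u p
  exists_right : ∃ p ∈ P₂, G.Adj v p

theorem Bridge.symm (h : Bridge G P₁ P₂ Q u v) : Bridge G P₂ P₁ Q v u :=
  ⟨h.path.symm, h.disj_right, h.disj_left,
    fun p hp q hq => ⟨(h.apart q hq p hp).1.symm, fun h' => (h.apart q hq p hp).2 h'.symm⟩,
    h.eq_right, h.eq_left, h.exists_right, h.exists_left⟩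

/-- A connecting path is shortened until only its ends lie in `P₁` and `P₂`. The ends are removed,
and the rest is shortened once more until only its own ends have neighbours there. -/
theorem Linked.exists_bridge (hl : Linked G Z x y) (hx : x ∈ P₁) (hy : y ∈ P₂)
    (h : ∀ p ∈ P₁, ∀ q ∈ P₂, p ≠ q ∧ ¬ G.Adj p q) :
    ∃ u v Q, Q ⊆ Z ∧ Bridge G P₁ P₂ Q u v := by
  obtain ⟨T, hT, hP⟩ := hl
  obtain ⟨p, q, T', h1, h2, h3, h4, h5, h6⟩ := hP.exists_crossing hx hy
  obtain ⟨c, T₁, k1, rfl, k2, k3, k4⟩ := h2.uncons (h p h3 q h4).1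
  have hcq : q ≠ c := by rintro rfl; exact (h p h3 q h4).2 k3
  obtain ⟨d, T₂, l1, rfl, l2, l3, l4⟩ := k1.symm.uncons hcq
  obtain ⟨u, v, Q, m1, m2, m3, m4, m5, m6⟩ := l1.symm.exists_crossing
    (X := {z | ∃ p ∈ P₁, G.Adj z p}) (Y := {z | ∃ p ∈ P₂, G.Adj z p}) ⟨p, h3, k3.symm⟩
    ⟨q, h4, l3.symm⟩
  refine ⟨u, v, Q, fun z hz => hT (h1 (.inr (.inr (m1 hz)))), m2, ?_, ?_, h, ?_, ?_, m3, m4⟩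
  · intro z hz hz'
    obtain rfl := h5 z (.inr (.inr (m1 hz))) hz'
    exact k2 (.inr (m1 hz))
  · intro z hz hz'
    obtain rfl := h6 z (.inr (.inr (m1 hz))) hz'
    exact l2 (m1 hz)
  · exact fun z hz p hp hzp => m5 z hz ⟨p, hp, hzp⟩
  · exact fun z hz p hp hzp => m6 z hz ⟨p, hp, hzp⟩

theorem Bridge.conn (h : Bridge G P₁ P₂ Q u v) (h₁ : Conn G P₁) : Conn G (P₁ ∪ Q) := by
  obtain ⟨p, hp, hup⟩ := h.exists_left
  exact h₁.union h.path.conn (.inr ⟨p, hp, u, h.path.left_mem, hup.symm⟩)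

namespace Frame

/-- If the bridge joins the two vertices next to `a`, both crossings and the bridge form one induced
path, which `b` closes to a cycle. On it `a` sees `b`, `y₁` and `y₂`, so everything lies in one
solid. -/
theorem eq_of_wheel (h : Frame G F R Z a b) (hR : R = {a, b}) (hab : G.Adj a b)
    (h₁ : P₁ ⊆ Z) (h₂ : P₂ ⊆ Z) (hQ : Q ⊆ Z)
    (c₁ : Crossing G a b x₁ y₁ P₁) (c₂ : Crossing G a b x₂ y₂ P₂) (hB : Bridge G P₁ P₂ Q u v)
    (hb : ∀ z ∈ Q, ¬ G.Adj b z) (hl : ∀ p ∈ P₁, G.Adj u p → p = y₁)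
    (hr : ∀ p ∈ P₂, G.Adj v p → p = y₂) : F (R ∪ P₁) = F (R ∪ P₂) := by
  subst hR
  have mx₁ := c₁.path.left_mem
  have my₁ := c₁.path.right_mem
  have mx₂ := c₂.path.left_mem
  have my₂ := c₂.path.right_mem
  have huy : G.Adj u y₁ := by
    obtain ⟨p, hp, hup⟩ := hB.exists_left
    rwa [← hl p hp hup]
  have hvy : G.Adj v y₂ := by
    obtain ⟨p, hp, hup⟩ := hB.exists_right
    rwa [← hr p hp hup]
  have hW : IPath G x₁ x₂ (P₁ ∪ (Q ∪ P₂)) := by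
    refine c₁.path.append (hB.path.append c₂.path.symm hvy hB.disj_right ?_) huy.symm ?_ ?_
    · intro z hz w hw hzw
      obtain rfl := hB.eq_right z hz w hw hzw
      exact ⟨rfl, hr w hw hzw⟩
    · rintro z hz (hz' | hz')
      · exact hB.disj_left z hz' hz
      · exact (hB.apart z hz z hz').1 rfl
    · rintro z hz w (hw | hw) hzw
      · obtain rfl := hB.eq_left w hw z hz hzw.symm
        exact ⟨hl z hz hzw.symm, rfl⟩
      · exact absurd hzw (hB.apart z hz w hw).2
  have hWZ : P₁ ∪ (Q ∪ P₂) ⊆ Z := Set.union_subset h₁ (Set.union_subset hQ h₂)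
  have haW : a ∉ P₁ ∪ (Q ∪ P₂) := fun h' => h.disj a (hWZ h') (by simp)
  have hbW : b ∉ P₁ ∪ (Q ∪ P₂) := fun h' => h.disj b (hWZ h') (by simp)
  have hO : Cyc G (insert b (P₁ ∪ (Q ∪ P₂))) := by
    refine ⟨b, x₁, x₂, _, rfl, hbW, hW, (hB.apart x₁ mx₁ x₂ mx₂).1, fun z hz => ⟨fun hbz => ?_, ?_⟩⟩
    · rcases hz with hz | hz | hz
      · exact .inl (c₁.eq_left z hz hbz)
      · exact absurd hbz (hb z hz)
      · exact .inr (c₂.eq_left z hz hbz)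
    · rintro (rfl | rfl)
      exacts [c₁.left, c₂.left]
  have hS : Sol G (insert a (insert b (P₁ ∪ (Q ∪ P₂)))) := by
    refine hO.sol_insert ?_ (.of_three (x := b) (y := y₁) (z := y₂) ⟨.inl rfl, hab⟩
      ⟨.inr (.inl my₁), c₁.right⟩ ⟨.inr (.inr (.inr my₂)), c₂.right⟩ ?_ ?_
      (hB.apart y₁ my₁ y₂ my₂).1)
    · rintro (h' | h')
      exacts [h.ne h', haW h']
    · rintro rfl; exact hbW (.inl my₁)
    · rintro rfl; exact hbW (.inr (.inr my₂))
  refine h.eq_of_sol h₁ h₂ c₁ c₂ hS ?_ ?_ ?_ ?_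
  · rintro z (rfl | rfl | hz)
    exacts [.inl (by simp), .inl (by simp), .inr (hWZ hz)]
  · rintro z (rfl | rfl)
    exacts [.inl rfl, .inr (.inl rfl)]
  · exact fun z hz => .inr (.inr (.inl hz))
  · exact fun z hz => .inr (.inr (.inr (.inr hz)))

/-- The vertex `x` followed by the bridge is an ear of the cycle of `P₂`: one end sees the edge
`ab`, the other end sees a nonempty set on `P₂` that is not wide. -/
theorem eq_of_bridge_single (h : Frame G F R Z a b) (hab : G.Adj a b)
    (h₁ : P₁ ⊆ Z) (h₂ : P₂ ⊆ Z) (hQ : Q ⊆ Z)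
    (c₁ : Crossing G a b x x P₁) (c₂ : Crossing G a b x₂ y₂ P₂) (hB : Bridge G P₁ P₂ Q u v)
    (ha : ∀ z ∈ Q, ¬ G.Adj a z) (hb : ∀ z ∈ Q, ¬ G.Adj b z) (hN : ¬ Wide G (Nb G v P₂)) :
    F (R ∪ P₁) = F (R ∪ P₂) := by
  obtain rfl := c₁.path.eq_singleton
  have hxu : G.Adj x u := by
    obtain ⟨_, rfl, hup⟩ := hB.exists_left
    exact hup.symm
  have mx₂ := c₂.path.left_mem
  have hxQ : x ∉ Q := fun h' => hB.disj_left x h' rfl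
  have hxP : x ∉ P₂ := fun h' => (hB.apart x rfl x h').1 rfl
  have hxZ : x ∈ Z := h₁ rfl
  have maR := h.path.left_mem
  have mbR := h.path.right_mem
  have mv := hB.path.right_mem
  have hQR : ∀ z ∈ Q, ∀ t ∈ R, ¬ G.Adj z t := by
    intro z hz t ht hzt
    rcases h.attach z (hQ hz) t ht hzt with rfl | rfl
    exacts [ha z hz hzt.symm, hb z hz hzt.symm]
  have hxn : ∀ t ∈ R ∪ P₂, G.Adj x t → t = a ∨ t = b := by
    rintro t (ht | ht) hxt
    · exact h.attach x hxZ t ht hxt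
    · exact absurd hxt (hB.apart x rfl t ht).2
  have hNv : Nb G v (R ∪ P₂) = Nb G v P₂ := by
    ext t
    constructor
    · rintro ⟨ht | ht, hvt⟩
      · exact absurd hvt (hQR v mv t ht)
      · exact ⟨ht, hvt⟩
    · exact fun ht => ⟨.inr ht.1, ht.2⟩
  obtain ⟨p, hp, hvp⟩ := hB.exists_right
  have hE : Ear G (R ∪ P₂) (insert x Q) x v := by
    refine ⟨h.cyc h₂ c₂, .cons hxu hB.path hxQ fun z hz hxz => hB.eq_left z hz x rfl hxz.symm,
      ?_, ?_, ?_, fun _ => ⟨⟨a, .inl maR, c₁.right.symm⟩, ?_⟩, fun _ => ?_⟩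
    · rintro z (hz | hz) (rfl | hz')
      exacts [h.disj z hxZ hz, h.disj z (hQ hz') hz, hxP hz, hB.disj_right z hz' hz]
    · rintro z (rfl | hz) t (ht | ht) hzt
      · exact .inl rfl
      · exact .inl rfl
      · exact absurd hzt (hQR z hz t ht)
      · exact .inr (hB.eq_right z hz t ht hzt)
    · refine .of_three (x := a) (y := b) (z := p) (.inl ⟨.inl maR, c₁.right.symm⟩)
        (.inl ⟨.inl mbR, c₁.left.symm⟩) (.inr ⟨.inr hp, hvp⟩) h.ne ?_ ?_
      · rintro rfl; exact h.disj _ (h₂ hp) maR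
      · rintro rfl; exact h.disj _ (h₂ hp) mbR
    · exact not_wide_of_subset_pair hab fun t ht => hxn t ht.1 ht.2
    · rw [hNv]
      exact ⟨⟨p, hp, hvp⟩, hN⟩
  refine h.eq_of_sol h₁ h₂ c₁ c₂ hE.sol ?_ ?_ ?_ ?_
  · rintro z ((hz | hz) | (rfl | hz))
    exacts [.inl hz, .inr (h₂ hz), .inr hxZ, .inr (hQ hz)]
  · exact fun z hz => .inl (.inl hz)
  · rintro z rfl
    exact .inr (.inl rfl)
  · exact fun z hz => .inl (.inr hz)

/-- By `hX` there are no crossings other than `P₁` and `P₂`. A neighbour of `a` on the bridge would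
produce one if the bridge met a crossing away from its vertex next to `a`, or if `b` had a neighbour
on the bridge. -/
theorem eq_of_label (h : Frame G F R Z a b) (hR : R = {a, b}) (hab : G.Adj a b)
    (h₁ : P₁ ⊆ Z) (h₂ : P₂ ⊆ Z) (hQ : Q ⊆ Z)
    (c₁ : Crossing G a b x₁ y₁ P₁) (c₂ : Crossing G a b x₂ y₂ P₂) (hB : Bridge G P₁ P₂ Q u v)
    (hX : ∀ S ⊆ Z, ∀ p q, G.Adj b p → G.Adj a q → Linked G S p q → P₁ ⊆ S ∨ P₂ ⊆ S)
    (hz : z ∈ Q) (haz : G.Adj a z) : F (R ∪ P₁) = F (R ∪ P₂) := by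
  have mx₁ := c₁.path.left_mem
  have my₁ := c₁.path.right_mem
  have mx₂ := c₂.path.left_mem
  have my₂ := c₂.path.right_mem
  have mu := hB.path.left_mem
  have mv := hB.path.right_mem
  have key : ∀ {P₁ P₂ x₁ y₁ x₂ y₂ u v}, P₁ ⊆ Z → P₂ ⊆ Z → Crossing G a b x₁ y₁ P₁ →
      Crossing G a b x₂ y₂ P₂ → Bridge G P₁ P₂ Q u v →
      (∀ S ⊆ Z, ∀ p q, G.Adj b p → G.Adj a q → Linked G S p q → P₁ ⊆ S ∨ P₂ ⊆ S) →
      ∀ p ∈ P₁, G.Adj u p → p = y₁ := by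
    intro P₁ P₂ x₁ y₁ x₂ y₂ u v h₁ h₂ c₁ c₂ hB hX p hp hup
    by_contra hpy
    have mu := hB.path.left_mem
    have l1 := (c₁.path.linked_diff_right hp hpy).mono (Set.subset_union_left (t := Q))
    have l2 := (hB.path.conn u mu z hz).mono (Set.subset_union_right (s := P₁ \ {y₁}))
    rcases hX ((P₁ \ {y₁}) ∪ Q) (Set.union_subset (Set.sdiff_subset.trans h₁) hQ) _ _ c₁.left haz
      (l1.trans (l2.cons hup.symm (.inl ⟨hp, hpy⟩))) with h' | h'
    · rcases h' c₁.path.right_mem with h' | h'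
      · exact h'.2 rfl
      · exact hB.disj_left _ h' c₁.path.right_mem
    · have m := c₂.path.left_mem
      rcases h' m with h' | h'
      · exact (hB.apart _ h'.1 _ m).1 rfl
      · exact hB.disj_right _ h' m
  refine h.eq_of_wheel hR hab h₁ h₂ hQ c₁ c₂ hB (fun w hw hbw => ?_) (key h₁ h₂ c₁ c₂ hB hX)
    (key h₂ h₁ c₂ c₁ hB.symm fun S hS p q hp hq hl => (hX S hS p q hp hq hl).symm)
  rcases hX Q hQ w z hbw haz (hB.path.conn w hw z hz) with h' | h'
  · exact hB.disj_left _ (h' mx₁) mx₁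
  · exact hB.disj_right _ (h' mx₂) mx₂

theorem eq_of_bridge (h : Frame G F R Z a b) (hR : R = {a, b}) (hab : G.Adj a b)
    (h₁ : P₁ ⊆ Z) (h₂ : P₂ ⊆ Z) (hQ : Q ⊆ Z)
    (c₁ : Crossing G a b x₁ y₁ P₁) (c₂ : Crossing G a b x₂ y₂ P₂) (hB : Bridge G P₁ P₂ Q u v)
    (hX : ∀ S ⊆ Z, ∀ p q, G.Adj b p → G.Adj a q → Linked G S p q → P₁ ⊆ S ∨ P₂ ⊆ S) :
    F (R ∪ P₁) = F (R ∪ P₂) := by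
  have mx₁ := c₁.path.left_mem
  have my₁ := c₁.path.right_mem
  have mx₂ := c₂.path.left_mem
  have my₂ := c₂.path.right_mem
  have mu := hB.path.left_mem
  have mv := hB.path.right_mem
  by_cases ha : ∃ z ∈ Q, G.Adj a z
  · obtain ⟨z, hz, haz⟩ := ha
    exact h.eq_of_label hR hab h₁ h₂ hQ c₁ c₂ hB hX hz haz
  by_cases hb : ∃ z ∈ Q, G.Adj b z
  · obtain ⟨z, hz, haz⟩ := hb
    exact h.symm.eq_of_label (hR.trans (Set.pair_comm _ _)) hab.symm h₁ h₂ hQ c₁.symm c₂.symm hB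
      (fun S hS p q hp hq hl => hX S hS q p hq hp hl.symm) hz haz
  push Not at ha hb
  have single : ∀ {P₁ P₂ x y₁ x₂ y₂ u v}, P₁ ⊆ Z → P₂ ⊆ Z → Crossing G a b x y₁ P₁ →
      Crossing G a b x₂ y₂ P₂ → Bridge G P₁ P₂ Q u v →
      (∀ S ⊆ Z, ∀ p q, G.Adj b p → G.Adj a q → Linked G S p q → P₁ ⊆ S ∨ P₂ ⊆ S) →
      x = y₁ → F (R ∪ P₁) = F (R ∪ P₂) := by
    rintro P₁ P₂ x y₁ x₂ y₂ u v h₁ h₂ c₁ c₂ hB hX rfl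
    have mv := hB.path.right_mem
    have hvP : v ∉ P₂ := hB.disj_right v mv
    refine h.eq_of_bridge_single hab h₁ h₂ hQ c₁ c₂ hB ha hb fun hw => ?_
    -- A wide set of neighbours on a path contains a nonadjacent pair, because a path has no
    -- triangle. Then `v` could replace a vertex of `P₂`, which would yield a new crossing.
    obtain ⟨p, hp, p', hp', hne, hpp⟩ : ∃ p ∈ Nb G v P₂, ∃ p' ∈ Nb G v P₂, p ≠ p' ∧ ¬ G.Adj p p' := by
      rcases hw with hw | ⟨p, hp, q, hq, r, hr, hpq, hpr, hqr⟩
      · exact hw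
      · by_contra hcon
        push Not at hcon
        exact c₂.path.not_triangle hp.1 hq.1 hr.1 (hcon p hp q hq hpq) (hcon p hp r hr hpr)
          (hcon q hq r hr hqr)
    obtain ⟨r, hr, hl⟩ := c₂.path.exists_linked_replace hvP hp.1 hp'.1 hne hpp hp.2 hp'.2
    rcases hX _ (Set.insert_subset (hQ mv) (Set.sdiff_subset.trans h₂)) _ _ c₂.left c₂.right hl with
      h' | h'
    · have m := c₁.path.left_mem
      rcases h' m with h' | h'
      · exact hB.disj_left _ (h' ▸ mv) m
      · exact (hB.apart _ m _ h'.1).1 rfl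
    · rcases h' hr with h' | h'
      · exact hvP (h' ▸ hr)
      · exact h'.2 rfl
  by_cases s₁ : x₁ = y₁
  · exact single h₁ h₂ c₁ c₂ hB hX s₁
  by_cases s₂ : x₂ = y₂
  · exact (single h₂ h₁ c₂ c₁ hB.symm (fun S hS p q hp hq hl => (hX S hS p q hp hq hl).symm) s₂).symm
  -- A passage over the bridge that avoids `y₁` and `x₂` would be a new crossing. Hence all contacts
  -- of the bridge are at `y₁` and `y₂`, or all are at `x₁` and `x₂`, and one of `a`, `b` is the
  -- apex of a wheel.
  have key : ∀ {P₁ P₂ x₁ y₁ x₂ y₂ u v}, P₁ ⊆ Z → P₂ ⊆ Z → Crossing G a b x₁ y₁ P₁ →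
      Crossing G a b x₂ y₂ P₂ → Bridge G P₁ P₂ Q u v →
      (∀ S ⊆ Z, ∀ p q, G.Adj b p → G.Adj a q → Linked G S p q → P₁ ⊆ S ∨ P₂ ⊆ S) →
      ∀ p ∈ P₁, ∀ q ∈ P₂, G.Adj u p → G.Adj v q → p = y₁ ∨ q = x₂ := by
    intro P₁ P₂ x₁ y₁ x₂ y₂ u v h₁ h₂ c₁ c₂ hB hX p hp q hq hup hvq
    by_contra hcon
    push Not at hcon
    have mu := hB.path.left_mem
    have mv := hB.path.right_mem
    have l1 := (c₁.path.linked_diff_right hp hcon.1).mono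
      (Set.subset_union_left (t := Q ∪ (P₂ \ {x₂})))
    have l2 := (hB.path.conn u mu v mv).mono (T := (P₁ \ {y₁}) ∪ (Q ∪ (P₂ \ {x₂})))
      fun z hz => .inr (.inl hz)
    have l3 := (c₂.path.linked_diff_left hq hcon.2).mono (T := (P₁ \ {y₁}) ∪ (Q ∪ (P₂ \ {x₂})))
      fun z hz => .inr (.inr hz)
    have l4 := l1.trans ((l2.trans (l3.cons hvq (.inr (.inl mv)))).cons hup.symm
      (.inl ⟨hp, hcon.1⟩))
    rcases hX _ (Set.union_subset (Set.sdiff_subset.trans h₁)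
      (Set.union_subset hQ (Set.sdiff_subset.trans h₂))) _ _ c₁.left c₂.right l4 with h' | h'
    · have m := c₁.path.right_mem
      rcases h' m with h' | h' | h'
      · exact h'.2 rfl
      · exact hB.disj_left _ h' m
      · exact (hB.apart _ m _ h'.1).1 rfl
    · have m := c₂.path.left_mem
      rcases h' m with h' | h' | h'
      · exact (hB.apart _ h'.1 _ m).1 rfl
      · exact hB.disj_right _ h' m
      · exact h'.2 rfl
  have k1 := key h₁ h₂ c₁ c₂ hB hX
  have k2 : ∀ p ∈ P₁, ∀ q ∈ P₂, G.Adj u p → G.Adj v q → q = y₂ ∨ p = x₁ := fun p hp q hq hup hvq =>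
    key h₂ h₁ c₂ c₁ hB.symm (fun S hS p q hp hq hl => (hX S hS p q hp hq hl).symm) q hq p hp hvq hup
  obtain ⟨p, hp, hup⟩ := hB.exists_left
  obtain ⟨q, hq, hvq⟩ := hB.exists_right
  by_cases hpy : p = y₁
  · have hqy : q = y₂ := (k2 p hp q hq hup hvq).resolve_right fun h' => s₁ (h'.symm.trans hpy)
    refine h.eq_of_wheel hR hab h₁ h₂ hQ c₁ c₂ hB hb (fun p' hp' hup' => ?_) fun q' hq' hvq' => ?_
    · exact (k1 p' hp' q hq hup' hvq).resolve_right fun h' => s₂ (h'.symm.trans hqy)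
    · exact (k2 p hp q' hq' hup hvq').resolve_right fun h' => s₁ (h'.symm.trans hpy)
  · have hqx : q = x₂ := (k1 p hp q hq hup hvq).resolve_left hpy
    have hpx : p = x₁ := (k2 p hp q hq hup hvq).resolve_left fun h' => s₂ (hqx.symm.trans h')
    refine h.symm.eq_of_wheel (hR.trans (Set.pair_comm _ _)) hab.symm h₁ h₂ hQ c₁.symm c₂.symm hB ha
      (fun p' hp' hup' => ?_) fun q' hq' hvq' => ?_
    · exact (k2 p' hp' q hq hup' hvq).resolve_left fun h' => s₂ (hqx.symm.trans h')
    · exact (k1 p hp q' hq' hup hvq').resolve_left hpy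

/-- In a smallest counterexample, two crossings with different values do not touch, so `ab` is an
edge, `Z` is connected and a bridge exists. Minimality leaves only these two crossings, and this
determines how the bridge is attached. -/
theorem const_of (h : Frame G F R Z a b) (hZ : ¬ G.Adj a b ∨ (Conn G Z ∧ R = {a, b})) :
    Const G F R Z a b := by
  induction hn : Z.ncard using Nat.strong_induction_on generalizing R Z a b with
  | _ n ih =>
  subst hn
  intro x₁ y₁ P₁ x₂ y₂ P₂ h₁ h₂ c₁ c₂
  by_contra hcon
  have ih' : ∀ R' Z' a' b', Z'.ncard < Z.ncard → Frame G F R' Z' a' b' → ¬ G.Adj a' b' →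
      Const G F R' Z' a' b' := fun R' Z' a' b' hlt h' hadj => ih _ hlt h' (.inl hadj) rfl
  have ht : ¬ (¬ G.Adj a b ∨ ∃ p ∈ P₁, ∃ q ∈ P₂, p = q ∨ G.Adj p q) := fun ht =>
    hcon (h.eq_of_touching ih' h₁ h₂ c₁ c₂ ht)
  push Not at ht
  obtain ⟨hab, hapart⟩ := ht
  obtain ⟨hconn, hR⟩ := hZ.resolve_left (not_not.2 hab)
  have mx₁ := c₁.path.left_mem
  have mx₂ := c₂.path.left_mem
  obtain ⟨u, v, Q, hQ, hB⟩ := (hconn x₁ (h₁ mx₁) x₂ (h₂ mx₂)).exists_bridge mx₁ mx₂ hapart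
  have small : ∀ {x y x' y' P P'}, P ⊆ Z → P' ⊆ Z → Crossing G a b x y P → Crossing G a b x' y' P' →
      Conn G (P ∪ Q ∪ P') → P ∪ Q ∪ P' ≠ Z → F (R ∪ P) = F (R ∪ P') := by
    intro x y x' y' P P' hP hP' c c' hc hne
    have hsub : P ∪ Q ∪ P' ⊆ Z := Set.union_subset (Set.union_subset hP hQ) hP'
    exact ih _ (Set.ncard_lt_ncard (hsub.ssubset_of_ne hne) h.finite) (h.mono hsub) (.inr ⟨hc, hR⟩)
      rfl _ _ _ _ _ _ (fun z hz => .inl (.inl hz)) (fun z hz => .inr hz) c c'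
  -- Otherwise the crossings with the bridge would already form a smaller connected counterexample.
  have hW : P₁ ∪ Q ∪ P₂ = Z := by
    by_contra hne
    refine hcon (small h₁ h₂ c₁ c₂ ?_ hne)
    obtain ⟨q, hq, hvq⟩ := hB.exists_right
    exact (hB.conn c₁.path.conn).union c₂.path.conn (.inr ⟨v, .inr hB.path.right_mem, q, hq, hvq⟩)
  -- A third crossing must use the bridge. With the bridge and either of the two crossings it spans
  -- a smaller connected set, so its value would agree with both.
  have hthird : ∀ x₃ y₃ P₃, P₃ ⊆ Z → Crossing G a b x₃ y₃ P₃ → P₃ = P₁ ∨ P₃ = P₂ := by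
    intro x₃ y₃ P₃ h₃ c₃
    by_contra hne
    push Not at hne
    obtain ⟨z, hz, hzQ⟩ : ∃ z ∈ P₃, z ∈ Q := by
      by_contra hcon'
      push Not at hcon'
      have key : ∀ z ∈ P₃, z ∈ P₁ ∨ z ∈ P₂ := fun z hz => by
        have h' : z ∈ P₁ ∪ Q ∪ P₂ := hW ▸ h₃ hz
        have := hcon' z hz
        clear * - h' this
        grind
      have m₃ := c₃.path.left_mem
      rcases key x₃ m₃ with h' | h'
      · refine hne.1 (c₃.eq_of_subset c₁ fun z hz => ?_)
        refine (c₃.path.conn x₃ m₃ z hz).mem_of_closed h' fun p hp q hq hpq => ?_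
        exact (key q hq).resolve_right fun hq' => (hapart p hp q hq').2 hpq
      · refine hne.2 (c₃.eq_of_subset c₂ fun z hz => ?_)
        refine (c₃.path.conn x₃ m₃ z hz).mem_of_closed h' fun p hp q hq hpq => ?_
        exact (key q hq).resolve_left fun hq' => (hapart q hq' p hp).2 hpq.symm
    have e1 : F (R ∪ P₁) = F (R ∪ P₃) := by
      refine small h₁ h₃ c₁ c₃ ((hB.conn c₁.path.conn).union c₃.path.conn (.inl ⟨z, .inr hzQ, hz⟩))
        fun heq => ?_
      refine hne.2 (c₂.eq_of_subset c₃ fun w hw => ?_).symm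
      have : w ∈ P₁ ∪ Q ∪ P₃ := heq ▸ h₂ hw
      rcases this with (h' | h') | h'
      · exact absurd rfl (hapart w h' w hw).1
      · exact absurd hw (hB.disj_right w h')
      · exact h'
    have e2 : F (R ∪ P₂) = F (R ∪ P₃) := by
      refine small h₂ h₃ c₂ c₃ ((hB.symm.conn c₂.path.conn).union c₃.path.conn
        (.inl ⟨z, .inr hzQ, hz⟩)) fun heq => ?_
      refine hne.1 (c₁.eq_of_subset c₃ fun w hw => ?_).symm
      have : w ∈ P₂ ∪ Q ∪ P₃ := heq ▸ h₁ hw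
      rcases this with (h' | h') | h'
      · exact absurd rfl (hapart w hw w h').1
      · exact absurd hw (hB.disj_left w h')
      · exact h'
    exact hcon (e1.trans e2.symm)
  refine hcon (h.eq_of_bridge hR hab h₁ h₂ hQ c₁ c₂ hB fun S hS p q hp hq hl => ?_)
  obtain ⟨x₃, y₃, P₃, h₃, c₃⟩ := exists_crossing hl hp hq
  rcases hthird _ _ _ (h₃.trans hS) c₃ with rfl | rfl
  exacts [.inl h₃, .inr h₃]

end Frame

end

/-! ### Critical graphs and the number of solids -/

section

variable {V : Type u} {G : SimpleGraph V} {B S T U P o : Set V} {C D : Finset ℕ} {f g : V → ℕ}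
  {a n x y : V}

/-- `f` is a proper colouring of the subgraph induced by `S` with colours from `C`. -/
def Proper (G : SimpleGraph V) (S : Set V) (C : Finset ℕ) (f : V → ℕ) : Prop :=
  (∀ v ∈ S, f v ∈ C) ∧ ∀ u ∈ S, ∀ v ∈ S, G.Adj u v → f u ≠ f v

/-- The subgraph induced by `S` can be coloured with colours from `C`. -/
def ColBy (G : SimpleGraph V) (S : Set V) (C : Finset ℕ) : Prop := ∃ f, Proper G S C f

/-- The subgraph induced by `S` is vertex-critical with respect to colourability by `C`. -/
def Critical (G : SimpleGraph V) (S : Set V) (C : Finset ℕ) : Prop :=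
  ¬ ColBy G S C ∧ ∀ T ⊂ S, ColBy G T C

theorem Proper.mono (h : Proper G S C f) (hT : T ⊆ S) : Proper G T C f :=
  ⟨fun v hv => h.1 v (hT hv), fun u hu v hv => h.2 u (hT hu) v (hT hv)⟩

open Classical in
theorem Proper.extend (h : Proper G (S \ {a}) C f) {c : ℕ} (hc : c ∈ C)
    (ha : ∀ n ∈ S, G.Adj a n → f n ≠ c) : Proper G S C (Function.update f a c) := by
  have hf : ∀ v, v ≠ a → Function.update f a c v = f v := fun v hv => Function.update_of_ne hv _ _
  refine ⟨fun v hv => ?_, fun u hu v hv huv => ?_⟩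
  · by_cases hva : v = a
    · subst hva; simpa using hc
    · rw [hf v hva]; exact h.1 v ⟨hv, hva⟩
  · by_cases hua : u = a
    · subst hua
      rw [hf v huv.ne', Function.update_self]
      exact (ha v hv huv).symm
    · by_cases hva : v = a
      · subst hva
        rw [hf u huv.ne, Function.update_self]
        exact ha u hu huv.symm
      · rw [hf u hua, hf v hva]
        exact h.2 u ⟨hu, hua⟩ v ⟨hv, hva⟩ huv

theorem exists_critical (hB : B.Finite) (h : ¬ ColBy G B C) : ∃ U ⊆ B, Critical G U C := by
  induction hn : B.ncard using Nat.strong_induction_on generalizing B with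
  | _ n ih =>
  subst hn
  by_cases hc : ∀ T ⊂ B, ColBy G T C
  · exact ⟨B, le_rfl, h, hc⟩
  · push Not at hc
    obtain ⟨T, hT, hTC⟩ := hc
    obtain ⟨U, hU, hUC⟩ := ih _ (Set.ncard_lt_ncard hT hB) (hB.subset hT.subset) hTC rfl
    exact ⟨U, hU.trans hT.subset, hUC⟩

theorem swap_mem {p q c : ℕ} (hp : p ∈ D) (hq : q ∈ D) (hc : c ∈ D) : Equiv.swap p q c ∈ D := by
  rw [Equiv.swap_apply_def]
  split_ifs
  exacts [hq, hp, hc]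

namespace Critical

/-- A colour missing among the neighbours of `a` could be given to `a`. -/
theorem exists_nbr (h : Critical G U D) (hf : Proper G (U \ {a}) D f) {c : ℕ} (hc : c ∈ D) :
    ∃ n ∈ U, G.Adj a n ∧ f n = c := by
  by_contra hcon
  push Not at hcon
  exact h.1 ⟨_, hf.extend hc hcon⟩

open Classical in
/-- A critical graph has no separating clique with at most two vertices. -/
theorem conn_diff (h : Critical G U D) (ha : a ∈ U) (hn : n ∈ U) (han : a = n ∨ G.Adj a n) :
    Conn G (U \ {a, n}) := by
  intro x hx y hy
  by_contra hxy
  set X : Set V := {z | Linked G (U \ {a, n}) x z} with hX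
  have hXU : X ⊆ U \ {a, n} := fun z hz => Linked.right_mem hz
  have hxX : x ∈ X := Linked.refl hx
  set Y : Set V := (U \ {a, n}) \ X with hY
  have hXY : ∀ p ∈ X, ∀ q ∈ Y, ¬ G.Adj p q := fun p hp q hq hpq =>
    hq.2 (Linked.trans hp (Linked.of_adj (hXU hp) hq.1 hpq))
  obtain ⟨f₁, h₁⟩ := h.2 ({a, n} ∪ X) ⟨by
    rintro z ((rfl | rfl) | hz)
    exacts [ha, hn, (hXU hz).1], fun h' => by
    rcases h' hy.1 with h' | h'
    exacts [hy.2 h', hxy h']⟩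
  obtain ⟨f₂, h₂⟩ := h.2 ({a, n} ∪ Y) ⟨by
    rintro z ((rfl | rfl) | hz)
    exacts [ha, hn, hz.1.1], fun h' => by
    rcases h' hx.1 with h' | h'
    exacts [hx.2 h', h'.2 hxX]⟩
  have m₁a := h₁.1 a (.inl (.inl rfl))
  have m₁n := h₁.1 n (.inl (.inr rfl))
  have m₂a := h₂.1 a (.inl (.inl rfl))
  have m₂n := h₂.1 n (.inl (.inr rfl))
  -- Both sides can be coloured by criticality. Two transpositions of the colours make the
  -- colourings agree on `a` and `n`, after which they can be glued.
  obtain ⟨σ, hσ, hσD, hσa, hσn⟩ : ∃ σ : ℕ → ℕ, Function.Injective σ ∧ (∀ c ∈ D, σ c ∈ D) ∧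
      σ (f₂ a) = f₁ a ∧ σ (f₂ n) = f₁ n := by
    set p := Equiv.swap (f₂ a) (f₁ a) (f₂ n) with hp
    have hpD : p ∈ D := swap_mem m₂a m₁a m₂n
    refine ⟨fun c => Equiv.swap p (f₁ n) (Equiv.swap (f₂ a) (f₁ a) c), ?_, ?_, ?_, ?_⟩
    · exact (Equiv.swap p (f₁ n)).injective.comp (Equiv.swap (f₂ a) (f₁ a)).injective
    · exact fun c hc => swap_mem hpD m₁n (swap_mem m₂a m₁a hc)
    · simp only [Equiv.swap_apply_left]
      rcases han with rfl | han
      · simp [hp]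
      · refine Equiv.swap_apply_of_ne_of_ne ?_ (h₁.2 a (.inl (.inl rfl)) n (.inl (.inr rfl)) han)
        rw [hp, ← Equiv.swap_apply_left (f₂ a) (f₁ a)]
        exact fun h' => h₂.2 a (.inl (.inl rfl)) n (.inl (.inr rfl)) han
          ((Equiv.swap (f₂ a) (f₁ a)).injective (by simpa using h'))
    · simp [hp]
  have hUXY : ∀ z ∈ U, z ∉ ({a, n} : Set V) ∪ X → z ∈ Y := fun z hz hz' =>
    ⟨⟨hz, fun h' => hz' (.inl h')⟩, fun h' => hz' (.inr h')⟩
  have hcross : ∀ u ∈ ({a, n} : Set V) ∪ X, ∀ v ∈ Y, G.Adj u v → f₁ u ≠ σ (f₂ v) := by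
    rintro u ((rfl | rfl) | hu) v hv huv
    · rw [← hσa]
      exact fun h' => h₂.2 _ (.inl (.inl rfl)) v (.inr hv) huv (hσ h')
    · rw [← hσn]
      exact fun h' => h₂.2 _ (.inl (.inr rfl)) v (.inr hv) huv (hσ h')
    · exact absurd huv (hXY u hu v hv)
  refine h.1 ⟨fun z => if z ∈ ({a, n} : Set V) ∪ X then f₁ z else σ (f₂ z), fun v hv => ?_,
    fun u hu v hv huv => ?_⟩
  · dsimp only
    split_ifs with hv'
    · exact h₁.1 v hv'
    · exact hσD _ (h₂.1 v (.inr (hUXY v hv hv')))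
  · dsimp only
    split_ifs with hu' hv' hv'
    · exact h₁.2 u hu' v hv' huv
    · exact hcross u hu' v (hUXY v hv hv') huv
    · exact (hcross v hv' u (hUXY u hu hu') huv.symm).symm
    · exact fun h' => h₂.2 u (.inr (hUXY u hu hu')) v (.inr (hUXY v hv hv')) huv (hσ h')

open Classical in
/-- A Kempe chain in a critical graph, closed to a cycle through `a`. -/
theorem exists_cyc (h : Critical G U D) (ha : a ∈ U) (hf : Proper G (U \ {a}) D f) {c₁ c₂ : ℕ}
    (h₁ : c₁ ∈ D) (h₂ : c₂ ∈ D) (hne : c₁ ≠ c₂) :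
    ∃ o ⊆ U, Cyc G o ∧ a ∈ o ∧ f '' (o \ {a}) = {c₁, c₂} := by
  set H : Set V := {z | z ∈ U ∧ z ≠ a ∧ (f z = c₁ ∨ f z = c₂)} with hH
  have hHU : H ⊆ U \ {a} := fun z hz => ⟨hz.1, hz.2.1⟩
  obtain ⟨n₁, n₂, hn₁, hn₂, e₁, e₂, hl⟩ : ∃ n₁ n₂, G.Adj a n₁ ∧ G.Adj a n₂ ∧ f n₁ = c₁ ∧ f n₂ = c₂ ∧
      Linked G H n₁ n₂ := by
    by_contra hcon
    push Not at hcon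
    -- If no Kempe chain joins a neighbour of colour `c₁` to one of colour `c₂`, swapping the
    -- colours on all components reached from the former removes `c₁` from the neighbours of `a`.
    set T : Set V := {z | ∃ n, G.Adj a n ∧ f n = c₁ ∧ Linked G H n z} with hT
    have hTH : T ⊆ H := by
      rintro z ⟨n, -, -, hl⟩
      exact hl.right_mem
    have hTc : ∀ u ∈ T, ∀ v ∈ H, G.Adj u v → v ∈ T := by
      rintro u ⟨n, h1, h2, h3⟩ v hv huv
      exact ⟨n, h1, h2, h3.trans (.of_adj h3.right_mem hv huv)⟩
    have hcross : ∀ u ∈ T, ∀ v ∈ U \ {a}, v ∉ T → G.Adj u v → Equiv.swap c₁ c₂ (f u) ≠ f v := by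
      intro u hu v hv hvT huv
      have hvH : v ∉ H := fun h' => hvT (hTc u hu v h' huv)
      have hv' : f v ≠ c₁ ∧ f v ≠ c₂ := by
        refine ⟨fun h' => hvH ⟨hv.1, hv.2, .inl h'⟩, fun h' => hvH ⟨hv.1, hv.2, .inr h'⟩⟩
      rcases (hTH hu).2.2 with h' | h' <;> rw [h'] <;> simp [hv'.1.symm, hv'.2.symm]
    have hg : Proper G (U \ {a}) D fun z => if z ∈ T then Equiv.swap c₁ c₂ (f z) else f z := by
      refine ⟨fun v hv => ?_, fun u hu v hv huv => ?_⟩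
      · dsimp only
        split_ifs
        exacts [swap_mem h₁ h₂ (hf.1 v hv), hf.1 v hv]
      · dsimp only
        split_ifs with hu' hv' hv'
        · exact fun h' => hf.2 u hu v hv huv ((Equiv.swap c₁ c₂).injective h')
        · exact hcross u hu' v hv hv' huv
        · exact (hcross v hv' u hu hu' huv.symm).symm
        · exact hf.2 u hu v hv huv
    obtain ⟨n, hnU, han, hn⟩ := h.exists_nbr hg h₁
    split_ifs at hn with hnT
    · have hfn : f n = c₂ := by
        rcases (hTH hnT).2.2 with h' | h'
        · rw [h', Equiv.swap_apply_left] at hn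
          exact absurd hn.symm hne
        · exact h'
      obtain ⟨m, h3, h4, h5⟩ := hnT
      exact hcon m n h3 han h4 hfn h5
    · exact hnT ⟨n, han, hn, .refl ⟨hnU, han.ne', .inl hn⟩⟩
  obtain ⟨P, hP, hpath⟩ := hl
  obtain ⟨x, y, P', hP', hpath', hx, hy, hxu, hyu⟩ := hpath.exists_crossing
    (X := {z | G.Adj a z ∧ f z = c₁}) (Y := {z | G.Adj a z ∧ f z = c₂}) ⟨hn₁, e₁⟩ ⟨hn₂, e₂⟩
  have hPH := hP'.trans hP
  have haP : a ∉ P' := fun h' => (hPH h').2.1 rfl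
  refine ⟨insert a P', ?_, ⟨a, x, y, P', rfl, haP, hpath', ?_, fun z hz => ⟨fun haz => ?_, ?_⟩⟩,
    .inl rfl, ?_⟩
  · rintro z (rfl | hz)
    exacts [ha, (hPH hz).1]
  · rintro rfl
    exact hne (hx.2.symm.trans hy.2)
  · rcases (hPH hz).2.2 with h' | h'
    exacts [.inl (hxu z hz ⟨haz, h'⟩), .inr (hyu z hz ⟨haz, h'⟩)]
  · rintro (rfl | rfl)
    exacts [hx.1, hy.1]
  · have : insert a P' \ {a} = P' := by
      ext z; constructor
      · rintro ⟨h' | h', h''⟩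
        exacts [absurd h' h'', h']
      · exact fun hz => ⟨.inr hz, by rintro rfl; exact haP hz⟩
    rw [this]
    ext c; constructor
    · rintro ⟨z, hz, rfl⟩
      exact (hPH hz).2.2
    · rintro (rfl | rfl)
      exacts [⟨x, hpath'.left_mem, hx.2⟩, ⟨y, hpath'.right_mem, hy.2⟩]

end Critical

/-- A cycle still contains an edge after the deletion of `a`. -/
theorem Cyc.two_le_ncard_image (ho : Cyc G o) (hoU : o ⊆ U) (ha : a ∈ o)
    (hf : Proper G (U \ {a}) D f) : 2 ≤ (f '' (o \ {a})).ncard := by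
  obtain ⟨x, y, P, rfl, haP, hP, hxy, -⟩ := ho.rotate ha
  obtain ⟨c, S, h1, rfl, h2, hxc, -⟩ := hP.uncons hxy
  have key : ∀ z ∈ insert x S, z ∈ insert a (insert x S) \ {a} := fun z hz =>
    ⟨.inr hz, by rintro rfl; exact haP hz⟩
  have hx := key x (.inl rfl)
  have hc := key c (.inr h1.left_mem)
  have hne := hf.2 x ⟨hoU hx.1, hx.2⟩ c ⟨hoU hc.1, hc.2⟩ hxc
  rw [← Set.ncard_pair hne]
  refine Set.ncard_le_ncard ?_ ((ho.finite.subset Set.sdiff_subset).image f)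
  rintro _ (rfl | rfl)
  exacts [⟨x, hx, rfl⟩, ⟨c, hc, rfl⟩]

theorem Cyc.exists_crossing (ho : Cyc G o) (ha : a ∈ o) (hn : n ∈ o) (han : G.Adj a n) :
    ∃ x y P, o = {a, n} ∪ P ∧ a ∉ P ∧ n ∉ P ∧ Crossing G a n x y P := by
  obtain ⟨x, y, P, rfl, haP, hP, hxy, hax, hay, hu⟩ := ho.rotate ha
  have key : ∀ y, IPath G n y P → n ≠ y → G.Adj a y → (∀ z ∈ P, G.Adj a z → z = n ∨ z = y) →
      ∃ x y Q, insert a P = {a, n} ∪ Q ∧ a ∉ Q ∧ n ∉ Q ∧ Crossing G a n x y Q := by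
    intro y hP hny hay hu
    obtain ⟨c, S, h1, rfl, h2, hxc, h3⟩ := hP.uncons hny
    refine ⟨c, y, S, by rw [Set.insert_union, Set.singleton_union], fun h' => haP (.inr h'), h2,
      h1, hxc, hay, h3, fun z hz haz => ?_⟩
    exact (hu z (.inr hz) haz).resolve_left (by rintro rfl; exact h2 hz)
  rcases hu n (hn.resolve_left han.ne') han with rfl | rfl
  · exact key y hP hxy hay hu
  · exact key x hP.symm hxy.symm hax fun z hz haz => (hu z hz haz).symm

/-- In a graph that is critical with respect to three colours, every vertex lies in a solid in
which all three colours occur. -/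
theorem Critical.exists_sol (h : Critical G U D) (hU : U.Finite) (hD : D.card = 3) (ha : a ∈ U)
    (hf : Proper G (U \ {a}) D f) : ∃ s ⊆ U, Sol G s ∧ a ∈ s ∧ f '' (s \ {a}) = D := by
  by_contra hcon
  push Not at hcon
  have hsub : ∀ s ⊆ U, f '' (s \ {a}) ⊆ D := by
    rintro s hs _ ⟨z, hz, rfl⟩
    exact hf.1 z ⟨hs hz.1, hz.2⟩
  -- By assumption such a solid shows at most two colours, and each cycle through `a` shows at least
  -- two. So all cycles through `a` in the same solid have the same colour set.
  have hsol : ∀ s ⊆ U, Sol G s → ∀ o ⊆ s, Cyc G o → a ∈ o → f '' (o \ {a}) = f '' (s \ {a}) := by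
    intro s hsU hs o hos ho hao
    have hfin : (f '' (s \ {a})).Finite := D.finite_toSet.subset (hsub s hsU)
    refine Set.eq_of_subset_of_ncard_le (Set.image_mono (Set.sdiff_subset_sdiff_left hos)) ?_ hfin
    refine le_trans ?_ (ho.two_le_ncard_image (hos.trans hsU) hao hf)
    have hlt := Set.ncard_lt_ncard ((hsub s hsU).ssubset_of_ne (hcon s hsU hs (hos hao)))
      D.finite_toSet
    rw [Set.ncard_coe_finset, hD] at hlt
    omega
  have hconst : ∀ n ∈ U, G.Adj a n → ∀ o ⊆ U, Cyc G o → a ∈ o → n ∈ o → ∀ o' ⊆ U, Cyc G o' →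
      a ∈ o' → n ∈ o' → f '' (o \ {a}) = f '' (o' \ {a}) := by
    intro n hn han o hoU ho hao hno o' hoU' ho' hao' hno'
    -- The function is the colour set of a cycle, and the path is the edge `an`. The rest of `U` is
    -- connected because an edge does not separate a critical graph.
    have hfr : Frame G (fun o => f '' (o \ {a})) {a, n} (U \ {a, n}) a n := by
      refine ⟨.pair han, han.ne, hU.subset Set.sdiff_subset, fun z hz => hz.2,
        fun _ _ t ht _ => ht, ?_⟩
      intro s hs hsU o ho hRo hos o' ho' hRo' hos'
      have hsU' : s ⊆ U := fun z hz => by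
        rcases hsU hz with (rfl | rfl) | hz
        exacts [ha, hn, hz.1]
      rw [hsol s hsU' hs o hos ho (hRo (.inl rfl)), hsol s hsU' hs o' hos' ho' (hRo' (.inl rfl))]
    obtain ⟨x₁, y₁, P₁, rfl, h1, h2, c₁⟩ := ho.exists_crossing hao hno han
    obtain ⟨x₂, y₂, P₂, rfl, h3, h4, c₂⟩ := ho'.exists_crossing hao' hno' han
    refine hfr.const_of (.inr ⟨h.conn_diff ha hn (.inr han), rfl⟩) _ _ _ _ _ _ (fun z hz => ?_)
      (fun z hz => ?_) c₁ c₂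
    · refine ⟨hoU (.inr hz), ?_⟩
      rintro (rfl | rfl)
      exacts [h1 hz, h2 hz]
    · refine ⟨hoU' (.inr hz), ?_⟩
      rintro (rfl | rfl)
      exacts [h3 hz, h4 hz]
  obtain ⟨c₁, c₂, c₃, h12, h13, h23, rfl⟩ := Finset.card_eq_three.1 hD
  obtain ⟨o₀, hoU, ho, hao, hoc⟩ := h.exists_cyc ha hf (c₁ := c₁) (c₂ := c₂) (by simp) (by simp) h12
  obtain ⟨n₃, hn₃U, han₃, hn₃⟩ := h.exists_nbr hf (c := c₃) (by simp)
  -- Some neighbours of `a` lie in `M`, but the neighbour `n₃` of the third colour does not.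
  set M : Set V := {n | ∃ o ⊆ U, Cyc G o ∧ a ∈ o ∧ n ∈ o ∧ f '' (o \ {a}) = {c₁, c₂}} with hM
  have hn₃M : n₃ ∉ M := by
    rintro ⟨o, h1, h2, h3, h4, h5⟩
    have : f n₃ ∈ f '' (o \ {a}) := ⟨n₃, ⟨h4, han₃.ne'⟩, rfl⟩
    rw [h5, hn₃] at this
    rcases this with h' | h'
    exacts [h13 h'.symm, h23 h'.symm]
  obtain ⟨n₁, hn₁, -, -, -, han₁, -⟩ := ho.exists_adj hao
  have hconn := h.conn_diff ha ha (.inl rfl)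
  obtain ⟨P, hP, hpath⟩ := hconn n₁ ⟨hoU hn₁, by simpa using han₁.ne'⟩ n₃
    ⟨hn₃U, by simpa using han₃.ne'⟩
  -- A shortest passage in `U \ {a}` from the neighbours of `a` in `M` to those outside closes up
  -- through `a` to a cycle. Since it contains `x`, its colour set is `{c₁, c₂}`; hence its other
  -- end `y` also lies in `M`.
  obtain ⟨x, y, P', hP', hpath', hx, hy, hxu, hyu⟩ := hpath.exists_crossing
    (X := {z | G.Adj a z ∧ z ∈ M}) (Y := {z | G.Adj a z ∧ z ∉ M})
    ⟨han₁, o₀, hoU, ho, hao, hn₁, hoc⟩ ⟨han₃, hn₃M⟩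
  have hPU := hP'.trans hP
  have haP : a ∉ P' := fun h' => (hPU h').2 (by simp)
  have hxy : x ≠ y := by rintro rfl; exact hy.2 hx.2
  have hcyc : Cyc G (insert a P') := by
    refine ⟨a, x, y, P', rfl, haP, hpath', hxy, fun z hz => ⟨fun haz => ?_, ?_⟩⟩
    · by_cases hzM : z ∈ M
      exacts [.inl (hxu z hz ⟨haz, hzM⟩), .inr (hyu z hz ⟨haz, hzM⟩)]
    · rintro (rfl | rfl)
      exacts [hx.1, hy.1]
  have hcU : insert a P' ⊆ U := by
    rintro z (rfl | hz)
    exacts [ha, (hPU hz).1]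
  obtain ⟨o, k1, k2, k3, k4, k5⟩ := hx.2
  refine hy.2 ⟨_, hcU, hcyc, .inl rfl, .inr hpath'.right_mem, ?_⟩
  rw [← k5]
  exact hconst x (hcU (.inr hpath'.left_mem)) hx.1 _ hcU hcyc (.inl rfl) (.inr hpath'.left_mem) o k1
    k2 k3 k4

open Classical in
/-- A graph that cannot be coloured with `k` colours contains at least `(k + 1).choose 4` solids. -/
theorem choose_le_ncard_sol (hB : B.Finite) (h : ¬ ColBy G B C) :
    (C.card + 1).choose 4 ≤ {s | Sol G s ∧ s ⊆ B}.ncard := by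
  induction C using Finset.induction_on generalizing B with
  | empty => simp [Nat.choose]
  | insert c C hc ih =>
    obtain ⟨U, hU, hUC⟩ := exists_critical hB h
    obtain ⟨a, ha⟩ : U.Nonempty := by
      by_contra hne
      rw [Set.not_nonempty_iff_eq_empty] at hne
      exact hUC.1 ⟨fun _ => 0, by simp [hne, Proper]⟩
    have hUfin := hB.subset hU
    have hUa : U \ {a} ⊂ U := ⟨Set.sdiff_subset, fun h' => (h' ha).2 rfl⟩
    obtain ⟨f, hf⟩ := hUC.2 _ hUa
    have h1 : ¬ ColBy G (U \ {a}) C := by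
      rintro ⟨g, hg⟩
      refine hUC.1 ⟨_, Proper.extend (a := a) (f := g)
        ⟨fun v hv => Finset.mem_insert_of_mem (hg.1 v hv), hg.2⟩ (Finset.mem_insert_self c C) ?_⟩
      intro n hn han hgn
      exact hc (hgn ▸ hg.1 n ⟨hn, han.ne'⟩)
    have h2 := ih (hUfin.subset Set.sdiff_subset) h1
    have h3 : ∀ D ∈ (insert c C).powersetCard 3, ∃ s ⊆ U, Sol G s ∧ a ∈ s ∧ f '' (s \ {a}) = D := by
      intro D hD
      obtain ⟨hDC, hD⟩ := Finset.mem_powersetCard.1 hD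
      set S : Set V := {v | v ∈ U ∧ (v = a ∨ f v ∈ D)} with hS
      have hSU : S ⊆ U := fun v hv => hv.1
      -- A colouring of `S` by `D` together with `f` on the other colour classes would colour all of
      -- `U`.
      have hSD : ¬ ColBy G S D := by
        rintro ⟨g, hg⟩
        have hcross : ∀ u ∈ S, ∀ v ∈ U, v ∉ S → g u ≠ f v := fun u hu v hv hvS h' =>
          hvS ⟨hv, .inr (h' ▸ hg.1 u hu)⟩
        have hout : ∀ v ∈ U, v ∉ S → v ∈ U \ {a} := fun v hv hvS => ⟨hv, fun h' => hvS ⟨hv, .inl h'⟩⟩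
        refine hUC.1 ⟨fun z => if z ∈ S then g z else f z, fun v hv => ?_, fun u hu v hv huv => ?_⟩
        · dsimp only
          split_ifs with hvS
          exacts [hDC (hg.1 v hvS), hf.1 v (hout v hv hvS)]
        · dsimp only
          split_ifs with huS hvS hvS
          · exact hg.2 u huS v hvS huv
          · exact hcross u huS v hv hvS
          · exact (hcross v hvS u hu huS).symm
          · exact hf.2 u (hout u hu huS) v (hout v hv hvS) huv
      have hfS : Proper G (S \ {a}) D f :=
        ⟨fun v hv => hv.1.2.resolve_left hv.2, fun u hu v hv =>
          hf.2 u ⟨hSU hu.1, hu.2⟩ v ⟨hSU hv.1, hv.2⟩⟩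
      obtain ⟨T, hT, hTD⟩ := exists_critical (hUfin.subset hSU) hSD
      have haT : a ∈ T := by
        by_contra haT
        exact hTD.1 ⟨f, hfS.mono fun z hz => ⟨hT hz, by rintro rfl; exact haT hz⟩⟩
      obtain ⟨s, hs, h'⟩ := hTD.exists_sol (hUfin.subset (hT.trans hSU)) hD haT
        (hfS.mono (Set.sdiff_subset_sdiff_left hT))
      exact ⟨s, hs.trans (hT.trans hSU), h'⟩
    choose! s hsU hs has hsf using h3
    have hfinB : {s | Sol G s ∧ s ⊆ B}.Finite := hB.finite_subsets.subset fun s hs => hs.2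
    -- The triple can be recovered from the solid as its set of colours. These solids contain `a`,
    -- so they differ from those found by induction, and Pascal's rule adds up both counts.
    have hinj : Set.InjOn s ((insert c C).powersetCard 3 : Finset (Finset ℕ)) := by
      intro D hD D' hD' heq
      have := (hsf D hD).symm.trans ((congrArg (fun s => f '' (s \ {a})) heq).trans (hsf D' hD'))
      exact_mod_cast this
    have hdisj : Disjoint {s | Sol G s ∧ s ⊆ U \ {a}}
        (s '' ((insert c C).powersetCard 3 : Finset (Finset ℕ))) := by
      rw [Set.disjoint_left]
      rintro _ ⟨-, h'⟩ ⟨D, hD, rfl⟩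
      exact (h' (has D hD)).2 rfl
    have hsub : {s | Sol G s ∧ s ⊆ U \ {a}} ∪ s '' ((insert c C).powersetCard 3 : Finset (Finset ℕ))
        ⊆ {s | Sol G s ∧ s ⊆ B} := by
      rintro t (⟨h4, h5⟩ | ⟨D, hD, rfl⟩)
      · exact ⟨h4, h5.trans (Set.sdiff_subset.trans hU)⟩
      · exact ⟨hs D hD, (hsU D hD).trans hU⟩
    have hcard := Set.ncard_le_ncard hsub hfinB
    rw [Set.ncard_union_eq hdisj (hfinB.subset (Set.subset_union_left.trans hsub))
      (hfinB.subset (Set.subset_union_right.trans hsub)), hinj.ncard_image,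
      Set.ncard_coe_finset, Finset.card_powersetCard, Finset.card_insert_of_notMem hc] at hcard
    have h4 : (C.card + 1 + 1).choose 4 = (C.card + 1).choose 3 + (C.card + 1).choose 4 :=
      Nat.choose_succ_succ _ _
    rw [Finset.card_insert_of_notMem hc, h4]
    omega

end

/-! ### Weights inside a closed neighbourhood and in a clique -/

section

variable {V : Type u} {G : SimpleGraph V} {T s : Set V} {w x y : V}

theorem eq_empty_or_singleton_or_pair_or_three (T : Set V) :
    T = ∅ ∨ (∃ x, T = {x}) ∨ (∃ x y, x ≠ y ∧ T = {x, y}) ∨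
    ∃ x ∈ T, ∃ y ∈ T, ∃ z ∈ T, x ≠ y ∧ x ≠ z ∧ y ≠ z := by
  rcases T.eq_empty_or_nonempty with h | ⟨x, hx⟩
  · exact .inl h
  by_cases hy : ∃ y ∈ T, x ≠ y
  · obtain ⟨y, hy, hxy⟩ := hy
    by_cases hz : ∃ z ∈ T, x ≠ z ∧ y ≠ z
    · obtain ⟨z, hz, hxz, hyz⟩ := hz
      exact .inr (.inr (.inr ⟨x, hx, y, hy, z, hz, hxy, hxz, hyz⟩))
    · push Not at hz
      refine .inr (.inr (.inl ⟨x, y, hxy, Set.Subset.antisymm (fun z hz' => ?_) ?_⟩))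
      · by_cases h : x = z
        exacts [.inl h.symm, .inr (hz z hz' h).symm]
      · rintro z (rfl | rfl)
        exacts [hx, hy]
  · push Not at hy
    refine .inr (.inl ⟨x, Set.Subset.antisymm (fun z hz => (hy z hz).symm) ?_⟩)
    rintro z rfl
    exact hx

open Classical in
/-- The contributions of a set of neighbours of `w` and of this set together with `w`. -/
theorem le_contrib_add_contrib_insert (hT : ∀ t ∈ T, G.Adj w t) :
    (if Sol G T then 1 else 0 : ℤ) - (if T = ∅ then 1 else 0) ≤ contrib G T + contrib G (insert w T) := by
  have hw : w ∉ T := fun h => (hT w h).ne rfl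
  have hsmall : ∀ {x y}, T ⊆ {x, y} → ¬ Sol G T := by
    intro x y hxy hs
    obtain ⟨p, hp, q, hq, r, hr, h1, h2, h3⟩ := hs.exists_three
    have := hxy hp
    have := hxy hq
    have := hxy hr
    grind
  rcases eq_empty_or_singleton_or_pair_or_three T with rfl | ⟨x, rfl⟩ | ⟨x, y, hxy, rfl⟩ |
    ⟨x, hx, y, hy, z, hz, hxy, hxz, hyz⟩
  · rw [if_neg (hsmall (x := w) (y := w) (by simp)), if_pos rfl, contrib_empty,
      show insert w (∅ : Set V) = {w} by ext; simp, contrib_singleton]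
    simp
  · rw [if_neg (hsmall (x := x) (y := x) (by simp)), if_neg (by simp), contrib_singleton,
      contrib_pair (hT x rfl)]
    simp
  · have hwx := hT x (.inl rfl)
    have hwy := hT y (.inr rfl)
    rw [if_neg (hsmall le_rfl), if_neg (Set.insert_nonempty x {y}).ne_empty]
    have h3 := contrib_cases (G := G) (s := {w, x, y}) (x := w) (y := x) (z := y) (by simp) (by simp)
      (by simp) hwx.ne hwy.ne hxy
    by_cases hadj : G.Adj x y
    · rw [contrib_pair hadj]
      omega
    · have h4 : ¬ Cyc G {w, x, y} := by
        intro hc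
        obtain ⟨p, hp, q, hq, hpq, hxp, hxq, -⟩ := hc.exists_adj (x := x) (by simp)
        have key : ∀ z ∈ ({w, x, y} : Set V), G.Adj x z → z = w := by
          rintro z (rfl | rfl | rfl) hxz
          exacts [rfl, absurd hxz (by simp), absurd hxz hadj]
        exact hpq ((key p hp hxp).trans (key q hq hxq).symm)
      rw [contrib_pair_of_not_adj hxy hadj]
      rcases h3 with h3 | h3 | h3
      · omega
      · exact absurd h3.1 h4
      · omega
  · have h1 := contrib_cases (G := G) hx hy hz hxy hxz hyz
    have h2 := contrib_cases (G := G) (s := insert w T) (.inr hx) (.inr hy) (.inr hz) hxy hxz hyz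
    -- Three neighbours of `w` exclude a cycle on `insert w T`, and they make it a solid when `T` is
    -- a cycle; the negative weight of `T` is thus compensated.
    have h3 : ¬ Cyc G (insert w T) := fun hc => by
      have := hc.eq_of_adj (.inl rfl) (.inr hx) (.inr hy) (.inr hz) (hT x hx) (hT y hy) (hT z hz)
      tauto
    have h4 : Cyc G T → Sol G (insert w T) := fun hc => hc.sol_insert hw
      (.of_three (x := x) (y := y) (z := z) ⟨hx, hT x hx⟩ ⟨hy, hT y hy⟩ ⟨hz, hT z hz⟩ hxy hxz hyz)
    rw [if_neg (show T ≠ ∅ by rintro rfl; exact hx)]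
    split_ifs with hs
    · rcases h1 with h1 | h1 | h1
      · rcases h2 with h2 | h2 | h2
        · omega
        · exact absurd h2.1 h3
        · omega
      · exact absurd hs h1.2.1
      · exact absurd hs h1.1
    · rcases h1 with h1 | h1 | h1
      · exact absurd h1.1 hs
      · rcases h2 with h2 | h2 | h2
        · omega
        · exact absurd h2.1 h3
        · exact absurd (h4 h1.1) h2.1
      · rcases h2 with h2 | h2 | h2
        · omega
        · exact absurd h2.1 h3
        · omega

open Classical in
/-- The contributions of the sets in the closed neighbourhood of `w`. -/
theorem ncard_sol_le_sum_contrib {N : Finset V} (hN : ∀ t ∈ N, G.Adj w t) :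
    ({s | Sol G s ∧ s ⊆ N}.ncard : ℤ) - 1 ≤ ∑ s ∈ (insert w N).powerset, contrib G (s : Set V) := by
  have hw : w ∉ N := fun h => (hN w h).ne rfl
  rw [Finset.sum_powerset_insert hw, ← Finset.sum_add_distrib]
  have h1 : ({s | Sol G s ∧ s ⊆ (N : Set V)}.ncard : ℤ) =
      ∑ s ∈ N.powerset, if Sol G (s : Set V) then 1 else 0 := by
    rw [Finset.sum_boole, ← Set.ncard_coe_finset]
    congr 1
    rw [← Set.ncard_image_of_injective _ (Finset.coe_injective (α := V))]
    congr 1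
    ext s
    simp only [Set.mem_ofPred_eq, Set.mem_image, Finset.coe_filter, Finset.mem_powerset]
    constructor
    · rintro ⟨h1, h2⟩
      obtain ⟨t, rfl⟩ := (N.finite_toSet.subset h2).exists_finset_coe
      exact ⟨t, ⟨by exact_mod_cast h2, h1⟩, rfl⟩
    · rintro ⟨t, ⟨h1, h2⟩, rfl⟩
      exact ⟨h2, by exact_mod_cast h1⟩
  have h2 : (1 : ℤ) = ∑ s ∈ N.powerset, if (s : Set V) = ∅ then 1 else 0 := by
    simp
  rw [h1]
  nth_rewrite 2 [h2]
  rw [← Finset.sum_sub_distrib]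
  refine Finset.sum_le_sum fun s hs => ?_
  rw [Finset.coe_insert]
  exact le_contrib_add_contrib_insert fun t ht => hN t (Finset.mem_powerset.1 hs ht)

/-- The contribution of a clique with `k` vertices. -/
def cliqueContrib (k : ℕ) : ℤ :=
  if k = 1 then -1 else if k = 2 then 1 else if k = 3 then -1 else if k = 4 then 1 else 0

theorem contrib_clique {K : Finset V} (hK : ∀ x ∈ K, ∀ y ∈ K, x ≠ y → G.Adj x y) :
    contrib G (K : Set V) = cliqueContrib K.card := by
  classical
  rcases Nat.lt_or_ge K.card 5 with h | h
  · interval_cases hc : K.card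
    · rw [Finset.card_eq_zero.1 hc, Finset.coe_empty, contrib_empty]
      rfl
    · obtain ⟨x, rfl⟩ := Finset.card_eq_one.1 hc
      rw [Finset.coe_singleton, contrib_singleton]
      rfl
    · obtain ⟨x, y, hxy, rfl⟩ := Finset.card_eq_two.1 hc
      rw [Finset.coe_pair, contrib_pair (hK _ (by simp) _ (by simp) hxy)]
      rfl
    · obtain ⟨x, y, z, hxy, hxz, hyz, rfl⟩ := Finset.card_eq_three.1 hc
      rw [contrib_of_cyc]
      · rfl
      · push_cast
        exact .of_triangle (hK _ (by simp) _ (by simp) hxy) (hK _ (by simp) _ (by simp) hxz)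
          (hK _ (by simp) _ (by simp) hyz)
    · obtain ⟨w, x, y, z, hwx, hwy, hwz, hxy, hxz, hyz, rfl⟩ := Finset.card_eq_four.1 hc
      rw [contrib_of_sol]
      · rfl
      · push_cast
        have h1 := hK w (by simp) x (by simp) hwx
        have h2 := hK w (by simp) y (by simp) hwy
        have h3 := hK w (by simp) z (by simp) hwz
        refine (Cyc.of_triangle (hK x (by simp) y (by simp) hxy) (hK x (by simp) z (by simp) hxz)
          (hK y (by simp) z (by simp) hyz)).sol_insert ?_
          (.of_three (x := x) (y := y) (z := z) ⟨by simp, h1⟩ ⟨by simp, h2⟩ ⟨by simp, h3⟩ hxy hxz hyz)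
        simp [hwx, hwy, hwz]
  · obtain ⟨L, hL, hLc⟩ := Finset.exists_subset_card_eq (s := K) (n := 4) (by omega)
    obtain ⟨w, x, y, z, hwx, hwy, hwz, hxy, hxz, hyz, rfl⟩ := Finset.card_eq_four.1 hLc
    have mw : w ∈ K := hL (by simp)
    have mx : x ∈ K := hL (by simp)
    have my : y ∈ K := hL (by simp)
    have mz : z ∈ K := hL (by simp)
    have hxy' := hK x mx y my hxy
    have hxz' := hK x mx z mz hxz
    have hyz' := hK y my z mz hyz
    rw [contrib_eq_zero (x := x) (y := y) (z := z) mx my mz hxy hxz hyz]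
    · unfold cliqueContrib
      rw [if_neg (by omega), if_neg (by omega), if_neg (by omega), if_neg (by omega)]
    · intro hs
      have h1 := hs.eq_of_four mw mx my mz (hK w mw x mx hwx) (hK w mw y my hwy) (hK w mw z mz hwz)
        hxy' hxz' hyz'
      have h2 : K = {w, x, y, z} := by
        apply Finset.coe_injective
        rw [h1]
        push_cast
        rfl
      rw [h2, hLc] at h
      omega
    · intro hc
      have h1 := hc.eq_triangle mx my mz hxy' hxz' hyz'
      have h2 : w ∈ ({x, y, z} : Set V) := h1 ▸ mw
      simp [hwx, hwy, hwz] at h2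

/-- In a clique the weight of a set depends only on its size: only the sizes 1 to 4 count, as
vertices, edges, triangles and complete graphs on four vertices. -/
theorem sum_contrib_clique {K : Finset V} (hK : ∀ x ∈ K, ∀ y ∈ K, x ≠ y → G.Adj x y) :
    ∑ s ∈ K.powerset, contrib G (s : Set V) =
      (K.card.choose 4 : ℤ) - K.card.choose 3 + K.card.choose 2 - K.card := by
  rw [Finset.sum_congr rfl fun s hs => contrib_clique fun x hx y hy =>
    hK x (Finset.mem_powerset.1 hs hx) y (Finset.mem_powerset.1 hs hy),
    Finset.sum_powerset_apply_card cliqueContrib]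
  generalize K.card = n
  have h1 : ∑ k ∈ Finset.range (n + 1), n.choose k • cliqueContrib k =
      ∑ k ∈ Finset.range (n + 5), n.choose k • cliqueContrib k := by
    refine Finset.sum_subset (Finset.range_subset_range.2 (by omega)) fun k _ hk => ?_
    rw [Nat.choose_eq_zero_of_lt (by simpa using hk), zero_smul]
  have h2 : ∑ k ∈ Finset.range 5, n.choose k • cliqueContrib k =
      ∑ k ∈ Finset.range (n + 5), n.choose k • cliqueContrib k := by
    refine Finset.sum_subset (Finset.range_subset_range.2 (by omega)) fun k _ hk => ?_
    have hk : 5 ≤ k := by simpa using hk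
    unfold cliqueContrib
    rw [if_neg (by omega), if_neg (by omega), if_neg (by omega), if_neg (by omega), smul_zero]
  rw [h1, ← h2]
  simp [Finset.sum_range_succ, cliqueContrib]
  ring

/-- The alternating sum telescopes by Pascal's rule. In this form the value is monotone in `m` and
can be compared with a number of solids. -/
theorem choose_alternating (m : ℕ) : ((m + 1).choose 4 : ℤ) - (m + 1).choose 3 + (m + 1).choose 2 -
    (m + 1 : ℕ) = m.choose 4 - 1 := by
  have h4 : (m + 1).choose 4 = m.choose 3 + m.choose 4 := Nat.choose_succ_succ _ _
  have h3 : (m + 1).choose 3 = m.choose 2 + m.choose 3 := Nat.choose_succ_succ _ _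
  have h2 : (m + 1).choose 2 = m.choose 1 + m.choose 2 := Nat.choose_succ_succ _ _
  rw [h4, h3, h2, Nat.choose_one_right]
  push_cast
  ring

theorem beth3_eq_sum_finset [Fintype V] : beth3 G = ∑ s : Finset V, contrib G (s : Set V) := by
  classical
  rw [beth3_eq_sum]
  exact (Fintype.sum_bijective (fun s : Finset V => (s : Set V))
    ⟨Finset.coe_injective, fun s => ⟨s.toFinset, by simp⟩⟩ _ _ fun _ => rfl).symm

theorem beth3_of_complete [Fintype V] (h : ∀ x y, x ≠ y → G.Adj x y) :
    beth3 G = ((Fintype.card V).choose 4 : ℤ) - (Fintype.card V).choose 3 +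
      (Fintype.card V).choose 2 - Fintype.card V := by
  rw [beth3_eq_sum_finset, ← Finset.powerset_univ, sum_contrib_clique fun x _ y _ => h x y,
    Finset.card_univ]

end

/-! ### Foldings and the effect of a vertex compression -/

section

variable {V : Type u} {W : Type v} {G : SimpleGraph V} {G' : SimpleGraph W} {A : Set V} {π : V → W}
  {w : V}

/-- `G'` is the image of `G` under the map `π`, which identifies only nonadjacent vertices of `A`. -/
structure IsFolding (G : SimpleGraph V) (G' : SimpleGraph W) (A : Set V) (π : V → W) : Prop where
  surj : Function.Surjective π
  fiber : ∀ x y, π x = π y → x ≠ y → x ∈ A ∧ y ∈ A ∧ ¬ G.Adj x y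
  adj_iff : ∀ p q, G'.Adj p q ↔ ∃ x y, π x = p ∧ π y = q ∧ G.Adj x y

/-- The maps of the single contractions are composed. Edges are never collapsed, because each step
merges two nonadjacent vertices and adjacency persists in the quotient. -/
theorem FoldsTo.exists_isFolding {A' : Set W} (h : FoldsTo G' A' G A) :
    ∃ π, IsFolding G G' A π ∧ π '' A = A' := by
  classical
  induction h with
  | of_iso G A e h =>
    refine ⟨e, ⟨e.surjective, fun x y hxy hne => absurd (e.injective hxy) hne, fun p q => ?_⟩, h⟩
    constructor
    · intro hpq
      exact ⟨e.symm p, e.symm q, by simp, by simp, e.symm.map_adj_iff.2 hpq⟩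
    · rintro ⟨x, y, rfl, rfl, hxy⟩
      exact e.map_adj_iff.2 hxy
  | contract G A a b ha hb hne hab h ih =>
    obtain ⟨π, hπ, hA⟩ := ih
    set ρ : _ → {z // z ≠ b} := fun z => if hz : z = b then ⟨a, hne⟩ else ⟨z, hz⟩ with hρ
    have ρb : ρ b = ⟨a, hne⟩ := by simp [hρ]
    have ρz : ∀ z, (hz : z ≠ b) → ρ z = ⟨z, hz⟩ := fun z hz => by simp [hρ, hz]
    have ρA : ∀ z, (ρ z).1 ∈ A ↔ z ∈ A := fun z => by
      by_cases hz : z = b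
      · subst hz; simp [ρb, ha, hb]
      · rw [ρz z hz]
    have ρne : ∀ x y, ρ x = ρ y → x ≠ y → x ∈ A ∧ y ∈ A ∧ ¬ G.Adj x y := by
      intro x y hxy hxy'
      by_cases hx : x = b
      · subst hx
        rw [ρb, ρz y hxy'.symm, Subtype.mk.injEq] at hxy
        subst hxy
        exact ⟨hb, ha, fun h => hab h.symm⟩
      · by_cases hy : y = b
        · subst hy
          rw [ρb, ρz x hx, Subtype.mk.injEq] at hxy
          subst hxy
          exact ⟨ha, hb, hab⟩
        · rw [ρz x hx, ρz y hy, Subtype.mk.injEq] at hxy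
          exact absurd hxy hxy'
    have ρadj : ∀ p q, (nonedgeContraction G a b).Adj p q ↔ ∃ x y, ρ x = p ∧ ρ y = q ∧ G.Adj x y := by
      intro p q
      constructor
      · rintro ⟨-, h | ⟨h, h'⟩ | ⟨h, h'⟩⟩
        · exact ⟨p, q, ρz _ p.2, ρz _ q.2, h⟩
        · exact ⟨b, q, ρb.trans (Subtype.ext h.symm), ρz _ q.2, h'⟩
        · exact ⟨p, b, ρz _ p.2, ρb.trans (Subtype.ext h.symm), h'.symm⟩
      · rintro ⟨x, y, rfl, rfl, hxy⟩
        refine ⟨fun h => (ρne x y h hxy.ne).2.2 hxy, ?_⟩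
        by_cases hx : x = b
        · subst hx
          rw [ρb, ρz y hxy.ne']
          exact .inr (.inl ⟨rfl, hxy⟩)
        · by_cases hy : y = b
          · subst hy
            rw [ρb, ρz x hx]
            exact .inr (.inr ⟨rfl, hxy.symm⟩)
          · rw [ρz x hx, ρz y hy]
            exact .inl hxy
    refine ⟨π ∘ ρ, ⟨?_, ?_, ?_⟩, ?_⟩
    · exact hπ.surj.comp fun z => ⟨z.1, ρz _ z.2⟩
    · intro x y hxy hxy'
      by_cases hxy'' : ρ x = ρ y
      · exact ρne x y hxy'' hxy'
      · obtain ⟨h1, h2, h3⟩ := hπ.fiber _ _ hxy hxy''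
        refine ⟨(ρA x).1 h1, (ρA y).1 h2, fun h => h3 ((ρadj _ _).2 ⟨x, y, rfl, rfl, h⟩)⟩
    · intro p q
      rw [hπ.adj_iff]
      constructor
      · rintro ⟨x, y, rfl, rfl, hxy⟩
        obtain ⟨x', y', rfl, rfl, h'⟩ := (ρadj _ _).1 hxy
        exact ⟨x', y', rfl, rfl, h'⟩
      · rintro ⟨x, y, rfl, rfl, hxy⟩
        exact ⟨_, _, rfl, rfl, (ρadj _ _).2 ⟨x, y, rfl, rfl, hxy⟩⟩
    · rw [← hA]
      ext p
      constructor
      · rintro ⟨x, hx, rfl⟩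
        exact ⟨ρ x, (ρA x).2 hx, rfl⟩
      · rintro ⟨x, hx, rfl⟩
        exact ⟨x.1, hx, by simp [ρz _ x.2]⟩

namespace IsFolding

/-- All other vertices of `A` are adjacent to `w`, so `w` is never identified with another vertex.
-/
theorem eq_center {A : Finset V} (h : IsFolding G G' A π) (hA : ∀ x, x ∈ A ↔ x = w ∨ G.Adj w x) {x : V}
    (hx : π x = π w) : x = w := by
  by_contra hne
  obtain ⟨h1, -, h3⟩ := h.fiber _ _ hx hne
  exact h3 (((hA x).1 h1).resolve_left hne).symm

variable {A : Finset V}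

-- Identified vertices are neighbours of `w` and hence adjacent in the filled graph, so the nonedge
-- contractions turn into edge contractions. The filled edges do no harm in the image, since `A`
-- becomes a clique there by `hK`.
open Classical in
theorem sum_image_le [Fintype V] [Fintype W] (h : IsFolding G G' A π) (hA : ∀ x, x ∈ A ↔ x = w ∨ G.Adj w x)
    (hK : ∀ x ∈ A, ∀ y ∈ A, π x ≠ π y → G'.Adj (π x) (π y)) :
    ∑ s ∈ (Finset.univ.erase (π w)).powerset, contribOn G' ((Finset.univ \ A).image π) s ≤
      ∑ s ∈ (Finset.univ.erase w).powerset,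
        contribOn (fill G (G.neighborSet w)) (Finset.univ \ A) s := by
  have hU : (Finset.univ.erase w).image π = Finset.univ.erase (π w) := by
    ext p
    simp only [Finset.mem_image, Finset.mem_erase, Finset.mem_univ, and_true]
    constructor
    · rintro ⟨x, hx, rfl⟩ hxw
      exact hx (h.eq_center hA hxw)
    · intro hp
      obtain ⟨x, rfl⟩ := h.surj p
      exact ⟨x, by rintro rfl; exact hp rfl, rfl⟩
  have hN : ∀ x ∈ A, x ≠ w → x ∈ G.neighborSet w := fun x hx hxw => ((hA x).1 hx).resolve_left hxw
  rw [← hU]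
  refine sum_contribOn_image G' π _ _ ?_ ?_ ?_
  · intro x hx
    simp only [Finset.mem_sdiff, Finset.mem_univ, true_and, Finset.mem_erase, and_true] at hx ⊢
    rintro rfl
    exact hx ((hA _).2 (.inl rfl))
  · intro a ha b hb hab hne
    obtain ⟨h1, h2, -⟩ := h.fiber _ _ hab hne
    have h1 : a ∈ A := h1
    have h2 : b ∈ A := h2
    refine ⟨⟨hne, .inr ⟨hN a h1 (Finset.ne_of_mem_erase ha), hN b h2 (Finset.ne_of_mem_erase hb)⟩⟩,
      ?_, ?_⟩ <;> simp [h1, h2]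
  · intro a ha b hb hab
    rw [h.adj_iff]
    constructor
    · rintro ⟨x, y, hx, hy, hxy⟩
      refine ⟨x, ?_, y, ?_, hx, hy, fill_adj_of_adj hxy⟩
      · rw [Finset.mem_erase]
        refine ⟨?_, Finset.mem_univ _⟩
        rintro rfl
        exact Finset.ne_of_mem_erase ha (h.eq_center hA hx.symm)
      · rw [Finset.mem_erase]
        refine ⟨?_, Finset.mem_univ _⟩
        rintro rfl
        exact Finset.ne_of_mem_erase hb (h.eq_center hA hy.symm)
    · rintro ⟨x, -, y, -, hx, hy, hxy, h' | ⟨h1, h2⟩⟩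
      · exact ⟨x, y, hx, hy, h'⟩
      · rw [← h.adj_iff, ← hx, ← hy]
        refine hK x ((hA x).2 (.inr h1)) y ((hA y).2 (.inr h2)) ?_
        rwa [hx, hy]

-- The neighbours of `π w` form a clique and `r` is not among them. A solid would have to contain
-- three of these neighbours, hence be a complete graph on four vertices without `r`.
open Classical in
theorem contrib_center_nonpos (h : IsFolding G G' A π) (hA : ∀ x, x ∈ A ↔ x = w ∨ G.Adj w x)
    (hK : ∀ x ∈ A, ∀ y ∈ A, π x ≠ π y → G'.Adj (π x) (π y)) {s : Set W} (hw : π w ∈ s)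
    {r : W} (hr : r ∈ s) (hrA : ∀ x ∈ A, π x ≠ r) : contrib G' s ≤ 0 := by
  have hN : ∀ p, G'.Adj (π w) p → ∃ x ∈ A, π x = p := by
    intro p hp
    obtain ⟨x, y, hx, rfl, hxy⟩ := (h.adj_iff _ _).1 hp
    obtain rfl := h.eq_center hA hx
    exact ⟨y, (hA y).2 (.inr hxy), rfl⟩
  have hwA : w ∈ A := (hA w).2 (.inl rfl)
  have hwr : ¬ G'.Adj (π w) r := fun h' => by
    obtain ⟨x, hx, hxr⟩ := hN r h'
    exact hrA x hx hxr
  have hne : π w ≠ r := hrA w hwA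
  have hcl : ∀ p q, G'.Adj (π w) p → G'.Adj (π w) q → p ≠ q → G'.Adj p q := by
    intro p q hp hq hpq
    obtain ⟨x, hx, rfl⟩ := hN p hp
    obtain ⟨y, hy, rfl⟩ := hN q hq
    exact hK x hx y hy hpq
  have hsol : ¬ Sol G' s := by
    intro hs
    rcases hs.wide_Nb hw with ⟨p, hp, q, hq, hpq, hpq'⟩ | ⟨p, hp, q, hq, t, ht, h1, h2, h3⟩
    · exact hpq' (hcl p q hp.2 hq.2 hpq)
    · have hs4 := hs.eq_of_four hw hp.1 hq.1 ht.1 hp.2 hq.2 ht.2 (hcl p q hp.2 hq.2 h1)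
        (hcl p t hp.2 ht.2 h2) (hcl q t hq.2 ht.2 h3)
      rw [hs4] at hr
      rcases hr with rfl | rfl | rfl | rfl
      exacts [hne rfl, hwr hp.2, hwr hq.2, hwr ht.2]
  by_cases ht : ∃ t ∈ s, π w ≠ t ∧ r ≠ t
  · obtain ⟨t, ht, h1, h2⟩ := ht
    exact contrib_nonpos hw hr ht hne h1 h2 hsol
  · push Not at ht
    have hs : s = {π w, r} := by
      refine Set.Subset.antisymm (fun t ht' => ?_) ?_
      · by_cases h' : π w = t
        exacts [.inl h'.symm, .inr (ht t ht' h').symm]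
      · rintro t (rfl | rfl)
        exacts [hw, hr]
    rw [hs, contrib_pair_of_not_adj hne hwr]

open Classical in
/-- The sets that are not contained in the closed neighbourhood of `w`. -/
theorem sum_outside_le [Fintype V] [Fintype W] (h : IsFolding G G' A π) (hA : ∀ x, x ∈ A ↔ x = w ∨ G.Adj w x)
    (hK : ∀ x ∈ A, ∀ y ∈ A, π x ≠ π y → G'.Adj (π x) (π y)) :
    ∑ s : Finset W, contribOn G' ((Finset.univ \ A).image π) s ≤
      ∑ s : Finset V, contribOn G (Finset.univ \ A) s := by
  have hwA : w ∈ A := (hA w).2 (.inl rfl)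
  rw [← Finset.powerset_univ, ← Finset.powerset_univ, ← Finset.insert_erase (Finset.mem_univ (π w)),
    ← Finset.insert_erase (Finset.mem_univ w), Finset.sum_powerset_insert (by simp),
    Finset.sum_powerset_insert (by simp), Finset.insert_erase (Finset.mem_univ w)]
  have h1 : ∑ s ∈ (Finset.univ.erase (π w)).powerset,
      contribOn G' ((Finset.univ \ A).image π) (insert (π w) s) ≤ 0 := by
    refine Finset.sum_nonpos fun s _ => ?_
    unfold contribOn
    split_ifs with hr
    · obtain ⟨r, hr, hrs⟩ := hr
      obtain ⟨x, hx, rfl⟩ := Finset.mem_image.1 hr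
      have hxA : x ∉ A := (Finset.mem_sdiff.1 hx).2
      refine h.contrib_center_nonpos hA hK (s := ((insert (π w) s : Finset W) : Set W))
        (by simp) (r := π x) (by exact_mod_cast hrs) fun y hy hyx => ?_
      exact hxA (h.fiber _ _ hyx (by rintro rfl; exact hxA hy)).2.1
    · exact le_rfl
  have h2 : ∑ s ∈ (Finset.univ.erase w).powerset,
        contribOn (fill G (G.neighborSet w)) (Finset.univ \ A) s ≤
      ∑ s ∈ (Finset.univ.erase w).powerset, contribOn G (Finset.univ \ A) s +
      ∑ s ∈ (Finset.univ.erase w).powerset, contribOn G (Finset.univ \ A) (insert w s) := by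
    rw [← Finset.sum_add_distrib]
    refine Finset.sum_le_sum fun s hs => ?_
    have hws : w ∉ s := fun h' => Finset.notMem_erase w _ (Finset.mem_powerset.1 hs h')
    have hiff : (∃ r ∈ Finset.univ \ A, r ∈ insert w s) ↔ ∃ r ∈ Finset.univ \ A, r ∈ s := by
      constructor
      · rintro ⟨r, hr, hrs⟩
        refine ⟨r, hr, (Finset.mem_insert.1 hrs).resolve_left ?_⟩
        rintro rfl
        exact (Finset.mem_sdiff.1 hr).2 hwA
      · rintro ⟨r, hr, hrs⟩
        exact ⟨r, hr, Finset.mem_insert_of_mem hrs⟩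
    unfold contribOn
    rw [if_congr hiff rfl rfl]
    split_ifs with hr
    · obtain ⟨r, hr, hrs⟩ := hr
      rw [Finset.coe_insert]
      exact contrib_fill_le (by exact_mod_cast hws) (t := r) (by exact_mod_cast hrs) fun h' =>
        (Finset.mem_sdiff.1 hr).2 ((hA r).2 (.inr h'))
    · simp
  have h3 := h.sum_image_le hA hK
  linarith

theorem sum_eq_add [Fintype V] [DecidableEq V] (G : SimpleGraph V) (A : Finset V) :
    ∑ s : Finset V, contrib G (s : Set V) =
      ∑ s ∈ A.powerset, contrib G (s : Set V) + ∑ s : Finset V, contribOn G (Finset.univ \ A) s := by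
  classical
  have h1 : ∑ s ∈ A.powerset, contrib G (s : Set V) =
      ∑ s : Finset V, if s ⊆ A then contrib G (s : Set V) else 0 := by
    rw [← Finset.sum_filter]
    refine Finset.sum_congr ?_ fun _ _ => rfl
    ext s
    simp
  rw [h1, ← Finset.sum_add_distrib]
  refine Finset.sum_congr rfl fun s _ => ?_
  unfold contribOn
  by_cases hs : s ⊆ A
  · rw [if_pos hs, if_neg, add_zero]
    rintro ⟨r, hr, hrs⟩
    exact (Finset.mem_sdiff.1 hr).2 (hs hrs)
  · rw [if_neg hs, if_pos, zero_add]
    obtain ⟨r, hr, hrA⟩ := Finset.not_subset.1 hs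
    exact ⟨r, by simp [hrA], hr⟩

-- The clique contributes `m.choose 4 - 1`, where `m + 1` is its size, and in `G` the sets inside
-- `A` contribute at least the number of solids among the neighbours of `w`, minus 1.
open Classical in
theorem sum_inside_le (hA : ∀ x, x ∈ A ↔ x = w ∨ G.Adj w x)
    (hK : ∀ x ∈ A, ∀ y ∈ A, π x ≠ π y → G'.Adj (π x) (π y))
    (hχ : ∀ C : Finset ℕ, ColBy G (A : Set V) C → (A.image π).card ≤ C.card) :
    ∑ s ∈ (A.image π).powerset, contrib G' (s : Set W) ≤ ∑ s ∈ A.powerset, contrib G (s : Set V) := by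
  have hwA : w ∈ A := (hA w).2 (.inl rfl)
  rw [sum_contrib_clique fun p hp q hq hpq => by
    obtain ⟨x, hx, rfl⟩ := Finset.mem_image.1 hp
    obtain ⟨y, hy, rfl⟩ := Finset.mem_image.1 hq
    exact hK x hx y hy hpq]
  obtain ⟨m, hm⟩ : ∃ m, (A.image π).card = m + 1 :=
    Nat.exists_eq_succ_of_ne_zero (Finset.card_pos.2 ⟨π w, Finset.mem_image_of_mem _ hwA⟩).ne'
  rw [hm, choose_alternating]
  have hAN : A = insert w (A.erase w) := (Finset.insert_erase hwA).symm
  have hN : ∀ t ∈ A.erase w, G.Adj w t := fun t ht =>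
    ((hA t).1 (Finset.mem_of_mem_erase ht)).resolve_left (Finset.ne_of_mem_erase ht)
  rw [hAN]
  refine le_trans ?_ (ncard_sol_le_sum_contrib hN)
  have key : m.choose 4 ≤ {s | Sol G s ∧ s ⊆ ((A.erase w : Finset V) : Set V)}.ncard := by
    rcases m with _ | m
    · simp [Nat.choose]
    -- The clique now has `m + 2` vertices. A colouring of the neighbours with `m` colours would
    -- extend to `A` with one extra colour for `w`, contrary to `hχ`.
    · have h1 := choose_le_ncard_sol (G := G) (B := ((A.erase w : Finset V) : Set V))
        (C := Finset.range m) (Finset.finite_toSet _) ?_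
      · simpa using h1
      · rintro ⟨f, hf⟩
        have h2 : ColBy G (A : Set V) (insert m (Finset.range m)) := by
          refine ⟨_, Proper.extend (a := w) (f := f) (c := m) ⟨fun v hv => ?_, fun u hu v hv => ?_⟩
            (Finset.mem_insert_self _ _) fun n hn hwn hfn => ?_⟩
          · exact Finset.mem_insert_of_mem (hf.1 v (by simpa [and_comm] using hv))
          · exact hf.2 u (by simpa [and_comm] using hu) v (by simpa [and_comm] using hv)
          · have := hf.1 n (by simpa [hwn.ne'] using hn)
            rw [hfn] at this
            simp at this
        have h3 := hχ _ h2
        rw [hm, Finset.card_insert_of_notMem (by simp), Finset.card_range] at h3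
        omega
  have : (m.choose 4 : ℤ) ≤ ({s | Sol G s ∧ s ⊆ ((A.erase w : Finset V) : Set V)}.ncard : ℤ) := by
    exact_mod_cast key
  linarith

open Classical in
theorem beth3_le [Fintype V] [Fintype W] (h : IsFolding G G' A π) (hA : ∀ x, x ∈ A ↔ x = w ∨ G.Adj w x)
    (hK : ∀ x ∈ A, ∀ y ∈ A, π x ≠ π y → G'.Adj (π x) (π y))
    (hχ : ∀ C : Finset ℕ, ColBy G (A : Set V) C → (A.image π).card ≤ C.card) :
    beth3 G' ≤ beth3 G := by
  have h1 : (Finset.univ \ A).image π = Finset.univ \ A.image π := by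
    ext p
    simp only [Finset.mem_image, Finset.mem_sdiff, Finset.mem_univ, true_and]
    constructor
    · rintro ⟨x, hx, rfl⟩ ⟨y, hy, hyx⟩
      exact hx (h.fiber _ _ hyx (by rintro rfl; exact hx hy)).2.1
    · intro hp
      obtain ⟨x, rfl⟩ := h.surj p
      exact ⟨x, fun hx => hp ⟨x, hx, rfl⟩, rfl⟩
  have h2 := h.sum_outside_le hA hK
  rw [h1] at h2
  have h3 := sum_inside_le hA hK hχ
  rw [beth3_eq_sum_finset, beth3_eq_sum_finset, sum_eq_add G A, sum_eq_add G' (A.image π)]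
  exact add_le_add h3 h2

end IsFolding

end

/-! ### Vertex compressions and the bound by the chromatic number -/

section

variable {V : Type u} {W : Type v} {G : SimpleGraph V} {G' : SimpleGraph W} {A : Set V} {π : V → W}
  {C : Finset ℕ}

theorem ColBy.chromaticNumber_le (h : ColBy G A C) : (G.induce A).chromaticNumber ≤ C.card := by
  obtain ⟨f, hf⟩ := h
  let c : (G.induce A).Coloring C := SimpleGraph.Coloring.mk (fun v => ⟨f v, hf.1 v v.2⟩)
    fun {u v} huv h' => hf.2 u u.2 v v.2 huv (congrArg Subtype.val h')
  have := c.colorable.chromaticNumber_le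
  rwa [Fintype.card_coe] at this

theorem ColBy.chromaticNumber_le_of_univ (h : ColBy G Set.univ C) : G.chromaticNumber ≤ C.card := by
  obtain ⟨f, hf⟩ := h
  let c : G.Coloring C := SimpleGraph.Coloring.mk (fun v => ⟨f v, hf.1 v trivial⟩)
    fun {u v} huv h' => hf.2 u trivial v trivial huv (congrArg Subtype.val h')
  have := c.colorable.chromaticNumber_le
  rwa [Fintype.card_coe] at this

theorem IsVertexCompression.beth3_le [Finite V] {w : V} (h : IsVertexCompression G w G') :
    beth3 G' ≤ beth3 G := by
  classical
  obtain ⟨K, hF, hK, hχ⟩ := h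
  obtain ⟨π, hπ, rfl⟩ := hF.exists_isFolding
  have := Fintype.ofFinite V
  have : Finite W := Finite.of_surjective π hπ.surj
  have := Fintype.ofFinite W
  set A : Finset V := (closedNeighbourhood G w).toFinset with hA
  have hA' : closedNeighbourhood G w = A := by simp [hA]
  rw [hA'] at hπ hK hχ
  refine hπ.beth3_le (w := w) (fun x => ?_) (fun x hx y hy hxy => ?_) fun C hC => ?_
  · rw [hA, Set.mem_toFinset]
    rfl
  · exact hK ⟨x, hx, rfl⟩ ⟨y, hy, rfl⟩ hxy
  · have h1 := hC.chromaticNumber_le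
    rw [← hχ, ← Finset.coe_image, Set.encard_coe_eq_coe_finsetCard] at h1
    exact_mod_cast h1

/-- A connected graph that is not complete has a vertex with two nonadjacent neighbours. -/
theorem exists_not_adj (hG : ∀ x y, Relation.ReflTransGen G.Adj x y)
    (h : ¬ ∀ x y, x ≠ y → G.Adj x y) : ∃ w x y, G.Adj w x ∧ G.Adj w y ∧ x ≠ y ∧ ¬ G.Adj x y := by
  by_contra hcon
  push Not at hcon
  refine h fun x y hxy => ?_
  have key : x = y ∨ G.Adj x y := by
    induction hG x y with
    | refl => exact .inl rfl
    | @tail y z _ hyz ih =>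
      by_cases hxz : x = z
      · exact .inl hxz
      by_cases hxy : x = y
      · exact .inr (hxy ▸ hyz)
      exact .inr (hcon y x z (ih hxy |>.resolve_left hxy).symm hyz hxz)
  exact key.resolve_left hxy

theorem exists_optimal_colouring (hA : A.Finite) : ∃ C f, Proper G A C f ∧
    ∀ C', ColBy G A C' → C.card ≤ C'.card := by
  classical
  have hex : ∃ k C, ColBy G A C ∧ C.card = k := by
    obtain ⟨e, he⟩ := Set.countable_iff_exists_injOn.1 hA.countable
    exact ⟨_, hA.toFinset.image e, ⟨e, fun v hv => Finset.mem_image_of_mem _ (hA.mem_toFinset.2 hv),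
      fun u hu v hv huv h' => huv.ne (he hu hv h')⟩, rfl⟩
  obtain ⟨C, ⟨f, hf⟩, hC⟩ := Nat.find_spec hex
  refine ⟨C, f, hf, fun C' hC' => ?_⟩
  rw [hC]
  exact Nat.find_min' hex ⟨C', hC', rfl⟩

/-- In an optimal colouring, any two colours are joined by an edge. -/
theorem Proper.exists_adj {f : V → ℕ} (h : Proper G A C f)
    (hC : ∀ C', ColBy G A C' → C.card ≤ C'.card) {x y : V} (hx : x ∈ A) (hy : y ∈ A)
    (hxy : f x ≠ f y) : ∃ x' ∈ A, ∃ y' ∈ A, f x' = f x ∧ f y' = f y ∧ G.Adj x' y' := by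
  classical
  by_contra hcon
  push Not at hcon
  have hxC := h.1 x hx
  have h1 : ColBy G A (C.erase (f x)) := by
    have hcross : ∀ u ∈ A, ∀ v ∈ A, G.Adj u v → f u = f x → f y ≠ f v :=
      fun u hu v hv huv hux hvy => hcon u hu v hv hux hvy.symm huv
    refine ⟨fun v => if f v = f x then f y else f v, fun v hv => ?_, fun u hu v hv huv => ?_⟩
    · dsimp only
      rw [Finset.mem_erase]
      split_ifs with hv'
      exacts [⟨hxy.symm, h.1 y hy⟩, ⟨hv', h.1 v hv⟩]
    · dsimp only
      split_ifs with hu' hv' hv'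
      · exact absurd (hu'.trans hv'.symm) (h.2 u hu v hv huv)
      · exact hcross u hu v hv huv hu'
      · exact (hcross v hv u hu huv.symm hv').symm
      · exact h.2 u hu v hv huv
  have h2 := hC _ h1
  rw [Finset.card_erase_of_mem hxC] at h2
  have := Finset.card_pos.2 ⟨_, hxC⟩
  omega

/-- Induction on the number of vertices by compressing a vertex with two nonadjacent neighbours. The
hypothesis is a lower bound on the number of colours, since this is inherited by the folded graph.
-/
theorem choose_le_beth3 [Fintype V] (hG : ∀ x y, Relation.ReflTransGen G.Adj x y) {m : ℕ}
    (hm : ∀ C, ColBy G Set.univ C → m + 1 ≤ C.card) : (m.choose 4 : ℤ) - 1 ≤ beth3 G := by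
  classical
  induction hn : Fintype.card V using Nat.strong_induction_on generalizing V with
  | _ n ih =>
  subst hn
  by_cases hc : ∀ x y, x ≠ y → G.Adj x y
  · have h1 := hm (Finset.univ.image fun v : V => (Fintype.equivFin V v : ℕ))
      ⟨_, fun v _ => Finset.mem_image_of_mem _ (Finset.mem_univ v), fun u _ v _ huv h' => huv.ne
        ((Fintype.equivFin V).injective (Fin.ext h'))⟩
    have h2 := h1.trans Finset.card_image_le
    rw [Finset.card_univ] at h2
    obtain ⟨k, hk⟩ : ∃ k, Fintype.card V = k + 1 := ⟨Fintype.card V - 1, by omega⟩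
    rw [beth3_of_complete hc, hk, choose_alternating]
    have h3 : m.choose 4 ≤ k.choose 4 := Nat.choose_le_choose 4 (by omega)
    have : (m.choose 4 : ℤ) ≤ k.choose 4 := by exact_mod_cast h3
    linarith
  obtain ⟨w, x₀, y₀, hwx, hwy, hne, hxy⟩ := exists_not_adj hG hc
  set A : Finset V := Finset.univ.filter fun x => x = w ∨ G.Adj w x with hA
  have hA' : ∀ x, x ∈ A ↔ x = w ∨ G.Adj w x := by simp [hA]
  obtain ⟨C, f, hf, hC⟩ := exists_optimal_colouring (G := G) A.finite_toSet
  -- The fibres of `g` are the colour classes in `A` and the single vertices outside; its range is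
  -- the vertex set of the compressed graph.
  set g : V → ℕ ⊕ V := fun x => if x ∈ A then .inl (f x) else .inr x with hg
  have hgl : ∀ x, x ∈ A → g x = .inl (f x) := fun x hx => by simp [hg, hx]
  have hgr : ∀ x, x ∉ A → g x = .inr x := fun x hx => by simp [hg, hx]
  have hfib : ∀ x y, g x = g y → x ≠ y → x ∈ A ∧ y ∈ A ∧ f x = f y := by
    intro x y hxy hne
    by_cases hx : x ∈ A <;> by_cases hy : y ∈ A
    · rw [hgl x hx, hgl y hy, Sum.inl.injEq] at hxy
      exact ⟨hx, hy, hxy⟩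
    · rw [hgl x hx, hgr y hy] at hxy
      cases hxy
    · rw [hgr x hx, hgl y hy] at hxy
      cases hxy
    · rw [hgr x hx, hgr y hy, Sum.inr.injEq] at hxy
      exact absurd hxy hne
  let π : V → Set.range g := fun x => ⟨g x, x, rfl⟩
  have hπg : ∀ x y, π x = π y ↔ g x = g y := fun x y => Subtype.ext_iff
  have hfiber : ∀ x y, π x = π y → x ≠ y → x ∈ (A : Set V) ∧ y ∈ (A : Set V) ∧ ¬ G.Adj x y := by
    intro x y hxy hne
    obtain ⟨h1, h2, h3⟩ := hfib x y ((hπg x y).1 hxy) hne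
    exact ⟨h1, h2, fun h' => hf.2 x h1 y h2 h' h3⟩
  let G' : SimpleGraph (Set.range g) :=
    { Adj := fun p q => ∃ x y, π x = p ∧ π y = q ∧ G.Adj x y
      symm := ⟨by
        rintro p q ⟨x, y, hx, hy, hxy⟩
        exact ⟨y, x, hy, hx, hxy.symm⟩⟩
      loopless := ⟨by
        rintro p ⟨x, y, hx, hy, hxy⟩
        exact (hfiber x y (hx.trans hy.symm) hxy.ne).2.2 hxy⟩ }
  have hfold : IsFolding G G' A π := by
    refine ⟨?_, hfiber, fun _ _ => Iff.rfl⟩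
    rintro ⟨_, x, rfl⟩
    exact ⟨x, rfl⟩
  -- By optimality any two colours are joined by an edge, so the colour classes form a clique.
  have hK : ∀ x ∈ A, ∀ y ∈ A, π x ≠ π y → G'.Adj (π x) (π y) := by
    intro x hx y hy hxy
    obtain ⟨x', hx', y', hy', h1, h2, h3⟩ := hf.exists_adj hC hx hy fun h' => hxy
      ((hπg x y).2 (by rw [hgl x hx, hgl y hy, h']))
    exact ⟨x', y', (hπg _ _).2 (by rw [hgl x hx, hgl x' hx', h1]),
      (hπg _ _).2 (by rw [hgl y hy, hgl y' hy', h2]), h3⟩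
  have hcard : (A.image π).card ≤ C.card := by
    have h1 : (A.image π).card ≤ (A.image f).card := by
      rw [← Finset.card_image_of_injective (A.image f) (Sum.inl_injective (β := V)),
        ← Finset.card_image_of_injective (A.image π) Subtype.val_injective]
      refine Finset.card_le_card fun p hp => ?_
      obtain ⟨_, hq, rfl⟩ := Finset.mem_image.1 hp
      obtain ⟨x, hx, rfl⟩ := Finset.mem_image.1 hq
      exact Finset.mem_image.2 ⟨f x, Finset.mem_image_of_mem _ hx, (hgl x hx).symm⟩
    refine h1.trans (Finset.card_le_card fun c hc => ?_)
    obtain ⟨x, hx, rfl⟩ := Finset.mem_image.1 hc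
    exact hf.1 x hx
  refine le_trans ?_ (hfold.beth3_le hA' hK fun C' hC' =>
    (le_of_eq (by congr; exact Subsingleton.elim _ _)).trans (hcard.trans (hC C' hC')))
  refine ih _ ?_ (G := G') ?_ ?_ rfl
  -- If nothing were identified, the nonadjacent neighbours `x₀`, `y₀` of `w` would be adjacent in
  -- the clique.
  · refine Fintype.card_lt_of_surjective_not_injective π hfold.surj fun hinj => ?_
    obtain ⟨x, y, hx, hy, h'⟩ := hK x₀ ((hA' _).2 (.inr hwx)) y₀ ((hA' _).2 (.inr hwy))
      fun h' => hne (hinj h')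
    rw [hinj hx, hinj hy] at h'
    exact hxy h'
  · intro p q
    obtain ⟨x, rfl⟩ := hfold.surj p
    obtain ⟨y, rfl⟩ := hfold.surj q
    exact (hG x y).lift π fun a b hab => ⟨a, b, rfl, rfl, hab⟩
  -- Colourings of the folded graph pull back along `π`, so it needs at least as many colours as
  -- `G`.
  · rintro C' ⟨c, hc⟩
    exact hm C' ⟨fun v => c (π v), fun v _ => hc.1 _ trivial, fun u _ v _ huv =>
      hc.2 _ trivial _ trivial ⟨u, v, rfl, rfl, huv⟩⟩

end

end GraphChar

theorem theorem4p3p1 {V : Type u} [Finite V] (G : SimpleGraph V) (hG : G.Connected) :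
    (∀ (w : V) {W : Type v} (G' : SimpleGraph W),
      GraphChar.IsVertexCompression G w G' → GraphChar.beth3 G' ≤ GraphChar.beth3 G) ∧
    (∀ n : ℕ, G.chromaticNumber = (n : ℕ∞) →
      GraphChar.beth3 (SimpleGraph.completeGraph (Fin n)) ≤ GraphChar.beth3 G ∧
      (n.choose 4 : ℤ) - (n.choose 3 : ℤ) + (n.choose 2 : ℤ) - (n : ℤ) ≤ GraphChar.beth3 G) := by
  refine ⟨fun w W G' h => h.beth3_le, fun n hn => ?_⟩
  have := Fintype.ofFinite V
  -- A connected graph has a vertex; this allows `n = m + 1` and the telescoped form of the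
  -- alternating sum.
  have hn0 : n ≠ 0 := by
    rintro rfl
    obtain ⟨v⟩ := hG.nonempty
    have h1 : G.Colorable 0 := SimpleGraph.chromaticNumber_le_iff_colorable.1 hn.le
    obtain ⟨c⟩ := h1
    exact (c v).elim0
  obtain ⟨m, rfl⟩ := Nat.exists_eq_succ_of_ne_zero hn0
  have h1 : (m.choose 4 : ℤ) - 1 ≤ GraphChar.beth3 G := by
    refine GraphChar.choose_le_beth3
      (fun x y => (SimpleGraph.reachable_iff_reflTransGen x y).1 (hG.preconnected x y)) fun C hC => ?_
    have h2 := hC.chromaticNumber_le_of_univ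
    rw [hn] at h2
    exact_mod_cast h2
  have h2 := (GraphChar.choose_alternating m).trans_le h1
  refine ⟨?_, h2⟩
  rw [GraphChar.beth3_of_complete (G := SimpleGraph.completeGraph (Fin (m + 1)))
    fun x y hxy => by simpa using hxy, Fintype.card_fin]
  exact h2
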